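/- Let $(\Omega,\mathcal F,(\mathcal F_t)_{t\ge0},P)$ be a filtered probability space and $T\ge 0$. Let $\mathcal M_2$ be the space of right-continuous square-integrable $(\mathcal F_t)$-martingales on $[0,T]$, with norm $\|X\|=(E X_T^2)^{1/2}$; path properties are understood almost surely. Let $\mathcal V_1$ be the set of functions $g(s,x,\omega)$ that are $\mathcal B([0,T]\times\mathbb R)\otimes\mathcal F$-measurable and such that $g(s,x)$ is $\mathcal F_s$-measurable for all $s,x$. Let $\mathcal V_2$ be the set of $h\in\mathcal V_1$ such that $h(\cdot,x)$ is a continuous martingale in $\mathcal M_2$ for each $x$, and such that the cross-variation $\langle h(x),h(y)\rangle_s$ has a version that is left continuous in $(s,x,y)$ (along sequences increasing to the point in the product order) and of locally bounded variation in $(s,x,y)$ (the sums of the absolute values of its increments over the boxes of a grid are bounded on compact sets). For $h\in\mathcal V_2$, let $d_{x,y,s}\langle h(x),h(y)\rangle_s$ be the random signed Lebesgue–Stieltjes measure that gives $[s_1,s_2)\times[x_1,x_2)\times[y_1,y_2)$ the increment of $\langle h(x),h(y)\rangle_s$ over this box, and let $|d_{x,y,s}\langle h(x),h(y)\rangle_s|$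 be its total variation measure. Let $\mathcal V_3(h)$ be the set of $g\in\mathcal V_1$ that have, almost surely, a compact support in $x$ and satisfy $$E\int_0^T\!\!\int_{\mathbb R^2}|g(s,x)g(s,y)|\,|d_{x,y,s}\langle h(x),h(y)\rangle_s|<\infty .$$ Write $k_a\to g$ if $$E\int_0^T\!\!\int_{\mathbb R^2}|(g-k_a)(s,x)\,(g-k_b)(s,y)|\,|d_{x,y,s}\langle h(x),h(y)\rangle_s|\to0\quad\text{as } a,b\to\infty ,$$ where the indices are integers or, for a double sequence, pairs of integers both tending to infinity. A simple function is $\varphi(s,x)=\sum_{j,i}e_{ji}1_{(t_j,t_{j+1}]}(s)1_{[x_i,x_{i+1})}(x)$ with finite grids $t_j\in[0,T]$, $x_i\in\mathbb R$ and real-valued $\mathcal F_{t_j}$-measurable $e_{ji}$; its integral is $$I_t(\varphi)=\sum_{j,i}e_{ji}\big[h(t_{j+1}\wedge t,x_{i+1})-h(t_j\wedge t,x_{i+1})-h(t_{j+1}\wedge t,x_i)+h(t_j\wedge t,x_i)\big].$$ Let $h\in\mathcal V_2$. 1. If $\varphi\in\mathcal V_3(h)$ is simple, then $I(\varphi)$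 is a continuous square-integrable martingale on $[0,T]$, and the isometry $$E\,J_t^2=E\int_0^t\!\!\int_{\mathbb R^2}g(s,x)g(s,y)\,d_{x,y,s}\langle h(x),h(y)\rangle_s\qquad(t\le T),$$ with both sides finite, holds for $g=\varphi$ and $J=I(\varphi)$. 2. If $g\in\mathcal V_3(h)$ and $(\varphi_{m,n})$ is a double sequence of simple functions in $\mathcal V_3(h)$ with $\varphi_{m,n}\to g$, then $I(\varphi_{m,n})$ converges in $\mathcal M_2$ to a continuous martingale; call it an integral of $g$. More generally, if $k_n\in\mathcal V_3(h)$ have integrals $K_n$ in this sense and $k_n\to g$, then $K_n$ converges in $\mathcal M_2$ to a continuous martingale; call this limit, too, an integral of $g$ (the first case is contained in it). 3. For $g\in\mathcal V_3(h)$, every integral $J$ of $g$ in the sense of 2 is a continuous square-integrable martingale on $[0,T]$ and satisfies the isometry of 1 for all $t\le T$. Any two integrals of $g$ are indistinguishable on $[0,T]$, whatever the approximating sequences. 4. Let $g\in\mathcal V_3(h)$ be progressively measurable (for each $t\le T$, its restriction to $[0,t]\times\mathbb R\times\Omega$ is $\mathcal B([0,t])\otimes\mathcal B(\mathbb R)\otimes\mathcal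 F_t$-measurable). If $|g|+1_{[-R,R]}(x)\in\mathcal V_3(h)$ for every $R$, then there is a double sequence of simple functions in $\mathcal V_3(h)$ with $\varphi_{m,n}\to g$. If $E\int_0^T\int_{[-R,R]^2}|d_{x,y,s}\langle h(x),h(y)\rangle_s|<\infty$ for every $R$, then every progressively measurable $g\in\mathcal V_3(h)$ has an integral in the sense of 2. -/

import Mathlib

open MeasureTheory ProbabilityTheory Filter Topology
open scoped NNReal ENNReal

noncomputable section

namespace StochLS

/-- Random fields `g(s, x, ω)`, with time `s ≥ 0` and space variable `x ∈ ℝ`. Only `s ≤ T` matters. -/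
abbrev RField (Ω : Type*) := ℝ≥0 → ℝ → Ω → ℝ

/-- Real-valued processes. Only times `t ≤ T` matter. -/
abbrev Proc (Ω : Type*) := ℝ≥0 → Ω → ℝ

/-! ### Three-variable functions and their Lebesgue-Stieltjes measures -/

/-- The increment of `F` over the box `[s₁, s₂) × [x₁, x₂) × [y₁, y₂)`. -/
def boxInc (F : ℝ≥0 → ℝ → ℝ → ℝ) (s₁ s₂ : ℝ≥0) (x₁ x₂ y₁ y₂ : ℝ) : ℝ :=
  (F s₂ x₂ y₂ - F s₂ x₁ y₂ - F s₂ x₂ y₁ + F s₂ x₁ y₁)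
    - (F s₁ x₂ y₂ - F s₁ x₁ y₂ - F s₁ x₂ y₁ + F s₁ x₁ y₁)

/-- Left continuity in all three variables together on `[0, T] × ℝ × ℝ`: continuity along
sequences that increase, in the product order, to the point. -/
def IsLeftCont (T : ℝ≥0) (F : ℝ≥0 → ℝ → ℝ → ℝ) : Prop :=
  ∀ (p : ℝ≥0 × ℝ × ℝ) (u : ℕ → ℝ≥0 × ℝ × ℝ), p.1 ≤ T → Monotone u → Tendsto u atTop (𝓝 p) →
    Tendsto (fun n => F (u n).1 (u n).2.1 (u n).2.2) atTop (𝓝 (F p.1 p.2.1 p.2.2))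

/-- Locally bounded variation in `(s, x, y)` on `[0, T] × ℝ × ℝ`: on every
`[0, T] × [-R, R] × [-R, R]` the sums of absolute box increments over grids are bounded. -/
def IsLocBV (T : ℝ≥0) (F : ℝ≥0 → ℝ → ℝ → ℝ) : Prop :=
  ∀ R : ℝ, ∃ C : ℝ, ∀ (N : ℕ) (s : ℕ → ℝ≥0) (x y : ℕ → ℝ),
    Monotone s → Monotone x → Monotone y →
    (∀ i, s i ≤ T) → (∀ i, |x i| ≤ R) → (∀ i, |y i| ≤ R) →
    ∑ i ∈ Finset.range N, ∑ j ∈ Finset.range N, ∑ k ∈ Finset.range N,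
      |boxInc F (s i) (s (i + 1)) (x j) (x (j + 1)) (y k) (y (k + 1))| ≤ C

/-- `μ.1` and `μ.2` are the positive and negative parts (Jordan decomposition) of the signed
Lebesgue-Stieltjes measure of `F`, which gives every half-open box the increment of `F`.
There is at most one such pair. -/
structure IsStieltjesPair (F : ℝ≥0 → ℝ → ℝ → ℝ)
    (μ : Measure (ℝ≥0 × ℝ × ℝ) × Measure (ℝ≥0 × ℝ × ℝ)) : Prop where
  locFinite_pos : IsLocallyFiniteMeasure μ.1
  locFinite_neg : IsLocallyFiniteMeasure μ.2
  singular : μ.1 ⟂ₘ μ.2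
  box : ∀ (s₁ s₂ : ℝ≥0) (x₁ x₂ y₁ y₂ : ℝ), s₁ ≤ s₂ → x₁ ≤ x₂ → y₁ ≤ y₂ →
    μ.1.real (Set.Ico s₁ s₂ ×ˢ Set.Ico x₁ x₂ ×ˢ Set.Ico y₁ y₂)
      - μ.2.real (Set.Ico s₁ s₂ ×ˢ Set.Ico x₁ x₂ ×ˢ Set.Ico y₁ y₂) = boxInc F s₁ s₂ x₁ x₂ y₁ y₂

open Classical in
/-- The positive and negative parts of the Lebesgue-Stieltjes measure of `F` (zero if `F` does not
generate one). -/
def stieltjesPair (F : ℝ≥0 → ℝ → ℝ → ℝ) :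
    Measure (ℝ≥0 × ℝ × ℝ) × Measure (ℝ≥0 × ℝ × ℝ) :=
  if H : ∃ μ, IsStieltjesPair F μ then H.choose else (0, 0)

section Processes

variable {Ω : Type*} [MeasurableSpace Ω]

/-! ### Martingales on `[0, T]` -/

/-- `X` is a martingale on `[0, T]` (that is, `X` stopped at time `T` is a martingale). -/
def IsMart (P : Measure Ω) (ℱ : Filtration ℝ≥0 ‹MeasurableSpace Ω›) (T : ℝ≥0) (X : Proc Ω) : Prop :=
  Martingale (fun t => X (min t T)) ℱ P

/-- The space `𝓜₂`: right-continuous square-integrable martingales on `[0, T]`. -/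
structure IsM2 (P : Measure Ω) (ℱ : Filtration ℝ≥0 ‹MeasurableSpace Ω›) (T : ℝ≥0)
    (X : Proc Ω) : Prop where
  mart : IsMart P ℱ T X
  memLp : MemLp (X T) 2 P
  rightCont : ∀ᵐ ω ∂P, ∀ t < T, ContinuousWithinAt (fun s => X s ω) (Set.Ici t) t

/-- Continuous square-integrable martingales on `[0, T]`. -/
structure IsContM2 (P : Measure Ω) (ℱ : Filtration ℝ≥0 ‹MeasurableSpace Ω›) (T : ℝ≥0)
    (X : Proc Ω) : Prop extends IsM2 P ℱ T X where
  cont : ∀ᵐ ω ∂P, ContinuousOn (fun s => X s ω) (Set.Iic T)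

/-- Convergence in `𝓜₂`, whose norm is `‖X‖ = (E X_T²)^{1/2}`. -/
def TendstoM2 {ι : Type*} [Preorder ι] (P : Measure Ω) (T : ℝ≥0)
    (X : ι → Proc Ω) (Y : Proc Ω) : Prop :=
  Tendsto (fun a => eLpNorm (fun ω => X a T ω - Y T ω) 2 P) atTop (𝓝 0)

/-- `A` is (a version of) the cross-variation process `⟨M, N⟩` on `[0, T]`: the adapted
continuous process of finite variation, null at `0`, for which `M N - A` is a martingale. -/
structure IsCrossVar (P : Measure Ω) (ℱ : Filtration ℝ≥0 ‹MeasurableSpace Ω›) (T : ℝ≥0)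
    (M N A : Proc Ω) : Prop where
  adapted : ∀ t ≤ T, Measurable[ℱ t] (A t)
  zero : ∀ᵐ ω ∂P, A 0 ω = 0
  cont : ∀ᵐ ω ∂P, ContinuousOn (fun s => A s ω) (Set.Iic T)
  bv : ∀ᵐ ω ∂P, BoundedVariationOn (fun s => A s ω) (Set.Iic T)
  mart : IsMart P ℱ T (fun t ω => M t ω * N t ω - A t ω)

/-! ### The classes `𝓥₁`, `𝓥₂`, `𝓥₃(h)` -/

/-- The class `𝓥₁`: jointly measurable on `[0, T] × ℝ × Ω`, and adapted for every `x`. -/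
structure IsV1 (ℱ : Filtration ℝ≥0 ‹MeasurableSpace Ω›) (T : ℝ≥0) (g : RField Ω) : Prop where
  meas : Measurable (fun p : Set.Iic T × ℝ × Ω => g p.1 p.2.1 p.2.2)
  adapted : ∀ s ≤ T, ∀ x, Measurable[ℱ s] (g s x)

/-- Progressive measurability of a field: for every `t ≤ T`, its restriction to
`[0, t] × ℝ × Ω` is `𝓑([0, t]) ⊗ 𝓑(ℝ) ⊗ ℱ_t`-measurable. -/
def IsProg (ℱ : Filtration ℝ≥0 ‹MeasurableSpace Ω›) (T : ℝ≥0) (g : RField Ω) : Prop :=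
  ∀ t ≤ T, Measurable[(inferInstance : MeasurableSpace (Set.Iic t)).prod
      ((inferInstance : MeasurableSpace ℝ).prod (ℱ t))]
    (fun p : Set.Iic t × ℝ × Ω => g p.1 p.2.1 p.2.2)

/-- The class `𝓥₂`: `h ∈ 𝓥₁` is for each `x` a continuous `𝓜₂`-martingale, and `Γ s x y` is a
version of the cross-variation `⟨h(x), h(y)⟩_s` that is left continuous and of locally bounded
variation in `(s, x, y)`. (Such a `Γ` is unique up to indistinguishability.) -/
structure IsV2 (P : Measure Ω) (ℱ : Filtration ℝ≥0 ‹MeasurableSpace Ω›) (T : ℝ≥0)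
    (h : RField Ω) (Γ : ℝ≥0 → ℝ → ℝ → Ω → ℝ) : Prop where
  v1 : IsV1 ℱ T h
  mart : ∀ x, IsContM2 P ℱ T (fun s => h s x)
  crossVar : ∀ x y, IsCrossVar P ℱ T (fun s => h s x) (fun s => h s y) (fun s => Γ s x y)
  leftCont : ∀ᵐ ω ∂P, IsLeftCont T (fun s x y => Γ s x y ω)
  locBV : ∀ᵐ ω ∂P, IsLocBV T (fun s x y => Γ s x y ω)

/-- Positive and negative parts of the random signed measure `d_{x,y,s}⟨h(x), h(y)⟩_s`. It lives
on `[0, T] × ℝ × ℝ`, the cross-variation being frozen at time `T`. -/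
def crossPair (T : ℝ≥0) (Γ : ℝ≥0 → ℝ → ℝ → Ω → ℝ) (ω : Ω) :
    Measure (ℝ≥0 × ℝ × ℝ) × Measure (ℝ≥0 × ℝ × ℝ) :=
  stieltjesPair (fun s x y => Γ (min s T) x y ω)

/-- The total variation measure `|d_{x,y,s}⟨h(x), h(y)⟩_s|`. -/
def crossTV (T : ℝ≥0) (Γ : ℝ≥0 → ℝ → ℝ → Ω → ℝ) (ω : Ω) : Measure (ℝ≥0 × ℝ × ℝ) :=
  (crossPair T Γ ω).1 + (crossPair T Γ ω).2

/-- `∫₀ᵗ ∫_{ℝ²} g(s,x) g(s,y) d_{x,y,s}⟨h(x), h(y)⟩_s`. -/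
def crossInt (T : ℝ≥0) (Γ : ℝ≥0 → ℝ → ℝ → Ω → ℝ) (g : RField Ω) (t : ℝ≥0) (ω : Ω) : ℝ :=
  (∫ z in Set.Iic t ×ˢ Set.univ, g z.1 z.2.1 ω * g z.1 z.2.2 ω ∂(crossPair T Γ ω).1)
    - ∫ z in Set.Iic t ×ˢ Set.univ, g z.1 z.2.1 ω * g z.1 z.2.2 ω ∂(crossPair T Γ ω).2

/-- `E ∫₀ᵀ ∫_{ℝ²} |u(s,x) v(s,y)| |d_{x,y,s}⟨h(x), h(y)⟩_s|`. -/
def absInt (P : Measure Ω) (T : ℝ≥0) (Γ : ℝ≥0 → ℝ → ℝ → Ω → ℝ) (u v : RField Ω) : ℝ≥0∞ :=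
  ∫⁻ ω, ∫⁻ z in Set.Iic T ×ˢ Set.univ, ‖u z.1 z.2.1 ω * v z.1 z.2.2 ω‖ₑ ∂(crossTV T Γ ω) ∂P

/-- The class `𝓥₃(h)`. -/
structure IsV3 (P : Measure Ω) (ℱ : Filtration ℝ≥0 ‹MeasurableSpace Ω›) (T : ℝ≥0)
    (Γ : ℝ≥0 → ℝ → ℝ → Ω → ℝ) (g : RField Ω) : Prop where
  v1 : IsV1 ℱ T g
  compactSupp : ∀ᵐ ω ∂P, ∃ R : ℝ, ∀ s ≤ T, ∀ x, R < |x| → g s x ω = 0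
  finite : absInt P T Γ g g < ∞

/-- The indicator function of `[-R, R]`, as a field. -/
def cutoff (R : ℝ) : RField Ω := fun _ x _ => Set.indicator (Set.Icc (-R) R) 1 x

/-- The cross-variation has locally integrable total variation:
`E |d_{x,y,s}⟨h(x), h(y)⟩_s|([0, T] × [-R, R]²) < ∞` for every `R`. -/
def IsLocIntegrable (P : Measure Ω) (T : ℝ≥0) (Γ : ℝ≥0 → ℝ → ℝ → Ω → ℝ) : Prop :=
  ∀ R : ℝ, absInt P T Γ (cutoff R) (cutoff R) < ∞

/-- The convergence of a family of fields to `g`: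
`E ∫₀ᵀ ∫_{ℝ²} |(g - k_a)(s,x) (g - k_b)(s,y)| |d_{x,y,s}⟨h(x), h(y)⟩_s| → 0` as `a, b → ∞`. -/
def Approx {ι : Type*} [Preorder ι] (P : Measure Ω) (T : ℝ≥0) (Γ : ℝ≥0 → ℝ → ℝ → Ω → ℝ)
    (k : ι → RField Ω) (g : RField Ω) : Prop :=
  Tendsto (fun p : ι × ι => absInt P T Γ (fun s x ω => g s x ω - k p.1 s x ω)
    (fun s x ω => g s x ω - k p.2 s x ω)) atTop (𝓝 0)

/-! ### Simple functions and the integral -/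

/-- Simple functions: a grid `t_0 < ⋯ < t_m ≤ T`, `x_0 < ⋯ < x_n`, and values `e j i` that are
`ℱ_{t_j}`-measurable. -/
structure Simple (ℱ : Filtration ℝ≥0 ‹MeasurableSpace Ω›) (T : ℝ≥0) where
  m : ℕ
  n : ℕ
  t : Fin (m + 1) → ℝ≥0
  x : Fin (n + 1) → ℝ
  e : Fin m → Fin n → Ω → ℝ
  t_mono : StrictMono t
  t_le : ∀ j, t j ≤ T
  x_mono : StrictMono x
  e_meas : ∀ j i, Measurable[ℱ (t j.castSucc)] (e j i)

variable {ℱ : Filtration ℝ≥0 ‹MeasurableSpace Ω›} {T : ℝ≥0}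

/-- `∑ e(t_j, x_i) 1_{(t_j, t_{j+1}]}(s) 1_{[x_i, x_{i+1})}(x)`. -/
def Simple.toField (φ : Simple ℱ T) : RField Ω := fun s x ω =>
  ∑ j, ∑ i, φ.e j i ω * Set.indicator (Set.Ioc (φ.t j.castSucc) (φ.t j.succ)) 1 s
    * Set.indicator (Set.Ico (φ.x i.castSucc) (φ.x i.succ)) 1 x

/-- The stochastic Lebesgue-Stieltjes integral `∫₀ᵗ ∫ φ(s,x) d_{s,x} h(s,x)` of a simple
function. -/
def Simple.integral (φ : Simple ℱ T) (h : RField Ω) : Proc Ω := fun t ω =>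
  ∑ j, ∑ i, φ.e j i ω *
    (h (min (φ.t j.succ) t) (φ.x i.succ) ω - h (min (φ.t j.castSucc) t) (φ.x i.succ) ω
      - h (min (φ.t j.succ) t) (φ.x i.castSucc) ω + h (min (φ.t j.castSucc) t) (φ.x i.castSucc) ω)

/-- The isometry `E J_t² = E ∫₀ᵗ ∫_{ℝ²} g(s,x) g(s,y) d_{x,y,s}⟨h(x), h(y)⟩_s`, for all `t ≤ T`,
both expectations being finite. -/
def IsIsometric (P : Measure Ω) (T : ℝ≥0) (Γ : ℝ≥0 → ℝ → ℝ → Ω → ℝ) (g : RField Ω)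
    (J : Proc Ω) : Prop :=
  ∀ t ≤ T, Integrable (fun ω => J t ω ^ 2) P ∧ Integrable (fun ω => crossInt T Γ g t ω) P ∧
    ∫ ω, J t ω ^ 2 ∂P = ∫ ω, crossInt T Γ g t ω ∂P

/-- `φ` is a double sequence of simple functions in `𝓥₃(h)` that converges to `g`. -/
def IsSimpleApprox (P : Measure Ω) (Γ : ℝ≥0 → ℝ → ℝ → Ω → ℝ) (g : RField Ω)
    (φ : ℕ × ℕ → Simple ℱ T) : Prop :=
  (∀ a, IsV3 P ℱ T Γ (φ a).toField) ∧ Approx P T Γ (fun a => (φ a).toField) g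

/-- `J` is the integral of `g` with respect to `h`: the `𝓜₂`-limit of the integrals of a double
sequence of simple functions in `𝓥₃(h)` that converges to `g`. -/
def IsSimpleLimit (P : Measure Ω) (ℱ : Filtration ℝ≥0 ‹MeasurableSpace Ω›) (T : ℝ≥0)
    (h : RField Ω) (Γ : ℝ≥0 → ℝ → ℝ → Ω → ℝ) (g : RField Ω) (J : Proc Ω) : Prop :=
  ∃ φ : ℕ × ℕ → Simple ℱ T, IsSimpleApprox P Γ g φ ∧ IsM2 P ℱ T J ∧
    TendstoM2 P T (fun a => (φ a).integral h) J

/-- `k` is a sequence in `𝓥₃(h)` that converges to `g`, and `K n` is the integral of `k n` as a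
limit of integrals of simple functions. -/
def IsIterApprox (P : Measure Ω) (ℱ : Filtration ℝ≥0 ‹MeasurableSpace Ω›) (T : ℝ≥0)
    (h : RField Ω) (Γ : ℝ≥0 → ℝ → ℝ → Ω → ℝ) (g : RField Ω)
    (k : ℕ → RField Ω) (K : ℕ → Proc Ω) : Prop :=
  (∀ n, IsV3 P ℱ T Γ (k n) ∧ IsSimpleLimit P ℱ T h Γ (k n) (K n)) ∧ Approx P T Γ k g

/-- `J` is the integral of `g` with respect to `h` as an iterated `𝓜₂`-limit of integrals of
simple functions. With a constant sequence `k` this contains `IsSimpleLimit`. -/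
def IsSLSIntegral (P : Measure Ω) (ℱ : Filtration ℝ≥0 ‹MeasurableSpace Ω›) (T : ℝ≥0)
    (h : RField Ω) (Γ : ℝ≥0 → ℝ → ℝ → Ω → ℝ) (g : RField Ω) (J : Proc Ω) : Prop :=
  ∃ (k : ℕ → RField Ω) (K : ℕ → Proc Ω), IsIterApprox P ℱ T h Γ g k K ∧ IsM2 P ℱ T J ∧
    TendstoM2 P T K J

end Processes

end StochLS

end

open StochLS

open MeasureTheory ProbabilityTheory Filter Topology
open scoped NNReal ENNReal

noncomputable section

namespace StochLS

/-! ### Existence of the Lebesgue-Stieltjes measure -/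

/-! The theorem is an Itô isometry followed by a completion. The difficulty is that d⟨h(x),h(y)⟩ is
a signed measure: 𝓥₃(h) is defined through its total variation, and this absolute form need not obey
a triangle inequality, since the mixed integral of two members of the class need not be finite. What
saves the argument is positivity. On almost every path the signed form u ↦ ∫ u(s,x) u(s,y)
d⟨h(x),h(y)⟩ is nonnegative, so its square root `crossNorm` obeys the triangle inequality as soon as
the summands and the sum have finite absolute forms, whatever the mixed terms do (`sqrt_qf_sum_le`).
Estimates of integrals go through this seminorm; the absolute form (`absNorm`) serves as an upper
bound for it.

Positivity comes from martingales. For M = ∑ d_k h(z_k), the process ∑ d_k d_l Γ(z_k, z_l)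
compensates M², so it is a submartingale, continuous and of bounded variation, and such a process is
nondecreasing (`ae_le_of_submartingale_bv`, an exponential estimate on dyadic grids). Left
continuity extends this to all points and times on one event (`psd_of_dense`), summation by parts to
simple functions, and L¹ density to bounded measurable functions (`IsGoodPath.qf_nonneg_of_bdd`).

The pathwise measure is a weak limit of discrete measures, reduced to its Jordan decomposition.
Continuity of Γ in time excludes mass at a fixed time (`IsGoodPath.measure_singleton`), and the two
parts depend measurably on the path (`measurable_of_mutuallySingular`).

For simple functions with bounded values the isometry is the orthogonality of martingale increments;
truncation removes the bound. If φ and ψ approximate g, the norm of I(φ) − I(ψ) is at most `absNorm`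
of g − φ plus that of g − ψ, so integrals of approximating sequences are Cauchy. Doob's inequality
makes the limit continuous, and isometry and uniqueness pass to the limit.

For the existence of approximations, simple functions are L¹-dense in the bounded predictable fields
by a π-λ argument. A bounded progressive field agrees almost everywhere with its conditional
expectation given the predictable σ-algebra: the difference of the two cumulated integrals is a
continuous martingale of bounded variation, hence zero (`IsGoodVersion.ae_cumul_eq`). An unbounded g
is truncated, and the weight |g| + 1_{[-R,R]} controls the products in which errors of different
levels meet (`abs_mul_abs_le_of_weights`). -/

theorem sum_ite_lt_eq_sub {α : Type*} [LinearOrder α] {u : ℕ → α} (hu : Monotone u) (a : α)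
    (f : α → ℝ) (N : ℕ) :
    ∑ i ∈ Finset.range N, (if u (i + 1) < a then f (u (i + 1)) - f (u i) else 0)
      = f (u (Nat.findGreatest (fun i => u i < a) N)) - f (u 0) := by
  induction N with
  | zero => simp
  | succ N ih =>
    rw [Finset.sum_range_succ, ih, Nat.findGreatest_succ]
    by_cases h : u (N + 1) < a
    · have hN : Nat.findGreatest (fun i => u i < a) N = N := by
        have := (hu (Nat.le_succ N)).trans_lt h
        exact le_antisymm (Nat.findGreatest_le N) (Nat.le_findGreatest le_rfl this)
      simp [h, hN]
    · simp [h]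

/-- The dyadic grid with `2 ^ n` steps on `[0, 1]`. -/
def dyad (n i : ℕ) : ℝ := min (i / 2 ^ n) 1

theorem dyad_mono (n : ℕ) : Monotone (dyad n) := fun i j h => by
  unfold dyad; gcongr

theorem dyad_two_mul (n i : ℕ) : dyad (n + 1) (2 * i) = dyad n i := by
  unfold dyad; push_cast; rw [pow_succ']; congr 1; rw [mul_div_mul_left _ _ two_ne_zero]

theorem dyad_zero (n : ℕ) : dyad n 0 = 0 := by simp [dyad]

theorem dyad_last (n : ℕ) : dyad n (2 ^ n) = 1 := by simp [dyad]

theorem dyad_nonneg (n i : ℕ) : 0 ≤ dyad n i := by unfold dyad; positivity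

theorem dyad_le_one (n i : ℕ) : dyad n i ≤ 1 := min_le_right _ _

theorem dyad_succ_le (n i : ℕ) : dyad n (i + 1) ≤ dyad n i + (1 / 2) ^ n := by
  unfold dyad
  rw [one_div_pow, min_def, min_def]
  push_cast
  have h : ((i : ℝ) + 1) / 2 ^ n = i / 2 ^ n + 1 / 2 ^ n := by ring
  have : (0 : ℝ) ≤ 1 / 2 ^ n := by positivity
  split_ifs <;> linarith

theorem dyad_sub_le (n i : ℕ) : dyad n (i + 1) - dyad n i ≤ (1 / 2) ^ n := by
  linarith [dyad_succ_le n i]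

/-- The largest point of the grid `e (dyad n i)` below `a`. -/
def gridBelow {α : Type*} [LinearOrder α] (e : ℝ → α) (a : α) (n : ℕ) : α :=
  e (dyad n (Nat.findGreatest (fun i => e (dyad n i) < a) (2 ^ n)))

/-- The dyadic grids are nested, so the greatest grid point below `a` can only move up. This matters
because left continuity is available only along increasing sequences. -/
theorem gridBelow_mono {α : Type*} [LinearOrder α] {e : ℝ → α} (he : Monotone e) (a : α) :
    Monotone (gridBelow e a) := by
  refine monotone_nat_of_le_succ fun n => ?_
  unfold gridBelow
  set i := Nat.findGreatest (fun i => e (dyad n i) < a) (2 ^ n) with hi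
  rcases Nat.eq_zero_or_pos i with h0 | h0
  · rw [h0, dyad_zero]; exact he (dyad_nonneg _ _)
  · have h1 : e (dyad n i) < a := Nat.findGreatest_of_ne_zero hi.symm h0.ne'
    rw [← dyad_two_mul n i] at h1 ⊢
    refine he (dyad_mono _ (Nat.le_findGreatest ?_ h1))
    have := Nat.findGreatest_le (P := fun i => e (dyad n i) < a) (2 ^ n)
    rw [pow_succ']; omega

theorem gridBelow_le {α : Type*} [LinearOrder α] {e : ℝ → α} {a : α} (h : e 0 ≤ a) (n : ℕ) :
    gridBelow e a n ≤ a := by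
  unfold gridBelow
  set i := Nat.findGreatest (fun i => e (dyad n i) < a) (2 ^ n) with hi
  rcases Nat.eq_zero_or_pos i with h0 | h0
  · rw [h0, dyad_zero]; exact h
  · exact (Nat.findGreatest_of_ne_zero hi.symm h0.ne' : e (dyad n i) < a).le

theorem le_gridBelow {α : Type*} [LinearOrder α] {e : ℝ → α} {a : α} (h : a ≤ e 1) (n : ℕ) :
    a ≤ gridBelow e a n ∨ ∃ i, gridBelow e a n = e (dyad n i) ∧ a ≤ e (dyad n (i + 1)) := by
  unfold gridBelow
  set i := Nat.findGreatest (fun i => e (dyad n i) < a) (2 ^ n) with hi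
  rcases (Nat.findGreatest_le (P := fun i => e (dyad n i) < a) (2 ^ n)).lt_or_eq with h1 | h1
  · right
    refine ⟨i, rfl, ?_⟩
    by_contra hc
    push Not at hc
    exact Nat.findGreatest_is_greatest (P := fun i => e (dyad n i) < a) (Nat.lt_succ_self _) h1 hc
  · left; rw [hi, h1, dyad_last]; exact h

theorem tendsto_gridBelow_real {e : ℝ → ℝ} {L : ℝ} (hL : ∀ n i, e (dyad n (i + 1)) ≤
      e (dyad n i) + L * (1 / 2) ^ n) (hL0 : 0 ≤ L) {a : ℝ} (h0 : e 0 ≤ a) (h1 : a ≤ e 1) :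
    Tendsto (gridBelow e a) atTop (𝓝 a) := by
  have hlim : Tendsto (fun n : ℕ => a - L * (1 / 2) ^ n) atTop (𝓝 (a - L * 0)) :=
    tendsto_const_nhds.sub (tendsto_const_nhds.mul
      (tendsto_pow_atTop_nhds_zero_of_lt_one (by norm_num) (by norm_num)))
  rw [mul_zero, sub_zero] at hlim
  refine tendsto_of_tendsto_of_tendsto_of_le_of_le hlim tendsto_const_nhds (fun n => ?_)
    (fun n => gridBelow_le h0 n)
  rcases le_gridBelow h1 n with h | ⟨i, h, h'⟩
  · have : 0 ≤ L * (1 / 2 : ℝ) ^ n := by positivity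
    simp only; linarith
  · simp only; rw [h]; linarith [hL n i]

theorem coe_gridBelow {e : ℝ → ℝ≥0} (a : ℝ≥0) (n : ℕ) :
    ((gridBelow e a n : ℝ≥0) : ℝ) = gridBelow (fun r => (e r : ℝ)) (a : ℝ) n := by
  simp [gridBelow]

/-- The time grid map on `[0, T]`. -/
def timeMap (T : ℝ≥0) (r : ℝ) : ℝ≥0 := r.toNNReal * T

/-- The space grid map on `[-R, R]`. -/
def spaceMap (R : ℝ) (r : ℝ) : ℝ := -R + 2 * R * r

theorem timeMap_mono (T : ℝ≥0) : Monotone (timeMap T) := fun a b h => by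
  unfold timeMap; gcongr

theorem spaceMap_mono {R : ℝ} (hR : 0 ≤ R) : Monotone (spaceMap R) := fun a b h => by
  unfold spaceMap; gcongr

theorem timeMap_zero (T : ℝ≥0) : timeMap T 0 = 0 := by simp [timeMap]
theorem timeMap_one (T : ℝ≥0) : timeMap T 1 = T := by simp [timeMap]
theorem spaceMap_zero (R : ℝ) : spaceMap R 0 = -R := by simp [spaceMap]
theorem spaceMap_one (R : ℝ) : spaceMap R 1 = R := by simp [spaceMap]; ring

theorem tendsto_gridBelow_space {R : ℝ} (hR : 0 ≤ R) {a : ℝ} (ha : |a| ≤ R) :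
    Tendsto (gridBelow (spaceMap R) a) atTop (𝓝 a) := by
  obtain ⟨h1, h2⟩ := abs_le.1 ha
  refine tendsto_gridBelow_real (L := 2 * R) (fun n i => ?_) (by positivity) ?_ ?_
  · have := dyad_succ_le n i
    unfold spaceMap
    have h3 : 2 * R * dyad n (i + 1) ≤ 2 * R * (dyad n i + (1 / 2) ^ n) := by gcongr
    linarith
  · rwa [spaceMap_zero]
  · rwa [spaceMap_one]

theorem tendsto_gridBelow_time (T : ℝ≥0) {a : ℝ≥0} (ha : a ≤ T) :
    Tendsto (gridBelow (timeMap T) a) atTop (𝓝 a) := by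
  rw [← NNReal.tendsto_coe]
  simp_rw [coe_gridBelow]
  refine tendsto_gridBelow_real (L := T) (fun n i => ?_) T.2 ?_ ?_
  · have := dyad_succ_le n i
    unfold timeMap
    push_cast
    rw [Real.coe_toNNReal _ (dyad_nonneg _ _), Real.coe_toNNReal _ (dyad_nonneg _ _)]
    have h3 : dyad n (i + 1) * T ≤ (dyad n i + (1 / 2) ^ n) * (T : ℝ) := by gcongr
    linarith
  · simp [timeMap]
  · simpa [timeMap] using ha

/-- The increments telescope in `y`, then in `x`, then in `s`. Cells are selected by their upper
corners, which fits open orthants and hence left continuity. -/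
theorem boxInc_sum_orthant {F : ℝ≥0 → ℝ → ℝ → ℝ} {s : ℕ → ℝ≥0} {x y : ℕ → ℝ} (hs : Monotone s)
    (hx : Monotone x) (hy : Monotone y) (N : ℕ) (a : ℝ≥0) (b c : ℝ) :
    ∑ i ∈ Finset.range N, ∑ j ∈ Finset.range N, ∑ k ∈ Finset.range N,
      (if s (i + 1) < a then (if x (j + 1) < b then (if y (k + 1) < c then
        boxInc F (s i) (s (i + 1)) (x j) (x (j + 1)) (y k) (y (k + 1)) else 0) else 0) else 0)
    = boxInc F (s 0) (s (Nat.findGreatest (fun i => s i < a) N))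
        (x 0) (x (Nat.findGreatest (fun i => x i < b) N))
        (y 0) (y (Nat.findGreatest (fun i => y i < c) N)) := by
  set c' := y (Nat.findGreatest (fun i => y i < c) N)
  set b' := x (Nat.findGreatest (fun i => x i < b) N)
  have h1 : ∀ i j, ∑ k ∈ Finset.range N, (if y (k + 1) < c then
        boxInc F (s i) (s (i + 1)) (x j) (x (j + 1)) (y k) (y (k + 1)) else 0)
        = boxInc F (s i) (s (i + 1)) (x j) (x (j + 1)) (y 0) c' := fun i j => by
    have := sum_ite_lt_eq_sub hy c (fun z => F (s (i + 1)) (x (j + 1)) z - F (s (i + 1)) (x j) z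
      - (F (s i) (x (j + 1)) z - F (s i) (x j) z)) N
    refine Eq.trans (Finset.sum_congr rfl fun k _ => ?_) (this.trans ?_)
    · split_ifs <;> simp [boxInc]; ring
    · simp [boxInc, c']; ring
  have h2 : ∀ i, ∑ j ∈ Finset.range N, (if x (j + 1) < b then
        boxInc F (s i) (s (i + 1)) (x j) (x (j + 1)) (y 0) c' else 0)
        = boxInc F (s i) (s (i + 1)) (x 0) b' (y 0) c' := fun i => by
    have := sum_ite_lt_eq_sub hx b (fun z => F (s (i + 1)) z c' - F (s (i + 1)) z (y 0)
      - (F (s i) z c' - F (s i) z (y 0))) N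
    refine Eq.trans (Finset.sum_congr rfl fun k _ => ?_) (this.trans ?_)
    · split_ifs <;> simp [boxInc]; ring
    · simp [boxInc, b']; ring
  have h3 := sum_ite_lt_eq_sub hs a (fun z => F z b' c' - F z (x 0) c' - F z b' (y 0)
    + F z (x 0) (y 0)) N
  refine Eq.trans (Finset.sum_congr rfl fun i _ => ?_) (h3.trans ?_)
  · by_cases hi : s (i + 1) < a
    · simp only [hi, if_true]
      rw [show (F (s (i + 1)) b' c' - F (s (i + 1)) (x 0) c' - F (s (i + 1)) b' (y 0)
        + F (s (i + 1)) (x 0) (y 0)) - (F (s i) b' c' - F (s i) (x 0) c' - F (s i) b' (y 0)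
        + F (s i) (x 0) (y 0)) = boxInc F (s i) (s (i + 1)) (x 0) b' (y 0) c' from rfl, ← h2 i]
      refine Finset.sum_congr rfl fun j _ => ?_
      by_cases hj : x (j + 1) < b
      · simp only [hj, if_true]; exact h1 i j
      · simp [hj]
    · simp [hi]
  · rfl

/-- The lower orthant with corner `(a, b, c)`. -/
def orthant (a : ℝ≥0) (b c : ℝ) : Set (ℝ≥0 × ℝ × ℝ) := Set.Iio a ×ˢ Set.Iio b ×ˢ Set.Iio c

theorem isOpen_orthant (a : ℝ≥0) (b c : ℝ) : IsOpen (orthant a b c) :=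
  isOpen_Iio.prod (isOpen_Iio.prod isOpen_Iio)

theorem frontier_orthant_subset (a : ℝ≥0) (b c : ℝ) :
    frontier (orthant a b c) ⊆ {z | z.1 = a} ∪ ({z | z.2.1 = b} ∪ {z | z.2.2 = c}) := by
  intro z hz
  rw [(isOpen_orthant a b c).frontier_eq] at hz
  have h1 : closure (orthant a b c) ⊆ Set.Iic a ×ˢ Set.Iic b ×ˢ Set.Iic c :=
    closure_minimal (Set.prod_mono Set.Iio_subset_Iic_self
      (Set.prod_mono Set.Iio_subset_Iic_self Set.Iio_subset_Iic_self))
      (isClosed_Iic.prod (isClosed_Iic.prod isClosed_Iic))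
  obtain ⟨h2, h3, h4⟩ := h1 hz.1
  have h5 := hz.2
  simp only [orthant, Set.mem_prod, Set.mem_Iio, not_and_or, not_lt] at h5
  rcases h5 with h | h | h
  · exact Or.inl (le_antisymm h2 h)
  · exact Or.inr (Or.inl (le_antisymm h3 h))
  · exact Or.inr (Or.inr (le_antisymm h4 h))

/-- The portmanteau bound for closed sets is applied to the closure of `A` and to its complement;
convergence of the total masses turns the second bound into a lower bound for `A`. -/
theorem tendsto_measureReal_of_null_frontier {E ι : Type*} [MeasurableSpace E] [TopologicalSpace E]
    [HasOuterApproxClosed E] [OpensMeasurableSpace E] {L : Filter ι} {ν : FiniteMeasure E}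
    {μ : ι → FiniteMeasure E} (h : Tendsto μ L (𝓝 ν)) {A : Set E} (hA : IsOpen A)
    (h0 : (ν : Measure E) (frontier A) = 0) :
    Tendsto (fun i => (μ i : Measure E).real A) L (𝓝 ((ν : Measure E).real A)) := by
  have hcl : ∀ B : Set E, IsClosed B → ∀ ε > 0, ∀ᶠ i in L,
      (μ i : Measure E).real B < (ν : Measure E).real B + ε := fun B hB ε hε => by
    have h1 := FiniteMeasure.limsup_measure_closed_le_of_tendsto h hB
    have h2 : (ν : Measure E) B < (ν : Measure E) B + ENNReal.ofReal ε :=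
      ENNReal.lt_add_right (measure_ne_top _ _) (by simpa using hε)
    filter_upwards [eventually_lt_of_limsup_lt (h1.trans_lt h2)] with i hi
    have h3 := ENNReal.toReal_strict_mono (by finiteness) hi
    rwa [ENNReal.toReal_add (measure_ne_top _ _) ENNReal.ofReal_ne_top,
      ENNReal.toReal_ofReal hε.le] at h3
  have hm : Tendsto (fun i => (μ i : Measure E).real Set.univ) L
      (𝓝 ((ν : Measure E).real Set.univ)) := by
    have := (FiniteMeasure.continuous_mass (Ω := E)).continuousAt.tendsto.comp h
    exact (NNReal.tendsto_coe.2 this)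
  have hclA : (ν : Measure E).real (closure A) = (ν : Measure E).real A := by
    refine le_antisymm ?_ (measureReal_mono subset_closure)
    rw [closure_eq_self_union_frontier]
    refine (measureReal_union_le _ _).trans ?_
    simp [Measure.real, h0]
  rw [Metric.tendsto_nhds]
  intro ε hε
  filter_upwards [hcl _ (isClosed_closure (s := A)) (ε / 2) (by positivity),
    hcl _ hA.isClosed_compl (ε / 2) (by positivity),
    (Metric.tendsto_nhds.1 hm) (ε / 2) (by positivity)] with i h1 h2 h3
  rw [Real.dist_eq, abs_lt] at h3 ⊢
  have h4 : (μ i : Measure E).real A ≤ (μ i : Measure E).real (closure A) :=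
    measureReal_mono subset_closure
  rw [measureReal_compl hA.measurableSet, measureReal_compl hA.measurableSet] at h2
  constructor <;> linarith

theorem exists_seq_notMem_countable {D : Set ℝ} (hD : D.Countable) {l a : ℝ} (h : l < a) :
    ∃ u : ℕ → ℝ, StrictMono u ∧ (∀ n, u n ∈ Set.Ioo l a ∧ u n ∉ D) ∧ Tendsto u atTop (𝓝 a) := by
  obtain ⟨u, hu, hm, ht⟩ :=
    (hD.dense_compl ℝ).exists_seq_strictMono_tendsto_of_lt h
  exact ⟨u, hu, fun n => ⟨(hm n).1, (hm n).2⟩, ht⟩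

theorem countable_level_pos {β : Type*} [MeasurableSpace β] [MeasurableSingletonClass β]
    (ν : Measure (ℝ≥0 × ℝ × ℝ)) [SFinite ν] {g : ℝ≥0 × ℝ × ℝ → β} (hg : Measurable g) :
    {t : β | ν {z | g z = t} ≠ 0}.Countable := by
  simpa [pos_iff_ne_zero] using Measure.countable_meas_level_set_pos (μ := ν) hg

/-- Open orthants are exhausted from below by smaller ones. Any measure thus has the left continuity
in the corner that is assumed of `F`, and equality at good corners extends to all. -/
theorem tendsto_measureReal_orthant (ν : Measure (ℝ≥0 × ℝ × ℝ)) [IsFiniteMeasure ν]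
    {a : ℕ → ℝ≥0} {b c : ℕ → ℝ} {a' : ℝ≥0} {b' c' : ℝ} (ha : StrictMono a) (hb : StrictMono b)
    (hc : StrictMono c) (ha' : Tendsto a atTop (𝓝 a')) (hb' : Tendsto b atTop (𝓝 b'))
    (hc' : Tendsto c atTop (𝓝 c')) :
    Tendsto (fun n => ν.real (orthant (a n) (b n) (c n))) atTop (𝓝 (ν.real (orthant a' b' c'))) := by
  have hmono : Monotone fun n => orthant (a n) (b n) (c n) := fun m n h =>
    Set.prod_mono (Set.Iio_subset_Iio (ha.monotone h)) (Set.prod_mono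
      (Set.Iio_subset_Iio (hb.monotone h)) (Set.Iio_subset_Iio (hc.monotone h)))
  have hU : ⋃ n, orthant (a n) (b n) (c n) = orthant a' b' c' := by
    apply Set.Subset.antisymm
    · refine Set.iUnion_subset fun n => Set.prod_mono (Set.Iio_subset_Iio ?_) (Set.prod_mono
        (Set.Iio_subset_Iio ?_) (Set.Iio_subset_Iio ?_))
      · exact ha.monotone.ge_of_tendsto ha' n
      · exact hb.monotone.ge_of_tendsto hb' n
      · exact hc.monotone.ge_of_tendsto hc' n
    · rintro ⟨s, x, y⟩ ⟨h1, h2, h3⟩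
      obtain ⟨n, h4, h5, h6⟩ := ((ha'.eventually_const_lt h1).and
        ((hb'.eventually_const_lt h2).and (hc'.eventually_const_lt h3))).exists
      exact Set.mem_iUnion.2 ⟨n, h4, h5, h6⟩
  have := tendsto_measure_iUnion_atTop (μ := ν) hmono
  rw [hU] at this
  exact (ENNReal.tendsto_toReal (measure_ne_top _ _)).comp this

theorem IsLeftCont.tendsto_boxInc {T : ℝ≥0} {F : ℝ≥0 → ℝ → ℝ → ℝ} (hF : IsLeftCont T F)
    {a₁ a₂ : ℕ → ℝ≥0} {b₁ b₂ c₁ c₂ : ℕ → ℝ} {p₁ p₂ : ℝ≥0} {x₁ x₂ y₁ y₂ : ℝ}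
    (h₁ : p₁ ≤ T) (h₂ : p₂ ≤ T) (ha₁ : Monotone a₁) (ha₂ : Monotone a₂) (hb₁ : Monotone b₁)
    (hb₂ : Monotone b₂) (hc₁ : Monotone c₁) (hc₂ : Monotone c₂)
    (ta₁ : Tendsto a₁ atTop (𝓝 p₁)) (ta₂ : Tendsto a₂ atTop (𝓝 p₂))
    (tb₁ : Tendsto b₁ atTop (𝓝 x₁)) (tb₂ : Tendsto b₂ atTop (𝓝 x₂))
    (tc₁ : Tendsto c₁ atTop (𝓝 y₁)) (tc₂ : Tendsto c₂ atTop (𝓝 y₂)) :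
    Tendsto (fun n => boxInc F (a₁ n) (a₂ n) (b₁ n) (b₂ n) (c₁ n) (c₂ n)) atTop
      (𝓝 (boxInc F p₁ p₂ x₁ x₂ y₁ y₂)) := by
  have key : ∀ {a : ℕ → ℝ≥0} {b c : ℕ → ℝ} {p : ℝ≥0} {x y : ℝ}, p ≤ T → Monotone a → Monotone b →
      Monotone c → Tendsto a atTop (𝓝 p) → Tendsto b atTop (𝓝 x) → Tendsto c atTop (𝓝 y) →
      Tendsto (fun n => F (a n) (b n) (c n)) atTop (𝓝 (F p x y)) :=
    fun {a b c p x y} hp ha hb hc ta tb tc =>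
      hF (p, x, y) (fun n => (a n, b n, c n)) hp
        (fun m n h => ⟨ha h, hb h, hc h⟩) (ta.prodMk_nhds (tb.prodMk_nhds tc))
  unfold boxInc
  exact ((((key h₂ ha₂ hb₂ hc₂ ta₂ tb₂ tc₂).sub (key h₂ ha₂ hb₁ hc₂ ta₂ tb₁ tc₂)).sub
    (key h₂ ha₂ hb₂ hc₁ ta₂ tb₂ tc₁)).add (key h₂ ha₂ hb₁ hc₁ ta₂ tb₁ tc₁)).sub
    ((((key h₁ ha₁ hb₂ hc₂ ta₁ tb₂ tc₂).sub (key h₁ ha₁ hb₁ hc₂ ta₁ tb₁ tc₂)).sub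
    (key h₁ ha₁ hb₂ hc₁ ta₁ tb₂ tc₁)).add (key h₁ ha₁ hb₁ hc₁ ta₁ tb₁ tc₁))

/-- The grid points of level `n` in `[0, T]`. -/
def gridT (T : ℝ≥0) (n i : ℕ) : ℝ≥0 := timeMap T (dyad n i)

/-- The grid points of level `n` in `[-R, R]`. -/
def gridX (R : ℝ) (n i : ℕ) : ℝ := spaceMap R (dyad n i)

theorem gridT_mono (T : ℝ≥0) (n : ℕ) : Monotone (gridT T n) :=
  (timeMap_mono T).comp (dyad_mono n)

theorem gridX_mono {R : ℝ} (hR : 0 ≤ R) (n : ℕ) : Monotone (gridX R n) :=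
  (spaceMap_mono hR).comp (dyad_mono n)

theorem gridT_zero (T : ℝ≥0) (n : ℕ) : gridT T n 0 = 0 := by
  simp [gridT, dyad_zero, timeMap_zero]

theorem gridX_zero (R : ℝ) (n : ℕ) : gridX R n 0 = -R := by
  simp [gridX, dyad_zero, spaceMap_zero]

theorem gridT_le (T : ℝ≥0) (n i : ℕ) : gridT T n i ≤ T := by
  have := timeMap_mono T (dyad_le_one n i)
  rwa [timeMap_one] at this

theorem abs_gridX_le {R : ℝ} (hR : 0 ≤ R) (n i : ℕ) : |gridX R n i| ≤ R := by
  have h1 := spaceMap_mono hR (dyad_le_one n i)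
  have h2 := spaceMap_mono hR (dyad_nonneg n i)
  rw [spaceMap_one] at h1
  rw [spaceMap_zero] at h2
  exact abs_le.2 ⟨h2, h1⟩

/-- The measure that puts the weights `w` on the upper corners of the grid cells of level `n`. -/
def gridMeasure (T : ℝ≥0) (R : ℝ) (n : ℕ) (w : ℕ → ℕ → ℕ → ℝ≥0) : Measure (ℝ≥0 × ℝ × ℝ) :=
  ∑ i ∈ Finset.range (2 ^ n), ∑ j ∈ Finset.range (2 ^ n), ∑ k ∈ Finset.range (2 ^ n),
    w i j k • Measure.dirac (gridT T n (i + 1), gridX R n (j + 1), gridX R n (k + 1))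

instance (T : ℝ≥0) (R : ℝ) (n : ℕ) (w : ℕ → ℕ → ℕ → ℝ≥0) : IsFiniteMeasure (gridMeasure T R n w) := by
  unfold gridMeasure
  refine isFiniteMeasure_iff _ |>.2 ?_
  simp only [Measure.coe_finsetSum, Finset.sum_apply, Measure.smul_apply]
  refine ENNReal.sum_lt_top.2 fun i _ => ENNReal.sum_lt_top.2 fun j _ => ENNReal.sum_lt_top.2
    fun k _ => ?_
  simp [ENNReal.smul_def]

theorem gridMeasure_real (T : ℝ≥0) (R : ℝ) (n : ℕ) (w : ℕ → ℕ → ℕ → ℝ≥0)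
    {A : Set (ℝ≥0 × ℝ × ℝ)} (hA : MeasurableSet A) :
    (gridMeasure T R n w).real A = ∑ i ∈ Finset.range (2 ^ n), ∑ j ∈ Finset.range (2 ^ n),
      ∑ k ∈ Finset.range (2 ^ n), (w i j k : ℝ) *
        A.indicator 1 (gridT T n (i + 1), gridX R n (j + 1), gridX R n (k + 1)) := by
  have hfin : ∀ i j k, (w i j k • Measure.dirac (gridT T n (i + 1), gridX R n (j + 1),
      gridX R n (k + 1))) A ≠ ∞ := fun i j k => by
    simp only [Measure.smul_apply, ENNReal.smul_def, smul_eq_mul]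
    exact ENNReal.mul_ne_top ENNReal.coe_ne_top (measure_ne_top _ _)
  unfold gridMeasure Measure.real
  simp only [Measure.coe_finsetSum, Finset.sum_apply]
  rw [ENNReal.toReal_sum fun i _ => (ENNReal.sum_lt_top.2 fun j _ => ENNReal.sum_lt_top.2
    fun k _ => (hfin i j k).lt_top).ne]
  refine Finset.sum_congr rfl fun i _ => ?_
  rw [ENNReal.toReal_sum fun j _ => (ENNReal.sum_lt_top.2 fun k _ => (hfin i j k).lt_top).ne]
  refine Finset.sum_congr rfl fun j _ => ?_
  rw [ENNReal.toReal_sum fun k _ => hfin i j k]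
  refine Finset.sum_congr rfl fun k _ => ?_
  simp only [Measure.smul_apply, ENNReal.smul_def, smul_eq_mul, ENNReal.toReal_mul,
    ENNReal.coe_toReal, Measure.dirac_apply' _ hA]
  congr 1
  by_cases h : (gridT T n (i + 1), gridX R n (j + 1), gridX R n (k + 1)) ∈ A <;> simp [h]

/-- The weights will be the positive and negative parts of the increments of the cells; for orthants
only their difference counts, and it telescopes. -/
theorem gridMeasure_real_sub_orthant {R : ℝ} (hR : 0 ≤ R) (T : ℝ≥0) (n : ℕ)
    (F : ℝ≥0 → ℝ → ℝ → ℝ) {w w' : ℕ → ℕ → ℕ → ℝ≥0}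
    (hw : ∀ i j k, (w i j k : ℝ) - w' i j k = boxInc F (gridT T n i) (gridT T n (i + 1))
      (gridX R n j) (gridX R n (j + 1)) (gridX R n k) (gridX R n (k + 1))) (a : ℝ≥0) (b c : ℝ) :
    (gridMeasure T R n w).real (orthant a b c) - (gridMeasure T R n w').real (orthant a b c)
      = boxInc F 0 (gridBelow (timeMap T) a n) (-R) (gridBelow (spaceMap R) b n)
          (-R) (gridBelow (spaceMap R) c n) := by
  have hm := (isOpen_orthant a b c).measurableSet
  have := boxInc_sum_orthant (F := F) (gridT_mono T n) (gridX_mono hR n) (gridX_mono hR n)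
    (2 ^ n) a b c
  rw [gridT_zero, gridX_zero] at this
  rw [gridMeasure_real _ _ _ _ hm, gridMeasure_real _ _ _ _ hm]
  simp only [← Finset.sum_sub_distrib]
  refine Eq.trans ?_ this
  refine Finset.sum_congr rfl fun i _ => Finset.sum_congr rfl fun j _ =>
    Finset.sum_congr rfl fun k _ => ?_
  rw [← sub_mul, hw]
  by_cases h1 : gridT T n (i + 1) < a <;> by_cases h2 : gridX R n (j + 1) < b <;>
    by_cases h3 : gridX R n (k + 1) < c <;> simp [orthant, h1, h2, h3]

theorem gridMeasure_compl {R : ℝ} (hR : 0 ≤ R) (T : ℝ≥0) (n : ℕ) (w : ℕ → ℕ → ℕ → ℝ≥0) :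
    gridMeasure T R n w (Set.Icc 0 T ×ˢ Set.Icc (-R) R ×ˢ Set.Icc (-R) R)ᶜ = 0 := by
  have hm : MeasurableSet (Set.Icc 0 T ×ˢ Set.Icc (-R) R ×ˢ Set.Icc (-R) R)ᶜ := by measurability
  rw [← measureReal_eq_zero_iff, gridMeasure_real _ _ _ _ hm]
  refine Finset.sum_eq_zero fun i _ => Finset.sum_eq_zero fun j _ => Finset.sum_eq_zero
    fun k _ => ?_
  have h1 := gridT_le T n (i + 1)
  have h2 := abs_le.1 (abs_gridX_le hR n (j + 1))
  have h3 := abs_le.1 (abs_gridX_le hR n (k + 1))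
  rw [Set.indicator_of_notMem, mul_zero]
  simp only [Set.mem_compl_iff, not_not]
  exact ⟨⟨zero_le, h1⟩, h2, h3⟩

/-- On a compact box there are finite measures whose difference has the increments of `F`. -/
theorem exists_finiteMeasure_orthant {T : ℝ≥0} {R : ℝ} (hR : 0 ≤ R) {F : ℝ≥0 → ℝ → ℝ → ℝ}
    (hF : IsLeftCont T F) (hbv : IsLocBV T F) :
    ∃ ν₁ ν₂ : FiniteMeasure (ℝ≥0 × ℝ × ℝ), ∀ a b c, a ≤ T → |b| ≤ R → |c| ≤ R →
      (ν₁ : Measure (ℝ≥0 × ℝ × ℝ)).real (orthant a b c)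
        - (ν₂ : Measure (ℝ≥0 × ℝ × ℝ)).real (orthant a b c) = boxInc F 0 a (-R) b (-R) c := by
  obtain ⟨C, hC⟩ := hbv R
  set B : ℕ → ℕ → ℕ → ℕ → ℝ := fun n i j k => boxInc F (gridT T n i) (gridT T n (i + 1))
      (gridX R n j) (gridX R n (j + 1)) (gridX R n k) (gridX R n (k + 1)) with hB
  set K : Set (ℝ≥0 × ℝ × ℝ) := Set.Icc 0 T ×ˢ Set.Icc (-R) R ×ˢ Set.Icc (-R) R with hKdef
  have hK : IsCompact K := isCompact_Icc.prod (isCompact_Icc.prod isCompact_Icc)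
  set μ₁ : ℕ → FiniteMeasure (ℝ≥0 × ℝ × ℝ) := fun n =>
    ⟨gridMeasure T R n fun i j k => (B n i j k).toNNReal, inferInstance⟩ with hμ₁
  set μ₂ : ℕ → FiniteMeasure (ℝ≥0 × ℝ × ℝ) := fun n =>
    ⟨gridMeasure T R n fun i j k => (-B n i j k).toNNReal, inferInstance⟩ with hμ₂
  have hmass : ∀ (n : ℕ) (w : ℕ → ℕ → ℕ → ℝ≥0) (_ : ∀ i j k, (w i j k : ℝ) ≤ |B n i j k|),
      FiniteMeasure.mass (⟨gridMeasure T R n w, inferInstance⟩ : FiniteMeasure (ℝ≥0 × ℝ × ℝ))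
      ≤ C.toNNReal := by
    intro n w hw
    rw [← NNReal.coe_le_coe]
    change (gridMeasure T R n w).real Set.univ ≤ _
    rw [gridMeasure_real _ _ _ _ MeasurableSet.univ]
    refine le_trans ?_ (Real.le_coe_toNNReal C)
    refine le_trans ?_ (hC (2 ^ n) _ _ _ (gridT_mono T n) (gridX_mono hR n) (gridX_mono hR n)
      (gridT_le T n) (abs_gridX_le hR n) (abs_gridX_le hR n))
    refine Finset.sum_le_sum fun i _ => Finset.sum_le_sum fun j _ => Finset.sum_le_sum
      fun k _ => ?_
    simpa using hw i j k
  -- Bounded mass on a fixed compact set gives weak compactness. Limits along one ultrafilter serve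
  -- both sequences at once, so no subsequences have to be extracted.
  have hcpt := isCompact_setOfPred_finiteMeasure_le_of_isCompact C.toNNReal hK
  have hmem₁ : ∀ n, μ₁ n ∈ {μ : FiniteMeasure (ℝ≥0 × ℝ × ℝ) | μ.mass ≤ C.toNNReal ∧ μ Kᶜ = 0} :=
    fun n => ⟨hmass n _ fun i j k => by
      rw [Real.coe_toNNReal']; exact max_le (le_abs_self _) (abs_nonneg _),
      (FiniteMeasure.null_iff_toMeasure_null _ _).2 (gridMeasure_compl hR T n _)⟩
  have hmem₂ : ∀ n, μ₂ n ∈ {μ : FiniteMeasure (ℝ≥0 × ℝ × ℝ) | μ.mass ≤ C.toNNReal ∧ μ Kᶜ = 0} :=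
    fun n => ⟨hmass n _ fun i j k => by
      rw [Real.coe_toNNReal']; exact max_le (neg_le_abs _) (abs_nonneg _),
      (FiniteMeasure.null_iff_toMeasure_null _ _).2 (gridMeasure_compl hR T n _)⟩
  set U : Ultrafilter ℕ := Filter.hyperfilter ℕ
  have hU : (U : Filter ℕ) ≤ atTop := Nat.hyperfilter_le_atTop
  obtain ⟨ν₁, hν₁m, hν₁⟩ := hcpt.ultrafilter_le_nhds (U.map μ₁)
    (by rw [Ultrafilter.coe_map]; exact le_principal_iff.2 (Filter.mem_map.2 (Filter.univ_mem' hmem₁)))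
  obtain ⟨ν₂, hν₂m, hν₂⟩ := hcpt.ultrafilter_le_nhds (U.map μ₂)
    (by rw [Ultrafilter.coe_map]; exact le_principal_iff.2 (Filter.mem_map.2 (Filter.univ_mem' hmem₂)))
  have ht₁ : Tendsto μ₁ U (𝓝 ν₁) := hν₁
  have ht₂ : Tendsto μ₂ U (𝓝 ν₂) := hν₂
  refine ⟨ν₁, ν₂, ?_⟩
  set ν : Measure (ℝ≥0 × ℝ × ℝ) := (ν₁ : Measure _) + (ν₂ : Measure _) with hν
  -- orthants whose frontier has no mass
  have hgood : ∀ a b c, a ≤ T → |b| ≤ R → |c| ≤ R → ν {z | z.1 = a} = 0 → ν {z | z.2.1 = b} = 0 →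
      ν {z | z.2.2 = c} = 0 → (ν₁ : Measure (ℝ≥0 × ℝ × ℝ)).real (orthant a b c)
        - (ν₂ : Measure (ℝ≥0 × ℝ × ℝ)).real (orthant a b c) = boxInc F 0 a (-R) b (-R) c := by
    intro a b c ha hb hc h1 h2 h3
    have hfr : ν (frontier (orthant a b c)) = 0 :=
      measure_mono_null (frontier_orthant_subset a b c)
        (measure_union_null h1 (measure_union_null h2 h3))
    rw [hν, Measure.add_apply, add_eq_zero] at hfr
    have l1 := (tendsto_measureReal_of_null_frontier ht₁ (isOpen_orthant a b c) hfr.1).sub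
      (tendsto_measureReal_of_null_frontier ht₂ (isOpen_orthant a b c) hfr.2)
    refine tendsto_nhds_unique l1 ?_
    have l2 := hF.tendsto_boxInc (zero_le : 0 ≤ T) ha (a₁ := fun _ => 0) (b₁ := fun _ => -R)
      (c₁ := fun _ => -R) monotone_const (gridBelow_mono (timeMap_mono T) a) monotone_const
      (gridBelow_mono (spaceMap_mono hR) b) monotone_const (gridBelow_mono (spaceMap_mono hR) c)
      tendsto_const_nhds (tendsto_gridBelow_time T ha) tendsto_const_nhds
      (tendsto_gridBelow_space hR hb) tendsto_const_nhds (tendsto_gridBelow_space hR hc)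
    refine (l2.mono_left hU).congr fun n => ?_
    refine (gridMeasure_real_sub_orthant hR T n F (fun i j k => ?_) a b c).symm
    simp only [Real.coe_toNNReal']
    exact max_zero_sub_eq_self _
  -- At other corners, approach from below through levels without mass; only countably many levels
  -- are excluded. This needs room below the corner, so the corners on the lower faces, where both
  -- sides vanish, are treated apart.
  intro a b c ha hb hc
  have hsupp : ∀ A, Disjoint A K → (ν₁ : Measure (ℝ≥0 × ℝ × ℝ)).real A
      - (ν₂ : Measure (ℝ≥0 × ℝ × ℝ)).real A = 0 := fun A hA => by
    have e1 : (ν₁ : Measure (ℝ≥0 × ℝ × ℝ)) A = 0 := measure_mono_null hA.subset_compl_right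
      ((FiniteMeasure.null_iff_toMeasure_null _ _).1 hν₁m.2)
    have e2 : (ν₂ : Measure (ℝ≥0 × ℝ × ℝ)) A = 0 := measure_mono_null hA.subset_compl_right
      ((FiniteMeasure.null_iff_toMeasure_null _ _).1 hν₂m.2)
    simp [Measure.real, e1, e2]
  rcases eq_or_ne a 0 with rfl | ha0
  · rw [hsupp]
    · simp [boxInc]
    · exact Set.disjoint_left.2 fun z hz _ => absurd hz.1 (by simp)
  rcases eq_or_ne b (-R) with rfl | hb0
  · rw [hsupp]
    · simp [boxInc]
    · exact Set.disjoint_left.2 fun z hz hz' => absurd hz.2.1 (not_lt.2 hz'.2.1.1)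
  rcases eq_or_ne c (-R) with rfl | hc0
  · rw [hsupp]
    · simp [boxInc]
    · exact Set.disjoint_left.2 fun z hz hz' => absurd hz.2.2 (not_lt.2 hz'.2.2.1)
  have hbl : -R < b := lt_of_le_of_ne (abs_le.1 hb).1 hb0.symm
  have hcl : -R < c := lt_of_le_of_ne (abs_le.1 hc).1 hc0.symm
  have hal : (0 : ℝ) < a := by exact_mod_cast pos_iff_ne_zero.2 ha0
  obtain ⟨u, hu, hum, hut⟩ := exists_seq_notMem_countable
    ((countable_level_pos ν measurable_fst).image ((↑) : ℝ≥0 → ℝ)) hal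
  obtain ⟨v, hv, hvm, hvt⟩ := exists_seq_notMem_countable
    (countable_level_pos ν (measurable_fst.comp measurable_snd)) hbl
  obtain ⟨w, hw, hwm, hwt⟩ := exists_seq_notMem_countable
    (countable_level_pos ν (measurable_snd.comp measurable_snd)) hcl
  set u' : ℕ → ℝ≥0 := fun n => ⟨u n, (hum n).1.1.le⟩ with hu'
  have hu'm : StrictMono u' := fun m n h => by
    rw [← NNReal.coe_lt_coe]; exact hu h
  have hu't : Tendsto u' atTop (𝓝 a) := NNReal.tendsto_coe.1 hut
  have hf := (tendsto_measureReal_orthant (ν₁ : Measure (ℝ≥0 × ℝ × ℝ)) hu'm hv hw hu't hvt hwt).sub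
    (tendsto_measureReal_orthant (ν₂ : Measure (ℝ≥0 × ℝ × ℝ)) hu'm hv hw hu't hvt hwt)
  refine tendsto_nhds_unique hf ?_
  have l2 := hF.tendsto_boxInc (zero_le : 0 ≤ T) ha (a₁ := fun _ => 0) (b₁ := fun _ => -R)
      (c₁ := fun _ => -R) monotone_const hu'm.monotone monotone_const hv.monotone monotone_const
      hw.monotone tendsto_const_nhds hu't tendsto_const_nhds hvt tendsto_const_nhds hwt
  refine l2.congr fun n => ?_
  refine (hgood _ _ _ ?_ ?_ ?_ ?_ ?_ ?_).symm
  · exact (hu'm.monotone.ge_of_tendsto hu't n).trans ha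
  · exact abs_le.2 ⟨(hvm n).1.1.le, (hvm n).1.2.le.trans (abs_le.1 hb).2⟩
  · exact abs_le.2 ⟨(hwm n).1.1.le, (hwm n).1.2.le.trans (abs_le.1 hc).2⟩
  · by_contra h; exact (hum n).2 ⟨u' n, h, rfl⟩
  · by_contra h; exact (hvm n).2 h
  · by_contra h; exact (hwm n).2 h

/-- Inclusion and exclusion, one variable at a time: a half-open box is an alternating combination
of eight open orthants. -/
theorem measureReal_box_eq_boxInc (ν : Measure (ℝ≥0 × ℝ × ℝ)) [IsFiniteMeasure ν]
    {s₁ s₂ : ℝ≥0} {x₁ x₂ y₁ y₂ : ℝ} (hs : s₁ ≤ s₂) (hx : x₁ ≤ x₂) (hy : y₁ ≤ y₂) :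
    ν.real (Set.Ico s₁ s₂ ×ˢ Set.Ico x₁ x₂ ×ˢ Set.Ico y₁ y₂)
      = boxInc (fun a b c => ν.real (orthant a b c)) s₁ s₂ x₁ x₂ y₁ y₂ := by
  have h1 : ∀ s x, ν.real (Set.Iio s ×ˢ Set.Iio x ×ˢ Set.Ico y₁ y₂)
      = ν.real (orthant s x y₂) - ν.real (orthant s x y₁) := fun s x => by
    rw [orthant, orthant, ← measureReal_sdiff (Set.prod_mono_right (Set.prod_mono_right
      (Set.Iio_subset_Iio hy))) (isOpen_orthant _ _ _).measurableSet]
    congr 1; ext z; simp only [Set.mem_prod, Set.mem_sdiff, Set.mem_Iio, Set.mem_Ico]; grind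
  have h2 : ∀ s, ν.real (Set.Iio s ×ˢ Set.Ico x₁ x₂ ×ˢ Set.Ico y₁ y₂)
      = ν.real (Set.Iio s ×ˢ Set.Iio x₂ ×ˢ Set.Ico y₁ y₂)
        - ν.real (Set.Iio s ×ˢ Set.Iio x₁ ×ˢ Set.Ico y₁ y₂) := fun s => by
    rw [← measureReal_sdiff (Set.prod_mono_right (Set.prod_mono_left (Set.Iio_subset_Iio hx)))
      (by measurability)]
    congr 1; ext z; simp only [Set.mem_prod, Set.mem_sdiff, Set.mem_Iio, Set.mem_Ico]; grind
  have h3 : ν.real (Set.Ico s₁ s₂ ×ˢ Set.Ico x₁ x₂ ×ˢ Set.Ico y₁ y₂)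
      = ν.real (Set.Iio s₂ ×ˢ Set.Ico x₁ x₂ ×ˢ Set.Ico y₁ y₂)
        - ν.real (Set.Iio s₁ ×ˢ Set.Ico x₁ x₂ ×ˢ Set.Ico y₁ y₂) := by
    rw [← measureReal_sdiff (Set.prod_mono_left (Set.Iio_subset_Iio hs)) (by measurability)]
    congr 1; ext z; simp only [Set.mem_prod, Set.mem_sdiff, Set.mem_Iio, Set.mem_Ico]; grind
  rw [h3, h2, h2, h1, h1, h1, h1, boxInc]
  ring

/-- On a compact box there are finite measures whose difference has the increments of `F`. -/
theorem exists_measure_box {T : ℝ≥0} {R : ℝ} (hR : 0 ≤ R) {F : ℝ≥0 → ℝ → ℝ → ℝ}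
    (hF : IsLeftCont T F) (hbv : IsLocBV T F) :
    ∃ ν₁ ν₂ : Measure (ℝ≥0 × ℝ × ℝ), IsFiniteMeasure ν₁ ∧ IsFiniteMeasure ν₂ ∧
      ∀ s₁ s₂ x₁ x₂ y₁ y₂, s₁ ≤ s₂ → s₂ ≤ T → x₁ ≤ x₂ → y₁ ≤ y₂ → |x₁| ≤ R → |x₂| ≤ R →
      |y₁| ≤ R → |y₂| ≤ R →
      ν₁.real (Set.Ico s₁ s₂ ×ˢ Set.Ico x₁ x₂ ×ˢ Set.Ico y₁ y₂)
        - ν₂.real (Set.Ico s₁ s₂ ×ˢ Set.Ico x₁ x₂ ×ˢ Set.Ico y₁ y₂)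
        = boxInc F s₁ s₂ x₁ x₂ y₁ y₂ := by
  obtain ⟨ν₁, ν₂, h⟩ := exists_finiteMeasure_orthant hR hF hbv
  refine ⟨ν₁, ν₂, inferInstance, inferInstance, ?_⟩
  intro s₁ s₂ x₁ x₂ y₁ y₂ hs hT hx hy hx₁ hx₂ hy₁ hy₂
  rw [measureReal_box_eq_boxInc _ hs hx hy, measureReal_box_eq_boxInc _ hs hx hy]
  have hs₁ := hs.trans hT
  have e := h s₂ x₂ y₂ hT hx₂ hy₂
  have e2 := h s₂ x₁ y₂ hT hx₁ hy₂
  have e3 := h s₂ x₂ y₁ hT hx₂ hy₁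
  have e4 := h s₂ x₁ y₁ hT hx₁ hy₁
  have e5 := h s₁ x₂ y₂ hs₁ hx₂ hy₂
  have e6 := h s₁ x₁ y₂ hs₁ hx₁ hy₂
  have e7 := h s₁ x₂ y₁ hs₁ hx₂ hy₁
  have e8 := h s₁ x₁ y₁ hs₁ hx₁ hy₁
  simp only [boxInc] at e e2 e3 e4 e5 e6 e7 e8 ⊢
  linarith

/-- Truncation of a real number to `[-R, R]`. -/
def clip (R x : ℝ) : ℝ := max (-R) (min x R)

theorem clip_mono (R : ℝ) : Monotone (clip R) := fun a b h => by unfold clip; gcongr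

theorem abs_clip_le {R : ℝ} (hR : 0 ≤ R) (x : ℝ) : |clip R x| ≤ R := by
  unfold clip
  exact abs_le.2 ⟨le_max_left _ _, max_le (by linarith) (min_le_right _ _)⟩

theorem clip_of_abs_le {R x : ℝ} (h : |x| ≤ R) : clip R x = x := by
  obtain ⟨h1, h2⟩ := abs_le.1 h
  simp [clip, h1, h2]

theorem clip_zero_left (x : ℝ) : clip 0 x = 0 := by
  simp only [clip, neg_zero]
  exact max_eq_left (min_le_right _ _)

/-- The part of `[0, T) × ℝ × ℝ` with space coordinates in `[-R, R)`. -/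
def slab (T : ℝ≥0) (R : ℝ) : Set (ℝ≥0 × ℝ × ℝ) := Set.Iio T ×ˢ Set.Ico (-R) R ×ˢ Set.Ico (-R) R

theorem measurableSet_slab (T : ℝ≥0) (R : ℝ) : MeasurableSet (slab T R) := by
  unfold slab; measurability

theorem slab_mono (T : ℝ≥0) {R R' : ℝ} (h : R ≤ R') : slab T R ⊆ slab T R' :=
  Set.prod_mono_right (Set.prod_mono (Set.Ico_subset_Ico (neg_le_neg h) h)
    (Set.Ico_subset_Ico (neg_le_neg h) h))

theorem Ico_inter_Ico_eq_clip (R a b : ℝ) :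
    Set.Ico a b ∩ Set.Ico (-R) R = Set.Ico (clip R a) (clip R b) := by
  ext z
  simp only [clip, Set.mem_inter_iff, Set.mem_Ico, max_le_iff, min_le_iff, lt_max_iff, lt_min_iff]
  grind

theorem box_inter_slab (T : ℝ≥0) (R : ℝ) (s₁ s₂ : ℝ≥0) (x₁ x₂ y₁ y₂ : ℝ) :
    (Set.Ico s₁ s₂ ×ˢ Set.Ico x₁ x₂ ×ˢ Set.Ico y₁ y₂) ∩ slab T R
      = Set.Ico (min s₁ T) (min s₂ T) ×ˢ Set.Ico (clip R x₁) (clip R x₂)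
        ×ˢ Set.Ico (clip R y₁) (clip R y₂) := by
  rw [slab, Set.prod_inter_prod, Set.prod_inter_prod, Ico_inter_Ico_eq_clip, Ico_inter_Ico_eq_clip]
  congr 1
  ext z
  simp only [Set.mem_inter_iff, Set.mem_Ico, Set.mem_Iio, min_le_iff, lt_min_iff]
  grind

/-- A family of measures on slabs, glued together. -/
def glue (T : ℝ≥0) (ν : ℕ → Measure (ℝ≥0 × ℝ × ℝ)) : Measure (ℝ≥0 × ℝ × ℝ) :=
  Measure.sum fun n => (ν n).restrict (slab T (n + 1 : ℕ) \ slab T n)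

theorem glue_apply {T : ℝ≥0} {ν : ℕ → Measure (ℝ≥0 × ℝ × ℝ)} {A : Set (ℝ≥0 × ℝ × ℝ)} {N : ℕ}
    (hA : MeasurableSet A)
    (hN : ∀ z ∈ A, z.2.1 ∈ Set.Ico (-N : ℝ) N ∧ z.2.2 ∈ Set.Ico (-N : ℝ) N) :
    glue T ν A = ∑ n ∈ Finset.range N, ν n (A ∩ (slab T (n + 1 : ℕ) \ slab T n)) := by
  rw [glue, Measure.sum_apply _ hA, tsum_eq_sum (s := Finset.range N)]
  · exact Finset.sum_congr rfl fun n _ => Measure.restrict_apply hA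
  · intro n hn
    rw [Measure.restrict_apply hA]
    have : A ∩ (slab T (n + 1 : ℕ) \ slab T n) = ∅ := by
      refine Set.eq_empty_of_forall_notMem fun z hz => hz.2.2 ?_
      have hNn : (N : ℝ) ≤ n := by exact_mod_cast not_lt.1 (by simpa using hn)
      obtain ⟨h1, h2⟩ := hN z hz.1
      exact ⟨hz.2.1.1, ⟨by linarith [h1.1], by linarith [h1.2]⟩,
        ⟨by linarith [h2.1], by linarith [h2.2]⟩⟩
    rw [this, measure_empty]

theorem measure_glue_lt_top {T : ℝ≥0} {ν : ℕ → Measure (ℝ≥0 × ℝ × ℝ)}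
    (hν : ∀ n, IsFiniteMeasure (ν n)) (N : ℕ) :
    glue T ν (Set.univ ×ˢ Set.Ico (-N : ℝ) N ×ˢ Set.Ico (-N : ℝ) N) < ∞ := by
  rw [glue_apply (N := N) (by measurability) fun z hz => hz.2]
  exact ENNReal.sum_lt_top.2 fun n _ => measure_lt_top _ _

theorem isLocallyFiniteMeasure_of_strips {μ : Measure (ℝ≥0 × ℝ × ℝ)}
    (h : ∀ N : ℕ, μ (Set.univ ×ˢ Set.Ico (-N : ℝ) N ×ˢ Set.Ico (-N : ℝ) N) < ∞) :
    IsLocallyFiniteMeasure μ := by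
  refine ⟨fun z => ?_⟩
  obtain ⟨N, hN⟩ := exists_nat_gt (max |z.2.1| |z.2.2|)
  refine ⟨Set.univ ×ˢ Set.Ico (-N : ℝ) N ×ˢ Set.Ico (-N : ℝ) N, ?_, h N⟩
  have h1 := abs_lt.1 ((le_max_left _ _).trans_lt hN)
  have h2 := abs_lt.1 ((le_max_right _ _).trans_lt hN)
  exact prod_mem_nhds univ_mem (prod_mem_nhds (Ico_mem_nhds h1.1 h1.2) (Ico_mem_nhds h2.1 h2.2))

/-- The pairs obtained for different `R` need not be compatible; only their differences agree on
common boxes. So the `n`-th pair is used only on the ring between two consecutive slabs, and the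
increments over clipped boxes telescope. -/
theorem exists_locFinite_box {T : ℝ≥0} {F : ℝ≥0 → ℝ → ℝ → ℝ}
    (hF : IsLeftCont T F) (hbv : IsLocBV T F) :
    ∃ ν₁ ν₂ : Measure (ℝ≥0 × ℝ × ℝ), IsLocallyFiniteMeasure ν₁ ∧ IsLocallyFiniteMeasure ν₂ ∧
      ∀ s₁ s₂ x₁ x₂ y₁ y₂, s₁ ≤ s₂ → x₁ ≤ x₂ → y₁ ≤ y₂ →
      ν₁.real (Set.Ico s₁ s₂ ×ˢ Set.Ico x₁ x₂ ×ˢ Set.Ico y₁ y₂)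
        - ν₂.real (Set.Ico s₁ s₂ ×ˢ Set.Ico x₁ x₂ ×ˢ Set.Ico y₁ y₂)
        = boxInc (fun s x y => F (min s T) x y) s₁ s₂ x₁ x₂ y₁ y₂ := by
  choose ν₁ ν₂ h₁ h₂ hbox using fun n : ℕ =>
    exists_measure_box (R := (n + 1 : ℕ)) (Nat.cast_nonneg _) hF hbv
  refine ⟨glue T ν₁, glue T ν₂, isLocallyFiniteMeasure_of_strips (measure_glue_lt_top h₁),
    isLocallyFiniteMeasure_of_strips (measure_glue_lt_top h₂), ?_⟩
  intro s₁ s₂ x₁ x₂ y₁ y₂ hs hx hy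
  obtain ⟨N, hN⟩ := exists_nat_ge (max (max |x₁| |x₂|) (max |y₁| |y₂|))
  simp only [max_le_iff] at hN
  obtain ⟨⟨hx₁, hx₂⟩, hy₁, hy₂⟩ := hN
  set B := Set.Ico s₁ s₂ ×ˢ Set.Ico x₁ x₂ ×ˢ Set.Ico y₁ y₂ with hB
  have hBm : MeasurableSet B := by measurability
  have hBN : ∀ z ∈ B, z.2.1 ∈ Set.Ico (-N : ℝ) N ∧ z.2.2 ∈ Set.Ico (-N : ℝ) N := fun z hz =>
    ⟨⟨(abs_le.1 hx₁).1.trans hz.2.1.1, hz.2.1.2.trans_le (abs_le.1 hx₂).2⟩,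
      ⟨(abs_le.1 hy₁).1.trans hz.2.2.1, hz.2.2.2.trans_le (abs_le.1 hy₂).2⟩⟩
  set c : ℕ → ℝ := fun n => boxInc F (min s₁ T) (min s₂ T) (clip n x₁) (clip n x₂)
    (clip n y₁) (clip n y₂) with hc
  have hsplit : ∀ (ν : ℕ → Measure (ℝ≥0 × ℝ × ℝ)), (∀ n, IsFiniteMeasure (ν n)) →
      (glue T ν).real B = ∑ n ∈ Finset.range N,
        ((ν n).real (B ∩ slab T (n + 1 : ℕ)) - (ν n).real (B ∩ slab T n)) := fun ν hν => by
    rw [Measure.real, glue_apply hBm hBN, ENNReal.toReal_sum fun n _ => measure_ne_top _ _]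
    refine Finset.sum_congr rfl fun n _ => ?_
    rw [← measureReal_sdiff (Set.inter_subset_inter_right _ (slab_mono T (by simp)))
      (hBm.inter (measurableSet_slab _ _)), Measure.real]
    congr 2
    ext z; simp only [Set.mem_inter_iff, Set.mem_sdiff]; tauto
  have hsub : ∀ n m : ℕ, m ≤ n + 1 → (ν₁ n).real (B ∩ slab T m) - (ν₂ n).real (B ∩ slab T m)
      = c m := fun n m hm => by
    rw [hB, box_inter_slab]
    have hm' : (m : ℝ) ≤ (n + 1 : ℕ) := by exact_mod_cast hm
    have hcl : ∀ x, |clip m x| ≤ (n + 1 : ℕ) := fun x => (abs_clip_le (Nat.cast_nonneg _) x).trans hm'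
    exact hbox n _ _ _ _ _ _ (min_le_min_right _ hs) (min_le_right _ _) (clip_mono _ hx)
      (clip_mono _ hy) (hcl _) (hcl _) (hcl _) (hcl _)
  rw [hsplit ν₁ h₁, hsplit ν₂ h₂, ← Finset.sum_sub_distrib]
  have : ∀ n ∈ Finset.range N, ((ν₁ n).real (B ∩ slab T (n + 1 : ℕ)) - (ν₁ n).real (B ∩ slab T n)
      - ((ν₂ n).real (B ∩ slab T (n + 1 : ℕ)) - (ν₂ n).real (B ∩ slab T n))) = c (n + 1) - c n :=
    fun n _ => by
      rw [← hsub n (n + 1) le_rfl, ← hsub n n (Nat.le_succ n)]; ring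
  -- The telescoping sum leaves `c N - c 0`. Clipping at `N` changes nothing, and `c 0` vanishes
  -- because clipping at `0` collapses the box.
  rw [Finset.sum_congr rfl this, Finset.sum_range_sub]
  simp only [hc, CharP.cast_eq_zero, clip_zero_left, clip_of_abs_le hx₁, clip_of_abs_le hx₂,
    clip_of_abs_le hy₁, clip_of_abs_le hy₂]
  simp [boxInc]

/-- The Jordan decomposition of a difference of two σ-finite measures. -/
theorem exists_jordan {α : Type*} [MeasurableSpace α] (ν₁ ν₂ : Measure α) [SigmaFinite ν₁]
    [SigmaFinite ν₂] : ∃ μ₁ μ₂ : Measure α, μ₁ ≤ ν₁ ∧ μ₂ ≤ ν₂ ∧ μ₁ ⟂ₘ μ₂ ∧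
      ∀ A, MeasurableSet A → μ₁ A + ν₂ A = μ₂ A + ν₁ A := by
  set ν := ν₁ + ν₂ with hν
  have hac₁ : ν₁ ≪ ν := Measure.absolutelyContinuous_of_le (Measure.le_add_right le_rfl)
  have hac₂ : ν₂ ≪ ν := Measure.absolutelyContinuous_of_le (Measure.le_add_left le_rfl)
  set f := ν₁.rnDeriv ν with hf
  set g := ν₂.rnDeriv ν with hg
  have hfm : Measurable f := Measure.measurable_rnDeriv _ _
  have hgm : Measurable g := Measure.measurable_rnDeriv _ _
  have e₁ : ν.withDensity f = ν₁ := Measure.withDensity_rnDeriv_eq _ _ hac₁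
  have e₂ : ν.withDensity g = ν₂ := Measure.withDensity_rnDeriv_eq _ _ hac₂
  -- Subtraction in `ℝ≥0∞` is truncated, so these densities are the positive and negative parts of
  -- `f - g`. Adding back the subtracted density gives `max f g` on both sides, which avoids
  -- differences of infinite masses.
  refine ⟨ν.withDensity fun x => f x - g x, ν.withDensity fun x => g x - f x, ?_, ?_, ?_, ?_⟩
  · conv_rhs => rw [← e₁]
    exact withDensity_mono (Eventually.of_forall fun x => tsub_le_self)
  · conv_rhs => rw [← e₂]
    exact withDensity_mono (Eventually.of_forall fun x => tsub_le_self)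
  · refine ⟨{x | f x ≤ g x}, measurableSet_le hfm hgm, ?_, ?_⟩
    · rw [withDensity_apply _ (measurableSet_le hfm hgm)]
      refine (setLIntegral_congr_fun (measurableSet_le hfm hgm) (g := 0) fun x hx => ?_).trans
        (by simp)
      exact tsub_eq_zero_of_le hx
    · rw [withDensity_apply _ (measurableSet_le hfm hgm).compl]
      refine (setLIntegral_congr_fun (measurableSet_le hfm hgm).compl (g := 0) fun x hx => ?_).trans
        (by simp)
      exact tsub_eq_zero_of_le (not_le.1 (show ¬ f x ≤ g x from hx)).le
  · intro A hA
    conv_lhs => rw [← e₂]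
    conv_rhs => rw [← e₁]
    rw [withDensity_apply _ hA, withDensity_apply _ hA, withDensity_apply _ hA,
      withDensity_apply _ hA, ← lintegral_add_right _ hgm, ← lintegral_add_right _ hfm]
    refine lintegral_congr fun x => ?_
    rw [tsub_add_eq_max, tsub_add_eq_max, max_comm]

/-- A left continuous function of locally bounded variation has a Lebesgue-Stieltjes measure. -/
theorem exists_isStieltjesPair {T : ℝ≥0} {F : ℝ≥0 → ℝ → ℝ → ℝ}
    (hF : IsLeftCont T F) (hbv : IsLocBV T F) :
    ∃ μ, IsStieltjesPair (fun s x y => F (min s T) x y) μ := by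
  obtain ⟨ν₁, ν₂, h₁, h₂, h⟩ := exists_locFinite_box hF hbv
  obtain ⟨μ₁, μ₂, l₁, l₂, hs, ha⟩ := exists_jordan ν₁ ν₂
  have i₁ : IsLocallyFiniteMeasure μ₁ := ⟨fun z => (ν₁.finiteAt_nhds z).imp fun s hs =>
    ⟨hs.1, (l₁ s).trans_lt hs.2⟩⟩
  have i₂ : IsLocallyFiniteMeasure μ₂ := ⟨fun z => (ν₂.finiteAt_nhds z).imp fun s hs =>
    ⟨hs.1, (l₂ s).trans_lt hs.2⟩⟩
  refine ⟨(μ₁, μ₂), i₁, i₂, hs, fun s₁ s₂ x₁ x₂ y₁ y₂ hs hx hy => ?_⟩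
  rw [← h _ _ _ _ _ _ hs hx hy]
  set B := Set.Ico s₁ s₂ ×ˢ Set.Ico x₁ x₂ ×ˢ Set.Ico y₁ y₂ with hB
  have hBm : MeasurableSet B := by measurability
  have hfin : ∀ (ν : Measure (ℝ≥0 × ℝ × ℝ)) [IsLocallyFiniteMeasure ν], ν B ≠ ∞ := fun ν _ => by
    have hsub : B ⊆ Set.Icc s₁ s₂ ×ˢ Set.Icc x₁ x₂ ×ˢ Set.Icc y₁ y₂ := Set.prod_mono
      Set.Ico_subset_Icc_self (Set.prod_mono Set.Ico_subset_Icc_self Set.Ico_subset_Icc_self)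
    exact ((measure_mono hsub).trans_lt
      (isCompact_Icc.prod (isCompact_Icc.prod isCompact_Icc)).measure_lt_top).ne
  have := congrArg ENNReal.toReal (ha B hBm)
  rw [ENNReal.toReal_add (hfin μ₁) (hfin ν₂), ENNReal.toReal_add (hfin μ₂) (hfin ν₁)] at this
  simp only [Measure.real]
  linarith

theorem isStieltjesPair_stieltjesPair {T : ℝ≥0} {F : ℝ≥0 → ℝ → ℝ → ℝ}
    (hF : IsLeftCont T F) (hbv : IsLocBV T F) :
    IsStieltjesPair (fun s x y => F (min s T) x y)
      (stieltjesPair fun s x y => F (min s T) x y) := by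
  rw [stieltjesPair, dif_pos (exists_isStieltjesPair hF hbv)]
  exact (exists_isStieltjesPair hF hbv).choose_spec

/-! ### Continuous submartingales of bounded variation are nondecreasing -/

theorem exp_neg_le_sq {y : ℝ} (h : -1 ≤ y) (h' : y ≤ 1) : Real.exp (-y) ≤ 1 - y + y ^ 2 := by
  have := Real.abs_exp_sub_one_sub_id_le (x := -y) (by rw [abs_neg]; exact abs_le.2 ⟨h, h'⟩)
  have := (abs_le.1 this).2
  nlinarith

theorem integral_mul_le_of_le_condExp {Ω : Type*} {m m0 : MeasurableSpace Ω} {P : Measure Ω}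
    [IsFiniteMeasure P] (hm : m ≤ m0) {X Y H : Ω → ℝ} (hX : Integrable X P) (hY : Integrable Y P)
    (h : X ≤ᵐ[P] P[Y | m]) {C : ℝ} (hH : StronglyMeasurable[m] H) (h0 : ∀ ω, 0 ≤ H ω)
    (hC : ∀ ω, H ω ≤ C) : ∫ ω, H ω * X ω ∂P ≤ ∫ ω, H ω * Y ω ∂P := by
  have hb : ∀ᵐ ω ∂P, ‖H ω‖ ≤ C := Eventually.of_forall fun ω => by
    rw [Real.norm_of_nonneg (h0 ω)]; exact hC ω
  have hHm := (hH.mono hm).aestronglyMeasurable (μ := P)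
  have hHY : Integrable (fun ω => H ω * Y ω) P := hY.bdd_mul hHm hb
  calc ∫ ω, H ω * X ω ∂P ≤ ∫ ω, H ω * (P[Y | m]) ω ∂P := by
        refine integral_mono_ae (hX.bdd_mul hHm hb) (integrable_condExp.bdd_mul hHm hb) ?_
        filter_upwards [h] with ω hω
        exact mul_le_mul_of_nonneg_left hω (h0 ω)
    _ = ∫ ω, (P[fun ω => H ω * Y ω | m]) ω ∂P := by
        refine integral_congr_ae ?_
        exact (condExp_mul_of_stronglyMeasurable_left hH hHY hY).symm
    _ = _ := integral_condExp hm

/-! ### The exponential estimate in discrete time -/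

section Discrete

variable {Ω : Type*} (X : ℕ → Ω → ℝ) (K η : ℝ)

/-- The variation of a discrete process. -/
def dVar (i : ℕ) (ω : Ω) : ℝ := ∑ k ∈ Finset.range i, |X (k + 1) ω - X k ω|

open Classical in
/-- The weight that switches off a discrete process when its variation exceeds `K`. -/
def dWeight (i : ℕ) (ω : Ω) : ℝ := if dVar X i ω ≤ K then 1 else 0

/-- The increments, truncated from below. -/
def dInc (i : ℕ) (ω : Ω) : ℝ := max (X (i + 1) ω - X i ω) (-η)

/-- The sum of the truncated increments up to the time when the variation exceeds `K`. -/
def dSum (n : ℕ) (ω : Ω) : ℝ := ∑ i ∈ Finset.range n, dWeight X K i ω * dInc X η i ω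

open Classical in
/-- The indicator of a large jump. -/
def dJump (i : ℕ) (ω : Ω) : ℝ := if dVar X i ω ≤ K ∧ η < X (i + 1) ω - X i ω then 1 else 0

variable {X K η}

theorem dVar_mono (ω : Ω) : Monotone fun i => dVar X i ω := by
  refine monotone_nat_of_le_succ fun i => ?_
  simp only [dVar, Finset.sum_range_succ]
  linarith [abs_nonneg (X (i + 1) ω - X i ω)]

theorem abs_sub_le_dVar (i : ℕ) (ω : Ω) : |X i ω - X 0 ω| ≤ dVar X i ω := by
  rw [← Finset.sum_range_sub (fun k => X k ω)]
  exact Finset.abs_sum_le_sum_abs _ _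

/-- As long as the variation is at most `K` all weights are `1`, and truncation from below only
raises the increments. -/
theorem neg_le_dSum {i : ℕ} {ω : Ω} (h : dVar X i ω ≤ K) : -K ≤ dSum X K η i ω := by
  have : -dVar X i ω ≤ dSum X K η i ω := by
    rw [dVar, dSum, ← Finset.sum_neg_distrib]
    refine Finset.sum_le_sum fun k hk => ?_
    have hw : dWeight X K k ω = 1 := by
      rw [dWeight, if_pos ((dVar_mono ω (Finset.mem_range.1 hk).le).trans h)]
    rw [hw, one_mul]
    exact (neg_abs_le _).trans (le_max_left _ _)
  linarith

theorem dWeight_nonneg (i : ℕ) (ω : Ω) : 0 ≤ dWeight X K i ω := by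
  unfold dWeight; split_ifs <;> norm_num

theorem dWeight_le_one (i : ℕ) (ω : Ω) : dWeight X K i ω ≤ 1 := by
  unfold dWeight; split_ifs <;> norm_num

theorem dJump_nonneg (i : ℕ) (ω : Ω) : 0 ≤ dJump X K η i ω := by
  unfold dJump; split_ifs <;> norm_num

theorem dJump_le_one (i : ℕ) (ω : Ω) : dJump X K η i ω ≤ 1 := by
  unfold dJump; split_ifs <;> norm_num

/-- This is the purpose of the truncation from below: the exponentials of `-l * dSum` are bounded,
hence integrable, with no assumption on the size of the jumps. -/
theorem neg_mul_le_dSum (hη : 0 ≤ η) (n : ℕ) (ω : Ω) : -(n * η) ≤ dSum X K η n ω := by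
  rw [dSum]
  have : ∀ i ∈ Finset.range n, -η ≤ dWeight X K i ω * dInc X η i ω := fun i _ => by
    have h1 : -η ≤ dInc X η i ω := le_max_right _ _
    unfold dWeight
    split_ifs <;> linarith
  calc -(n * η) = ∑ i ∈ Finset.range n, -η := by simp
    _ ≤ _ := Finset.sum_le_sum this

/-- The weight looks at the variation before the step, so the last step that counts may overshoot
`K`; cutting it at `η` limits the overshoot to `η`. The induction carries the bound by the variation
itself as well. -/
theorem sum_dWeight_mul_min_le (hη : 0 ≤ η) (hK : 0 ≤ K) (n : ℕ) (ω : Ω) :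
    ∑ i ∈ Finset.range n, dWeight X K i ω * min |X (i + 1) ω - X i ω| η ≤ K + η := by
  have key : ∀ n, ∑ i ∈ Finset.range n, dWeight X K i ω * min |X (i + 1) ω - X i ω| η
      ≤ min (dVar X n ω) (K + η) := fun n => by
    induction n with
    | zero => simp [dVar]; positivity
    | succ n ih =>
      rw [Finset.sum_range_succ]
      have hV : dVar X (n + 1) ω = dVar X n ω + |X (n + 1) ω - X n ω| := by
        simp [dVar, Finset.sum_range_succ]
      have h2 := abs_nonneg (X (n + 1) ω - X n ω)
      have h3 := min_le_left |X (n + 1) ω - X n ω| η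
      have h4 := min_le_right |X (n + 1) ω - X n ω| η
      rw [le_min_iff] at ih ⊢
      unfold dWeight at ih ⊢
      split_ifs with h
      · constructor <;> linarith [ih.1, ih.2]
      · constructor <;> linarith [ih.1, ih.2]
  exact (key n).trans (min_le_right _ _)

/-- Each counted jump uses up `η` of a sum that is at most `K + η`. -/
theorem sum_dJump_le (hη : 0 < η) (hK : 0 ≤ K) (n : ℕ) (ω : Ω) :
    ∑ i ∈ Finset.range n, dJump X K η i ω ≤ (K + η) / η := by
  rw [le_div_iff₀ hη, Finset.sum_mul]
  refine le_trans (Finset.sum_le_sum fun i _ => ?_) (sum_dWeight_mul_min_le hη.le hK n ω (X := X))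
  unfold dJump dWeight
  split_ifs with h1 h2 h2
  · rw [one_mul, one_mul]
    exact le_min (h1.2.le.trans (le_abs_self _)) le_rfl
  · exact absurd h1.1 h2
  · have := abs_nonneg (X (i + 1) ω - X i ω); simp; positivity
  · simp

/-- One step of the exponential estimate. -/
theorem exp_neg_dSum_succ_le {l : ℝ} (hη : 0 < η) (hl : 0 < l) (hlη : l * η ≤ 1) (i : ℕ) (ω : Ω) :
    Real.exp (-(l * dSum X K η (i + 1) ω)) ≤ Real.exp (-(l * dSum X K η i ω))
      + l * (Real.exp (-(l * dSum X K η i ω)) * dWeight X K i ω * X i ω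
        - Real.exp (-(l * dSum X K η i ω)) * dWeight X K i ω * X (i + 1) ω)
      + Real.exp (l * K) * (l ^ 2 * η * (dWeight X K i ω * min |X (i + 1) ω - X i ω| η)
        + l * (dJump X K η i ω * (X (i + 1) ω - X i ω))) := by
  have hS : dSum X K η (i + 1) ω = dSum X K η i ω + dWeight X K i ω * dInc X η i ω := by
    simp [dSum, Finset.sum_range_succ]
  by_cases hw : dVar X i ω ≤ K
  · have hw1 : dWeight X K i ω = 1 := if_pos hw
    set E := Real.exp (-(l * dSum X K η i ω)) with hE
    set D := X (i + 1) ω - X i ω with hD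
    have hEpos : 0 < E := Real.exp_pos _
    have hEK : E ≤ Real.exp (l * K) := by
      refine Real.exp_le_exp.2 ?_
      nlinarith [neg_le_dSum hw (η := η)]
    rw [hS, hw1, one_mul, mul_add, neg_add, Real.exp_add, ← hE]
    have hcD : D ≤ dInc X η i ω := le_max_left _ _
    have hcη : -η ≤ dInc X η i ω := le_max_right _ _
    -- the remainder
    have hr : Real.exp (-(l * dInc X η i ω)) ≤ 1 - l * dInc X η i ω
        + (l ^ 2 * η * min |D| η + l * (dJump X K η i ω * D)) := by
      -- A large upward jump is bounded trivially by `1 = 1 - l D + l D` and charged to the jump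
      -- term. Otherwise the truncated increment is at most `η` in absolute value, whether or not
      -- the truncation acted, and the quadratic expansion applies.
      by_cases hj : η < D
      · have hc : dInc X η i ω = D := max_eq_left (by linarith)
        have hjj : dJump X K η i ω = 1 := if_pos ⟨hw, hj⟩
        rw [hjj, hc]
        have h1 : Real.exp (-(l * D)) ≤ 1 := Real.exp_le_one_iff.2 (by nlinarith)
        have h2 : 0 ≤ l ^ 2 * η * min |D| η := by positivity
        linarith
      · have hjj : dJump X K η i ω = 0 := if_neg fun h => hj h.2
        have hcη' : dInc X η i ω ≤ η := max_le (not_lt.1 hj) (by linarith)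
        have habs : |dInc X η i ω| ≤ min |D| η := by
          refine le_min ?_ (abs_le.2 ⟨hcη, hcη'⟩)
          unfold dInc
          rcases le_total D (-η) with h | h
          · rw [max_eq_right h, abs_of_nonpos (by linarith), abs_of_nonpos (by linarith)]; linarith
          · rw [max_eq_left h]
        have h1 := exp_neg_le_sq (y := l * dInc X η i ω) (by nlinarith) (by nlinarith)
        have h2 : (l * dInc X η i ω) ^ 2 ≤ l ^ 2 * η * min |D| η := by
          rw [mul_pow, mul_assoc]
          refine mul_le_mul_of_nonneg_left ?_ (sq_nonneg l)
          rw [← sq_abs, sq]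
          exact mul_le_mul (habs.trans (min_le_right _ _)) habs (abs_nonneg _) hη.le
        rw [hjj]; linarith
    have hrpos : 0 ≤ l ^ 2 * η * min |D| η + l * (dJump X K η i ω * D) := by
      have : 0 ≤ dJump X K η i ω * D := by
        unfold dJump; split_ifs with h
        · rw [one_mul]; linarith [h.2]
        · simp
      have h2 : 0 ≤ min |D| η := le_min (abs_nonneg _) hη.le
      positivity
    -- Since `D ≤ dInc`, replacing `-l * dInc` by `-l * D` in the linear term only enlarges the
    -- bound, and for `D` the submartingale property is available.
    calc E * Real.exp (-(l * dInc X η i ω))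
        ≤ E * (1 - l * D + (l ^ 2 * η * min |D| η + l * (dJump X K η i ω * D))) := by
          refine mul_le_mul_of_nonneg_left (hr.trans ?_) hEpos.le
          nlinarith
      _ = E + l * (E * 1 * X i ω - E * 1 * X (i + 1) ω)
          + E * (l ^ 2 * η * min |D| η + l * (dJump X K η i ω * D)) := by rw [hD]; ring
      _ ≤ _ := by
          have := mul_le_mul_of_nonneg_right hEK hrpos
          rw [one_mul]; linarith
  · have hw1 : dWeight X K i ω = 0 := if_neg hw
    have hj : dJump X K η i ω = 0 := if_neg fun h => hw h.1
    rw [hS, hw1, hj]; simp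

variable {m0 : MeasurableSpace Ω} {P : Measure Ω} {G : ℕ → MeasurableSpace Ω}

theorem measurable_dVar (hX : ∀ i, Measurable[G i] (X i)) (hG : Monotone G) (i : ℕ) :
    Measurable[G i] (dVar X i) := by
  unfold dVar
  refine Finset.measurable_sum _ fun k hk => ?_
  have h1 : Measurable[G i] (X (k + 1)) := (hX _).mono (hG (Finset.mem_range.1 hk)) le_rfl
  have h2 : Measurable[G i] (X k) := (hX _).mono (hG (Finset.mem_range.1 hk).le) le_rfl
  exact continuous_abs.measurable.comp (h1.sub h2)

theorem measurable_dWeight (hX : ∀ i, Measurable[G i] (X i)) (hG : Monotone G) (i : ℕ) :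
    Measurable[G i] (dWeight X K i) := by
  unfold dWeight
  refine Measurable.ite ?_ measurable_const measurable_const
  exact measurable_dVar hX hG i (measurableSet_Iic : MeasurableSet (Set.Iic K))

theorem measurable_dSum (hX : ∀ i, Measurable[G i] (X i)) (hG : Monotone G) (i : ℕ) :
    Measurable[G i] (dSum X K η i) := by
  unfold dSum
  refine Finset.measurable_sum _ fun k hk => ?_
  have h1 : Measurable[G i] (X (k + 1)) := (hX _).mono (hG (Finset.mem_range.1 hk)) le_rfl
  have h2 : Measurable[G i] (X k) := (hX _).mono (hG (Finset.mem_range.1 hk).le) le_rfl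
  have h3 : Measurable[G i] (dWeight X K k) :=
    (measurable_dWeight hX hG k).mono (hG (Finset.mem_range.1 hk).le) le_rfl
  exact h3.mul ((h1.sub h2).max measurable_const)

theorem measurable_dJump (hX : ∀ i, Measurable[G i] (X i)) (hG : Monotone G) (i : ℕ) :
    Measurable[G (i + 1)] (dJump X K η i) := by
  unfold dJump
  have h2 : Measurable[G (i + 1)] (X i) := (hX _).mono (hG (Nat.le_succ i)) le_rfl
  have h3 : Measurable[G (i + 1)] (dVar X i) :=
    (measurable_dVar hX hG i).mono (hG (Nat.le_succ i)) le_rfl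
  refine Measurable.ite ?_ measurable_const measurable_const
  exact MeasurableSet.inter (h3 measurableSet_Iic)
    (((hX (i + 1)).sub h2) (measurableSet_Ioi : MeasurableSet (Set.Ioi η)))

/-- The exponential estimate for a discrete submartingale. -/
theorem integral_exp_neg_dSum_le [IsProbabilityMeasure P] (hG : Monotone G) (hG0 : ∀ i, G i ≤ m0)
    (hX : ∀ i, Measurable[G i] (X i)) (hint : ∀ i, Integrable (X i) P)
    (hsub : ∀ i j, i ≤ j → X i ≤ᵐ[P] P[X j | G i]) {l : ℝ} (hη : 0 < η) (hK : 0 ≤ K) (hl : 0 < l)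
    (hlη : l * η ≤ 1) (N : ℕ) :
    ∫ ω, Real.exp (-(l * dSum X K η N ω)) ∂P ≤ 1 + Real.exp (l * K) * (l ^ 2 * η * (K + η)
      + l * ∫ ω, (∑ i ∈ Finset.range N, dJump X K η i ω) * (|X N ω| + |X 0 ω| + K) ∂P) := by
  have hX0 : ∀ i, Measurable (X i) := fun i => (hX i).mono (hG0 i) le_rfl
  have hS0 : ∀ i, Measurable (dSum X K η i) := fun i => (measurable_dSum hX hG i).mono (hG0 i) le_rfl
  have hW0 : ∀ i, Measurable (dWeight X K i) := fun i =>
    (measurable_dWeight hX hG i).mono (hG0 i) le_rfl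
  have hJ0 : ∀ i, Measurable (dJump X K η i) := fun i =>
    (measurable_dJump hX hG i).mono (hG0 _) le_rfl
  have hEb : ∀ i ω, Real.exp (-(l * dSum X K η i ω)) ≤ Real.exp (l * (i * η)) := fun i ω =>
    Real.exp_le_exp.2 (by nlinarith [neg_mul_le_dSum hη.le i ω (X := X) (K := K)])
  have hEint : ∀ i, Integrable (fun ω => Real.exp (-(l * dSum X K η i ω))) P := fun i => by
    refine Integrable.of_bound (C := Real.exp (l * (i * η))) ?_ (Eventually.of_forall fun ω => ?_)
    · exact (((hS0 i).const_mul l).neg.exp).aestronglyMeasurable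
    · rw [Real.norm_of_nonneg (Real.exp_pos _).le]; exact hEb i ω
  have hZint : Integrable (fun ω => |X N ω| + |X 0 ω| + K) P :=
    ((hint N).abs.add (hint 0).abs).add (integrable_const K)
  have hJb : ∀ i, ∀ᵐ ω ∂P, ‖dJump X K η i ω‖ ≤ 1 := fun i => Eventually.of_forall fun ω => by
    rw [Real.norm_of_nonneg (dJump_nonneg i ω)]; exact dJump_le_one i ω
  have hWb : ∀ i, ∀ᵐ ω ∂P, ‖dWeight X K i ω‖ ≤ 1 := fun i => Eventually.of_forall fun ω => by
    rw [Real.norm_of_nonneg (dWeight_nonneg i ω)]; exact dWeight_le_one i ω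
  have hJZ : ∀ i, Integrable (fun ω => dJump X K η i ω * (|X N ω| + |X 0 ω| + K)) P := fun i =>
    hZint.bdd_mul (hJ0 i).aestronglyMeasurable (hJb i)
  have hMint : ∀ i, Integrable (fun ω => dWeight X K i ω * min |X (i + 1) ω - X i ω| η) P :=
    fun i => by
      have : Integrable (fun ω => min |X (i + 1) ω - X i ω| η) P :=
        Integrable.of_bound (C := η) (((hX0 _).sub (hX0 _)).abs.min
          measurable_const).aestronglyMeasurable (Eventually.of_forall fun ω => by
            rw [Real.norm_of_nonneg (le_min (abs_nonneg _) hη.le)]; exact min_le_right _ _)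
      exact this.bdd_mul (hW0 i).aestronglyMeasurable (hWb i)
  have hstep : ∀ n ≤ N, ∫ ω, Real.exp (-(l * dSum X K η n ω)) ∂P ≤ 1 + Real.exp (l * K) *
      ∑ i ∈ Finset.range n, (l ^ 2 * η * ∫ ω, dWeight X K i ω * min |X (i + 1) ω - X i ω| η ∂P
      + l * ∫ ω, dJump X K η i ω * (|X N ω| + |X 0 ω| + K) ∂P) := by
    intro n
    induction n with
    | zero => intro _; simp [dSum]
    | succ n ih =>
      intro hn
      rw [Finset.sum_range_succ]
      set H : Ω → ℝ := fun ω => Real.exp (-(l * dSum X K η n ω)) * dWeight X K n ω with hH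
      have hHm : Measurable[G n] H :=
        (((measurable_dSum hX hG n).const_mul l).neg.exp).mul (measurable_dWeight hX hG n)
      have hH0 : ∀ ω, 0 ≤ H ω := fun ω => mul_nonneg (Real.exp_pos _).le (dWeight_nonneg _ _)
      have hHC : ∀ ω, H ω ≤ Real.exp (l * (n * η)) := fun ω =>
        (mul_le_of_le_one_right (Real.exp_pos _).le (dWeight_le_one _ _)).trans (hEb n ω)
      have hHb : ∀ᵐ ω ∂P, ‖H ω‖ ≤ Real.exp (l * (n * η)) := Eventually.of_forall fun ω => by
        rw [Real.norm_of_nonneg (hH0 ω)]; exact hHC ω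
      have hHs := (hHm.mono (hG0 n) le_rfl).aestronglyMeasurable (μ := P)
      have hHX : ∀ j, Integrable (fun ω => H ω * X j ω) P := fun j => (hint j).bdd_mul hHs hHb
      -- The factor `H` is nonnegative and known at step `n`, so the linear term of the one-step
      -- estimate has nonpositive mean and can be dropped.
      have h1 := integral_mul_le_of_le_condExp (hG0 n) (hint n) (hint (n + 1))
        (hsub n (n + 1) (Nat.le_succ n)) hHm.stronglyMeasurable hH0 hHC
      -- the large jumps
      have hJX : ∀ j, Integrable (fun ω => dJump X K η n ω * X j ω) P := fun j =>
        (hint j).bdd_mul (hJ0 n).aestronglyMeasurable (hJb n)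
      have h2 : ∫ ω, dJump X K η n ω * (X (n + 1) ω - X n ω) ∂P
          ≤ ∫ ω, dJump X K η n ω * (|X N ω| + |X 0 ω| + K) ∂P := by
        -- The jump indicator is known at step `n + 1`, so there `X (n + 1)` may be replaced by the
        -- terminal value. All jumps are then charged to one integrable variable that is the same
        -- for every grid.
        have h3 := integral_mul_le_of_le_condExp (hG0 (n + 1)) (hint (n + 1)) (hint N)
          (hsub (n + 1) N hn) (measurable_dJump hX hG n (K := K) (η := η)).stronglyMeasurable
          (dJump_nonneg n) (dJump_le_one n)
        calc ∫ ω, dJump X K η n ω * (X (n + 1) ω - X n ω) ∂P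
            = ∫ ω, dJump X K η n ω * X (n + 1) ω ∂P - ∫ ω, dJump X K η n ω * X n ω ∂P := by
              rw [← integral_sub (hJX _) (hJX _)]; congr 1; ext ω; ring
          _ ≤ ∫ ω, dJump X K η n ω * X N ω ∂P - ∫ ω, dJump X K η n ω * X n ω ∂P := by linarith
          _ = ∫ ω, dJump X K η n ω * (X N ω - X n ω) ∂P := by
              rw [← integral_sub (hJX _) (hJX _)]; congr 1; ext ω; ring
          _ ≤ _ := by
              refine integral_mono (((hJX N).sub (hJX n)).congr (Eventually.of_forall fun ω => by
                simp only [Pi.sub_apply]; ring)) (hJZ n) fun ω => ?_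
              simp only [dJump]
              split_ifs with h
              · have h4 := abs_sub_le_dVar n ω (X := X)
                have h5 := le_abs_self (X N ω)
                have h6 := neg_le_abs (X 0 ω)
                have h7 := (abs_le.1 h4).1
                linarith [h.1]
              · simp
      have hR : Integrable (fun ω => l ^ 2 * η * (dWeight X K n ω * min |X (n + 1) ω - X n ω| η)
          + l * (dJump X K η n ω * (X (n + 1) ω - X n ω))) P := by
        refine ((hMint n).const_mul _).add (Integrable.const_mul ?_ _)
        exact ((hJX (n + 1)).sub (hJX n)).congr (Eventually.of_forall fun ω => by
                simp only [Pi.sub_apply]; ring)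
      have hJD : Integrable (fun ω => dJump X K η n ω * (X (n + 1) ω - X n ω)) P :=
        ((hJX (n + 1)).sub (hJX n)).congr (Eventually.of_forall fun ω => by
                simp only [Pi.sub_apply]; ring)
      have h3 : ∫ ω, Real.exp (-(l * dSum X K η (n + 1) ω)) ∂P
          ≤ ∫ ω, (Real.exp (-(l * dSum X K η n ω)) + l * (H ω * X n ω - H ω * X (n + 1) ω)
          + Real.exp (l * K) * (l ^ 2 * η * (dWeight X K n ω * min |X (n + 1) ω - X n ω| η)
          + l * (dJump X K η n ω * (X (n + 1) ω - X n ω)))) ∂P := by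
        refine integral_mono (hEint _) ?_ fun ω => exp_neg_dSum_succ_le hη hl hlη n ω
        exact ((hEint n).add (((hHX n).sub (hHX (n + 1))).const_mul l)).add (hR.const_mul _)
      have hsubint : Integrable (fun ω => H ω * X n ω - H ω * X (n + 1) ω) P :=
        (hHX n).sub (hHX (n + 1))
      have hB : Integrable (fun ω => Real.exp (-(l * dSum X K η n ω))
          + l * (H ω * X n ω - H ω * X (n + 1) ω)) P := (hEint n).add (hsubint.const_mul l)
      rw [integral_add hB (hR.const_mul _), integral_add (hEint n) (hsubint.const_mul l),
        integral_const_mul, integral_const_mul, integral_sub (hHX n) (hHX (n + 1)),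
        integral_add ((hMint n).const_mul _) (hJD.const_mul l), integral_const_mul,
        integral_const_mul] at h3
      have h4 := ih (Nat.le_of_succ_le hn)
      have h5 := mul_le_mul_of_nonneg_left h2 hl.le
      have h6 := mul_le_mul_of_nonneg_left h5 (Real.exp_pos (l * K)).le
      have h7 := mul_nonneg hl.le (sub_nonneg.2 h1)
      linarith
  refine (hstep N le_rfl).trans ?_
  rw [Finset.sum_add_distrib, ← Finset.mul_sum, ← Finset.mul_sum,
    ← integral_finsetSum _ fun i _ => hMint i, ← integral_finsetSum _ fun i _ => hJZ i]
  have : ∫ ω, ∑ i ∈ Finset.range N, dWeight X K i ω * min |X (i + 1) ω - X i ω| η ∂P ≤ K + η := by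
    calc _ ≤ ∫ ω, (K + η) ∂P := integral_mono (integrable_finsetSum _ fun i _ => hMint i)
            (integrable_const _) fun ω => sum_dWeight_mul_min_le hη.le hK N ω
      _ = _ := by simp
  simp only [Finset.sum_mul]
  gcongr

end Discrete

/-- The dyadic grid on `[s, t]`. -/
def gridI (s t : ℝ≥0) (n i : ℕ) : ℝ≥0 := s + timeMap (t - s) (dyad n i)

theorem gridI_mono (s t : ℝ≥0) (n : ℕ) : Monotone (gridI s t n) := fun _ _ h =>
  add_le_add_right (timeMap_mono _ (dyad_mono n h)) _

theorem gridI_zero (s t : ℝ≥0) (n : ℕ) : gridI s t n 0 = s := by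
  simp [gridI, dyad_zero, timeMap_zero]

theorem gridI_last {s t : ℝ≥0} (h : s ≤ t) (n : ℕ) : gridI s t n (2 ^ n) = t := by
  simp [gridI, dyad_last, timeMap_one, h]

theorem gridI_mem {s t : ℝ≥0} (h : s ≤ t) (n i : ℕ) : gridI s t n i ∈ Set.Icc s t := by
  refine ⟨le_self_add, ?_⟩
  have := timeMap_mono (t - s) (dyad_le_one n i)
  rw [timeMap_one] at this
  calc gridI s t n i ≤ s + (t - s) := add_le_add_right this _
    _ = t := add_tsub_cancel_of_le h

theorem dist_gridI_le (s t : ℝ≥0) (n i : ℕ) :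
    dist (gridI s t n (i + 1)) (gridI s t n i) ≤ (t - s : ℝ≥0) * (1 / 2) ^ n := by
  have h1 : (gridI s t n i : ℝ) ≤ gridI s t n (i + 1) := by
    exact_mod_cast gridI_mono s t n (Nat.le_succ i)
  rw [NNReal.dist_eq, abs_of_nonneg (by linarith)]
  unfold gridI timeMap
  push_cast
  rw [Real.coe_toNNReal _ (dyad_nonneg _ _), Real.coe_toNNReal _ (dyad_nonneg _ _)]
  have := mul_le_mul_of_nonneg_right (dyad_sub_le n i) (t - s : ℝ≥0).2
  rw [NNReal.val_eq_coe] at this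
  linarith

theorem eventually_abs_gridI_lt {f : ℝ≥0 → ℝ} {s t : ℝ≥0} (h : s ≤ t)
    (hf : ContinuousOn f (Set.Icc s t)) {ε : ℝ} (hε : 0 < ε) :
    ∀ᶠ n in atTop, ∀ i, |f (gridI s t n (i + 1)) - f (gridI s t n i)| < ε := by
  have hu := isCompact_Icc.uniformContinuousOn_of_continuous hf
  obtain ⟨d, hd, hfd⟩ := Metric.uniformContinuousOn_iff.1 hu ε hε
  have hlim : Tendsto (fun n : ℕ => ((t - s : ℝ≥0) : ℝ) * (1 / 2) ^ n) atTop (𝓝 ((t - s : ℝ≥0) * 0)) :=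
    tendsto_const_nhds.mul (tendsto_pow_atTop_nhds_zero_of_lt_one (by norm_num) (by norm_num))
  rw [mul_zero] at hlim
  filter_upwards [hlim.eventually_lt_const hd] with n hn i
  exact hfd _ (gridI_mem h _ _) _ (gridI_mem h _ _) ((dist_gridI_le s t n i).trans_lt hn)

theorem dVar_gridI_le {f : ℝ≥0 → ℝ} {s t T : ℝ≥0} (h : s ≤ t) (ht : t ≤ T)
    (hf : BoundedVariationOn f (Set.Iic T)) (n i : ℕ) :
    dVar (fun k (_ : Unit) => f (gridI s t n k)) i () ≤ (eVariationOn f (Set.Iic T)).toReal := by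
  have := eVariationOn.sum_le (f := f) (s := Set.Iic T) (n := i) (gridI_mono s t n)
    (fun k => (gridI_mem h n k).2.trans ht)
  rw [dVar, ← ENNReal.toReal_ofReal (Finset.sum_nonneg fun k _ => abs_nonneg _)]
  refine ENNReal.toReal_mono hf ?_
  rw [ENNReal.ofReal_sum_of_nonneg fun k _ => abs_nonneg _]
  simpa [edist_dist, Real.dist_eq] using this

/-- A submartingale with a continuous version of bounded variation is nondecreasing. -/
theorem ae_le_of_submartingale_bv {Ω : Type*} {m0 : MeasurableSpace Ω} {P : Measure Ω}
    [IsProbabilityMeasure P] {ℱ : Filtration ℝ≥0 m0} {T : ℝ≥0} {A B : Proc Ω}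
    (hA : ∀ t ≤ T, Measurable[ℱ t] (A t)) (hint : ∀ t ≤ T, Integrable (A t) P)
    (hsub : ∀ s t, s ≤ t → t ≤ T → A s ≤ᵐ[P] P[A t | ℱ s])
    (hAB : ∀ t ≤ T, A t =ᵐ[P] B t)
    (hcont : ∀ᵐ ω ∂P, ContinuousOn (fun s => B s ω) (Set.Iic T))
    (hbv : ∀ᵐ ω ∂P, BoundedVariationOn (fun s => B s ω) (Set.Iic T))
    {s t : ℝ≥0} (hst : s ≤ t) (htT : t ≤ T) : ∀ᵐ ω ∂P, A s ω ≤ A t ω := by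
  have hgT : ∀ n i, gridI s t n i ≤ T := fun n i => (gridI_mem hst n i).2.trans htT
  set X : ℕ → ℕ → Ω → ℝ := fun n i => A (gridI s t n i) with hXdef
  have hX0 : ∀ n, X n 0 = A s := fun n => by simp [hXdef, gridI_zero]
  have hXN : ∀ n, X n (2 ^ n) = A t := fun n => by simp [hXdef, gridI_last hst]
  -- the good paths
  have hgood : ∀ᵐ ω ∂P, ContinuousOn (fun s => B s ω) (Set.Iic T) ∧
      BoundedVariationOn (fun s => B s ω) (Set.Iic T) ∧
      ∀ n i, A (gridI s t n i) ω = B (gridI s t n i) ω := by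
    -- `A` carries adaptedness and `B` the regular paths. They agree outside null sets that depend
    -- on the time, but only the countably many grid times enter.
    have : ∀ᵐ ω ∂P, ∀ n i, A (gridI s t n i) ω = B (gridI s t n i) ω :=
      ae_all_iff.2 fun n => ae_all_iff.2 fun i => hAB _ (hgT n i)
    filter_upwards [hcont, hbv, this] with ω h1 h2 h3 using ⟨h1, h2, h3⟩
  have hsmall : ∀ᵐ ω ∂P, ∀ η > 0, ∀ᶠ n in atTop, ∀ i, |X n (i + 1) ω - X n i ω| < η := by
    filter_upwards [hgood] with ω hω η hη
    have := eventually_abs_gridI_lt hst (hω.1.mono (Set.Icc_subset_Iic_self.trans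
      (Set.Iic_subset_Iic.2 htT))) hη
    filter_upwards [this] with n hn i
    rw [hXdef]; simp only [hω.2.2]; exact hn i
  -- it suffices to treat paths of variation at most `K` and decrements of at least `δ`
  suffices H : ∀ K m : ℕ, ∀ᵐ ω ∂P, (∀ n i, dVar (X n) i ω ≤ K) → -(1 / ((m : ℝ) + 1)) < A t ω - A s ω by
    have H' := ae_all_iff.2 fun K => ae_all_iff.2 fun m => H K m
    filter_upwards [H', hgood] with ω h1 h2
    obtain ⟨K, hK⟩ := exists_nat_ge (eVariationOn (fun s => B s ω) (Set.Iic T)).toReal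
    have hV : ∀ n i, dVar (X n) i ω ≤ K := fun n i => by
      refine le_trans ?_ ((dVar_gridI_le hst htT h2.2.1 n i).trans hK)
      simp only [dVar, hXdef, h2.2.2]; exact le_rfl
    by_contra hc
    push Not at hc
    obtain ⟨m, hm⟩ := exists_nat_one_div_lt (sub_pos.2 hc)
    have := h1 K m hV
    linarith
  intro K m
  set δ : ℝ := 1 / ((m : ℝ) + 1) with hδ
  have hδ0 : 0 < δ := by positivity
  set E : Set Ω := {ω | (∀ n i, dVar (X n) i ω ≤ K) ∧ A t ω - A s ω ≤ -δ ∧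
    ∀ η > 0, ∀ᶠ n in atTop, ∀ i, |X n (i + 1) ω - X n i ω| < η} with hE
  suffices hPE : P E = 0 by
    have : ∀ᵐ ω ∂P, ω ∉ E := measure_eq_zero_iff_ae_notMem.1 hPE
    filter_upwards [this, hsmall] with ω h1 h2 h3
    by_contra hc
    exact h1 ⟨h3, not_lt.1 hc, h2⟩
  have hKn : (0 : ℝ) ≤ K := Nat.cast_nonneg K
  -- The bound `3` is `1` for the start, `1` for the quadratic terms by the choice of `η`, and `1`
  -- for the jump terms, which vanish as the grid is refined. It does not depend on `l`, so letting
  -- `l` grow forces `P E = 0`.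
  have key : ∀ l : ℝ, 0 < l → P E * ENNReal.ofReal (Real.exp (l * δ)) ≤ 3 := by
    intro l hl
    obtain ⟨η, hη, hlη, hηb⟩ : ∃ η : ℝ, 0 < η ∧ l * η ≤ 1 ∧
        Real.exp (l * K) * (l ^ 2 * η * (K + η)) ≤ 1 := by
      set c := Real.exp (l * K) * l ^ 2 * (K + 1) with hc
      have hc0 : 0 < c := by positivity
      refine ⟨min 1 (min (1 / l) (1 / c)), by positivity, ?_, ?_⟩
      · calc l * min 1 (min (1 / l) (1 / c)) ≤ l * (1 / l) := by
              gcongr; exact (min_le_right _ _).trans (min_le_left _ _)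
          _ = 1 := by field_simp
      · set η := min 1 (min (1 / l) (1 / c))
        have h0 : 0 < η := by positivity
        have h1 : η ≤ 1 := min_le_left _ _
        have h2 : η ≤ 1 / c := (min_le_right _ _).trans (min_le_right _ _)
        calc Real.exp (l * K) * (l ^ 2 * η * (K + η)) ≤ Real.exp (l * K) * (l ^ 2 * η * (K + 1)) := by
              gcongr
          _ = c * η := by rw [hc]; ring
          _ ≤ c * (1 / c) := by gcongr
          _ = 1 := by field_simp
    have hGm : ∀ n, Monotone fun i => (ℱ (gridI s t n i) : MeasurableSpace Ω) := fun n i j h =>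
      ℱ.mono (gridI_mono s t n h)
    have hXm : ∀ n i, Measurable[ℱ (gridI s t n i)] (X n i) := fun n i => hA _ (hgT n i)
    set Y : Ω → ℝ := fun ω => |A t ω| + |A s ω| + K with hY
    have hYint : Integrable Y P :=
      ((hint t htT).abs.add (hint s (hst.trans htT)).abs).add (integrable_const _)
    set I : ℕ → ℝ := fun n => ∫ ω, (∑ i ∈ Finset.range (2 ^ n), dJump (X n) K η i ω) * Y ω ∂P with hI
    have hbound : ∀ n, ∫ ω, Real.exp (-(l * dSum (X n) K η (2 ^ n) ω)) ∂P
        ≤ 1 + 1 + Real.exp (l * K) * (l * I n) := fun n => by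
      have := integral_exp_neg_dSum_le (G := fun i => ℱ (gridI s t n i)) (hGm n) (fun i => ℱ.le _)
        (hXm n) (fun i => hint _ (hgT n i))
        (fun i j h => hsub _ _ (gridI_mono s t n h) (hgT n j)) hη hKn hl hlη (2 ^ n)
      rw [hX0, hXN, mul_add] at this
      linarith
    have hIlim : Tendsto I atTop (𝓝 0) := by
      have h0 : (0 : ℝ) = ∫ _, (0 : ℝ) ∂P := by simp
      rw [h0]
      refine tendsto_integral_of_dominated_convergence (fun ω => (K + η) / η * Y ω) (fun n => ?_)
        (hYint.const_mul _) (fun n => ?_) ?_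
      · refine AEStronglyMeasurable.mul ?_ hYint.1
        refine (Finset.measurable_sum _ fun i _ => ?_).aestronglyMeasurable
        exact (measurable_dJump (hXm n) (hGm n) i).mono (ℱ.le _) le_rfl
      · refine Eventually.of_forall fun ω => ?_
        have hY0 : 0 ≤ Y ω := by positivity
        rw [norm_mul, Real.norm_of_nonneg hY0,
          Real.norm_of_nonneg (Finset.sum_nonneg fun i _ => dJump_nonneg i ω)]
        exact mul_le_mul_of_nonneg_right (sum_dJump_le hη hKn _ ω) hY0
      · filter_upwards [hsmall] with ω hω
        refine tendsto_const_nhds.congr' ?_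
        filter_upwards [hω η hη] with n hn
        rw [Finset.sum_eq_zero, zero_mul]
        intro i _
        exact if_neg fun h => absurd ((le_abs_self _).trans_lt (hn i)) (not_lt.2 h.2.le)
    have hIev : ∀ᶠ n in atTop, Real.exp (l * K) * (l * I n) ≤ 1 := by
      have h1 : Tendsto (fun n => Real.exp (l * K) * (l * I n)) atTop
          (𝓝 (Real.exp (l * K) * (l * 0))) := (hIlim.const_mul l).const_mul _
      rw [mul_zero, mul_zero] at h1
      exact (h1.eventually_lt_const one_pos).mono fun _ h => h.le
    set f : ℕ → Ω → ℝ≥0∞ := fun n ω =>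
      ENNReal.ofReal (Real.exp (-(l * dSum (X n) K η (2 ^ n) ω))) with hf
    have hSm : ∀ n, Measurable (dSum (X n) K η (2 ^ n)) := fun n =>
      (measurable_dSum (hXm n) (hGm n) _).mono (ℱ.le _) le_rfl
    have hfm : ∀ n, Measurable (f n) := fun n => (((hSm n).const_mul l).neg.exp).ennreal_ofReal
    have hfle : ∀ᶠ n in atTop, ∫⁻ ω, f n ω ∂P ≤ 3 := by
      filter_upwards [hIev] with n hn
      rw [← ofReal_integral_eq_lintegral_ofReal]
      · refine (ENNReal.ofReal_le_ofReal ((hbound n).trans (add_le_add_right hn _))).trans ?_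
        norm_num
      · refine Integrable.of_bound (C := Real.exp (l * ((2 ^ n : ℕ) * η)))
          (((hSm n).const_mul l).neg.exp).aestronglyMeasurable (Eventually.of_forall fun ω => ?_)
        rw [Real.norm_of_nonneg (Real.exp_pos _).le]
        exact Real.exp_le_exp.2
          (by nlinarith [neg_mul_le_dSum hη.le (2 ^ n) ω (X := X n) (K := (K : ℝ))])
      · exact Eventually.of_forall fun ω => (Real.exp_pos _).le
    have hlim : ∫⁻ ω, liminf (fun n => f n ω) atTop ∂P ≤ 3 :=
      (lintegral_liminf_le hfm).trans
        (liminf_le_of_frequently_le' hfle.frequently)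
    have hsubset : E ⊆ {ω | ENNReal.ofReal (Real.exp (l * δ)) ≤ liminf (fun n => f n ω) atTop} := by
      intro ω hω
      suffices hev : ∀ᶠ n in atTop, ENNReal.ofReal (Real.exp (l * δ)) ≤ f n ω from
        le_liminf_of_le (by isBoundedDefault) hev
      filter_upwards [hω.2.2 η hη] with n hn
      refine ENNReal.ofReal_le_ofReal (Real.exp_le_exp.2 ?_)
      -- On `E` the weights stay `1`, and on a fine grid no increment reaches `-η`, so nothing is
      -- truncated and the sum telescopes.
      have hS : dSum (X n) K η (2 ^ n) ω = A t ω - A s ω := by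
        rw [← hX0 n, ← hXN n, ← Finset.sum_range_sub (fun k => X n k ω), dSum]
        refine Finset.sum_congr rfl fun i _ => ?_
        rw [dWeight, if_pos (hω.1 n i), one_mul, dInc, max_eq_left]
        exact (abs_lt.1 (hn i)).1.le
      rw [hS]
      have h5 := mul_le_mul_of_nonneg_left hω.2.1 hl.le
      linarith
    calc P E * ENNReal.ofReal (Real.exp (l * δ))
        ≤ ENNReal.ofReal (Real.exp (l * δ)) *
          P {ω | ENNReal.ofReal (Real.exp (l * δ)) ≤ liminf (fun n => f n ω) atTop} := by
          rw [mul_comm]; gcongr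
      _ ≤ ∫⁻ ω, liminf (fun n => f n ω) atTop ∂P :=
          mul_meas_ge_le_lintegral (Measurable.liminf hfm) _
      _ ≤ 3 := hlim
  by_contra hne
  have hpos : 0 < (P E).toReal := ENNReal.toReal_pos hne (measure_ne_top _ _)
  obtain ⟨l, hl⟩ := exists_nat_gt (3 / (P E).toReal / δ)
  have hl0 : (0 : ℝ) < l := lt_of_le_of_lt (by positivity) hl
  have h1 := key l hl0
  have h2 := ENNReal.toReal_mono (by simp) h1
  rw [ENNReal.toReal_mul, ENNReal.toReal_ofReal (Real.exp_pos _).le] at h2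
  rw [div_lt_iff₀ hδ0, div_lt_iff₀ hpos] at hl
  have h3 := Real.add_one_le_exp ((l : ℝ) * δ)
  have h4 : (P E).toReal * (l * δ + 1) ≤ (P E).toReal * Real.exp (l * δ) := by gcongr
  norm_num at h2
  nlinarith

/-- A martingale with a continuous version of bounded variation is constant. -/
theorem ae_eq_of_martingale_bv {Ω : Type*} {m0 : MeasurableSpace Ω} {P : Measure Ω}
    [IsProbabilityMeasure P] {ℱ : Filtration ℝ≥0 m0} {T : ℝ≥0} {A B : Proc Ω}
    (hA : ∀ t ≤ T, Measurable[ℱ t] (A t)) (hint : ∀ t ≤ T, Integrable (A t) P)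
    (hmart : ∀ s t, s ≤ t → t ≤ T → P[A t | ℱ s] =ᵐ[P] A s)
    (hAB : ∀ t ≤ T, A t =ᵐ[P] B t)
    (hcont : ∀ᵐ ω ∂P, ContinuousOn (fun s => B s ω) (Set.Iic T))
    (hbv : ∀ᵐ ω ∂P, BoundedVariationOn (fun s => B s ω) (Set.Iic T))
    {s t : ℝ≥0} (hst : s ≤ t) (htT : t ≤ T) : A s =ᵐ[P] A t := by
  have h1 := ae_le_of_submartingale_bv hA hint (fun s t h h' => (hmart s t h h').symm.le) hAB hcont
    hbv hst htT
  have h2 := ae_le_of_submartingale_bv (A := fun t ω => -A t ω) (B := fun t ω => -B t ω)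
    (fun t ht => (hA t ht).neg) (fun t ht => (hint t ht).neg)
    (fun s t h h' => by
      have h3 := condExp_neg (A t) (ℱ s) (μ := P)
      filter_upwards [hmart s t h h', h3] with ω h4 h5
      change -A s ω ≤ (P[-A t | ℱ s]) ω
      rw [h5, Pi.neg_apply, h4])
    (fun t ht => (hAB t ht).fun_comp Neg.neg) (hcont.mono fun ω h => h.neg)
    (hbv.mono fun ω h => by
      refine (LipschitzWith.comp_boundedVariationOn (C := 1) (f := fun x : ℝ => -x) ?_ h)
      exact LipschitzWith.of_dist_le_mul fun x y => by simp) hst htT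
  filter_upwards [h1, h2] with ω h3 h4
  exact le_antisymm h3 (neg_le_neg_iff.1 h4)

section Martingales

variable {Ω : Type*} [MeasurableSpace Ω] {P : Measure Ω}
  {ℱ : Filtration ℝ≥0 ‹MeasurableSpace Ω›} {T : ℝ≥0}

/-! ### Martingales on `[0, T]` -/

theorem IsMart.measurable {X : Proc Ω} (h : IsMart P ℱ T X) {t : ℝ≥0} (ht : t ≤ T) :
    Measurable[ℱ t] (X t) := by
  have : Measurable[ℱ t] (X (min t T)) := (h.1 t).measurable
  rwa [min_eq_left ht] at this

theorem IsMart.integrable {X : Proc Ω} (h : IsMart P ℱ T X) {t : ℝ≥0} (ht : t ≤ T) :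
    Integrable (X t) P := by
  have : Integrable (X (min t T)) P := Martingale.integrable h t
  rwa [min_eq_left ht] at this

theorem IsMart.condExp_eq {X : Proc Ω} (h : IsMart P ℱ T X) {s t : ℝ≥0} (hst : s ≤ t) (ht : t ≤ T) :
    P[X t | ℱ s] =ᵐ[P] X s := by
  have : P[X (min t T) | ℱ s] =ᵐ[P] X (min s T) := h.2 s t hst
  rwa [min_eq_left ht, min_eq_left (hst.trans ht)] at this

theorem IsMart.of_condExp [IsFiniteMeasure P] {X : Proc Ω}
    (hm : ∀ t ≤ T, Measurable[ℱ t] (X t)) (hi : ∀ t ≤ T, Integrable (X t) P)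
    (hc : ∀ s t, s ≤ t → t ≤ T → P[X t | ℱ s] =ᵐ[P] X s) : IsMart P ℱ T X := by
  refine ⟨fun t => ((hm _ (min_le_right t T)).mono (ℱ.mono (min_le_left t T)) le_rfl).stronglyMeasurable,
    fun s t hst => ?_⟩
  change P[X (min t T) | ℱ s] =ᵐ[P] X (min s T)
  rcases le_total T s with h | h
  · rw [min_eq_right h, min_eq_right (h.trans hst)]
    rw [condExp_of_stronglyMeasurable (ℱ.le s) ((hm T le_rfl).mono (ℱ.mono h) le_rfl).stronglyMeasurable
      (hi T le_rfl)]
  · rw [min_eq_left h]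
    exact hc s _ (le_min hst h) (min_le_right _ _)

theorem IsMart.add [IsFiniteMeasure P] {X Y : Proc Ω} (hX : IsMart P ℱ T X) (hY : IsMart P ℱ T Y) :
    IsMart P ℱ T (fun t ω => X t ω + Y t ω) := Martingale.add hX hY

theorem IsMart.sub [IsFiniteMeasure P] {X Y : Proc Ω} (hX : IsMart P ℱ T X) (hY : IsMart P ℱ T Y) :
    IsMart P ℱ T (fun t ω => X t ω - Y t ω) := Martingale.sub hX hY

theorem IsMart.const_mul {X : Proc Ω} (c : ℝ) (hX : IsMart P ℱ T X) :
    IsMart P ℱ T (fun t ω => c * X t ω) := Martingale.smul c hX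

theorem IsMart.sum [IsFiniteMeasure P] {ι : Type*} (s : Finset ι) {X : ι → Proc Ω}
    (hX : ∀ i ∈ s, IsMart P ℱ T (X i)) : IsMart P ℱ T (fun t ω => ∑ i ∈ s, X i t ω) := by
  classical
  induction s using Finset.induction_on with
  | empty => simp only [Finset.sum_empty]; exact martingale_zero ℝ ℱ P
  | insert i s hi ih =>
    simp only [Finset.sum_insert hi]
    exact (hX i (by simp)).add (ih fun j hj => hX j (by simp [hj]))

theorem IsM2.memLp_of_le [IsFiniteMeasure P] {X : Proc Ω} (h : IsM2 P ℱ T X) {t : ℝ≥0} (ht : t ≤ T) :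
    MemLp (X t) 2 P :=
  (memLp_congr_ae (h.mart.condExp_eq ht le_rfl)).1 (h.memLp.condExp one_le_two)

/-- The square of a square-integrable martingale is a submartingale. -/
theorem IsMart.sq_le_condExp_sq [IsFiniteMeasure P] {X : Proc Ω} (h : IsMart P ℱ T X)
    (hX : ∀ t ≤ T, MemLp (X t) 2 P) {s t : ℝ≥0} (hst : s ≤ t) (ht : t ≤ T) :
    (fun ω => X s ω ^ 2) ≤ᵐ[P] P[fun ω => X t ω ^ 2 | ℱ s] := by
  have h1 := condVar_ae_eq_condExp_sq_sub_sq_condExp (ℱ.le s) (hX t ht)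
  have h2 : (0 : Ω → ℝ) ≤ᵐ[P] Var[X t; P | ℱ s] :=
    condExp_nonneg (Eventually.of_forall fun ω => sq_nonneg _)
  filter_upwards [h1, h2, h.condExp_eq hst ht] with ω h3 h4 h5
  rw [h3] at h4
  simp only [Pi.sub_apply, Pi.pow_apply, Pi.zero_apply, h5] at h4
  have h6 : (fun ω => X t ω ^ 2) = X t ^ 2 := rfl
  rw [h6]; linarith

/-! ### Positivity of the cross-variation -/

variable {h : RField Ω} {Γ : ℝ≥0 → ℝ → ℝ → Ω → ℝ}

theorem IsV2.memLp [IsProbabilityMeasure P] (hh : IsV2 P ℱ T h Γ) (x : ℝ) {t : ℝ≥0} (ht : t ≤ T) :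
    MemLp (h t x) 2 P := (hh.mart x).toIsM2.memLp_of_le ht

theorem IsV2.integrable_mul [IsProbabilityMeasure P] (hh : IsV2 P ℱ T h Γ) (x y : ℝ) {s t : ℝ≥0}
    (hs : s ≤ T) (ht : t ≤ T) : Integrable (fun ω => h s x ω * h t y ω) P :=
  (hh.memLp x hs).integrable_mul (hh.memLp y ht)

theorem IsV2.integrable_Γ [IsProbabilityMeasure P] (hh : IsV2 P ℱ T h Γ) (x y : ℝ) {t : ℝ≥0}
    (ht : t ≤ T) : Integrable (Γ t x y) P := by
  have := (hh.integrable_mul x y ht ht).sub ((hh.crossVar x y).mart.integrable ht)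
  exact this.congr (Eventually.of_forall fun ω => by simp)

theorem boundedVariationOn_real_iff {f : ℝ≥0 → ℝ} {s : Set ℝ≥0} :
    BoundedVariationOn f s ↔ ∃ C : ℝ, ∀ (n : ℕ) (u : ℕ → ℝ≥0), Monotone u → (∀ i, u i ∈ s) →
      ∑ i ∈ Finset.range n, |f (u (i + 1)) - f (u i)| ≤ C := by
  have hsum : ∀ (n : ℕ) (u : ℕ → ℝ≥0), ∑ i ∈ Finset.range n, edist (f (u (i + 1))) (f (u i))
      = ENNReal.ofReal (∑ i ∈ Finset.range n, |f (u (i + 1)) - f (u i)|) := fun n u => by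
    rw [ENNReal.ofReal_sum_of_nonneg fun k _ => abs_nonneg _]
    simp [edist_dist, Real.dist_eq]
  constructor
  · intro h
    refine ⟨(eVariationOn f s).toReal, fun n u hu hus => ?_⟩
    have := eVariationOn.sum_le (f := f) (n := n) hu hus
    rw [hsum] at this
    exact (ENNReal.ofReal_le_iff_le_toReal h).1 this
  · rintro ⟨C, hC⟩
    have : eVariationOn f s ≤ ENNReal.ofReal C := by
      refine iSup_le fun p => ?_
      rw [hsum]
      exact ENNReal.ofReal_le_ofReal (hC _ _ p.2.2.1 p.2.2.2)
    exact (this.trans_lt ENNReal.ofReal_lt_top).ne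

theorem boundedVariationOn_linear_comb {ι : Type*} (v : Finset ι) (c : ι → ℝ) {f : ι → ℝ≥0 → ℝ}
    {s : Set ℝ≥0} (hf : ∀ i ∈ v, BoundedVariationOn (f i) s) :
    BoundedVariationOn (fun t => ∑ i ∈ v, c i * f i t) s := by
  rw [boundedVariationOn_real_iff]
  choose! C hC using fun i hi => boundedVariationOn_real_iff.1 (hf i hi)
  refine ⟨∑ i ∈ v, |c i| * C i, fun n u hu hus => ?_⟩
  calc ∑ k ∈ Finset.range n, |∑ i ∈ v, c i * f i (u (k + 1)) - ∑ i ∈ v, c i * f i (u k)|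
      ≤ ∑ k ∈ Finset.range n, ∑ i ∈ v, |c i| * |f i (u (k + 1)) - f i (u k)| := by
        refine Finset.sum_le_sum fun k _ => ?_
        rw [← Finset.sum_sub_distrib]
        refine (Finset.abs_sum_le_sum_abs _ _).trans (Finset.sum_le_sum fun i _ => ?_)
        rw [← mul_sub, abs_mul]
    _ = ∑ i ∈ v, |c i| * ∑ k ∈ Finset.range n, |f i (u (k + 1)) - f i (u k)| := by
        rw [Finset.sum_comm]; simp only [Finset.mul_sum]
    _ ≤ _ := Finset.sum_le_sum fun i hi =>
        mul_le_mul_of_nonneg_left (hC i hi n u hu hus) (abs_nonneg _)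

/-- The increments in time of `(x, y) ↦ Γ s x y` are positive semidefinite. -/
theorem IsV2.ae_psd [IsProbabilityMeasure P] (hh : IsV2 P ℱ T h Γ) {N : ℕ} (z d : Fin N → ℝ)
    {s t : ℝ≥0} (hst : s ≤ t) (ht : t ≤ T) :
    ∀ᵐ ω ∂P, ∑ k, ∑ l, d k * d l * Γ s (z k) (z l) ω ≤ ∑ k, ∑ l, d k * d l * Γ t (z k) (z l) ω := by
  set M : Proc Ω := fun t ω => ∑ k, d k * h t (z k) ω with hM
  set A : Proc Ω := fun t ω => ∑ k, ∑ l, d k * d l * Γ t (z k) (z l) ω with hA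
  have hMm : IsMart P ℱ T M := IsMart.sum _ fun k _ => ((hh.mart (z k)).mart).const_mul (d k)
  have hML : ∀ t ≤ T, MemLp (M t) 2 P := fun t ht =>
    memLp_finsetSum _ fun k _ => (hh.memLp (z k) ht).const_mul (d k)
  -- `A` compensates the square of the martingale `M`, so it is a submartingale because `M ^ 2` is
  -- one. Being continuous and of bounded variation, it is nondecreasing.
  have hN : IsMart P ℱ T (fun t ω => M t ω ^ 2 - A t ω) := by
    have : (fun t ω => M t ω ^ 2 - A t ω) = fun t ω => ∑ k, ∑ l, (d k * d l) *
        (h t (z k) ω * h t (z l) ω - Γ t (z k) (z l) ω) := by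
      ext t ω
      simp only [hM, hA, sq, Finset.sum_mul_sum, mul_sub, Finset.sum_sub_distrib]
      congr 1
      refine Finset.sum_congr rfl fun k _ => Finset.sum_congr rfl fun l _ => by ring
    rw [this]
    exact IsMart.sum _ fun k _ => IsMart.sum _ fun l _ => (hh.crossVar _ _).mart.const_mul _
  have hAm : ∀ t ≤ T, Measurable[ℱ t] (A t) := fun t ht =>
    Finset.measurable_fun_sum _ fun k _ => Finset.measurable_fun_sum _ fun l _ =>
      ((hh.crossVar _ _).adapted t ht).const_mul _
  have hAi : ∀ t ≤ T, Integrable (A t) P := fun t ht =>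
    integrable_finsetSum _ fun k _ => integrable_finsetSum _ fun l _ =>
      (hh.integrable_Γ _ _ ht).const_mul _
  refine ae_le_of_submartingale_bv (B := A) hAm hAi ?_ (fun t _ => ae_eq_rfl) ?_ ?_ hst ht
  · intro s t hst ht
    have h1 := hMm.sq_le_condExp_sq hML hst ht
    have h2 := hN.condExp_eq hst ht
    have h3 := condExp_sub ((hML t ht).integrable_sq) (hAi t ht) (ℱ s)
    filter_upwards [h1, h2, h3] with ω h4 h5 h6
    have h7 : (P[fun ω => M t ω ^ 2 - A t ω | ℱ s]) ω = (P[fun ω => M t ω ^ 2 | ℱ s]) ω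
      - (P[A t | ℱ s]) ω := h6
    rw [h5] at h7
    linarith
  · have : ∀ᵐ ω ∂P, ∀ k l, ContinuousOn (fun s => Γ s (z k) (z l) ω) (Set.Iic T) :=
      ae_all_iff.2 fun k => ae_all_iff.2 fun l => (hh.crossVar _ _).cont
    filter_upwards [this] with ω hω
    exact continuousOn_finsetSum _ fun k _ => continuousOn_finsetSum _ fun l _ =>
      continuousOn_const.mul (hω k l)
  · have : ∀ᵐ ω ∂P, ∀ k l, BoundedVariationOn (fun s => Γ s (z k) (z l) ω) (Set.Iic T) :=
      ae_all_iff.2 fun k => ae_all_iff.2 fun l => (hh.crossVar _ _).bv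
    filter_upwards [this] with ω hω
    have := boundedVariationOn_linear_comb Finset.univ (fun p : Fin N × Fin N => d p.1 * d p.2)
      (fun p _ => hω p.1 p.2)
    simpa only [hA, ← Finset.univ_product_univ, Finset.sum_product] using this

/-- The pathwise properties of the cross-variation that hold almost surely. -/
structure IsGoodPath (T : ℝ≥0) (F : ℝ≥0 → ℝ → ℝ → ℝ) : Prop where
  leftCont : IsLeftCont T F
  locBV : IsLocBV T F
  cont : ∀ q r : ℚ, ContinuousOn (fun s => F s q r) (Set.Iic T)
  psd : ∀ (N : ℕ) (z d : Fin N → ℝ) (s t : ℝ≥0), s ≤ t → t ≤ T →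
    ∑ k, ∑ l, d k * d l * F s (z k) (z l) ≤ ∑ k, ∑ l, d k * d l * F t (z k) (z l)

/-- The point `0` cannot be approached from below and must therefore itself belong to `D`. -/
theorem exists_monotone_seq_nnreal {D : Set ℝ≥0} (hD : Dense D) (h0 : 0 ∈ D) (s : ℝ≥0) :
    ∃ u : ℕ → ℝ≥0, Monotone u ∧ (∀ n, u n ∈ D) ∧ Tendsto u atTop (𝓝 s) := by
  rcases eq_or_ne s 0 with rfl | hs
  · exact ⟨fun _ => 0, monotone_const, fun _ => h0, tendsto_const_nhds⟩
  · obtain ⟨u, hu, hm, ht⟩ := hD.exists_seq_strictMono_tendsto_of_lt (pos_iff_ne_zero.2 hs)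
    exact ⟨u, hu.monotone, fun n => (hm n).2, ht⟩

theorem exists_monotone_rat_seq (x : ℝ) :
    ∃ u : ℕ → ℚ, Monotone u ∧ Tendsto (fun n => (u n : ℝ)) atTop (𝓝 x) := by
  obtain ⟨u, hu, -, ht⟩ := Real.exists_seq_rat_strictMono_tendsto x
  exact ⟨u, hu.monotone, ht⟩

/-- Almost sure statements can be combined only for countably many points, coefficients and times.
Real coefficients follow because both sides are continuous in them; real points and times are
approached from below by left continuity. -/
theorem psd_of_dense {F : ℝ≥0 → ℝ → ℝ → ℝ} (hF : IsLeftCont T F) {D : Set ℝ≥0} (hD : Dense D)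
    (h0 : 0 ∈ D)
    (H : ∀ (N : ℕ) (z d : Fin N → ℚ), ∀ s ∈ D, ∀ t ∈ D, s ≤ t → t ≤ T →
      ∑ k, ∑ l, (d k * d l : ℝ) * F s (z k) (z l) ≤ ∑ k, ∑ l, (d k * d l : ℝ) * F t (z k) (z l))
    (N : ℕ) (z d : Fin N → ℝ) (s t : ℝ≥0) (hst : s ≤ t) (ht : t ≤ T) :
    ∑ k, ∑ l, d k * d l * F s (z k) (z l) ≤ ∑ k, ∑ l, d k * d l * F t (z k) (z l) := by
  rcases hst.eq_or_lt with rfl | hlt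
  · exact le_rfl
  -- real coefficients
  have H' : ∀ (z : Fin N → ℚ) (d : Fin N → ℝ), ∀ s ∈ D, ∀ t ∈ D, s ≤ t → t ≤ T →
      ∑ k, ∑ l, d k * d l * F s (z k) (z l) ≤ ∑ k, ∑ l, d k * d l * F t (z k) (z l) := by
    intro z d s hs t ht hst htT
    have hdense : DenseRange (Pi.map (fun (_ : Fin N) (q : ℚ) => (q : ℝ))) :=
      DenseRange.piMap fun _ => Rat.denseRange_cast
    refine hdense.induction_on (p := fun d => ∑ k, ∑ l, d k * d l * F s (z k) (z l)
      ≤ ∑ k, ∑ l, d k * d l * F t (z k) (z l)) d (isClosed_le (by fun_prop) (by fun_prop)) ?_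
    intro q
    exact H N z q s hs t ht hst htT
  obtain ⟨u, hu, huD, hut⟩ := exists_monotone_seq_nnreal hD h0 s
  obtain ⟨v, hv, hvD, hvt⟩ := exists_monotone_seq_nnreal hD h0 t
  choose w hw hwt using fun k => exists_monotone_rat_seq (z k)
  have hlim : ∀ (p : ℝ≥0) (a : ℕ → ℝ≥0), p ≤ T → Monotone a → Tendsto a atTop (𝓝 p) →
      Tendsto (fun n => ∑ k, ∑ l, d k * d l * F (a n) (w k n) (w l n)) atTop
        (𝓝 (∑ k, ∑ l, d k * d l * F p (z k) (z l))) := fun p a hp ha hat => by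
    refine tendsto_finsetSum _ fun k _ => tendsto_finsetSum _ fun l _ => Tendsto.const_mul _ ?_
    refine hF (p, z k, z l) (fun n => (a n, (w k n : ℝ), (w l n : ℝ))) hp (fun m n hmn => ?_)
      (hat.prodMk_nhds ((hwt k).prodMk_nhds (hwt l)))
    exact ⟨ha hmn, Rat.cast_le.2 (hw k hmn), Rat.cast_le.2 (hw l hmn)⟩
  refine le_of_tendsto_of_tendsto (hlim s u (hst.trans ht) hu hut) (hlim t v ht hv hvt) ?_
  -- Eventually `u n ≤ s < v n`, so the approximating times are in order; the case `s = t` was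
  -- settled beforehand for this reason.
  filter_upwards [hvt.eventually_const_lt hlt] with n hn
  exact H' (fun k => w k n) d _ (huD n) _ (hvD n) ((hu.ge_of_tendsto hut n).trans hn.le)
    ((hv.ge_of_tendsto hvt n).trans ht)

theorem IsV2.ae_isGoodPath [IsProbabilityMeasure P] (hh : IsV2 P ℱ T h Γ) :
    ∀ᵐ ω ∂P, IsGoodPath T (fun s x y => Γ s x y ω) := by
  obtain ⟨D, hDc, hDd⟩ := TopologicalSpace.exists_countable_dense ℝ≥0
  set D' := insert 0 D
  have hD'c : D'.Countable := hDc.insert 0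
  have := hD'c.to_subtype
  have h1 : ∀ᵐ ω ∂P, ∀ (N : ℕ) (z d : Fin N → ℚ) (s t : D'), (s : ℝ≥0) ≤ t → (t : ℝ≥0) ≤ T →
      ∑ k, ∑ l, (d k * d l : ℝ) * Γ s (z k) (z l) ω ≤ ∑ k, ∑ l, (d k * d l : ℝ) * Γ t (z k) (z l) ω := by
    simp only [ae_all_iff]
    exact fun N z d s t hst ht => hh.ae_psd (fun k => (z k : ℝ)) (fun k => (d k : ℝ)) hst ht
  have h2 : ∀ᵐ ω ∂P, ∀ q r : ℚ, ContinuousOn (fun s => Γ s q r ω) (Set.Iic T) := by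
    simp only [ae_all_iff]
    exact fun q r => (hh.crossVar _ _).cont
  filter_upwards [hh.leftCont, hh.locBV, h1, h2] with ω h3 h4 h5 h6
  refine ⟨h3, h4, h6, psd_of_dense h3 (hDd.mono (Set.subset_insert _ _)) (Set.mem_insert _ _) ?_⟩
  intro N z d s hs t ht
  exact h5 N z d ⟨s, hs⟩ ⟨t, ht⟩

end Martingales

/-! ### The algebra of simple functions -/

theorem sum_fin_succ_sub_castSucc (m : ℕ) (G : Fin (m + 1) → ℝ) :
    ∑ j : Fin m, (G j.succ - G j.castSucc) = G (Fin.last m) - G 0 := by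
  induction m with
  | zero => simp
  | succ m ih =>
    rw [Fin.sum_univ_castSucc]
    have := ih fun j => G j.castSucc
    simp only [Fin.succ_castSucc, Fin.castSucc_zero, Fin.succ_last] at this ⊢
    rw [this]; ring

/-- Telescoping is applied to `G` frozen outside the index interval from `p` to `q`: steps outside
that interval have increment zero. -/
theorem sum_fin_ite_succ_sub_castSucc {m : ℕ} (G : Fin (m + 1) → ℝ) {p q : Fin (m + 1)} (h : p ≤ q) :
    ∑ j : Fin m, (if p < j.succ ∧ j.succ ≤ q then G j.succ - G j.castSucc else 0) = G q - G p := by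
  have := sum_fin_succ_sub_castSucc m fun k => G (max p (min k q))
  simp only [min_eq_right (Fin.le_last q), max_eq_right h, min_eq_left (Fin.zero_le q),
    max_eq_left (Fin.zero_le p)] at this
  rw [← this]
  refine Finset.sum_congr rfl fun j _ => ?_
  have hlt : ∀ r : Fin (m + 1), r < j.succ ↔ r ≤ j.castSucc := fun r => Fin.le_castSucc_iff.symm
  by_cases h1 : p < j.succ
  · have h1' := (hlt p).1 h1
    by_cases h2 : j.succ ≤ q
    · have h2' : j.castSucc ≤ q := (Fin.castSucc_lt_succ.le).trans h2
      simp [h1, h2, h2', max_eq_right h1.le, max_eq_right h1']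
    · have h2' := (hlt q).1 (not_le.1 h2)
      simp [h2, min_eq_right (not_le.1 h2).le, min_eq_right h2']
  · have h1' : j.castSucc ≤ p := (Fin.castSucc_lt_succ.le).trans (not_lt.1 h1)
    simp [h1, max_eq_left ((min_le_left _ q).trans (not_lt.1 h1)),
      max_eq_left ((min_le_left _ q).trans h1')]

section

variable {Ω : Type*} [MeasurableSpace Ω] {ℱ : Filtration ℝ≥0 ‹MeasurableSpace Ω›} {T : ℝ≥0}

/-- The sum of the increments of `H` over the grid cells, weighted by the values of `φ`. -/
def Simple.bilin (φ : Simple ℱ T) (H : ℝ≥0 → ℝ → ℝ) (ω : Ω) : ℝ :=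
  ∑ j, ∑ i, φ.e j i ω * (H (φ.t j.succ) (φ.x i.succ) - H (φ.t j.castSucc) (φ.x i.succ)
    - H (φ.t j.succ) (φ.x i.castSucc) + H (φ.t j.castSucc) (φ.x i.castSucc))

theorem Simple.integral_eq_bilin (φ : Simple ℱ T) (h : RField Ω) (t : ℝ≥0) (ω : Ω) :
    φ.integral h t ω = φ.bilin (fun r z => h (min r t) z ω) ω := rfl

/-- The indicator of a cell is the increment of `1_{s ≤ r} 1_{x < z}` over the cell. Value and
integral of a simple function are thus one expression in two functions `H`, and an identity valid
for every `H` settles both. -/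
theorem Simple.toField_eq_bilin (φ : Simple ℱ T) (s : ℝ≥0) (x : ℝ) (ω : Ω) :
    φ.toField s x ω = φ.bilin (fun r z => (if s ≤ r then 1 else 0) * (if x < z then 1 else 0)) ω := by
  unfold Simple.toField Simple.bilin
  refine Finset.sum_congr rfl fun j _ => Finset.sum_congr rfl fun i _ => ?_
  have h1 : Set.indicator (Set.Ioc (φ.t j.castSucc) (φ.t j.succ)) (1 : ℝ≥0 → ℝ) s
      = (if s ≤ φ.t j.succ then 1 else 0) - (if s ≤ φ.t j.castSucc then 1 else 0) := by
    have := φ.t_mono (Fin.castSucc_lt_succ (i := j))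
    simp only [Set.indicator_apply, Set.mem_Ioc, Pi.one_apply]
    grind
  have h2 : Set.indicator (Set.Ico (φ.x i.castSucc) (φ.x i.succ)) (1 : ℝ → ℝ) x
      = (if x < φ.x i.succ then 1 else 0) - (if x < φ.x i.castSucc then 1 else 0) := by
    have := φ.x_mono (Fin.castSucc_lt_succ (i := i))
    simp only [Set.indicator_apply, Set.mem_Ico, Pi.one_apply]
    grind
  rw [h1, h2]; ring

-- A fine cell inherits the value of the coarse cell that contains it. That value is known at the
-- left end of the coarse cell, hence no later than needed, and the increments over the fine cells
-- telescope to the increment over the coarse one.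
open Classical in
theorem Simple.exists_refine (φ : Simple ℱ T) {m n : ℕ} {t : Fin (m + 1) → ℝ≥0}
    {x : Fin (n + 1) → ℝ} (ht : StrictMono t) (hx : StrictMono x) (htT : ∀ j, t j ≤ T)
    (hφt : ∀ j, φ.t j ∈ Set.range t) (hφx : ∀ i, φ.x i ∈ Set.range x) :
    ∃ (e : Fin m → Fin n → Ω → ℝ) (he : ∀ j i, Measurable[ℱ (t j.castSucc)] (e j i)),
      ∀ H ω, (Simple.mk m n t x e ht htT hx he).bilin H ω = φ.bilin H ω := by
  choose a ha using hφt
  choose b hb using hφx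
  have ham : StrictMono a := fun i j hij => by
    rw [← ht.lt_iff_lt, ha, ha]; exact φ.t_mono hij
  have hbm : StrictMono b := fun i j hij => by
    rw [← hx.lt_iff_lt, hb, hb]; exact φ.x_mono hij
  refine ⟨fun j i ω => ∑ j₀, ∑ i₀, (if (a j₀.castSucc < j.succ ∧ j.succ ≤ a j₀.succ) ∧
    (b i₀.castSucc < i.succ ∧ i.succ ≤ b i₀.succ) then φ.e j₀ i₀ ω else 0), fun j i => ?_,
    fun H ω => ?_⟩
  · refine Finset.measurable_fun_sum _ fun j₀ _ => Finset.measurable_fun_sum _ fun i₀ _ => ?_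
    split_ifs with h
    · refine (φ.e_meas j₀ i₀).mono (ℱ.mono ?_) le_rfl
      rw [← ha, ht.le_iff_le]
      exact Fin.le_castSucc_iff.2 h.1.1
    · exact measurable_const
  · have key : ∀ j₀ i₀, ∑ j : Fin m, ∑ i : Fin n, (if (a (Fin.castSucc j₀) < j.succ ∧
        j.succ ≤ a (Fin.succ j₀)) ∧ (b (Fin.castSucc i₀) < i.succ ∧ i.succ ≤ b (Fin.succ i₀))
        then φ.e j₀ i₀ ω else 0) * (H (t j.succ) (x i.succ) - H (t j.castSucc) (x i.succ)
          - H (t j.succ) (x i.castSucc) + H (t j.castSucc) (x i.castSucc))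
        = φ.e j₀ i₀ ω * (H (φ.t j₀.succ) (φ.x i₀.succ) - H (φ.t j₀.castSucc) (φ.x i₀.succ)
          - H (φ.t j₀.succ) (φ.x i₀.castSucc) + H (φ.t j₀.castSucc) (φ.x i₀.castSucc)) := by
      intro j₀ i₀
      have h1 : ∀ j : Fin m, ∑ i : Fin n, (if (a (Fin.castSucc j₀) < j.succ ∧
        j.succ ≤ a (Fin.succ j₀)) ∧ (b (Fin.castSucc i₀) < i.succ ∧ i.succ ≤ b (Fin.succ i₀))
        then φ.e j₀ i₀ ω else 0) * (H (t j.succ) (x i.succ) - H (t j.castSucc) (x i.succ)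
          - H (t j.succ) (x i.castSucc) + H (t j.castSucc) (x i.castSucc))
        = φ.e j₀ i₀ ω * (if (a (Fin.castSucc j₀) < j.succ ∧ j.succ ≤ a (Fin.succ j₀)) then
          (H (t j.succ) (φ.x i₀.succ) - H (t j.succ) (φ.x i₀.castSucc))
          - (H (t j.castSucc) (φ.x i₀.succ) - H (t j.castSucc) (φ.x i₀.castSucc)) else 0) := by
        intro j
        by_cases hj : a (Fin.castSucc j₀) < j.succ ∧ j.succ ≤ a (Fin.succ j₀)
        · have := sum_fin_ite_succ_sub_castSucc
            (fun k => H (t j.succ) (x k) - H (t j.castSucc) (x k))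
            (hbm (Fin.castSucc_lt_succ (i := i₀))).le
          simp only [hj, true_and, and_self, if_true]
          rw [← hb, ← hb, show ∀ p q r s : ℝ, p - q - (r - s) = (p - r) - (q - s) from
            fun p q r s => by ring, ← this, Finset.mul_sum]
          refine Finset.sum_congr rfl fun i _ => ?_
          split_ifs
          · ring
          · simp
        · simp [hj]
      have h2 := sum_fin_ite_succ_sub_castSucc
            (fun k => H (t k) (φ.x i₀.succ) - H (t k) (φ.x i₀.castSucc))
            (ham (Fin.castSucc_lt_succ (i := j₀))).le
      rw [Finset.sum_congr rfl fun j _ => h1 j, ← Finset.mul_sum, h2, ha, ha]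
      ring
    simp only [Simple.bilin]
    rw [← Finset.sum_congr rfl fun j₀ _ => Finset.sum_congr rfl fun i₀ _ => key j₀ i₀]
    simp only [Finset.sum_mul]
    calc _ = ∑ j : Fin m, ∑ j₀, ∑ i : Fin n, ∑ i₀, _ :=
          Finset.sum_congr rfl fun j _ => Finset.sum_comm
      _ = ∑ j₀, ∑ j : Fin m, ∑ i : Fin n, ∑ i₀, _ := Finset.sum_comm
      _ = ∑ j₀, ∑ j : Fin m, ∑ i₀, ∑ i : Fin n, _ :=
          Finset.sum_congr rfl fun j₀ _ => Finset.sum_congr rfl fun j _ => Finset.sum_comm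
      _ = ∑ j₀, ∑ i₀, ∑ j : Fin m, ∑ i : Fin n, _ :=
          Finset.sum_congr rfl fun j₀ _ => Finset.sum_comm

open Classical in
/-- Simple functions are closed under linear combinations. -/
theorem Simple.exists_linear_comb (φ ψ : Simple ℱ T) (a b : ℝ) :
    ∃ χ : Simple ℱ T, ∀ H ω, χ.bilin H ω = a * φ.bilin H ω + b * ψ.bilin H ω := by
  set A : Finset ℝ≥0 := Finset.univ.image φ.t ∪ Finset.univ.image ψ.t with hA
  set B : Finset ℝ := Finset.univ.image φ.x ∪ Finset.univ.image ψ.x with hB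
  have hAc : A.card = (A.card - 1) + 1 := by
    have : 0 < A.card := Finset.card_pos.2 ⟨φ.t 0, by simp [hA]⟩
    omega
  have hBc : B.card = (B.card - 1) + 1 := by
    have : 0 < B.card := Finset.card_pos.2 ⟨φ.x 0, by simp [hB]⟩
    omega
  set t := A.orderEmbOfFin hAc with ht
  set x := B.orderEmbOfFin hBc with hx
  have htr : Set.range t = A := Finset.range_orderEmbOfFin _ _
  have hxr : Set.range x = B := Finset.range_orderEmbOfFin _ _
  have htT : ∀ j, t j ≤ T := fun j => by
    have : t j ∈ A := Finset.orderEmbOfFin_mem _ _ _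
    simp only [hA, Finset.mem_union, Finset.mem_image, Finset.mem_univ, true_and] at this
    rcases this with ⟨k, hk⟩ | ⟨k, hk⟩ <;> rw [← hk]
    · exact φ.t_le k
    · exact ψ.t_le k
  obtain ⟨e₁, he₁, h₁⟩ := φ.exists_refine t.strictMono x.strictMono htT
    (fun j => by rw [htr]; simp [hA]) (fun j => by rw [hxr]; simp [hB])
  obtain ⟨e₂, he₂, h₂⟩ := ψ.exists_refine t.strictMono x.strictMono htT
    (fun j => by rw [htr]; simp [hA]) (fun j => by rw [hxr]; simp [hB])
  refine ⟨Simple.mk _ _ t x (fun j i ω => a * e₁ j i ω + b * e₂ j i ω) t.strictMono htT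
    x.strictMono fun j i => ((he₁ j i).const_mul a).add ((he₂ j i).const_mul b), fun H ω => ?_⟩
  rw [← h₁, ← h₂]
  simp only [Simple.bilin, Finset.mul_sum, ← Finset.sum_add_distrib]
  refine Finset.sum_congr rfl fun j _ => Finset.sum_congr rfl fun i _ => by ring

theorem Simple.toField_of_mem (φ : Simple ℱ T) {s : ℝ≥0} {x : ℝ} {j : Fin φ.m} {i : Fin φ.n}
    (hs : s ∈ Set.Ioc (φ.t j.castSucc) (φ.t j.succ)) (hx : x ∈ Set.Ico (φ.x i.castSucc) (φ.x i.succ))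
    (ω : Ω) : φ.toField s x ω = φ.e j i ω := by
  unfold Simple.toField
  rw [Finset.sum_eq_single j, Finset.sum_eq_single i]
  · simp [hs, hx]
  · intro i' _ hi'
    have : x ∉ Set.Ico (φ.x i'.castSucc) (φ.x i'.succ) := fun hx' => by
      rcases lt_or_gt_of_ne hi' with h | h
      · have h1 := φ.x_mono.monotone (Fin.succ_le_castSucc_iff.2 h)
        exact absurd (hx'.2.trans_le (h1.trans hx.1)) (lt_irrefl _)
      · have h1 := φ.x_mono.monotone (Fin.succ_le_castSucc_iff.2 h)
        exact absurd (hx.2.trans_le (h1.trans hx'.1)) (lt_irrefl _)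
    simp [this]
  · simp
  · intro j' _ hj'
    have : s ∉ Set.Ioc (φ.t j'.castSucc) (φ.t j'.succ) := fun hs' => by
      rcases lt_or_gt_of_ne hj' with h | h
      · have h1 := φ.t_mono.monotone (Fin.succ_le_castSucc_iff.2 h)
        exact absurd (hs.1.trans_le (hs'.2.trans h1)) (lt_irrefl _)
      · have h1 := φ.t_mono.monotone (Fin.succ_le_castSucc_iff.2 h)
        exact absurd (hs'.1.trans_le (hs.2.trans h1)) (lt_irrefl _)
    simp [this]
  · simp

theorem Simple.toField_of_notMem (φ : Simple ℱ T) {s : ℝ≥0} {x : ℝ}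
    (h : ∀ (j : Fin φ.m) (i : Fin φ.n), s ∈ Set.Ioc (φ.t j.castSucc) (φ.t j.succ) →
      x ∉ Set.Ico (φ.x i.castSucc) (φ.x i.succ)) (ω : Ω) : φ.toField s x ω = 0 := by
  unfold Simple.toField
  refine Finset.sum_eq_zero fun j _ => Finset.sum_eq_zero fun i _ => ?_
  by_cases hs : s ∈ Set.Ioc (φ.t j.castSucc) (φ.t j.succ)
  · simp [h j i hs]
  · simp [hs]

/-- The composition of a simple function with a function that vanishes at `0`. -/
theorem Simple.exists_comp (φ : Simple ℱ T) {f : ℝ → ℝ} (hf : Measurable f) (hf0 : f 0 = 0) :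
    ∃ χ : Simple ℱ T, ∀ s x ω, χ.toField s x ω = f (φ.toField s x ω) := by
  refine ⟨Simple.mk φ.m φ.n φ.t φ.x (fun j i ω => f (φ.e j i ω)) φ.t_mono φ.t_le φ.x_mono
    fun j i => hf.comp (φ.e_meas j i), fun s x ω => ?_⟩
  set χ : Simple ℱ T := Simple.mk φ.m φ.n φ.t φ.x (fun j i ω => f (φ.e j i ω)) φ.t_mono φ.t_le
    φ.x_mono fun j i => hf.comp (φ.e_meas j i) with hχ
  by_cases h : ∃ (j : Fin φ.m) (i : Fin φ.n), s ∈ Set.Ioc (φ.t j.castSucc) (φ.t j.succ) ∧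
      x ∈ Set.Ico (φ.x i.castSucc) (φ.x i.succ)
  · obtain ⟨j, i, hs, hx⟩ := h
    rw [φ.toField_of_mem hs hx, χ.toField_of_mem (j := j) (i := i) hs hx]
  · push Not at h
    rw [φ.toField_of_notMem h, χ.toField_of_notMem h, hf0]

theorem Simple.toField_adapted (φ : Simple ℱ T) (s : ℝ≥0) (x : ℝ) :
    Measurable[ℱ s] (φ.toField s x) := by
  by_cases h : ∃ (j : Fin φ.m) (i : Fin φ.n), s ∈ Set.Ioc (φ.t j.castSucc) (φ.t j.succ) ∧
      x ∈ Set.Ico (φ.x i.castSucc) (φ.x i.succ)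
  · obtain ⟨j, i, hs, hx⟩ := h
    rw [show φ.toField s x = φ.e j i from funext fun ω => φ.toField_of_mem hs hx ω]
    exact (φ.e_meas j i).mono (ℱ.mono hs.1.le) le_rfl
  · push Not at h
    rw [show φ.toField s x = fun _ => 0 from funext fun ω => φ.toField_of_notMem h ω]
    exact measurable_const

theorem Simple.measurable_toField (φ : Simple ℱ T) :
    Measurable (fun p : ℝ≥0 × ℝ × Ω => φ.toField p.1 p.2.1 p.2.2) := by
  unfold Simple.toField
  refine Finset.measurable_fun_sum _ fun j _ => Finset.measurable_fun_sum _ fun i _ => ?_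
  refine Measurable.mul (Measurable.mul ?_ ?_) ?_
  · exact ((φ.e_meas j i).mono (ℱ.le _) le_rfl).comp measurable_snd.snd
  · exact (measurable_one.indicator measurableSet_Ioc).comp measurable_fst
  · exact (measurable_one.indicator measurableSet_Ico).comp measurable_snd.fst

theorem Simple.isV1 (φ : Simple ℱ T) : IsV1 ℱ T φ.toField := by
  have h : Measurable (fun p : Set.Iic T × ℝ × Ω => ((p.1 : ℝ≥0), p.2)) :=
    (measurable_subtype_coe.comp measurable_fst).prodMk measurable_snd
  have h1 := φ.measurable_toField.comp h
  have h2 : ∀ s ≤ T, ∀ x, Measurable[ℱ s] (φ.toField s x) := fun s _ x => φ.toField_adapted s x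
  exact ⟨h1, h2⟩

theorem Simple.exists_supp (φ : Simple ℱ T) :
    ∃ R : ℝ, ∀ s x ω, R < |x| → φ.toField s x ω = 0 := by
  refine ⟨max |φ.x 0| |φ.x (Fin.last _)|, fun s x ω hx => φ.toField_of_notMem (fun j i _ hi => ?_) ω⟩
  have h1 := φ.x_mono.monotone (Fin.zero_le i.castSucc)
  have h2 := φ.x_mono.monotone (Fin.le_last i.succ)
  have h3 : |x| ≤ max |φ.x 0| |φ.x (Fin.last _)| := by
    refine abs_le.2 ⟨?_, ?_⟩
    · have := neg_abs_le (φ.x 0)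
      have := le_max_left |φ.x 0| |φ.x (Fin.last _)|
      linarith [hi.1]
    · have := le_abs_self (φ.x (Fin.last _))
      have := le_max_right |φ.x 0| |φ.x (Fin.last _)|
      linarith [hi.2]
  exact absurd hx (not_lt.2 h3)

/-- The zero simple function. -/
def Simple.zero (ℱ : Filtration ℝ≥0 ‹MeasurableSpace Ω›) (T : ℝ≥0) : Simple ℱ T where
  m := 0
  n := 0
  t := fun _ => 0
  x := fun _ => 0
  e := fun j => j.elim0
  t_mono := fun i j h => by omega
  t_le := fun _ => zero_le
  x_mono := fun i j h => by omega
  e_meas := fun j => j.elim0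

theorem Simple.zero_toField (s : ℝ≥0) (x : ℝ) (ω : Ω) : (Simple.zero ℱ T).toField s x ω = 0 := by
  simp [Simple.zero, Simple.toField]

open Classical in
/-- Indicators of predictable rectangles are simple. -/
theorem Simple.exists_rect {a b : ℝ≥0} {c d : ℝ} (hab : a < b) (hb : b ≤ T) (hcd : c < d)
    {D : Set Ω} (hD : MeasurableSet[ℱ a] D) :
    ∃ φ : Simple ℱ T, ∀ s x ω, φ.toField s x ω =
      (D ×ˢ (Set.Ioc a b ×ˢ Set.Ico c d)).indicator 1 (ω, s, x) := by
  refine ⟨⟨1, 1, ![a, b], ![c, d], fun _ _ => D.indicator 1, ?_, ?_, ?_, ?_⟩, fun s x ω => ?_⟩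
  · refine Fin.strictMono_iff_lt_succ.2 fun i => ?_
    fin_cases i; simpa
  · intro j; fin_cases j
    · exact hab.le.trans hb
    · exact hb
  · refine Fin.strictMono_iff_lt_succ.2 fun i => ?_
    fin_cases i; simpa
  · intro j i
    fin_cases j
    exact measurable_const.indicator hD
  · simp only [Simple.toField, Finset.univ_unique, Fin.default_eq_zero, Fin.isValue,
      Finset.sum_singleton, Set.indicator_apply, Set.mem_prod, Pi.one_apply]
    by_cases h1 : ω ∈ D <;> by_cases h2 : s ∈ Set.Ioc a b <;> by_cases h3 : x ∈ Set.Ico c d <;>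
      simp [h1, h2, h3, Fin.castSucc, Fin.succ]

end

/-! ### Density of simple functions -/

section

variable {Ω : Type*} [MeasurableSpace Ω]

/-- The predictable rectangles, together with all measurable sets at time `0`. -/
def predRects (ℱ : Filtration ℝ≥0 ‹MeasurableSpace Ω›) : Set (Set (Ω × ℝ≥0 × ℝ)) :=
  {S | ∃ (a b : ℝ≥0) (c d : ℝ) (D : Set Ω), MeasurableSet[ℱ a] D ∧
    S = D ×ˢ (Set.Ioc a b ×ˢ Set.Ico c d)} ∪ {S | MeasurableSet S ∧ ∀ z ∈ S, z.2.1 = 0}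

/-- The predictable σ-algebra on `Ω × ℝ≥0 × ℝ`. -/
abbrev predSigma (ℱ : Filtration ℝ≥0 ‹MeasurableSpace Ω›) : MeasurableSpace (Ω × ℝ≥0 × ℝ) :=
  MeasurableSpace.generateFrom (predRects ℱ)

variable {ℱ : Filtration ℝ≥0 ‹MeasurableSpace Ω›}

theorem measurableSet_of_mem_predRects {S : Set (Ω × ℝ≥0 × ℝ)} (hS : S ∈ predRects ℱ) :
    MeasurableSet S := by
  rcases hS with ⟨a, b, c, d, D, hD, rfl⟩ | ⟨h, -⟩
  · exact (ℱ.le a _ hD).prod (measurableSet_Ioc.prod measurableSet_Ico)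
  · exact h

theorem predSigma_le : predSigma ℱ ≤ (inferInstance : MeasurableSpace (Ω × ℝ≥0 × ℝ)) :=
  MeasurableSpace.generateFrom_le fun _ => measurableSet_of_mem_predRects

theorem isPiSystem_predRects : IsPiSystem (predRects ℱ) := by
  rintro S hS S' hS' hne
  rcases hS with ⟨a, b, c, d, D, hD, rfl⟩ | ⟨h, h0⟩
  · rcases hS' with ⟨a', b', c', d', D', hD', rfl⟩ | ⟨h', h0'⟩
    · refine Or.inl ⟨max a a', min b b', max c c', min d d', D ∩ D',
        (ℱ.mono (le_max_left _ _) _ hD).inter (ℱ.mono (le_max_right _ _) _ hD'), ?_⟩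
      rw [Set.prod_inter_prod, Set.prod_inter_prod, Set.Ioc_inter_Ioc, Set.Ico_inter_Ico]
    · exact Or.inr ⟨(measurableSet_of_mem_predRects (Or.inl ⟨a, b, c, d, D, hD, rfl⟩)).inter h',
        fun z hz => h0' z hz.2⟩
  · exact Or.inr ⟨h.inter (measurableSet_of_mem_predRects hS'), fun z hz => h0 z hz.1⟩

/-- The measures used for approximation live on times in `(0, T]`, so every measurable set at time
`0` may be declared predictable. This makes the time and space coordinates predictable, although the
intervals of the rectangles never contain `0`. -/
theorem measurableSet_predSigma_of_zero {S : Set (Ω × ℝ≥0 × ℝ)} (hS : MeasurableSet S)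
    (h : ∀ z ∈ S, z.2.1 = 0) : MeasurableSet[predSigma ℱ] S :=
  MeasurableSpace.measurableSet_generateFrom (Or.inr ⟨hS, h⟩)

theorem measurableSet_predSigma_rect (a b : ℝ≥0) (c d : ℝ) {D : Set Ω} (hD : MeasurableSet[ℱ a] D) :
    MeasurableSet[predSigma ℱ] (D ×ˢ (Set.Ioc a b ×ˢ Set.Ico c d)) :=
  MeasurableSpace.measurableSet_generateFrom (Or.inl ⟨a, b, c, d, D, hD, rfl⟩)

theorem measurableSet_predSigma_slab (a b : ℝ≥0) {D : Set Ω} (hD : MeasurableSet[ℱ a] D) :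
    MeasurableSet[predSigma ℱ] (D ×ˢ (Set.Ioc a b ×ˢ (Set.univ : Set ℝ))) := by
  have : D ×ˢ (Set.Ioc a b ×ˢ (Set.univ : Set ℝ))
      = ⋃ n : ℕ, D ×ˢ (Set.Ioc a b ×ˢ Set.Ico (-(n : ℝ)) n) := by
    ext ⟨ω, s, x⟩
    simp only [Set.mem_prod, Set.mem_univ, and_true, Set.mem_iUnion, Set.mem_Ico]
    refine ⟨fun h => ?_, fun ⟨n, h⟩ => ⟨h.1, h.2.1⟩⟩
    obtain ⟨n, hn⟩ := exists_nat_gt |x|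
    exact ⟨n, h.1, h.2, (abs_lt.1 hn).1.le, (abs_lt.1 hn).2⟩
  rw [this]
  exact MeasurableSet.iUnion fun n => measurableSet_predSigma_rect _ _ _ _ hD

theorem measurable_predSigma_snd : Measurable[predSigma ℱ] (fun z : Ω × ℝ≥0 × ℝ => z.2) := by
  have hs : Measurable[predSigma ℱ] (fun z : Ω × ℝ≥0 × ℝ => z.2.1) := by
    refine @measurable_of_Ioi _ _ _ _ _ (predSigma ℱ) _ _ _ _ fun a => ?_
    have : (fun z : Ω × ℝ≥0 × ℝ => z.2.1) ⁻¹' Set.Ioi a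
        = ⋃ n : ℕ, Set.univ ×ˢ (Set.Ioc a n ×ˢ (Set.univ : Set ℝ)) := by
      ext ⟨ω, s, x⟩
      simp only [Set.mem_preimage, Set.mem_Ioi, Set.mem_iUnion, Set.mem_prod, Set.mem_univ,
        true_and, and_true, Set.mem_Ioc]
      refine ⟨fun h => ?_, fun ⟨n, h⟩ => h.1⟩
      obtain ⟨n, hn⟩ := exists_nat_ge s
      exact ⟨n, h, hn⟩
    rw [this]
    exact MeasurableSet.iUnion fun n => measurableSet_predSigma_slab _ _ MeasurableSet.univ
  have hx : Measurable[predSigma ℱ] (fun z : Ω × ℝ≥0 × ℝ => z.2.2) := by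
    refine @measurable_of_Iio _ _ _ _ _ (predSigma ℱ) _ _ _ _ fun d => ?_
    have : (fun z : Ω × ℝ≥0 × ℝ => z.2.2) ⁻¹' Set.Iio d
        = (⋃ n : ℕ, Set.univ ×ˢ (Set.Ioc 0 (n : ℝ≥0) ×ˢ Set.Ico (-(n : ℝ)) d)) ∪
          {z | z.2.1 = 0 ∧ z.2.2 < d} := by
      ext ⟨ω, s, x⟩
      simp only [Set.mem_preimage, Set.mem_Iio, Set.mem_iUnion, Set.mem_prod, Set.mem_univ,
        true_and, Set.mem_Ioc, Set.mem_Ico, Set.mem_union, Set.mem_ofPred_eq]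
      constructor
      · intro h
        rcases eq_or_lt_of_le (zero_le : 0 ≤ s) with h0 | h0
        · exact Or.inr ⟨h0.symm, h⟩
        · obtain ⟨n, hn⟩ := exists_nat_ge s
          obtain ⟨m, hm⟩ := exists_nat_gt |x|
          refine Or.inl ⟨max n m, ⟨h0, hn.trans (by exact_mod_cast le_max_left _ _)⟩, ?_, h⟩
          have h1 : (m : ℝ) ≤ (max n m : ℕ) := by exact_mod_cast le_max_right _ _
          linarith [(abs_lt.1 hm).1]
      · rintro (⟨n, h⟩ | h)
        exacts [h.2.2, h.2]
    rw [this]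
    refine (MeasurableSet.iUnion fun n => measurableSet_predSigma_rect _ _ _ _ .univ).union ?_
    refine measurableSet_predSigma_of_zero ?_ fun z hz => hz.1
    exact (measurableSet_eq_fun measurable_snd.fst measurable_const).inter
      (measurableSet_lt measurable_snd.snd measurable_const)
  exact hs.prodMk hx

/-- The functions on `Ω × ℝ≥0 × ℝ` that are limits in `L¹(ν)` of simple functions supported
in `[-R, R)`. -/
def IsSimpleApproximable (ℱ : Filtration ℝ≥0 ‹MeasurableSpace Ω›) (T : ℝ≥0) (R : ℝ)
    (ν : Measure (Ω × ℝ≥0 × ℝ)) (f : Ω × ℝ≥0 × ℝ → ℝ) : Prop :=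
  ∀ ε : ℝ≥0∞, 0 < ε → ∃ φ : Simple ℱ T, (∀ s x ω, x ∉ Set.Ico (-R) R → φ.toField s x ω = 0) ∧
    ∫⁻ z, ‖f z - φ.toField z.2.1 z.2.2 z.1‖ₑ ∂ν < ε

variable {T : ℝ≥0} {R : ℝ} {ν : Measure (Ω × ℝ≥0 × ℝ)}

theorem Simple.measurable_toField_prod (φ : Simple ℱ T) :
    Measurable (fun z : Ω × ℝ≥0 × ℝ => φ.toField z.2.1 z.2.2 z.1) := by
  have h : Measurable (fun z : Ω × ℝ≥0 × ℝ => (z.2.1, z.2.2, z.1)) :=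
    measurable_snd.fst.prodMk (measurable_snd.snd.prodMk measurable_fst)
  have h1 := φ.measurable_toField.comp h
  exact h1

theorem IsSimpleApproximable.of_toField {f : Ω × ℝ≥0 × ℝ → ℝ} (φ : Simple ℱ T)
    (hφ : ∀ s x ω, x ∉ Set.Ico (-R) R → φ.toField s x ω = 0)
    (h : ∀ᵐ z ∂ν, f z = φ.toField z.2.1 z.2.2 z.1) : IsSimpleApproximable ℱ T R ν f := by
  intro ε hε
  refine ⟨φ, hφ, ?_⟩
  rw [lintegral_congr_ae (g := fun _ => 0) (h.mono fun z hz => by simp [hz])]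
  simpa

theorem IsSimpleApproximable.congr {f g : Ω × ℝ≥0 × ℝ → ℝ} (hf : IsSimpleApproximable ℱ T R ν f)
    (h : f =ᵐ[ν] g) : IsSimpleApproximable ℱ T R ν g := by
  intro ε hε
  obtain ⟨φ, hφ, h1⟩ := hf ε hε
  refine ⟨φ, hφ, ?_⟩
  rwa [lintegral_congr_ae (g := fun z => ‖f z - φ.toField z.2.1 z.2.2 z.1‖ₑ)
    (h.symm.mono fun z hz => by simp only [hz])]

theorem Simple.exists_linear_comb_toField (φ ψ : Simple ℱ T) (a b : ℝ) :
    ∃ χ : Simple ℱ T, (∀ s x ω, χ.toField s x ω = a * φ.toField s x ω + b * ψ.toField s x ω) ∧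
      ∀ (h : RField Ω) t ω,
        χ.integral h t ω = a * φ.integral h t ω + b * ψ.integral h t ω := by
  obtain ⟨χ, hχ⟩ := φ.exists_linear_comb ψ a b
  refine ⟨χ, fun s x ω => ?_, fun h t ω => ?_⟩
  · simp only [Simple.toField_eq_bilin, hχ]
  · simp only [Simple.integral_eq_bilin, hχ]

theorem IsSimpleApproximable.linear_comb {f g : Ω × ℝ≥0 × ℝ → ℝ}
    (hf : IsSimpleApproximable ℱ T R ν f) (hg : IsSimpleApproximable ℱ T R ν g)
    (hfm : Measurable f) (a b : ℝ) :
    IsSimpleApproximable ℱ T R ν fun z => a * f z + b * g z := by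
  intro ε hε
  have hpos : ∀ c : ℝ, 0 < ε / 2 / (‖c‖ₑ + 1) := fun c =>
    ENNReal.div_pos (ENNReal.half_pos hε.ne').ne' (by simp)
  obtain ⟨φ, hφ, h1⟩ := hf _ (hpos a)
  obtain ⟨ψ, hψ, h2⟩ := hg _ (hpos b)
  obtain ⟨χ, hχ, -⟩ := φ.exists_linear_comb_toField ψ a b
  refine ⟨χ, fun s x ω hx => by rw [hχ, hφ s x ω hx, hψ s x ω hx]; simp, ?_⟩
  have hm : Measurable fun z : Ω × ℝ≥0 × ℝ => ‖a‖ₑ * ‖f z - φ.toField z.2.1 z.2.2 z.1‖ₑ :=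
    (hfm.sub φ.measurable_toField_prod).enorm.const_mul _
  have hle : ∀ (c : ℝ) (I : ℝ≥0∞), I < ε / 2 / (‖c‖ₑ + 1) → ‖c‖ₑ * I ≤ ε / 2 := fun c I hI =>
    calc ‖c‖ₑ * I ≤ (‖c‖ₑ + 1) * (ε / 2 / (‖c‖ₑ + 1)) := by gcongr; exact le_self_add
      _ = ε / 2 := ENNReal.mul_div_cancel (by simp) (by simp)
  by_cases htop : ε = ∞
  · subst htop
    calc _ ≤ ∫⁻ z, (‖a‖ₑ * ‖f z - φ.toField z.2.1 z.2.2 z.1‖ₑ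
          + ‖b‖ₑ * ‖g z - ψ.toField z.2.1 z.2.2 z.1‖ₑ) ∂ν := by
          refine lintegral_mono fun z => ?_
          rw [hχ, ← enorm_mul, ← enorm_mul]
          refine le_trans (le_of_eq ?_) (enorm_add_le _ _)
          congr 1; ring
      _ = ‖a‖ₑ * ∫⁻ z, ‖f z - φ.toField z.2.1 z.2.2 z.1‖ₑ ∂ν
          + ‖b‖ₑ * ∫⁻ z, ‖g z - ψ.toField z.2.1 z.2.2 z.1‖ₑ ∂ν := by
          rw [lintegral_add_left hm, lintegral_const_mul' _ _ (by simp),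
            lintegral_const_mul' _ _ (by simp)]
      _ < ∞ := ENNReal.add_lt_top.2 ⟨ENNReal.mul_lt_top (by simp) (h1.trans_le le_top),
          ENNReal.mul_lt_top (by simp) (h2.trans_le le_top)⟩
  have hle' : ∀ (c : ℝ) (I : ℝ≥0∞), I < ε / 2 / (‖c‖ₑ + 1) → ‖c‖ₑ * I < ε / 2 := by
    intro c I hI
    calc ‖c‖ₑ * I ≤ (‖c‖ₑ + 1) * I := by gcongr; exact le_self_add
      _ < (‖c‖ₑ + 1) * (ε / 2 / (‖c‖ₑ + 1)) := by
          refine (ENNReal.mul_lt_mul_iff_right (by simp) (by simp)).2 hI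
      _ = ε / 2 := ENNReal.mul_div_cancel (by simp) (by simp)
  calc _ ≤ ∫⁻ z, (‖a‖ₑ * ‖f z - φ.toField z.2.1 z.2.2 z.1‖ₑ
          + ‖b‖ₑ * ‖g z - ψ.toField z.2.1 z.2.2 z.1‖ₑ) ∂ν := by
          refine lintegral_mono fun z => ?_
          rw [hχ, ← enorm_mul, ← enorm_mul]
          refine le_trans (le_of_eq ?_) (enorm_add_le _ _)
          congr 1; ring
    _ = ‖a‖ₑ * ∫⁻ z, ‖f z - φ.toField z.2.1 z.2.2 z.1‖ₑ ∂ν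
          + ‖b‖ₑ * ∫⁻ z, ‖g z - ψ.toField z.2.1 z.2.2 z.1‖ₑ ∂ν := by
          rw [lintegral_add_left hm, lintegral_const_mul' _ _ (by simp),
            lintegral_const_mul' _ _ (by simp)]
    _ < ε / 2 + ε / 2 := ENNReal.add_lt_add (hle' a _ h1) (hle' b _ h2)
    _ = ε := ENNReal.add_halves ε

theorem IsSimpleApproximable.of_tendsto {f : Ω × ℝ≥0 × ℝ → ℝ} {F : ℕ → Ω × ℝ≥0 × ℝ → ℝ}
    (hF : ∀ n, IsSimpleApproximable ℱ T R ν (F n)) (hm : ∀ n, Measurable (F n)) (hf : Measurable f)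
    (h : Tendsto (fun n => ∫⁻ z, ‖f z - F n z‖ₑ ∂ν) atTop (𝓝 0)) :
    IsSimpleApproximable ℱ T R ν f := by
  intro ε hε
  wlog htop : ε ≠ ∞ generalizing ε
  · obtain ⟨φ, hφ, h1⟩ := this 1 one_pos (by simp)
    exact ⟨φ, hφ, h1.trans_le (by rw [not_not.1 htop]; exact le_top)⟩
  have hε2 : 0 < ε / 2 := ENNReal.half_pos hε.ne'
  obtain ⟨n, hn⟩ := (h.eventually (gt_mem_nhds hε2)).exists
  obtain ⟨φ, hφ, h1⟩ := hF n _ hε2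
  refine ⟨φ, hφ, ?_⟩
  calc _ ≤ ∫⁻ z, (‖f z - F n z‖ₑ + ‖F n z - φ.toField z.2.1 z.2.2 z.1‖ₑ) ∂ν := by
        refine lintegral_mono fun z => ?_
        refine le_trans (le_of_eq ?_) (enorm_add_le _ _)
        congr 1; ring
    _ = _ := lintegral_add_left (hf.sub (hm n)).enorm _
    _ < ε / 2 + ε / 2 := ENNReal.add_lt_add hn h1
    _ = ε := ENNReal.add_halves ε

theorem isSimpleApproximable_zero : IsSimpleApproximable ℱ T R ν fun _ => 0 :=
  .of_toField (Simple.zero ℱ T) (fun s x ω _ => Simple.zero_toField s x ω)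
    (.of_forall fun _ => (Simple.zero_toField _ _ _).symm)

theorem isSimpleApproximable_rect
    (hν : ∀ᵐ z ∂ν, z.2.1 ∈ Set.Ioc 0 T ∧ z.2.2 ∈ Set.Ico (-R) R) (a b : ℝ≥0) (c d : ℝ) {D : Set Ω}
    (hD : MeasurableSet[ℱ a] D) :
    IsSimpleApproximable ℱ T R ν ((D ×ˢ (Set.Ioc a b ×ˢ Set.Ico c d)).indicator 1) := by
  have h1 : (D ×ˢ (Set.Ioc a b ×ˢ Set.Ico c d)).indicator 1 =ᵐ[ν]
      (D ×ˢ (Set.Ioc a (min b T) ×ˢ Set.Ico (max c (-R)) (min d R))).indicator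
        (1 : Ω × ℝ≥0 × ℝ → ℝ) := by
    filter_upwards [hν] with z hz
    have : z ∈ (D ×ˢ (Set.Ioc a b ×ˢ Set.Ico c d)) ↔
        z ∈ (D ×ˢ (Set.Ioc a (min b T) ×ˢ Set.Ico (max c (-R)) (min d R))) := by
      simp only [Set.mem_prod, Set.mem_Ioc, Set.mem_Ico, le_min_iff, max_le_iff, lt_min_iff] at hz ⊢
      tauto
    by_cases h : z ∈ (D ×ˢ (Set.Ioc a b ×ˢ Set.Ico c d))
    · rw [Set.indicator_of_mem h, Set.indicator_of_mem (this.1 h)]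
    · rw [Set.indicator_of_notMem h, Set.indicator_of_notMem (fun h' => h (this.2 h'))]
  refine IsSimpleApproximable.congr ?_ h1.symm
  by_cases hab : a < min b T
  · by_cases hcd : max c (-R) < min d R
    · obtain ⟨φ, hφ⟩ := Simple.exists_rect hab (min_le_right _ _) hcd hD
      refine .of_toField φ (fun s x ω hx => ?_) (.of_forall fun z => (hφ _ _ _).symm)
      rw [hφ, Set.indicator_of_notMem]
      rintro ⟨-, -, h⟩
      exact hx ⟨(le_max_right _ _).trans h.1, h.2.trans_le (min_le_right _ _)⟩
    · rw [Set.Ico_eq_empty hcd]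
      simp only [Set.prod_empty, Set.indicator_empty]
      exact isSimpleApproximable_zero
  · rw [Set.Ioc_eq_empty hab]
    simp only [Set.empty_prod, Set.prod_empty, Set.indicator_empty]
    exact isSimpleApproximable_zero

/-- A π-λ argument. Complements are taken inside the rectangle over `(0, T]` and `[-R, R)` that
carries `ν`; disjoint unions follow by dominated convergence, as `ν` is finite. -/
theorem isSimpleApproximable_indicator [IsFiniteMeasure ν]
    (hν : ∀ᵐ z ∂ν, z.2.1 ∈ Set.Ioc 0 T ∧ z.2.2 ∈ Set.Ico (-R) R) {E : Set (Ω × ℝ≥0 × ℝ)}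
    (hE : MeasurableSet[predSigma ℱ] E) : IsSimpleApproximable ℱ T R ν (E.indicator 1) := by
  induction E, hE using MeasurableSpace.induction_on_inter rfl isPiSystem_predRects with
  | empty => simpa using isSimpleApproximable_zero
  | basic S hS =>
    rcases hS with ⟨a, b, c, d, D, hD, rfl⟩ | ⟨h, h0⟩
    · exact isSimpleApproximable_rect hν a b c d hD
    · refine isSimpleApproximable_zero.congr ?_
      filter_upwards [hν] with z hz
      rw [Set.indicator_of_notMem]
      intro hz'
      exact absurd (h0 z hz') hz.1.1.ne'
  | compl S hS ih =>
    have h1 := ((isSimpleApproximable_rect (ℱ := ℱ) hν 0 T (-R) R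
      (MeasurableSet.univ)).linear_comb ih (measurable_one.indicator
      (MeasurableSet.univ.prod (measurableSet_Ioc.prod measurableSet_Ico))) 1 (-1))
    refine h1.congr ?_
    filter_upwards [hν] with z hz
    rw [Set.indicator_of_mem (show z ∈ (Set.univ : Set Ω) ×ˢ (Set.Ioc 0 T ×ˢ Set.Ico (-R) R) from
      ⟨trivial, hz.1, hz.2⟩)]
    by_cases h : z ∈ S
    · simp [h]
    · simp [h]
  | iUnion f hd hf ih =>
    have hmf : ∀ n, MeasurableSet (f n) := fun n => predSigma_le _ (hf n)
    have h2 : ∀ n : ℕ, IsSimpleApproximable ℱ T R ν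
        (fun z => ∑ i ∈ Finset.range n, (f i).indicator (1 : Ω × ℝ≥0 × ℝ → ℝ) z) := by
      intro n
      induction n with
      | zero => simpa using isSimpleApproximable_zero
      | succ n ihn =>
        have := (ih n).linear_comb ihn (measurable_one.indicator (hmf n)) 1 1
        refine this.congr (.of_forall fun z => ?_)
        simp only [Finset.sum_range_succ]; ring
    have hm : ∀ n : ℕ, Measurable
        (fun z => ∑ i ∈ Finset.range n, (f i).indicator (1 : Ω × ℝ≥0 × ℝ → ℝ) z) := fun n =>
      Finset.measurable_fun_sum _ fun i _ => measurable_one.indicator (hmf i)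
    have hU : Measurable ((⋃ i, f i).indicator (1 : Ω × ℝ≥0 × ℝ → ℝ)) :=
      measurable_one.indicator (MeasurableSet.iUnion hmf)
    have hval : ∀ n z, ∑ i ∈ Finset.range n, (f i).indicator (1 : Ω × ℝ≥0 × ℝ → ℝ) z
        = (⋃ i ∈ Finset.range n, f i).indicator 1 z := by
      intro n z
      rw [Finset.indicator_biUnion]
      exact fun i _ j _ hij => hd hij
    refine .of_tendsto h2 hm hU ?_
    have := tendsto_lintegral_of_dominated_convergence (μ := ν)
      (F := fun n z => ‖(⋃ i, f i).indicator (1 : Ω × ℝ≥0 × ℝ → ℝ) z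
        - ∑ i ∈ Finset.range n, (f i).indicator (1 : Ω × ℝ≥0 × ℝ → ℝ) z‖ₑ) (f := fun _ => 0)
      (fun _ => 2) (fun n => (hU.sub (hm n)).enorm) (fun n => .of_forall fun z => ?_) (by
        simp [lintegral_const, ENNReal.mul_eq_top]) (.of_forall fun z => ?_)
    · simpa using this
    · have h1 : ∀ S : Set (Ω × ℝ≥0 × ℝ), ‖S.indicator (1 : Ω × ℝ≥0 × ℝ → ℝ) z‖ₑ ≤ 1 := fun S =>
        (enorm_indicator_le_enorm_self _ _).trans (by simp)
      refine (enorm_sub_le).trans ?_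
      rw [hval, show (2 : ℝ≥0∞) = 1 + 1 by norm_num]
      exact add_le_add (h1 _) (h1 _)
    · by_cases hz : ∃ i, z ∈ f i
      · obtain ⟨i, hi⟩ := hz
        refine tendsto_const_nhds.congr' ?_
        filter_upwards [eventually_gt_atTop i] with n hn
        rw [hval, Set.indicator_of_mem (Set.mem_iUnion.2 ⟨i, hi⟩),
          Set.indicator_of_mem (by
            simp only [Set.mem_iUnion]; exact ⟨i, Finset.mem_range.2 hn, hi⟩)]
        simp
      · push Not at hz
        simp [hz]

/-- Simple functions are dense, in `L¹`, in the bounded predictable functions. -/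
theorem isSimpleApproximable_of_bounded [IsFiniteMeasure ν]
    (hν : ∀ᵐ z ∂ν, z.2.1 ∈ Set.Ioc 0 T ∧ z.2.2 ∈ Set.Ico (-R) R) {f : Ω × ℝ≥0 × ℝ → ℝ}
    (hf : Measurable[predSigma ℱ] f) {C : ℝ} (hC : ∀ z, |f z| ≤ C) :
    IsSimpleApproximable ℱ T R ν f := by
  have hsf : ∀ g : @SimpleFunc _ (predSigma ℱ) ℝ, IsSimpleApproximable ℱ T R ν g := by
    intro g
    induction g using SimpleFunc.induction with
    | const c hs =>
      rename_i s
      have := (isSimpleApproximable_indicator hν hs).linear_comb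
        (isSimpleApproximable_zero (ℱ := ℱ) (T := T) (R := R) (ν := ν))
        (measurable_one.indicator (predSigma_le _ hs)) c 0
      refine this.congr (.of_forall fun z => ?_)
      by_cases hz : z ∈ s <;> simp [SimpleFunc.const, SimpleFunc.piecewise, Set.piecewise, hz]
    | add hd hf hg =>
      rename_i f g
      have := hf.linear_comb hg ((@SimpleFunc.measurable _ _ (predSigma ℱ) _ f).mono
        predSigma_le le_rfl) 1 1
      exact this.congr (.of_forall fun z => by simp)
  have hsm : StronglyMeasurable[predSigma ℱ] f := hf.stronglyMeasurable
  have hC' : ∀ z, ‖f z‖ ≤ max C 0 := fun z => (hC z).trans (le_max_left _ _)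
  have hm : ∀ n, Measurable (hsm.approxBounded (max C 0) n : Ω × ℝ≥0 × ℝ → ℝ) := fun n =>
    (@SimpleFunc.measurable _ _ (predSigma ℱ) _ _).mono predSigma_le le_rfl
  have hfm : Measurable f := hf.mono predSigma_le le_rfl
  refine .of_tendsto (F := fun n => hsm.approxBounded (max C 0) n) (fun n => hsf _) hm hfm ?_
  have := tendsto_lintegral_of_dominated_convergence (μ := ν)
    (F := fun n z => ‖f z - hsm.approxBounded (max C 0) n z‖ₑ) (f := fun _ => 0)
    (fun _ => ENNReal.ofReal (max C 0) + ENNReal.ofReal (max C 0))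
    (fun n => (hfm.sub (hm n)).enorm) (fun n => .of_forall fun z => ?_) (by
      simp [lintegral_const, ENNReal.mul_eq_top]) (.of_forall fun z => ?_)
  · simpa using this
  · refine (enorm_sub_le).trans (add_le_add ?_ ?_)
    · rw [← ofReal_norm]
      exact ENNReal.ofReal_le_ofReal (hC' z)
    · rw [← ofReal_norm]
      exact ENNReal.ofReal_le_ofReal (hsm.norm_approxBounded_le (le_max_right _ _) n z)
  · have h1 := hsm.tendsto_approxBounded_of_norm_le (hC' z)
    have h2 := (tendsto_const_nhds.sub h1 : Tendsto (fun n => f z - _) atTop (𝓝 (f z - f z))).enorm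
    simpa using h2

end

/-! ### Rational boxes -/

/-- Boxes with rational corners. -/
def ratBox (p : (ℚ≥0 × ℚ≥0) × (ℚ × ℚ) × (ℚ × ℚ)) : Set (ℝ≥0 × ℝ × ℝ) :=
  Set.Ico (p.1.1 : ℝ≥0) p.1.2 ×ˢ Set.Ico (p.2.1.1 : ℝ) p.2.1.2 ×ˢ Set.Ico (p.2.2.1 : ℝ) p.2.2.2

theorem measurableSet_ratBox (p : (ℚ≥0 × ℚ≥0) × (ℚ × ℚ) × (ℚ × ℚ)) : MeasurableSet (ratBox p) :=
  measurableSet_Ico.prod (measurableSet_Ico.prod measurableSet_Ico)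

theorem ratBox_inter (p q : (ℚ≥0 × ℚ≥0) × (ℚ × ℚ) × (ℚ × ℚ)) : ratBox p ∩ ratBox q =
    ratBox ((max p.1.1 q.1.1, min p.1.2 q.1.2), (max p.2.1.1 q.2.1.1, min p.2.1.2 q.2.1.2),
      (max p.2.2.1 q.2.2.1, min p.2.2.2 q.2.2.2)) := by
  simp only [ratBox, Set.prod_inter_prod, Set.Ico_inter_Ico]
  push_cast [NNRat.cast_max, NNRat.cast_min, Rat.cast_max, Rat.cast_min]
  rfl

theorem isPiSystem_ratBox : IsPiSystem (Set.range ratBox) := by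
  rintro _ ⟨p, rfl⟩ _ ⟨q, rfl⟩ -
  exact ⟨_, (ratBox_inter p q).symm⟩

theorem exists_nat_bound (s : ℝ≥0) (x y : ℝ) : ∃ n : ℕ, s < n ∧ |x| < n ∧ |y| < n := by
  obtain ⟨a, ha⟩ := exists_nat_gt s
  obtain ⟨b, hb⟩ := exists_nat_gt |x|
  obtain ⟨c, hc⟩ := exists_nat_gt |y|
  refine ⟨max a (max b c), ha.trans_le ?_, hb.trans_le ?_, hc.trans_le ?_⟩ <;> norm_cast <;> omega

theorem mem_ratBox_nat {n : ℕ} {s : ℝ≥0} {x y : ℝ} (h : s < n ∧ |x| < n ∧ |y| < n) :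
    (s, x, y) ∈ ratBox ((0, n), (-n, n), (-n, n)) := by
  have h1 := abs_lt.1 h.2.1
  have h2 := abs_lt.1 h.2.2
  simp only [ratBox, Set.mem_prod, Set.mem_Ico]
  push_cast
  exact ⟨⟨zero_le, h.1⟩, ⟨h1.1.le, h1.2⟩, h2.1.le, h2.2⟩

theorem iUnion_ratBox_nat : ⋃ n : ℕ, ratBox ((0, n), (-n, n), (-n, n)) = Set.univ := by
  refine Set.eq_univ_of_forall fun ⟨s, x, y⟩ => ?_
  obtain ⟨n, h⟩ := exists_nat_bound s x y
  exact Set.mem_iUnion.2 ⟨n, mem_ratBox_nat h⟩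

theorem generateFrom_ratBox :
    (inferInstance : MeasurableSpace (ℝ≥0 × ℝ × ℝ)) = .generateFrom (Set.range ratBox) := by
  refine le_antisymm ?_ (MeasurableSpace.generateFrom_le ?_)
  swap
  · rintro _ ⟨p, rfl⟩; exact measurableSet_ratBox p
  have key : ∀ (S : Set (ℝ≥0 × ℝ × ℝ)) (I : Set ((ℚ≥0 × ℚ≥0) × (ℚ × ℚ) × (ℚ × ℚ))),
      (∀ p ∈ I, ratBox p ⊆ S) → (∀ z ∈ S, ∃ p ∈ I, z ∈ ratBox p) →
      MeasurableSet[.generateFrom (Set.range ratBox)] S := by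
    intro S I h1 h2
    have : S = ⋃ p ∈ I, ratBox p := by
      refine Set.Subset.antisymm (fun z hz => ?_) (Set.iUnion₂_subset h1)
      obtain ⟨p, hp, hz⟩ := h2 z hz
      exact Set.mem_biUnion hp hz
    rw [this]
    exact MeasurableSet.biUnion (Set.to_countable I) fun p _ =>
      MeasurableSpace.measurableSet_generateFrom ⟨p, rfl⟩
  have m1 : Measurable[.generateFrom (Set.range ratBox)] (fun z : ℝ≥0 × ℝ × ℝ => z.1) := by
    refine @measurable_of_Iio _ _ _ _ _ (.generateFrom (Set.range ratBox)) _ _ _ _ fun a => ?_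
    refine key _ {p | (p.1.2 : ℝ≥0) ≤ a} (fun p hp z hz => hz.1.2.trans_le hp) fun ⟨s, x, y⟩ hz => ?_
    obtain ⟨n, h⟩ := exists_nat_bound s x y
    obtain ⟨q, hq1, hq2⟩ : ∃ q : ℚ≥0, s < q ∧ (q : ℝ≥0) < a := by
      obtain ⟨q, h1, h2⟩ := exists_rat_btwn (NNReal.coe_lt_coe.2 (show s < a from hz))
      have h0 : (0 : ℚ) ≤ q := by exact_mod_cast s.2.trans h1.le
      lift q to ℚ≥0 using h0
      exact ⟨q, by rw [← NNReal.coe_lt_coe]; exact_mod_cast h1,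
        by rw [← NNReal.coe_lt_coe]; exact_mod_cast h2⟩
    have := mem_ratBox_nat h
    exact ⟨((0, q), (-n, n), (-n, n)), hq2.le, ⟨this.1.1, hq1⟩, this.2⟩
  have m2 : Measurable[.generateFrom (Set.range ratBox)] (fun z : ℝ≥0 × ℝ × ℝ => z.2.1) := by
    refine @measurable_of_Iio _ _ _ _ _ (.generateFrom (Set.range ratBox)) _ _ _ _ fun a => ?_
    refine key _ {p | (p.2.1.2 : ℝ) ≤ a} (fun p hp z hz => hz.2.1.2.trans_le hp)
      fun ⟨s, x, y⟩ hz => ?_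
    obtain ⟨n, h⟩ := exists_nat_bound s x y
    obtain ⟨q, hq1, hq2⟩ := exists_rat_btwn (show x < a from hz)
    have := mem_ratBox_nat h
    exact ⟨((0, n), (-n, q), (-n, n)), hq2.le, this.1, ⟨this.2.1.1, hq1⟩, this.2.2⟩
  have m3 : Measurable[.generateFrom (Set.range ratBox)] (fun z : ℝ≥0 × ℝ × ℝ => z.2.2) := by
    refine @measurable_of_Iio _ _ _ _ _ (.generateFrom (Set.range ratBox)) _ _ _ _ fun a => ?_
    refine key _ {p | (p.2.2.2 : ℝ) ≤ a} (fun p hp z hz => hz.2.2.2.trans_le hp)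
      fun ⟨s, x, y⟩ hz => ?_
    obtain ⟨n, h⟩ := exists_nat_bound s x y
    obtain ⟨q, hq1, hq2⟩ := exists_rat_btwn (show y < a from hz)
    have := mem_ratBox_nat h
    exact ⟨((0, n), (-n, n), (-n, q)), hq2.le, this.1, this.2.1, this.2.2.1, hq1⟩
  exact (measurable_iff_le_map.1 (m1.prodMk (m2.prodMk m3)))

/-! ### The measures of a good path -/

/-- The Lebesgue-Stieltjes measure on `[0, T] × ℝ × ℝ`. -/
abbrev pathPair (T : ℝ≥0) (F : ℝ≥0 → ℝ → ℝ → ℝ) :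
    Measure (ℝ≥0 × ℝ × ℝ) × Measure (ℝ≥0 × ℝ × ℝ) :=
  stieltjesPair fun s x y => F (min s T) x y

theorem measure_lt_top_of_bounded (μ : Measure (ℝ≥0 × ℝ × ℝ)) [IsLocallyFiniteMeasure μ] {t : ℝ≥0}
    {R : ℝ} {S : Set (ℝ≥0 × ℝ × ℝ)} (hS : ∀ z ∈ S, z.1 ≤ t ∧ |z.2.1| ≤ R ∧ |z.2.2| ≤ R) :
    μ S < ∞ := by
  have hsub : S ⊆ Set.Icc 0 t ×ˢ Set.Icc (-R) R ×ˢ Set.Icc (-R) R := fun z hz =>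
    ⟨⟨zero_le, (hS z hz).1⟩, abs_le.1 (hS z hz).2.1, abs_le.1 (hS z hz).2.2⟩
  exact (measure_mono hsub).trans_lt
    (isCompact_Icc.prod (isCompact_Icc.prod isCompact_Icc)).measure_lt_top

theorem measure_box_lt_top (μ : Measure (ℝ≥0 × ℝ × ℝ)) [IsLocallyFiniteMeasure μ] (a b : ℝ≥0)
    (c d e f : ℝ) : μ (Set.Icc a b ×ˢ Set.Icc c d ×ˢ Set.Icc e f) < ∞ :=
  (isCompact_Icc.prod (isCompact_Icc.prod isCompact_Icc)).measure_lt_top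

section Path

variable {T : ℝ≥0} {F : ℝ≥0 → ℝ → ℝ → ℝ}

theorem IsGoodPath.isStieltjesPair (hF : IsGoodPath T F) :
    IsStieltjesPair (fun s x y => F (min s T) x y) (pathPair T F) :=
  isStieltjesPair_stieltjesPair hF.leftCont hF.locBV

theorem IsGoodPath.continuous (hF : IsGoodPath T F) (q r : ℚ) :
    Continuous fun s => F (min s T) q r := by
  have := (hF.cont q r).comp_continuous (f := fun s => min s T) (by fun_prop)
    fun s => min_le_right s T
  exact this

/-- The increment over `[s, s + 1/(n+1))` tends to zero because the path is continuous in time at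
rational space points; hence the signed mass of the slice at time `s` vanishes. -/
theorem IsGoodPath.measure_singleton_eq (hF : IsGoodPath T F) (s : ℝ≥0) (q q' r r' : ℚ) :
    (pathPair T F).1 ({s} ×ˢ Set.Ico (q : ℝ) q' ×ˢ Set.Ico (r : ℝ) r')
      = (pathPair T F).2 ({s} ×ˢ Set.Ico (q : ℝ) q' ×ˢ Set.Ico (r : ℝ) r') := by
  have hμ := hF.isStieltjesPair
  have i1 := hμ.locFinite_pos
  have i2 := hμ.locFinite_neg
  by_cases hq : (q : ℝ) ≤ q'
  swap
  · rw [Set.Ico_eq_empty (fun h => hq h.le)]; simp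
  by_cases hr : (r : ℝ) ≤ r'
  swap
  · rw [Set.Ico_eq_empty (a := (r : ℝ)) (fun h => hr h.le)]; simp
  set Q := Set.Ico (q : ℝ) q' ×ˢ Set.Ico (r : ℝ) r' with hQ
  have hQm : MeasurableSet Q := measurableSet_Ico.prod measurableSet_Ico
  have hu : Tendsto (fun n : ℕ => s + ((n : ℝ≥0) + 1)⁻¹) atTop (𝓝 s) := by
    have : Tendsto (fun n : ℕ => ((n : ℝ≥0) + 1)⁻¹) atTop (𝓝 0) := by
      have := tendsto_one_div_add_atTop_nhds_zero_nat (𝕜 := ℝ)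
      rw [← NNReal.tendsto_coe]
      refine this.congr fun n => ?_
      push_cast; rw [one_div]
    simpa using tendsto_const_nhds.add this
  have hfin : ∀ (μ : Measure (ℝ≥0 × ℝ × ℝ)) [IsLocallyFiniteMeasure μ] (b : ℝ≥0),
      μ (Set.Icc s b ×ˢ Q) < ∞ := fun μ _ b =>
    (measure_mono (Set.prod_mono subset_rfl (Set.prod_mono Set.Ico_subset_Icc_self
      Set.Ico_subset_Icc_self))).trans_lt (measure_box_lt_top μ s b q q' r r')
  have hlim : ∀ (μ : Measure (ℝ≥0 × ℝ × ℝ)) [IsLocallyFiniteMeasure μ],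
      Tendsto (fun n : ℕ => μ.real (Set.Ico s (s + ((n : ℝ≥0) + 1)⁻¹) ×ˢ Q)) atTop
        (𝓝 (μ.real ({s} ×ˢ Q))) := by
    intro μ _
    refine (ENNReal.tendsto_toReal ?_).comp ?_
    · exact ((measure_mono (Set.prod_mono (by simp) subset_rfl)).trans_lt (hfin μ s)).ne
    have heq : {s} ×ˢ Q = ⋂ n : ℕ, Set.Ico s (s + ((n : ℝ≥0) + 1)⁻¹) ×ˢ Q := by
      ext ⟨r, z⟩
      simp only [Set.mem_prod, Set.mem_singleton_iff, Set.mem_iInter, Set.mem_Ico]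
      constructor
      · rintro ⟨rfl, hz⟩ n
        exact ⟨⟨le_rfl, by simp⟩, hz⟩
      · intro h
        refine ⟨le_antisymm (ge_of_tendsto' hu fun n => (h n).1.2.le) (h 0).1.1, (h 0).2⟩
    rw [heq]
    refine tendsto_measure_iInter_atTop (fun n => (measurableSet_Ico.prod hQm).nullMeasurableSet)
      (fun m n hmn => Set.prod_mono (Set.Ico_subset_Ico_right ?_) subset_rfl)
      ⟨0, ((measure_mono (Set.prod_mono Set.Ico_subset_Icc_self subset_rfl)).trans_lt (hfin μ _)).ne⟩
    gcongr
  have h1 := (hlim (pathPair T F).1).sub (hlim (pathPair T F).2)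
  have h2 : Tendsto (fun n : ℕ => boxInc (fun s x y => F (min s T) x y) s
      (s + ((n : ℝ≥0) + 1)⁻¹) q q' r r') atTop (𝓝 0) := by
    have h3 : ∀ a b : ℚ, Tendsto (fun n : ℕ => F (min (s + ((n : ℝ≥0) + 1)⁻¹) T) a b) atTop
        (𝓝 (F (min s T) a b)) := fun a b => ((hF.continuous a b).tendsto s).comp hu
    unfold boxInc
    have := ((((h3 q' r').sub (h3 q r')).sub (h3 q' r)).add (h3 q r)).sub_const
      (F (min s T) q' r' - F (min s T) q r' - F (min s T) q' r + F (min s T) q r)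
    simpa using this
  have h4 := tendsto_nhds_unique (h1.congr fun n => hμ.box _ _ _ _ _ _ (by simp) hq hr) h2
  have := sub_eq_zero.1 h4
  refine (ENNReal.toReal_eq_toReal_iff' ?_ ?_).1 this <;>
  exact ((measure_mono (Set.prod_mono (by simp) subset_rfl)).trans_lt (hfin _ s)).ne

/-- By the previous lemma the two parts agree on rational boxes inside the slice, hence coincide on
it. Since they are mutually singular, both must vanish there. -/
theorem IsGoodPath.measure_singleton (hF : IsGoodPath T F) (s : ℝ≥0) :
    (pathPair T F).1 ({s} ×ˢ Set.univ) = 0 ∧ (pathPair T F).2 ({s} ×ˢ Set.univ) = 0 := by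
  have hμ := hF.isStieltjesPair
  have i1 := hμ.locFinite_pos
  have hm : MeasurableSet ({s} ×ˢ Set.univ : Set (ℝ≥0 × ℝ × ℝ)) :=
    (measurableSet_singleton s).prod .univ
  have heq : (pathPair T F).1.restrict ({s} ×ˢ Set.univ)
      = (pathPair T F).2.restrict ({s} ×ˢ Set.univ) := by
    refine Measure.ext_of_generateFrom_of_iUnion (Set.range ratBox) _ generateFrom_ratBox
      isPiSystem_ratBox iUnion_ratBox_nat (fun i => ⟨_, rfl⟩) (fun i => ?_) ?_
    · rw [Measure.restrict_apply (measurableSet_ratBox _)]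
      refine ((measure_mono Set.inter_subset_left).trans_lt (measure_lt_top_of_bounded
        (t := i) (R := i) _ fun z hz => ?_)).ne
      have h1 := hz.1.2.le
      have h2 := hz.2.1
      have h3 := hz.2.2
      push_cast at h1 h2 h3
      exact ⟨h1, abs_le.2 ⟨h2.1, h2.2.le⟩, abs_le.2 ⟨h3.1, h3.2.le⟩⟩
    · rintro _ ⟨p, rfl⟩
      rw [Measure.restrict_apply (measurableSet_ratBox _),
        Measure.restrict_apply (measurableSet_ratBox _)]
      by_cases h : s ∈ Set.Ico (p.1.1 : ℝ≥0) p.1.2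
      · have : ratBox p ∩ {s} ×ˢ Set.univ = {s} ×ˢ Set.Ico (p.2.1.1 : ℝ) p.2.1.2 ×ˢ
            Set.Ico (p.2.2.1 : ℝ) p.2.2.2 := by
          rw [ratBox, Set.prod_inter_prod, Set.inter_univ, Set.inter_eq_right.2 (by simpa using h)]
        rw [this]
        exact hF.measure_singleton_eq _ _ _ _ _
      · have : ratBox p ∩ {s} ×ˢ Set.univ = ∅ := by
          rw [ratBox, Set.prod_inter_prod, Set.inter_singleton_eq_empty.2 h, Set.empty_prod]
        simp [this]
  have h0 : (pathPair T F).1.restrict ({s} ×ˢ Set.univ) = 0 := by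
    rw [← Measure.MutuallySingular.self_iff]
    nth_rw 2 [heq]
    exact (hμ.singular.restrict _).symm.restrict _ |>.symm
  have h0' := heq ▸ h0
  exact ⟨Measure.restrict_eq_zero.1 h0, Measure.restrict_eq_zero.1 h0'⟩

/-- Stieltjes measures are prescribed on `[a, b)` in time, simple functions live on `(a, b]`. As no
fixed time carries mass, the two agree. -/
theorem IsGoodPath.real_Ioc_box (hF : IsGoodPath T F) {a b : ℝ≥0} {c d e f : ℝ} (hab : a ≤ b)
    (hcd : c ≤ d) (hef : e ≤ f) :
    (pathPair T F).1.real (Set.Ioc a b ×ˢ Set.Ico c d ×ˢ Set.Ico e f)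
      - (pathPair T F).2.real (Set.Ioc a b ×ˢ Set.Ico c d ×ˢ Set.Ico e f)
      = boxInc (fun s x y => F (min s T) x y) a b c d e f := by
  rw [← hF.isStieltjesPair.box _ _ _ _ _ _ hab hcd hef]
  have key : ∀ μ : Measure (ℝ≥0 × ℝ × ℝ), (∀ s : ℝ≥0, μ ({s} ×ˢ Set.univ) = 0) →
      μ.real (Set.Ioc a b ×ˢ Set.Ico c d ×ˢ Set.Ico e f)
      = μ.real (Set.Ico a b ×ˢ Set.Ico c d ×ˢ Set.Ico e f) := by
    intro μ hμ
    refine measureReal_congr ?_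
    have h1 := measure_eq_zero_iff_ae_notMem.1 (hμ a)
    have h2 := measure_eq_zero_iff_ae_notMem.1 (hμ b)
    filter_upwards [h1, h2] with z hz1 hz2
    simp only [Set.mem_prod, Set.mem_singleton_iff, Set.mem_univ, and_true] at hz1 hz2
    refine propext ?_
    change z ∈ Set.Ioc a b ×ˢ Set.Ico c d ×ˢ Set.Ico e f ↔
      z ∈ Set.Ico a b ×ˢ Set.Ico c d ×ˢ Set.Ico e f
    simp only [Set.mem_prod, Set.mem_Ioc, Set.mem_Ico]
    have e1 : a < z.1 ↔ a ≤ z.1 := ⟨le_of_lt, fun h => lt_of_le_of_ne h (Ne.symm hz1)⟩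
    have e2 : z.1 ≤ b ↔ z.1 < b := ⟨fun h => lt_of_le_of_ne h hz2, le_of_lt⟩
    rw [e1, e2]
  rw [key _ fun s => (hF.measure_singleton s).1, key _ fun s => (hF.measure_singleton s).2]

end Path

/-! ### Quadratic forms given by signed measures -/

section Form

/-- The tensor product `u(s, x) v(s, y)`. -/
def tens (u v : ℝ≥0 × ℝ → ℝ) (z : ℝ≥0 × ℝ × ℝ) : ℝ := u (z.1, z.2.1) * v (z.1, z.2.2)

/-- The integral with respect to the difference of two measures. -/
def sInt (ρ : Measure (ℝ≥0 × ℝ × ℝ) × Measure (ℝ≥0 × ℝ × ℝ)) (f : ℝ≥0 × ℝ × ℝ → ℝ) : ℝ :=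
  ∫ z, f z ∂ρ.1 - ∫ z, f z ∂ρ.2

/-- The form `u ↦ ∫ u(s, x) u(s, y) dρ`, where `ρ` is the difference of two measures. -/
def qf (ρ : Measure (ℝ≥0 × ℝ × ℝ) × Measure (ℝ≥0 × ℝ × ℝ)) (u : ℝ≥0 × ℝ → ℝ) : ℝ :=
  sInt ρ (tens u u)

variable {ρ : Measure (ℝ≥0 × ℝ × ℝ) × Measure (ℝ≥0 × ℝ × ℝ)} {u v : ℝ≥0 × ℝ → ℝ}

theorem measurable_tens (hu : Measurable u) (hv : Measurable v) : Measurable (tens u v) :=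
  (hu.comp (measurable_fst.prodMk measurable_snd.fst)).mul
    (hv.comp (measurable_fst.prodMk measurable_snd.snd))

theorem sInt_add {f g : ℝ≥0 × ℝ × ℝ → ℝ} (hf : Integrable f (ρ.1 + ρ.2))
    (hg : Integrable g (ρ.1 + ρ.2)) : sInt ρ (fun z => f z + g z) = sInt ρ f + sInt ρ g := by
  obtain ⟨hf1, hf2⟩ := integrable_add_measure.1 hf
  obtain ⟨hg1, hg2⟩ := integrable_add_measure.1 hg
  simp only [sInt]
  rw [integral_add hf1 hg1, integral_add hf2 hg2]; ring

theorem sInt_const_mul (c : ℝ) (f : ℝ≥0 × ℝ × ℝ → ℝ) :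
    sInt ρ (fun z => c * f z) = c * sInt ρ f := by
  simp only [sInt, integral_const_mul]; ring

theorem sInt_sub {f g : ℝ≥0 × ℝ × ℝ → ℝ} (hf : Integrable f (ρ.1 + ρ.2))
    (hg : Integrable g (ρ.1 + ρ.2)) : sInt ρ (fun z => f z - g z) = sInt ρ f - sInt ρ g := by
  obtain ⟨hf1, hf2⟩ := integrable_add_measure.1 hf
  obtain ⟨hg1, hg2⟩ := integrable_add_measure.1 hg
  simp only [sInt]
  rw [integral_sub hf1 hg1, integral_sub hf2 hg2]; ring

theorem sInt_finset_sum {ι : Type*} (s : Finset ι) {f : ι → ℝ≥0 × ℝ × ℝ → ℝ}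
    (hf : ∀ i ∈ s, Integrable (f i) (ρ.1 + ρ.2)) :
    sInt ρ (fun z => ∑ i ∈ s, f i z) = ∑ i ∈ s, sInt ρ (f i) := by
  simp only [sInt]
  rw [integral_finsetSum s fun i hi => (integrable_add_measure.1 (hf i hi)).1,
    integral_finsetSum s fun i hi => (integrable_add_measure.1 (hf i hi)).2,
    Finset.sum_sub_distrib]

theorem abs_sInt_le {f : ℝ≥0 × ℝ × ℝ → ℝ} :
    ENNReal.ofReal |sInt ρ f| ≤ ∫⁻ z, ‖f z‖ₑ ∂(ρ.1 + ρ.2) := by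
  rw [← Real.norm_eq_abs, ofReal_norm, lintegral_add_measure]
  refine enorm_sub_le.trans (add_le_add ?_ ?_) <;> exact enorm_integral_le_lintegral_enorm _

theorem sInt_tendsto {f : ℝ≥0 × ℝ × ℝ → ℝ} (hf : Integrable f (ρ.1 + ρ.2))
    {g : ℕ → ℝ≥0 × ℝ × ℝ → ℝ} (hg : ∀ n, Measurable (g n)) (hle : ∀ n z, |g n z| ≤ |f z|)
    (hlim : ∀ z, Tendsto (fun n => g n z) atTop (𝓝 (f z))) :
    Tendsto (fun n => sInt ρ (g n)) atTop (𝓝 (sInt ρ f)) := by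
  obtain ⟨hf1, hf2⟩ := integrable_add_measure.1 hf
  refine Tendsto.sub ?_ ?_
  · exact tendsto_integral_of_dominated_convergence (fun z => |f z|)
      (fun n => (hg n).aestronglyMeasurable) hf1.abs (fun n => .of_forall fun z => hle n z)
      (.of_forall hlim)
  · exact tendsto_integral_of_dominated_convergence (fun z => |f z|)
      (fun n => (hg n).aestronglyMeasurable) hf2.abs (fun n => .of_forall fun z => hle n z)
      (.of_forall hlim)

/-- Bounded measurable functions whose support is bounded in space. -/
structure IsBddSupp (u : ℝ≥0 × ℝ → ℝ) : Prop where
  meas : Measurable u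
  bdd : ∃ C, ∀ p, |u p| ≤ C
  supp : ∃ R, ∀ p, R < |p.2| → u p = 0

theorem IsBddSupp.add (hu : IsBddSupp u) (hv : IsBddSupp v) : IsBddSupp fun p => u p + v p := by
  obtain ⟨C, hC⟩ := hu.bdd
  obtain ⟨R, hR⟩ := hu.supp
  obtain ⟨C', hC'⟩ := hv.bdd
  obtain ⟨R', hR'⟩ := hv.supp
  refine ⟨hu.meas.add hv.meas, ⟨C + C', fun p => (abs_add_le _ _).trans (add_le_add (hC p) (hC' p))⟩,
    ⟨max R R', fun p hp => ?_⟩⟩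
  rw [hR p ((le_max_left _ _).trans_lt hp), hR' p ((le_max_right _ _).trans_lt hp), add_zero]

theorem IsBddSupp.const_mul (hu : IsBddSupp u) (c : ℝ) : IsBddSupp fun p => c * u p := by
  obtain ⟨C, hC⟩ := hu.bdd
  obtain ⟨R, hR⟩ := hu.supp
  refine ⟨hu.meas.const_mul c, ⟨|c| * C, fun p => ?_⟩, ⟨R, fun p hp => by rw [hR p hp, mul_zero]⟩⟩
  rw [abs_mul]
  gcongr
  exact hC p

theorem isBddSupp_zero : IsBddSupp fun _ => 0 :=
  ⟨measurable_const, ⟨0, by simp⟩, ⟨0, by simp⟩⟩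

theorem IsBddSupp.sum {ι : Type*} (s : Finset ι) {v : ι → ℝ≥0 × ℝ → ℝ}
    (hv : ∀ i ∈ s, IsBddSupp (v i)) : IsBddSupp fun p => ∑ i ∈ s, v i p := by
  classical
  induction s using Finset.induction_on with
  | empty => simpa using isBddSupp_zero
  | insert i s hi ih =>
    simp only [Finset.sum_insert hi]
    exact (hv i (Finset.mem_insert_self _ _)).add
      (ih fun j hj => hv j (Finset.mem_insert_of_mem hj))

/-- A difference of two measures, finite on bounded sets in space, whose quadratic form is
nonnegative. -/
structure IsPSDPair (ρ : Measure (ℝ≥0 × ℝ × ℝ) × Measure (ℝ≥0 × ℝ × ℝ)) : Prop where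
  fin : ∀ R : ℝ, (ρ.1 + ρ.2) (Set.univ ×ˢ Set.Icc (-R) R ×ˢ Set.Icc (-R) R) < ∞
  nonneg : ∀ u, IsBddSupp u → 0 ≤ qf ρ u

theorem integrable_tens_of_bdd
    (hfin : ∀ R : ℝ, (ρ.1 + ρ.2) (Set.univ ×ˢ Set.Icc (-R) R ×ˢ Set.Icc (-R) R) < ∞)
    (hu : IsBddSupp u) (hv : IsBddSupp v) :
    Integrable (tens u v) (ρ.1 + ρ.2) := by
  obtain ⟨C, hC⟩ := hu.bdd
  obtain ⟨R, hR⟩ := hu.supp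
  obtain ⟨C', hC'⟩ := hv.bdd
  obtain ⟨R', hR'⟩ := hv.supp
  have hS : MeasurableSet (Set.univ ×ˢ Set.Icc (-max R R') (max R R')
      ×ˢ Set.Icc (-max R R') (max R R') : Set (ℝ≥0 × ℝ × ℝ)) :=
    MeasurableSet.univ.prod (measurableSet_Icc.prod measurableSet_Icc)
  refine Integrable.mono' (g := Set.indicator (Set.univ ×ˢ Set.Icc (-max R R') (max R R')
    ×ˢ Set.Icc (-max R R') (max R R')) fun _ => C * C') ?_
    (measurable_tens hu.meas hv.meas).aestronglyMeasurable (.of_forall fun z => ?_)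
  · rw [integrable_indicator_iff hS]
    exact integrableOn_const (hfin _).ne
  · by_cases hz : z ∈ (Set.univ ×ˢ Set.Icc (-max R R') (max R R')
      ×ˢ Set.Icc (-max R R') (max R R') : Set (ℝ≥0 × ℝ × ℝ))
    · rw [Set.indicator_of_mem hz, tens, norm_mul]
      exact mul_le_mul (hC _) (hC' _) (norm_nonneg _) ((abs_nonneg _).trans (hC (0, 0)))
    · rw [Set.indicator_of_notMem hz]
      have : tens u v z = 0 := by
        by_contra hne
        obtain ⟨h1, h2⟩ := mul_ne_zero_iff.1 hne
        have h3 : |z.2.1| ≤ R := not_lt.1 fun h => h1 (hR _ h)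
        have h4 : |z.2.2| ≤ R' := not_lt.1 fun h => h2 (hR' _ h)
        exact hz ⟨trivial, abs_le.1 (h3.trans (le_max_left _ _)),
          abs_le.1 (h4.trans (le_max_right _ _))⟩
      simp [this]

theorem qf_linear_comb (hρ : IsPSDPair ρ) (hu : IsBddSupp u) (hv : IsBddSupp v) (c : ℝ) :
    qf ρ (fun p => u p + c * v p)
      = qf ρ u + c * (sInt ρ (tens u v) + sInt ρ (tens v u)) + c ^ 2 * qf ρ v := by
  have huu := integrable_tens_of_bdd hρ.fin hu hu
  have huv := integrable_tens_of_bdd hρ.fin hu hv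
  have hvu := integrable_tens_of_bdd hρ.fin hv hu
  have hvv := integrable_tens_of_bdd hρ.fin hv hv
  have : tens (fun p => u p + c * v p) (fun p => u p + c * v p)
      = fun z => (tens u u z + c * (tens u v z + tens v u z)) + c ^ 2 * tens v v z := by
    funext z; simp only [tens]; ring
  have h1 : Integrable (fun z => c * (tens u v z + tens v u z)) (ρ.1 + ρ.2) :=
    (huv.add hvu).const_mul c
  have h2 : Integrable (fun z => tens u u z + c * (tens u v z + tens v u z)) (ρ.1 + ρ.2) :=
    huu.add h1
  rw [qf, this, sInt_add h2 (hvv.const_mul _), sInt_add huu h1, sInt_const_mul, sInt_const_mul,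
    sInt_add huv hvu]
  rfl

/-- Cauchy–Schwarz from the discriminant of `c ↦ qf ρ (u + c v)`. The form is not assumed symmetric,
so the mixed term is the sum over both orders. -/
theorem sqrt_qf_add_le (hρ : IsPSDPair ρ) (hu : IsBddSupp u) (hv : IsBddSupp v) :
    √(qf ρ fun p => u p + v p) ≤ √(qf ρ u) + √(qf ρ v) := by
  set b := sInt ρ (tens u v) + sInt ρ (tens v u) with hb
  have h0 : ∀ c : ℝ, 0 ≤ qf ρ v * (c * c) + b * c + qf ρ u := fun c => by
    have h1 := hρ.nonneg _ (hu.add (hv.const_mul c))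
    rw [qf_linear_comb hρ hu hv c] at h1
    linarith
  have h1 := discrim_le_zero h0
  rw [discrim] at h1
  have h2 := qf_linear_comb hρ hu hv 1
  simp only [one_mul, one_pow] at h2
  rw [h2, ← hb]
  have hqu := hρ.nonneg _ hu
  have hqv := hρ.nonneg _ hv
  have h3 : b ≤ 2 * (√(qf ρ u) * √(qf ρ v)) := by
    refine le_of_sq_le_sq ?_ (by positivity)
    rw [mul_pow, mul_pow, Real.sq_sqrt hqu, Real.sq_sqrt hqv]
    linarith
  refine Real.sqrt_le_iff.2 ⟨by positivity, ?_⟩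
  rw [add_sq, Real.sq_sqrt hqu, Real.sq_sqrt hqv]
  linarith

theorem sqrt_qf_sum_le_of_bdd (hρ : IsPSDPair ρ) {ι : Type*} (s : Finset ι) {v : ι → ℝ≥0 × ℝ → ℝ}
    (hv : ∀ i ∈ s, IsBddSupp (v i)) :
    √(qf ρ fun p => ∑ i ∈ s, v i p) ≤ ∑ i ∈ s, √(qf ρ (v i)) := by
  classical
  induction s using Finset.induction_on with
  | empty => simp [qf, tens, sInt]
  | insert i s hi ih =>
    simp only [Finset.sum_insert hi]
    have h1 := hv i (Finset.mem_insert_self _ _)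
    have h2 := fun j hj => hv j (Finset.mem_insert_of_mem (a := j) (s := s) (b := i) hj)
    exact (sqrt_qf_add_le hρ h1 (IsBddSupp.sum s h2)).trans (by gcongr; exact ih h2)

theorem qf_tendsto_indicator (hu : Measurable u) (hint : Integrable (tens u u) (ρ.1 + ρ.2))
    {B : ℕ → Set (ℝ≥0 × ℝ)} (hBm : ∀ n, MeasurableSet (B n)) (hB : ∀ p, ∀ᶠ n in atTop, p ∈ B n) :
    Tendsto (fun n => qf ρ ((B n).indicator u)) atTop (𝓝 (qf ρ u)) := by
  refine sInt_tendsto hint (fun n => measurable_tens (hu.indicator (hBm n)) (hu.indicator (hBm n)))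
    (fun n z => ?_) fun z => ?_
  · simp only [tens, abs_mul]
    have : ∀ p, |(B n).indicator u p| ≤ |u p| := fun p => norm_indicator_le_norm_self u p
    exact mul_le_mul (this _) (this _) (abs_nonneg _) (abs_nonneg _)
  · refine tendsto_const_nhds.congr' ?_
    filter_upwards [hB (z.1, z.2.1), hB (z.1, z.2.2)] with n h1 h2
    simp only [tens, Set.indicator_of_mem h1, Set.indicator_of_mem h2]

/-- The triangle inequality for the square root of the form; the mixed integrals need not exist. -/
theorem sqrt_qf_sum_le (hρ : IsPSDPair ρ) {ι : Type*} (s : Finset ι) {v : ι → ℝ≥0 × ℝ → ℝ}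
    (hv : ∀ i ∈ s, Measurable (v i)) (hint : ∀ i ∈ s, Integrable (tens (v i) (v i)) (ρ.1 + ρ.2))
    (hsum : Integrable (tens (fun p => ∑ i ∈ s, v i p) fun p => ∑ i ∈ s, v i p) (ρ.1 + ρ.2)) :
    √(qf ρ fun p => ∑ i ∈ s, v i p) ≤ ∑ i ∈ s, √(qf ρ (v i)) := by
  -- On `B n` all summands are bounded with bounded support, so the mixed integrals exist and the
  -- triangle inequality holds. The passage to the limit involves only the diagonal forms, each
  -- dominated by its untruncated version.
  set B : ℕ → Set (ℝ≥0 × ℝ) := fun n => {p | |p.2| ≤ n} ∩ ⋂ i ∈ s, {p | |v i p| ≤ n} with hBdef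
  have hBm : ∀ n, MeasurableSet (B n) := fun n =>
    (measurableSet_le (continuous_abs.measurable.comp measurable_snd) measurable_const).inter
      (Finset.measurableSet_biInter s fun i hi =>
        measurableSet_le (continuous_abs.measurable.comp (hv i hi)) measurable_const)
  have hB : ∀ p, ∀ᶠ n in atTop, p ∈ B n := fun p => by
    have h1 : ∀ a : ℝ, ∀ᶠ n : ℕ in atTop, a ≤ n := fun a =>
      tendsto_natCast_atTop_atTop.eventually_ge_atTop a
    have h2 : ∀ᶠ n : ℕ in atTop, ∀ i ∈ s, |v i p| ≤ n :=
      (Finset.eventually_all s).2 fun i _ => h1 _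
    filter_upwards [h1 |p.2|, h2] with n h3 h4
    exact ⟨h3, Set.mem_iInter₂.2 h4⟩
  have hbdd : ∀ n, ∀ i ∈ s, IsBddSupp ((B n).indicator (v i)) := fun n i hi => by
    refine ⟨(hv i hi).indicator (hBm n), ⟨n, fun p => ?_⟩, ⟨n, fun p hp => ?_⟩⟩
    · by_cases hp : p ∈ B n
      · rw [Set.indicator_of_mem hp]; exact Set.mem_iInter₂.1 hp.2 i hi
      · rw [Set.indicator_of_notMem hp]; simp
    · exact Set.indicator_of_notMem (fun h => absurd h.1 (not_le.2 hp)) _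
  have hm : Measurable fun p => ∑ i ∈ s, v i p := Finset.measurable_fun_sum s hv
  have h1 := (qf_tendsto_indicator hm hsum hBm hB).sqrt
  have h2 := tendsto_finsetSum s fun i hi => (qf_tendsto_indicator (hv i hi) (hint i hi) hBm hB).sqrt
  refine le_of_tendsto_of_tendsto' h1 h2 fun n => ?_
  have h3 := sqrt_qf_sum_le_of_bdd hρ s (hbdd n)
  have h4 : (B n).indicator (fun p => ∑ i ∈ s, v i p)
      = fun p => ∑ i ∈ s, (B n).indicator (v i) p := by
    funext p
    by_cases hp : p ∈ B n
    · simp [Set.indicator_of_mem hp]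
    · simp [Set.indicator_of_notMem hp]
  rw [h4]
  exact h3

theorem IsPSDPair.qf_nonneg (hρ : IsPSDPair ρ) (hu : Measurable u)
    (hint : Integrable (tens u u) (ρ.1 + ρ.2)) : 0 ≤ qf ρ u := by
  set B : ℕ → Set (ℝ≥0 × ℝ) := fun n => {p | |p.2| ≤ n} ∩ {p | |u p| ≤ n} with hBdef
  have hBm : ∀ n, MeasurableSet (B n) := fun n =>
    (measurableSet_le (continuous_abs.measurable.comp measurable_snd) measurable_const).inter
      (measurableSet_le (continuous_abs.measurable.comp hu) measurable_const)
  have hB : ∀ p, ∀ᶠ n in atTop, p ∈ B n := fun p => by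
    have h1 : ∀ a : ℝ, ∀ᶠ n : ℕ in atTop, a ≤ n := fun a =>
      tendsto_natCast_atTop_atTop.eventually_ge_atTop a
    filter_upwards [h1 |p.2|, h1 |u p|] with n h3 h4
    exact ⟨h3, h4⟩
  refine ge_of_tendsto' (qf_tendsto_indicator hu hint hBm hB) fun n => hρ.nonneg _ ?_
  refine ⟨hu.indicator (hBm n), ⟨n, fun p => ?_⟩, ⟨n, fun p hp => ?_⟩⟩
  · by_cases hp : p ∈ B n
    · rw [Set.indicator_of_mem hp]; exact hp.2
    · rw [Set.indicator_of_notMem hp]; simp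
  · exact Set.indicator_of_notMem (fun h => absurd h.1 (not_le.2 hp)) _

end Form

/-! ### Positivity of the form of a good path -/

/-- The restriction of a pair of measures to `[0, t] × ℝ × ℝ`. -/
def upTo (t : ℝ≥0) (μ : Measure (ℝ≥0 × ℝ × ℝ) × Measure (ℝ≥0 × ℝ × ℝ)) :
    Measure (ℝ≥0 × ℝ × ℝ) × Measure (ℝ≥0 × ℝ × ℝ) :=
  (μ.1.restrict (Set.Iic t ×ˢ Set.univ), μ.2.restrict (Set.Iic t ×ˢ Set.univ))

theorem upTo_add (t : ℝ≥0) (μ : Measure (ℝ≥0 × ℝ × ℝ) × Measure (ℝ≥0 × ℝ × ℝ)) :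
    (upTo t μ).1 + (upTo t μ).2 = (μ.1 + μ.2).restrict (Set.Iic t ×ˢ Set.univ) :=
  (Measure.restrict_add _ _ _).symm

theorem upTo_fin (t : ℝ≥0) {μ : Measure (ℝ≥0 × ℝ × ℝ) × Measure (ℝ≥0 × ℝ × ℝ)}
    [IsLocallyFiniteMeasure μ.1] [IsLocallyFiniteMeasure μ.2] (R : ℝ) :
    ((upTo t μ).1 + (upTo t μ).2) (Set.univ ×ˢ Set.Icc (-R) R ×ˢ Set.Icc (-R) R) < ∞ := by
  have hS : MeasurableSet (Set.univ ×ˢ Set.Icc (-R) R ×ˢ Set.Icc (-R) R : Set (ℝ≥0 × ℝ × ℝ)) :=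
    MeasurableSet.univ.prod (measurableSet_Icc.prod measurableSet_Icc)
  have hb : ∀ z ∈ (Set.univ ×ˢ Set.Icc (-R) R ×ˢ Set.Icc (-R) R : Set (ℝ≥0 × ℝ × ℝ))
      ∩ Set.Iic t ×ˢ Set.univ, z.1 ≤ t ∧ |z.2.1| ≤ R ∧ |z.2.2| ≤ R := fun z hz =>
    ⟨hz.2.1, abs_le.2 hz.1.2.1, abs_le.2 hz.1.2.2⟩
  rw [upTo_add, Measure.restrict_apply hS, Measure.add_apply]
  exact ENNReal.add_lt_top.2 ⟨measure_lt_top_of_bounded μ.1 hb, measure_lt_top_of_bounded μ.2 hb⟩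

theorem exists_sum_by_parts {n : ℕ} (e : Fin n → ℝ) : ∃ d : Fin (n + 1) → ℝ,
    ∀ G : Fin (n + 1) → ℝ, ∑ i, e i * (G i.succ - G i.castSucc) = ∑ k, d k * G k := by
  refine ⟨fun k => (Fin.cons 0 e : Fin (n + 1) → ℝ) k - (Fin.snoc e 0 : Fin (n + 1) → ℝ) k,
    fun G => ?_⟩
  simp only [sub_mul, mul_sub, Finset.sum_sub_distrib]
  rw [Fin.sum_univ_succ (f := fun k => (Fin.cons 0 e : Fin (n + 1) → ℝ) k * G k),
    Fin.sum_univ_castSucc (f := fun k => (Fin.snoc e 0 : Fin (n + 1) → ℝ) k * G k)]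
  simp

section Path

variable {T : ℝ≥0} {F : ℝ≥0 → ℝ → ℝ → ℝ}

/-- Summation by parts in both space variables turns the weighted box increments into a quadratic
form in point values of the path, to which `psd` applies. -/
theorem IsGoodPath.sum_boxInc_nonneg (hF : IsGoodPath T F) {n : ℕ} (e : Fin n → ℝ)
    (x : Fin (n + 1) → ℝ) {s t : ℝ≥0} (hst : s ≤ t) (ht : t ≤ T) :
    0 ≤ ∑ i, ∑ k, e i * e k * boxInc F s t (x i.castSucc) (x i.succ) (x k.castSucc) (x k.succ) := by
  obtain ⟨d, hd⟩ := exists_sum_by_parts e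
  set G : ℝ → ℝ → ℝ := fun a b => F t a b - F s a b with hG
  have h1 : ∑ i, ∑ k, e i * e k * boxInc F s t (x i.castSucc) (x i.succ) (x k.castSucc) (x k.succ)
      = ∑ i, e i * ((fun m => ∑ l, d l * G (x m) (x l)) i.succ
        - (fun m => ∑ l, d l * G (x m) (x l)) i.castSucc) := by
    refine Finset.sum_congr rfl fun i _ => ?_
    simp only
    rw [← hd fun l => G (x i.succ) (x l), ← hd fun l => G (x i.castSucc) (x l),
      ← Finset.sum_sub_distrib, Finset.mul_sum]
    refine Finset.sum_congr rfl fun k _ => ?_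
    simp only [boxInc, hG]; ring
  rw [h1, hd fun m => ∑ l, d l * G (x m) (x l)]
  have h2 := hF.psd (n + 1) x d s t hst ht
  have h3 : ∑ k, d k * ∑ l, d l * G (x k) (x l)
      = ∑ k, ∑ l, d k * d l * F t (x k) (x l) - ∑ k, ∑ l, d k * d l * F s (x k) (x l) := by
    rw [← Finset.sum_sub_distrib]
    refine Finset.sum_congr rfl fun k _ => ?_
    rw [← Finset.sum_sub_distrib, Finset.mul_sum]
    refine Finset.sum_congr rfl fun l _ => ?_
    simp only [hG]; ring
  rw [h3]
  linarith

variable {Ω : Type*} [MeasurableSpace Ω] {ℱ : Filtration ℝ≥0 ‹MeasurableSpace Ω›}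

theorem Simple.isBddSupp (φ : Simple ℱ T) (ω : Ω) : IsBddSupp fun p => φ.toField p.1 p.2 ω := by
  refine ⟨?_, ?_, ?_⟩
  · have h : Measurable fun p : ℝ≥0 × ℝ => (p.1, p.2, ω) :=
      measurable_fst.prodMk (measurable_snd.prodMk measurable_const)
    have := φ.measurable_toField.comp h
    exact this
  · refine ⟨∑ j, ∑ i, |φ.e j i ω|, fun p => ?_⟩
    unfold Simple.toField
    refine (Finset.abs_sum_le_sum_abs _ _).trans (Finset.sum_le_sum fun j _ =>
      (Finset.abs_sum_le_sum_abs _ _).trans (Finset.sum_le_sum fun i _ => ?_))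
    rw [abs_mul, abs_mul]
    have h1 : ∀ (α : Type) (S : Set α) (a : α), |S.indicator (1 : α → ℝ) a| ≤ 1 := fun α S a => by
      by_cases ha : a ∈ S <;> simp [ha]
    calc _ ≤ |φ.e j i ω| * 1 * 1 := by gcongr <;> exact h1 _ _ _
      _ = _ := by ring
  · obtain ⟨R, hR⟩ := φ.exists_supp
    exact ⟨R, fun p hp => hR _ _ _ hp⟩

/-- Both factors are evaluated at the same time `s`, so no terms mixing two time intervals occur. -/
theorem Simple.tens_toField (φ : Simple ℱ T) (ω : Ω) (z : ℝ≥0 × ℝ × ℝ) :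
    tens (fun p => φ.toField p.1 p.2 ω) (fun p => φ.toField p.1 p.2 ω) z
      = ∑ j, ∑ i, ∑ k, φ.e j i ω * φ.e j k ω *
        Set.indicator (Set.Ioc (φ.t j.castSucc) (φ.t j.succ) ×ˢ
          Set.Ico (φ.x i.castSucc) (φ.x i.succ) ×ˢ Set.Ico (φ.x k.castSucc) (φ.x k.succ)) 1 z := by
  obtain ⟨s, x, y⟩ := z
  have hdisj : ∀ j j' : Fin φ.m, j ≠ j' → s ∈ Set.Ioc (φ.t j.castSucc) (φ.t j.succ) →
      s ∉ Set.Ioc (φ.t j'.castSucc) (φ.t j'.succ) := by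
    intro j j' hj hs hs'
    rcases lt_or_gt_of_ne hj with h | h
    · have h1 := φ.t_mono.monotone (Fin.succ_le_castSucc_iff.2 h)
      exact absurd (hs'.1.trans_le (hs.2.trans h1)) (lt_irrefl _)
    · have h1 := φ.t_mono.monotone (Fin.succ_le_castSucc_iff.2 h)
      exact absurd (hs.1.trans_le (hs'.2.trans h1)) (lt_irrefl _)
  have hind : ∀ (A : Set ℝ≥0) (B C : Set ℝ), (A ×ˢ B ×ˢ C).indicator (1 : ℝ≥0 × ℝ × ℝ → ℝ) (s, x, y)
      = A.indicator 1 s * (B.indicator 1 x * C.indicator 1 y) := by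
    intro A B C
    by_cases h1 : s ∈ A <;> by_cases h2 : x ∈ B <;> by_cases h3 : y ∈ C <;> simp [h1, h2, h3]
  by_cases h : ∃ j : Fin φ.m, s ∈ Set.Ioc (φ.t j.castSucc) (φ.t j.succ)
  · obtain ⟨j, hj⟩ := h
    have hz : ∀ j' : Fin φ.m, j' ≠ j → Set.indicator (Set.Ioc (φ.t j'.castSucc) (φ.t j'.succ))
        (1 : ℝ≥0 → ℝ) s = 0 := fun j' hj' => Set.indicator_of_notMem (hdisj j j' hj'.symm hj) _
    simp only [tens, Simple.toField, hind]
    rw [Finset.sum_eq_single j (fun j' _ hj' => by simp [hz j' hj']) (by simp),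
      Finset.sum_eq_single j (fun j' _ hj' => by simp [hz j' hj']) (by simp),
      Finset.sum_eq_single j (fun j' _ hj' => by simp [hz j' hj']) (by simp), Finset.sum_mul_sum]
    refine Finset.sum_congr rfl fun i _ => Finset.sum_congr rfl fun k _ => ?_
    rw [Set.indicator_of_mem hj]; simp only [Pi.one_apply]; ring
  · push Not at h
    have hz : ∀ j : Fin φ.m, Set.indicator (Set.Ioc (φ.t j.castSucc) (φ.t j.succ)) (1 : ℝ≥0 → ℝ) s = 0 :=
      fun j => Set.indicator_of_notMem (h j) _
    simp [tens, Simple.toField, hind, hz]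

/-- The form of a simple function. -/
theorem IsGoodPath.qf_simple (hF : IsGoodPath T F) (φ : Simple ℱ T) (ω : Ω) {t : ℝ≥0} (ht : t ≤ T) :
    qf (upTo t (pathPair T F)) (fun p => φ.toField p.1 p.2 ω)
      = ∑ j, ∑ i, ∑ k, φ.e j i ω * φ.e j k ω *
        boxInc F (min (φ.t j.castSucc) t) (min (φ.t j.succ) t)
          (φ.x i.castSucc) (φ.x i.succ) (φ.x k.castSucc) (φ.x k.succ) := by
  have i1 := hF.isStieltjesPair.locFinite_pos
  have i2 := hF.isStieltjesPair.locFinite_neg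
  set B : Fin φ.m → Fin φ.n → Fin φ.n → Set (ℝ≥0 × ℝ × ℝ) := fun j i k =>
    Set.Ioc (φ.t j.castSucc) (φ.t j.succ) ×ˢ
          Set.Ico (φ.x i.castSucc) (φ.x i.succ) ×ˢ Set.Ico (φ.x k.castSucc) (φ.x k.succ) with hB
  have hBm : ∀ j i k, MeasurableSet (B j i k) := fun j i k =>
    measurableSet_Ioc.prod (measurableSet_Ico.prod measurableSet_Ico)
  have hBt : ∀ j i k, B j i k ∩ Set.Iic t ×ˢ Set.univ =
      Set.Ioc (min (φ.t j.castSucc) t) (min (φ.t j.succ) t) ×ˢ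
          Set.Ico (φ.x i.castSucc) (φ.x i.succ) ×ˢ Set.Ico (φ.x k.castSucc) (φ.x k.succ) := by
    intro j i k
    have : Set.Ioc (φ.t j.castSucc) (φ.t j.succ) ∩ Set.Iic t
        = Set.Ioc (min (φ.t j.castSucc) t) (min (φ.t j.succ) t) := by
      ext s
      simp only [Set.mem_inter_iff, Set.mem_Ioc, Set.mem_Iic, le_min_iff, min_lt_iff]
      constructor
      · rintro ⟨⟨h1, h2⟩, h3⟩; exact ⟨Or.inl h1, h2, h3⟩
      · rintro ⟨h1 | h1, h2, h3⟩
        · exact ⟨⟨h1, h2⟩, h3⟩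
        · exact absurd h1 (not_lt.2 h3)
    rw [hB, Set.prod_inter_prod, Set.inter_univ, this]
  have hfinB : ∀ j i k, ((upTo t (pathPair T F)).1 + (upTo t (pathPair T F)).2) (B j i k) ≠ ∞ := by
    intro j i k
    rw [upTo_add, Measure.restrict_apply (hBm j i k), hBt, Measure.add_apply]
    have : ∀ μ : Measure (ℝ≥0 × ℝ × ℝ), IsLocallyFiniteMeasure μ → μ _ < ∞ := fun μ _ =>
      (measure_mono (Set.prod_mono Set.Ioc_subset_Icc_self (Set.prod_mono Set.Ico_subset_Icc_self
        Set.Ico_subset_Icc_self))).trans_lt (measure_box_lt_top μ (min (φ.t j.castSucc) t)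
          (min (φ.t j.succ) t) (φ.x i.castSucc) (φ.x i.succ) (φ.x k.castSucc) (φ.x k.succ))
    exact (ENNReal.add_lt_top.2 ⟨this _ i1, this _ i2⟩).ne
  have hint : ∀ j i k, Integrable (fun z => φ.e j i ω * φ.e j k ω * (B j i k).indicator 1 z)
      ((upTo t (pathPair T F)).1 + (upTo t (pathPair T F)).2) := fun j i k => by
    refine Integrable.const_mul ?_ _
    exact (integrable_indicator_iff (hBm j i k)).2 (integrableOn_const (hfinB j i k))
  have hval : ∀ j i k, sInt (upTo t (pathPair T F)) ((B j i k).indicator 1) =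
      boxInc F (min (φ.t j.castSucc) t) (min (φ.t j.succ) t)
          (φ.x i.castSucc) (φ.x i.succ) (φ.x k.castSucc) (φ.x k.succ) := by
    intro j i k
    have h1 := hF.real_Ioc_box (min_le_min_right t (φ.t_mono (Fin.castSucc_lt_succ (i := j))).le)
      (φ.x_mono (Fin.castSucc_lt_succ (i := i))).le (φ.x_mono (Fin.castSucc_lt_succ (i := k))).le
    simp only [sInt, integral_indicator_one (hBm j i k), upTo, measureReal_restrict_apply (hBm j i k),
      hBt, h1]
    simp only [boxInc, min_eq_left ((min_le_right _ t).trans ht)]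
  have heq : tens (fun p => φ.toField p.1 p.2 ω) (fun p => φ.toField p.1 p.2 ω)
      = fun z => ∑ j, ∑ i, ∑ k, φ.e j i ω * φ.e j k ω * (B j i k).indicator 1 z :=
    funext fun z => φ.tens_toField ω z
  rw [qf, heq, sInt_finset_sum _ fun j _ => integrable_finsetSum _ fun i _ =>
    integrable_finsetSum _ fun k _ => hint j i k]
  refine Finset.sum_congr rfl fun j _ => ?_
  rw [sInt_finset_sum _ fun i _ => integrable_finsetSum _ fun k _ => hint j i k]
  refine Finset.sum_congr rfl fun i _ => ?_
  rw [sInt_finset_sum _ fun k _ => hint j i k]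
  refine Finset.sum_congr rfl fun k _ => ?_
  rw [sInt_const_mul, hval]

theorem IsGoodPath.qf_simple_nonneg (hF : IsGoodPath T F) (φ : Simple ℱ T) (ω : Ω) {t : ℝ≥0}
    (ht : t ≤ T) : 0 ≤ qf (upTo t (pathPair T F)) (fun p => φ.toField p.1 p.2 ω) := by
  rw [hF.qf_simple φ ω ht]
  exact Finset.sum_nonneg fun j _ => hF.sum_boxInc_nonneg (fun i => φ.e j i ω) φ.x
    (min_le_min_right t (φ.t_mono (Fin.castSucc_lt_succ (i := j))).le) ((min_le_right _ _).trans ht)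

end Path

theorem tens_sub_tens_abs_le {u v : ℝ≥0 × ℝ → ℝ} {C : ℝ} (hu : ∀ p, |u p| ≤ C) (hv : ∀ p, |v p| ≤ C)
    (z : ℝ≥0 × ℝ × ℝ) : |tens u u z - tens v v z|
      ≤ C * (|u (z.1, z.2.1) - v (z.1, z.2.1)| + |u (z.1, z.2.2) - v (z.1, z.2.2)|) := by
  have : tens u u z - tens v v z = u (z.1, z.2.1) * (u (z.1, z.2.2) - v (z.1, z.2.2))
      + (u (z.1, z.2.1) - v (z.1, z.2.1)) * v (z.1, z.2.2) := by simp only [tens]; ring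
  rw [this]
  refine (abs_add_le _ _).trans ?_
  rw [abs_mul, abs_mul, mul_add, add_comm]
  have h1 := mul_le_mul_of_nonneg_right (hu (z.1, z.2.1)) (abs_nonneg (u (z.1, z.2.2) - v (z.1, z.2.2)))
  have h2 := mul_le_mul_of_nonneg_left (hv (z.1, z.2.2)) (abs_nonneg (u (z.1, z.2.1) - v (z.1, z.2.1)))
  linarith

theorem abs_clip_sub_clip_le (C x y : ℝ) : |clip C x - clip C y| ≤ |x - y| := by
  unfold clip
  grind

/-- Simple functions can be truncated to `[-C, C]`. -/
theorem exists_simple_clamp {Ω : Type*} [MeasurableSpace Ω] {ℱ : Filtration ℝ≥0 ‹MeasurableSpace Ω›}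
    {T : ℝ≥0} (φ : Simple ℱ T) {C : ℝ} (hC : 0 ≤ C) :
    ∃ χ : Simple ℱ T, (∀ s x ω, |χ.toField s x ω| ≤ C) ∧
      (∀ s x ω, φ.toField s x ω = 0 → χ.toField s x ω = 0) ∧
      ∀ s x ω (r : ℝ), |r| ≤ C → |r - χ.toField s x ω| ≤ |r - φ.toField s x ω| := by
  have hm : Measurable (clip C) := by unfold clip; fun_prop
  have h0 : clip C 0 = 0 := clip_of_abs_le (by simpa)
  obtain ⟨χ, hχ⟩ := φ.exists_comp hm h0
  refine ⟨χ, fun s x ω => by rw [hχ]; exact abs_clip_le hC _, fun s x ω h => by rw [hχ, h, h0],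
    fun s x ω r hr => ?_⟩
  rw [hχ]
  conv_lhs => rw [← clip_of_abs_le hr]
  exact abs_clip_sub_clip_le _ _ _

variable {T : ℝ≥0} {F : ℝ≥0 → ℝ → ℝ → ℝ}

/-- The form is nonnegative on simple functions, and these approximate `u`. For bounded functions
the error in `u(s,x) u(s,y)` is at most a constant times the sum of the errors at the two points, so
it is enough to approximate in L¹ of the sum of the two space marginals of the total variation. -/
theorem IsGoodPath.qf_nonneg_of_bdd (hF : IsGoodPath T F) {t : ℝ≥0} (ht : t ≤ T) {u : ℝ≥0 × ℝ → ℝ}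
    (hu : IsBddSupp u) : 0 ≤ qf (upTo t (pathPair T F)) u := by
  have i1 := hF.isStieltjesPair.locFinite_pos
  have i2 := hF.isStieltjesPair.locFinite_neg
  obtain ⟨C₀, hC₀⟩ := hu.bdd
  obtain ⟨R₀, hR₀⟩ := hu.supp
  set C := max C₀ 0 with hCdef
  have hC : ∀ p, |u p| ≤ C := fun p => (hC₀ p).trans (le_max_left _ _)
  have hC0 : 0 ≤ C := le_max_right _ _
  set R := |R₀| + 1 with hRdef
  have hR : ∀ p : ℝ≥0 × ℝ, p.2 ∉ Set.Ico (-R) R → u p = 0 := fun p hp => hR₀ p (by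
    by_contra hle
    have h1 := abs_le.1 ((not_lt.1 hle).trans (le_abs_self R₀))
    exact hp ⟨by linarith [h1.1], by linarith [h1.2]⟩)
  set Q : Set (ℝ≥0 × ℝ × ℝ) := Set.univ ×ˢ Set.Ico (-R) R ×ˢ Set.Ico (-R) R with hQ
  have hQm : MeasurableSet Q := MeasurableSet.univ.prod (measurableSet_Ico.prod measurableSet_Ico)
  set ρ := upTo t (pathPair T F) with hρ
  set m := (ρ.1 + ρ.2).restrict Q with hm
  have hmfin : IsFiniteMeasure m := ⟨by
    rw [hm, Measure.restrict_apply .univ, Set.univ_inter]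
    exact (measure_mono (Set.prod_mono subset_rfl (Set.prod_mono Set.Ico_subset_Icc_self
      Set.Ico_subset_Icc_self))).trans_lt (upTo_fin t R)⟩
  set p1 : ℝ≥0 × ℝ × ℝ → Unit × ℝ≥0 × ℝ := fun z => ((), z.1, z.2.1) with hp1
  set p2 : ℝ≥0 × ℝ × ℝ → Unit × ℝ≥0 × ℝ := fun z => ((), z.1, z.2.2) with hp2
  have hp1m : Measurable p1 := measurable_const.prodMk (measurable_fst.prodMk measurable_snd.fst)
  have hp2m : Measurable p2 := measurable_const.prodMk (measurable_fst.prodMk measurable_snd.snd)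
  set ν := m.map p1 + m.map p2 with hν
  have hmK : ∀ᵐ z ∂m, z.1 ∈ Set.Ioc 0 T ∧ z.2.1 ∈ Set.Ico (-R) R ∧ z.2.2 ∈ Set.Ico (-R) R := by
    have h1 : ∀ᵐ z ∂m, z ∈ Q := ae_restrict_mem hQm
    have h2 : ∀ᵐ z ∂m, z.1 ≤ t := by
      refine ae_restrict_of_ae ?_
      rw [hρ, upTo_add]
      filter_upwards [ae_restrict_mem (measurableSet_Iic.prod MeasurableSet.univ)] with z hz
      exact hz.1
    have h3 : ∀ᵐ z ∂m, z ∉ ({0} ×ˢ Set.univ : Set (ℝ≥0 × ℝ × ℝ)) := by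
      refine ae_restrict_of_ae ?_
      rw [hρ, upTo_add]
      refine ae_restrict_of_ae ?_
      rw [← measure_eq_zero_iff_ae_notMem, Measure.add_apply, (hF.measure_singleton 0).1,
        (hF.measure_singleton 0).2, add_zero]
    filter_upwards [h1, h2, h3] with z hz1 hz2 hz3
    refine ⟨⟨pos_iff_ne_zero.2 fun h => hz3 ⟨h, trivial⟩, hz2.trans ht⟩, hz1.2⟩
  have hνK : ∀ᵐ z ∂ν, z.2.1 ∈ Set.Ioc 0 T ∧ z.2.2 ∈ Set.Ico (-R) R := by
    have hS : MeasurableSet {z : Unit × ℝ≥0 × ℝ | z.2.1 ∈ Set.Ioc 0 T ∧ z.2.2 ∈ Set.Ico (-R) R} :=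
      (measurableSet_Ioc.preimage measurable_snd.fst).inter
        (measurableSet_Ico.preimage measurable_snd.snd)
    rw [hν, ae_add_measure_iff, ae_map_iff hp1m.aemeasurable hS, ae_map_iff hp2m.aemeasurable hS]
    exact ⟨hmK.mono fun z hz => ⟨hz.1, hz.2.1⟩, hmK.mono fun z hz => ⟨hz.1, hz.2.2⟩⟩
  -- The path is fixed, so the density theorem is used over a one-point probability space, where
  -- every measurable function of `(s, x)` is predictable.
  set 𝒢 : Filtration ℝ≥0 (inferInstance : MeasurableSpace Unit) := ⊤ with h𝒢
  have happ : IsSimpleApproximable 𝒢 T R ν (fun z => u z.2) :=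
    isSimpleApproximable_of_bounded hνK (hu.meas.comp measurable_predSigma_snd) fun z => hC z.2
  refine le_of_forall_pos_sub_le fun ε hε => ?_
  have hε' : 0 < ENNReal.ofReal (ε / (C + 1)) := ENNReal.ofReal_pos.2 (by positivity)
  obtain ⟨φ, hφ0, hφ⟩ := happ _ hε'
  -- Approximation in L¹ gives no bound on `φ`, but the estimate of products needs one. Clamping at
  -- the bound of `u` provides it without enlarging the error.
  obtain ⟨χ, hχC, hχ0, hχ⟩ := exists_simple_clamp φ hC0
  set v : ℝ≥0 × ℝ → ℝ := fun p => χ.toField p.1 p.2 () with hv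
  have hvB : IsBddSupp v := χ.isBddSupp ()
  have hint1 := integrable_tens_of_bdd (upTo_fin (μ := pathPair T F) t) hu hu
  have hint2 := integrable_tens_of_bdd (upTo_fin (μ := pathPair T F) t) hvB hvB
  have hdiff : qf ρ u - qf ρ v = sInt ρ (fun z => tens u u z - tens v v z) :=
    (sInt_sub hint1 hint2).symm
  have h0 : 0 ≤ qf ρ v := hF.qf_simple_nonneg χ () ht
  have hle : ENNReal.ofReal |qf ρ u - qf ρ v| ≤ ENNReal.ofReal ε := by
    rw [hdiff]
    refine abs_sInt_le.trans ?_
    have hum : Measurable fun z : Unit × ℝ≥0 × ℝ => ‖u z.2 - φ.toField z.2.1 z.2.2 z.1‖ₑ :=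
      ((hu.meas.comp measurable_snd).sub φ.measurable_toField_prod).enorm
    calc ∫⁻ z, ‖tens u u z - tens v v z‖ₑ ∂(ρ.1 + ρ.2)
        = ∫⁻ z in Q, ‖tens u u z - tens v v z‖ₑ ∂(ρ.1 + ρ.2) := by
          rw [← lintegral_indicator hQm]
          refine lintegral_congr fun z => ?_
          by_cases hz : z ∈ Q
          · rw [Set.indicator_of_mem hz]
          · rw [Set.indicator_of_notMem hz]
            have hz' : z.2.1 ∉ Set.Ico (-R) R ∨ z.2.2 ∉ Set.Ico (-R) R := by
              by_contra hcon
              push Not at hcon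
              exact hz ⟨trivial, hcon⟩
            have hv0 : ∀ p : ℝ≥0 × ℝ, p.2 ∉ Set.Ico (-R) R → v p = 0 := fun p hp =>
              hχ0 _ _ _ (hφ0 _ _ _ hp)
            rcases hz' with h | h
            · simp [tens, hR (z.1, z.2.1) h, hv0 (z.1, z.2.1) h]
            · simp [tens, hR (z.1, z.2.2) h, hv0 (z.1, z.2.2) h]
      _ ≤ ∫⁻ z, ENNReal.ofReal C * (‖u (p1 z).2 - φ.toField (p1 z).2.1 (p1 z).2.2 (p1 z).1‖ₑ
            + ‖u (p2 z).2 - φ.toField (p2 z).2.1 (p2 z).2.2 (p2 z).1‖ₑ) ∂m := by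
          refine lintegral_mono fun z => ?_
          rw [← ofReal_norm, ← ofReal_norm, ← ofReal_norm, ← ENNReal.ofReal_add (norm_nonneg _)
            (norm_nonneg _), ← ENNReal.ofReal_mul hC0]
          refine ENNReal.ofReal_le_ofReal ?_
          refine (tens_sub_tens_abs_le hC (fun p => hχC _ _ _) z).trans ?_
          gcongr
          · exact hχ _ _ _ _ (hC _)
          · exact hχ _ _ _ _ (hC _)
      _ = ENNReal.ofReal C * ∫⁻ z, ‖u z.2 - φ.toField z.2.1 z.2.2 z.1‖ₑ ∂ν := by
          have hum' : Measurable fun z : ℝ≥0 × ℝ × ℝ =>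
              ‖u (p1 z).2 - φ.toField (p1 z).2.1 (p1 z).2.2 (p1 z).1‖ₑ := by
            have := hum.comp hp1m
            exact this
          rw [lintegral_const_mul' _ _ ENNReal.ofReal_ne_top, lintegral_add_left hum',
            hν, lintegral_add_measure, lintegral_map hum hp1m, lintegral_map hum hp2m]
      _ ≤ ENNReal.ofReal C * ENNReal.ofReal (ε / (C + 1)) := by gcongr
      _ ≤ ENNReal.ofReal ε := by
          rw [← ENNReal.ofReal_mul hC0]
          refine ENNReal.ofReal_le_ofReal ?_
          rw [mul_div_assoc', div_le_iff₀ (by positivity)]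
          nlinarith
  have := (ENNReal.ofReal_le_ofReal_iff hε.le).1 hle
  linarith [(abs_le.1 this).1]

theorem IsGoodPath.isPSDPair (hF : IsGoodPath T F) {t : ℝ≥0} (ht : t ≤ T) :
    IsPSDPair (upTo t (pathPair T F)) := by
  have i1 := hF.isStieltjesPair.locFinite_pos
  have i2 := hF.isStieltjesPair.locFinite_neg
  exact ⟨upTo_fin t, fun u hu => hF.qf_nonneg_of_bdd ht hu⟩

/-! ### Measurable dependence of the Lebesgue-Stieltjes measures on the path -/

theorem isFiniteMeasure_of_le {α : Type*} [MeasurableSpace α] {μ : Measure α} (h : μ Set.univ < ∞) :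
    IsFiniteMeasure μ := ⟨h⟩

/-- The positive part of a measurable family of signed measures is measurable. -/
theorem measurable_of_mutuallySingular {Ω : Type*} [MeasurableSpace Ω]
    {κ₁ κ₂ : Ω → Measure (ℝ≥0 × ℝ × ℝ)} [∀ ω, IsFiniteMeasure (κ₁ ω)] [∀ ω, IsFiniteMeasure (κ₂ ω)]
    (hs : ∀ ω, κ₁ ω ⟂ₘ κ₂ ω)
    (h : ∀ B, MeasurableSet B → Measurable fun ω => (κ₁ ω).real B - (κ₂ ω).real B) :
    Measurable κ₁ := by
  refine Measure.measurable_of_measurable_coe _ fun B hB => ?_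
  set 𝒞 := generateSetAlgebra (Set.range ratBox) with h𝒞
  have h𝒞c : 𝒞.Countable := countable_generateSetAlgebra (Set.countable_range _)
  have h𝒞a : IsSetAlgebra 𝒞 := isSetAlgebra_generateSetAlgebra
  have h𝒞g : (inferInstance : MeasurableSpace (ℝ≥0 × ℝ × ℝ)) = .generateFrom 𝒞 := by
    rw [h𝒞, generateFrom_generateSetAlgebra_eq]; exact generateFrom_ratBox
  have h𝒞m : ∀ t ∈ 𝒞, MeasurableSet t := fun t ht => by
    have : MeasurableSet[.generateFrom 𝒞] t := MeasurableSpace.measurableSet_generateFrom ht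
    rwa [← h𝒞g] at this
  -- The positive part of `B` is the largest signed mass of a part of `B`. A Hahn set attains it,
  -- and this set can be approximated within a countable algebra, so a countable supremum of
  -- measurable functions suffices.
  have key : ∀ ω, κ₁ ω B = ⨆ t ∈ 𝒞, ENNReal.ofReal ((κ₁ ω).real (t ∩ B) - (κ₂ ω).real (t ∩ B)) := by
    intro ω
    refine le_antisymm ?_ (iSup₂_le fun t _ => ?_)
    · obtain ⟨H', hH'm, h1, h2⟩ := hs ω
      set H := H'ᶜ with hH
      have hHm : MeasurableSet H := hH'm.compl
      refine ENNReal.le_of_forall_pos_le_add fun ε hε _ => ?_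
      obtain ⟨t, ht, htε⟩ := (Measure.MeasureDense.of_generateFrom_isSetAlgebra_finite
        (μ := κ₁ ω + κ₂ ω) h𝒞a h𝒞g).approx H hHm (measure_ne_top _ _) ε hε
      have htm := h𝒞m t ht
      have hreal : (κ₁ ω + κ₂ ω).real (symmDiff H t) ≤ ε := by
        refine ENNReal.toReal_le_of_le_ofReal hε.le htε.le
      rw [measureReal_add_apply] at hreal
      have e1 : (κ₁ ω).real B ≤ (κ₁ ω).real (t ∩ B) + (κ₁ ω).real (symmDiff H t) := by
        have hsub : B ⊆ (t ∩ B) ∪ symmDiff H t ∪ H' := fun z hz => by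
          by_cases hzt : z ∈ t
          · exact Or.inl (Or.inl ⟨hzt, hz⟩)
          · by_cases hzH : z ∈ H'
            · exact Or.inr hzH
            · exact Or.inl (Or.inr (Or.inl ⟨hzH, hzt⟩))
        have h0 : (κ₁ ω).real H' = 0 := by simp [Measure.real, h1]
        calc _ ≤ (κ₁ ω).real ((t ∩ B) ∪ symmDiff H t ∪ H') := measureReal_mono hsub
          _ ≤ (κ₁ ω).real (t ∩ B) + (κ₁ ω).real (symmDiff H t) + (κ₁ ω).real H' :=
            (measureReal_union_le _ _).trans (by gcongr; exact measureReal_union_le _ _)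
          _ = _ := by rw [h0, add_zero]
      have e2 : (κ₂ ω).real (t ∩ B) ≤ (κ₂ ω).real (symmDiff H t) := by
        have hsub : t ∩ B ⊆ symmDiff H t ∪ H := fun z hz => by
          by_cases hzH : z ∈ H
          · exact Or.inr hzH
          · exact Or.inl (Or.inr ⟨hz.1, hzH⟩)
        have h0 : (κ₂ ω).real H = 0 := by simp [Measure.real, h2]
        calc _ ≤ (κ₂ ω).real (symmDiff H t ∪ H) := measureReal_mono hsub
          _ ≤ (κ₂ ω).real (symmDiff H t) + (κ₂ ω).real H := measureReal_union_le _ _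
          _ = _ := by rw [h0, add_zero]
      calc κ₁ ω B = ENNReal.ofReal ((κ₁ ω).real B) := (ofReal_measureReal).symm
        _ ≤ ENNReal.ofReal (((κ₁ ω).real (t ∩ B) - (κ₂ ω).real (t ∩ B)) + ε) :=
          ENNReal.ofReal_le_ofReal (by linarith)
        _ ≤ ENNReal.ofReal ((κ₁ ω).real (t ∩ B) - (κ₂ ω).real (t ∩ B)) + ENNReal.ofReal ε :=
          ENNReal.ofReal_add_le
        _ ≤ _ := by
          rw [ENNReal.ofReal_coe_nnreal]
          gcongr
          exact le_iSup₂ (f := fun t _ =>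
            ENNReal.ofReal ((κ₁ ω).real (t ∩ B) - (κ₂ ω).real (t ∩ B))) t ht
    · calc _ ≤ ENNReal.ofReal ((κ₁ ω).real (t ∩ B)) :=
          ENNReal.ofReal_le_ofReal (sub_le_self _ measureReal_nonneg)
        _ = κ₁ ω (t ∩ B) := ofReal_measureReal
        _ ≤ κ₁ ω B := measure_mono Set.inter_subset_right
  rw [show (fun ω => κ₁ ω B) = _ from funext key]
  exact Measurable.biSup _ h𝒞c fun t ht => (h _ ((h𝒞m t ht).inter hB)).ennreal_ofReal

section

variable {T : ℝ≥0} {F : ℝ≥0 → ℝ → ℝ → ℝ}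

theorem IsGoodPath.ae_ne (hF : IsGoodPath T F) (s : ℝ≥0) :
    (∀ᵐ z ∂(pathPair T F).1, z.1 ≠ s) ∧ ∀ᵐ z ∂(pathPair T F).2, z.1 ≠ s := by
  constructor
  · filter_upwards [measure_eq_zero_iff_ae_notMem.1 (hF.measure_singleton s).1] with z hz h
    exact hz ⟨h, trivial⟩
  · filter_upwards [measure_eq_zero_iff_ae_notMem.1 (hF.measure_singleton s).2] with z hz h
    exact hz ⟨h, trivial⟩

theorem IsGoodPath.real_inter_Iic_box (hF : IsGoodPath T F) {a b t : ℝ≥0} {c d e f : ℝ} (hab : a ≤ b)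
    (ht : t ≤ T) (hcd : c ≤ d) (hef : e ≤ f) :
    (pathPair T F).1.real ((Set.Ico a b ∩ Set.Iic t) ×ˢ Set.Ico c d ×ˢ Set.Ico e f)
      - (pathPair T F).2.real ((Set.Ico a b ∩ Set.Iic t) ×ˢ Set.Ico c d ×ˢ Set.Ico e f)
      = boxInc F (min a t) (min b t) c d e f := by
  have h1 := hF.isStieltjesPair.box (min a t) (min b t) c d e f (min_le_min_right t hab) hcd hef
  have h2 : boxInc (fun s x y => F (min s T) x y) (min a t) (min b t) c d e f
      = boxInc F (min a t) (min b t) c d e f := by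
    simp only [boxInc, min_eq_left ((min_le_right _ t).trans ht)]
  rw [← h2, ← h1]
  have key : ∀ μ : Measure (ℝ≥0 × ℝ × ℝ), (∀ᵐ z ∂μ, z.1 ≠ t) →
      μ.real ((Set.Ico a b ∩ Set.Iic t) ×ˢ Set.Ico c d ×ˢ Set.Ico e f)
      = μ.real (Set.Ico (min a t) (min b t) ×ˢ Set.Ico c d ×ˢ Set.Ico e f) := by
    intro μ hμ
    refine measureReal_congr ?_
    filter_upwards [hμ] with z hz
    refine propext ?_
    change z ∈ (Set.Ico a b ∩ Set.Iic t) ×ˢ Set.Ico c d ×ˢ Set.Ico e f ↔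
      z ∈ Set.Ico (min a t) (min b t) ×ˢ Set.Ico c d ×ˢ Set.Ico e f
    simp only [Set.mem_prod, Set.mem_inter_iff, Set.mem_Ico, Set.mem_Iic, min_le_iff, lt_min_iff]
    have e1 : z.1 ≤ t ↔ z.1 < t := ⟨fun h => lt_of_le_of_ne h hz, le_of_lt⟩
    rw [e1]
    constructor
    · rintro ⟨⟨⟨h1, h2⟩, h3⟩, h4⟩; exact ⟨⟨Or.inl h1, h2, h3⟩, h4⟩
    · rintro ⟨⟨h1 | h1, h2, h3⟩, h4⟩
      · exact ⟨⟨⟨h1, h2⟩, h3⟩, h4⟩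
      · exact absurd h3 (not_lt.2 h1)
  rw [key _ (hF.ae_ne t).1, key _ (hF.ae_ne t).2]

/-- The path that will replace the exceptional ones. -/
theorem isGoodPath_zero (T : ℝ≥0) : IsGoodPath T fun _ _ _ => 0 where
  leftCont := fun _ _ _ _ _ => tendsto_const_nhds
  locBV := fun _ => ⟨0, by intros; simp [boxInc]⟩
  cont := fun _ _ => continuousOn_const
  psd := by intros; simp

/-- The set `[0, t] × [-R, R)²`. -/
def cutBox (t : ℝ≥0) (R : ℕ) : Set (ℝ≥0 × ℝ × ℝ) :=
  Set.Iic t ×ˢ Set.Ico (-(R : ℝ)) R ×ˢ Set.Ico (-(R : ℝ)) R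

theorem cutBox_mono (t : ℝ≥0) : Monotone (cutBox t) := fun R R' h => by
  have : (R : ℝ) ≤ R' := by exact_mod_cast h
  exact Set.prod_mono subset_rfl (Set.prod_mono (Set.Ico_subset_Ico (by linarith) this)
    (Set.Ico_subset_Ico (by linarith) this))

theorem iUnion_cutBox (t : ℝ≥0) : ⋃ R, cutBox t R = Set.Iic t ×ˢ Set.univ := by
  ext ⟨s, x, y⟩
  simp only [Set.mem_iUnion, cutBox, Set.mem_prod, Set.mem_univ, and_true]
  refine ⟨fun ⟨R, h⟩ => h.1, fun h => ?_⟩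
  obtain ⟨n, -, hx, hy⟩ := exists_nat_bound s x y
  have h1 := abs_lt.1 hx
  have h2 := abs_lt.1 hy
  exact ⟨n, h, ⟨h1.1.le, h1.2⟩, h2.1.le, h2.2⟩

theorem isFiniteMeasure_restrict_cutBox (μ : Measure (ℝ≥0 × ℝ × ℝ)) [IsLocallyFiniteMeasure μ]
    (t : ℝ≥0) (R : ℕ) : IsFiniteMeasure (μ.restrict (cutBox t R)) := by
  refine isFiniteMeasure_of_le ?_
  rw [Measure.restrict_apply .univ, Set.univ_inter]
  exact measure_lt_top_of_bounded (t := t) (R := R) μ fun z hz =>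
    ⟨hz.1, abs_le.2 ⟨hz.2.1.1, hz.2.1.2.le⟩, abs_le.2 ⟨hz.2.2.1, hz.2.2.2.le⟩⟩

variable {Ω : Type*} [MeasurableSpace Ω] {G : Ω → ℝ≥0 → ℝ → ℝ → ℝ} {t : ℝ≥0}

/-- Signed masses of boxes are combinations of values of the path up to time `t`; a π-λ argument
extends measurability to Borel sets, and mutual singularity separates the two parts. The σ-algebra
on `Ω` is arbitrary, so the lemma yields measurability and adaptedness alike. -/
theorem measurable_restrict_pathPair (hG : ∀ ω, IsGoodPath T (G ω)) (ht : t ≤ T)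
    (hm : ∀ s ≤ t, ∀ x y, Measurable fun ω => G ω s x y) (R : ℕ) :
    Measurable (fun ω => (pathPair T (G ω)).1.restrict (cutBox t R)) ∧
    Measurable (fun ω => (pathPair T (G ω)).2.restrict (cutBox t R)) := by
  have i1 := fun ω => (hG ω).isStieltjesPair.locFinite_pos
  have i2 := fun ω => (hG ω).isStieltjesPair.locFinite_neg
  have j1 := fun ω => isFiniteMeasure_restrict_cutBox (pathPair T (G ω)).1 t R
  have j2 := fun ω => isFiniteMeasure_restrict_cutBox (pathPair T (G ω)).2 t R
  have hsing : ∀ ω, (pathPair T (G ω)).1.restrict (cutBox t R) ⟂ₘ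
      (pathPair T (G ω)).2.restrict (cutBox t R) := fun ω =>
    (((hG ω).isStieltjesPair.singular.restrict _).symm.restrict _).symm
  have hbox : ∀ (a b : ℝ≥0) (c d e f : ℝ), Measurable fun ω =>
      (pathPair T (G ω)).1.real ((Set.Ico a b ∩ Set.Iic t) ×ˢ Set.Ico c d ×ˢ Set.Ico e f)
      - (pathPair T (G ω)).2.real ((Set.Ico a b ∩ Set.Iic t) ×ˢ Set.Ico c d ×ˢ Set.Ico e f) := by
    intro a b c d e f
    by_cases hab : a ≤ b
    swap
    · simp [Set.Ico_eq_empty (fun h => hab (le_of_lt h))]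
    by_cases hcd : c ≤ d
    swap
    · simp [Set.Ico_eq_empty (a := c) (fun h => hcd (le_of_lt h))]
    by_cases hef : e ≤ f
    swap
    · simp [Set.Ico_eq_empty (a := e) (fun h => hef (le_of_lt h))]
    simp_rw [fun ω => (hG ω).real_inter_Iic_box hab ht hcd hef]
    unfold boxInc
    have h1 := fun x y => hm (min b t) (min_le_right _ _) x y
    have h2 := fun x y => hm (min a t) (min_le_right _ _) x y
    exact ((((h1 _ _).sub (h1 _ _)).sub (h1 _ _)).add (h1 _ _)).sub
      ((((h2 _ _).sub (h2 _ _)).sub (h2 _ _)).add (h2 _ _))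
  have hsigned : ∀ B, MeasurableSet B → Measurable fun ω =>
      ((pathPair T (G ω)).1.restrict (cutBox t R)).real B
        - ((pathPair T (G ω)).2.restrict (cutBox t R)).real B := by
    intro B hB
    have huniv : Measurable fun ω => ((pathPair T (G ω)).1.restrict (cutBox t R)).real Set.univ
        - ((pathPair T (G ω)).2.restrict (cutBox t R)).real Set.univ := by
      simp only [measureReal_restrict_apply .univ, Set.univ_inter]
      have : cutBox t R = (Set.Ico 0 (t + 1) ∩ Set.Iic t) ×ˢ Set.Ico (-(R : ℝ)) R
          ×ˢ Set.Ico (-(R : ℝ)) R := by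
        rw [cutBox, Set.inter_eq_right.2 (show Set.Iic t ⊆ Set.Ico 0 (t + 1) from
          fun s hs => ⟨zero_le, lt_of_le_of_lt hs (by simp)⟩)]
      rw [this]
      exact hbox _ _ _ _ _ _
    induction B, hB using MeasurableSpace.induction_on_inter generateFrom_ratBox
      isPiSystem_ratBox with
    | empty => simp
    | basic S hS =>
      obtain ⟨p, rfl⟩ := hS
      simp only [measureReal_restrict_apply (measurableSet_ratBox p)]
      have : ratBox p ∩ cutBox t R = (Set.Ico (p.1.1 : ℝ≥0) p.1.2 ∩ Set.Iic t) ×ˢ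
          Set.Ico (max (p.2.1.1 : ℝ) (-R)) (min p.2.1.2 R) ×ˢ
          Set.Ico (max (p.2.2.1 : ℝ) (-R)) (min p.2.2.2 R) := by
        rw [ratBox, cutBox, Set.prod_inter_prod, Set.prod_inter_prod, Set.Ico_inter_Ico,
          Set.Ico_inter_Ico]
      rw [this]
      exact hbox _ _ _ _ _ _
    | compl S hS ih =>
      simp_rw [measureReal_compl hS]
      convert huniv.sub ih using 1
      funext ω
      simp only [Pi.sub_apply]; ring
    | iUnion f hd hf ih =>
      have hlim : ∀ ω, Tendsto (fun n : ℕ => ∑ i ∈ Finset.range n,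
          (((pathPair T (G ω)).1.restrict (cutBox t R)).real (f i)
          - ((pathPair T (G ω)).2.restrict (cutBox t R)).real (f i))) atTop
          (𝓝 (((pathPair T (G ω)).1.restrict (cutBox t R)).real (⋃ i, f i)
          - ((pathPair T (G ω)).2.restrict (cutBox t R)).real (⋃ i, f i))) := by
        intro ω
        have h1 : ∀ μ : Measure (ℝ≥0 × ℝ × ℝ), IsFiniteMeasure μ →
            HasSum (fun i => μ.real (f i)) (μ.real (⋃ i, f i)) := fun μ _ => by
          have hne : ∑' i, μ (f i) ≠ ∞ := by rw [← measure_iUnion hd hf]; exact measure_ne_top _ _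
          have := ENNReal.hasSum_toReal hne
          rw [← ENNReal.tsum_toReal_eq fun i => measure_ne_top _ _, ← measure_iUnion hd hf] at this
          exact this
        exact ((h1 _ (j1 ω)).sub (h1 _ (j2 ω))).tendsto_sum_nat
      exact measurable_of_tendsto_metrizable (fun n => Finset.measurable_fun_sum _ fun i _ => ih i)
        (tendsto_pi_nhds.2 hlim)
  refine ⟨measurable_of_mutuallySingular hsing hsigned,
    measurable_of_mutuallySingular (fun ω => (hsing ω).symm) fun B hB => ?_⟩
  convert (hsigned B hB).neg using 1
  funext ω
  simp

theorem measurable_lintegral_of_finite {κ : Ω → Measure (ℝ≥0 × ℝ × ℝ)} (hκ : Measurable κ)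
    (hfin : ∀ ω, IsFiniteMeasure (κ ω)) {f : Ω × ℝ≥0 × ℝ × ℝ → ℝ≥0∞} (hf : Measurable f) :
    Measurable fun ω => ∫⁻ z, f (ω, z) ∂κ ω := by
  have h1 : Measurable fun ω => (κ ω).map (Prod.mk ω) := by
    refine Measure.measurable_of_measurable_coe _ fun S hS => ?_
    simp_rw [Measure.map_apply measurable_prodMk_left hS]
    exact Kernel.measurable_kernel_prodMk_left_of_finite (κ := ⟨κ, hκ⟩) hS hfin
  have h2 := (Measure.measurable_lintegral hf).comp h1
  convert h2 using 1
  funext ω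
  exact (lintegral_map hf measurable_prodMk_left).symm

/-- The measures are only locally finite; the integral is an increasing limit over bounded boxes, on
which they are finite. -/
theorem measurable_lintegral_pathPair (hG : ∀ ω, IsGoodPath T (G ω)) (ht : t ≤ T)
    (hm : ∀ s ≤ t, ∀ x y, Measurable fun ω => G ω s x y) {f : Ω × ℝ≥0 × ℝ × ℝ → ℝ≥0∞}
    (hf : Measurable f) :
    Measurable (fun ω => ∫⁻ z in Set.Iic t ×ˢ Set.univ, f (ω, z) ∂(pathPair T (G ω)).1) ∧
    Measurable (fun ω => ∫⁻ z in Set.Iic t ×ˢ Set.univ, f (ω, z) ∂(pathPair T (G ω)).2) := by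
  have i1 := fun ω => (hG ω).isStieltjesPair.locFinite_pos
  have i2 := fun ω => (hG ω).isStieltjesPair.locFinite_neg
  have key : ∀ (ω : Ω) (μ : Measure (ℝ≥0 × ℝ × ℝ)), ∫⁻ z in Set.Iic t ×ˢ Set.univ, f (ω, z) ∂μ
      = ⨆ R, ∫⁻ z in cutBox t R, f (ω, z) ∂μ := fun ω μ => by
    rw [← iUnion_cutBox, setLIntegral_iUnion_of_directed]
    exact (cutBox_mono t).directed_le
  simp_rw [key]
  exact ⟨.iSup fun R => measurable_lintegral_of_finite (measurable_restrict_pathPair hG ht hm R).1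
      (fun ω => isFiniteMeasure_restrict_cutBox _ t R) hf,
    .iSup fun R => measurable_lintegral_of_finite (measurable_restrict_pathPair hG ht hm R).2
      (fun ω => isFiniteMeasure_restrict_cutBox _ t R) hf⟩

end

/-! ### The random quadratic form -/

section

variable {Ω : Type*}

/-- The section of a field, stopped at time `T`. -/
def sec (T : ℝ≥0) (g : RField Ω) (ω : Ω) (p : ℝ≥0 × ℝ) : ℝ := g (min p.1 T) p.2 ω

theorem qf_congr {ρ : Measure (ℝ≥0 × ℝ × ℝ) × Measure (ℝ≥0 × ℝ × ℝ)} {t : ℝ≥0} {u v : ℝ≥0 × ℝ → ℝ}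
    (h : ∀ p, p.1 ≤ t → u p = v p) : qf (upTo t ρ) u = qf (upTo t ρ) v := by
  have hS : MeasurableSet (Set.Iic t ×ˢ Set.univ : Set (ℝ≥0 × ℝ × ℝ)) := measurableSet_Iic.prod .univ
  have : ∀ z ∈ (Set.Iic t ×ˢ Set.univ : Set (ℝ≥0 × ℝ × ℝ)), tens u u z = tens v v z := fun z hz => by
    simp only [tens, h (z.1, z.2.1) hz.1, h (z.1, z.2.2) hz.1]
  simp only [qf, sInt, upTo]
  rw [setIntegral_congr_fun hS this, setIntegral_congr_fun hS this]

variable {T : ℝ≥0} {Γ : ℝ≥0 → ℝ → ℝ → Ω → ℝ}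

theorem crossInt_eq (g : RField Ω) {t : ℝ≥0} (ht : t ≤ T) (ω : Ω) :
    crossInt T Γ g t ω = qf (upTo t (crossPair T Γ ω)) (sec T g ω) := by
  rw [← qf_congr (u := fun p => g p.1 p.2 ω) fun p hp => by
    rw [sec, min_eq_left (hp.trans ht)]]
  rfl

/-- The integral of `|u(s, x) v(s, y)|` against the total variation measure. -/
def absForm (T : ℝ≥0) (Γ : ℝ≥0 → ℝ → ℝ → Ω → ℝ) (u v : RField Ω) (ω : Ω) : ℝ≥0∞ :=
  ∫⁻ z, ‖tens (sec T u ω) (sec T v ω) z‖ₑ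
    ∂((upTo T (crossPair T Γ ω)).1 + (upTo T (crossPair T Γ ω)).2)

theorem abs_crossInt_le {u : RField Ω} {t : ℝ≥0} (ht : t ≤ T) (ω : Ω) :
    ENNReal.ofReal |crossInt T Γ u t ω| ≤ absForm T Γ u u ω := by
  rw [crossInt_eq u ht]
  refine abs_sInt_le.trans ?_
  rw [absForm, upTo_add, upTo_add]
  exact lintegral_mono' (Measure.restrict_mono (Set.prod_mono (Set.Iic_subset_Iic.2 ht) subset_rfl)
    le_rfl) le_rfl

variable [MeasurableSpace Ω] {P : Measure Ω} {ℱ : Filtration ℝ≥0 ‹MeasurableSpace Ω›}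

theorem absInt_eq (u v : RField Ω) : absInt P T Γ u v = ∫⁻ ω, absForm T Γ u v ω ∂P := by
  have hS : MeasurableSet (Set.Iic T ×ˢ Set.univ : Set (ℝ≥0 × ℝ × ℝ)) := measurableSet_Iic.prod .univ
  refine lintegral_congr fun ω => ?_
  rw [absForm, upTo_add]
  refine setLIntegral_congr_fun hS fun z hz => ?_
  simp only [tens, sec, min_eq_left (show z.1 ≤ T from hz.1)]

/-- Joint measurability on `[0, T] × ℝ × Ω`. -/
def IsJointMeas (T : ℝ≥0) (g : RField Ω) : Prop :=
  Measurable (fun p : Set.Iic T × ℝ × Ω => g p.1 p.2.1 p.2.2)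

theorem IsJointMeas.sub {g k : RField Ω} (hg : IsJointMeas T g) (hk : IsJointMeas T k) :
    IsJointMeas T fun s x ω => g s x ω - k s x ω := Measurable.sub hg hk

theorem IsJointMeas.measurable_sec {g : RField Ω} (hg : IsJointMeas T g) :
    Measurable fun q : Ω × ℝ≥0 × ℝ => sec T g q.1 q.2 := by
  have h1 : Measurable fun q : Ω × ℝ≥0 × ℝ => (⟨min q.2.1 T, Set.mem_Iic.2 (min_le_right _ _)⟩ : Set.Iic T) :=
    (measurable_snd.fst.min measurable_const).subtype_mk
  have h2 : Measurable fun q : Ω × ℝ≥0 × ℝ =>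
      ((⟨min q.2.1 T, Set.mem_Iic.2 (min_le_right _ _)⟩ : Set.Iic T), q.2.2, q.1) :=
    h1.prodMk (measurable_snd.snd.prodMk measurable_fst)
  have := Measurable.comp hg h2
  exact this

theorem IsJointMeas.measurable_sec_apply {g : RField Ω} (hg : IsJointMeas T g) (ω : Ω) :
    Measurable (sec T g ω) := by
  have := hg.measurable_sec.comp (measurable_prodMk_left (x := ω))
  exact this

theorem IsJointMeas.measurable_tens {u v : RField Ω} (hu : IsJointMeas T u) (hv : IsJointMeas T v) :
    Measurable fun q : Ω × ℝ≥0 × ℝ × ℝ => tens (sec T u q.1) (sec T v q.1) q.2 := by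
  have h1 : Measurable fun q : Ω × ℝ≥0 × ℝ × ℝ => (q.1, q.2.1, q.2.2.1) :=
    measurable_fst.prodMk (measurable_snd.fst.prodMk measurable_snd.snd.fst)
  have h2 : Measurable fun q : Ω × ℝ≥0 × ℝ × ℝ => (q.1, q.2.1, q.2.2.2) :=
    measurable_fst.prodMk (measurable_snd.fst.prodMk measurable_snd.snd.snd)
  have := (hu.measurable_sec.comp h1).mul (hv.measurable_sec.comp h2)
  exact this

/-- A version of the cross-variation all of whose paths are good. -/
structure IsGoodVersion (P : Measure Ω) (ℱ : Filtration ℝ≥0 ‹MeasurableSpace Ω›) (T : ℝ≥0)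
    (Γ : ℝ≥0 → ℝ → ℝ → Ω → ℝ) (G : Ω → ℝ≥0 → ℝ → ℝ → ℝ) : Prop where
  good : ∀ ω, IsGoodPath T (G ω)
  ae_eq : ∀ᵐ ω ∂P, crossPair T Γ ω = pathPair T (G ω)
  meas : ∀ s ≤ T, ∀ x y, Measurable fun ω => G ω s x y
  adapted : ∀ s ≤ T, ∀ x y, Measurable[eventuallyMeasurableSpace (ℱ s) (ae P)] fun ω => G ω s x y

/-- `Γ` is replaced by zero on a measurable null set that contains all bad paths. This set need not
lie in `ℱ s`, as the filtration is not assumed complete, so adaptedness survives only up to null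
sets. -/
theorem IsV2.exists_goodVersion [IsProbabilityMeasure P] {h : RField Ω} (hh : IsV2 P ℱ T h Γ) :
    ∃ G, IsGoodVersion P ℱ T Γ G := by
  classical
  obtain ⟨S, hSsub, hSm, hS0⟩ := exists_measurable_superset_of_null
    (ae_iff.1 hh.ae_isGoodPath)
  have hSae : ∀ᵐ ω ∂P, ω ∉ S := measure_eq_zero_iff_ae_notMem.1 hS0
  set G : Ω → ℝ≥0 → ℝ → ℝ → ℝ := fun ω s x y => if ω ∈ S then 0 else Γ s x y ω with hG
  have hGΓ : ∀ s x y, (fun ω => G ω s x y) =ᵐ[P] Γ s x y := fun s x y => by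
    filter_upwards [hSae] with ω hω
    simp [hG, hω]
  refine ⟨G, fun ω => ?_, ?_, fun s hs x y => ?_, fun s hs x y => ?_⟩
  · by_cases hω : ω ∈ S
    · have : G ω = fun _ _ _ => 0 := by funext s x y; simp [hG, hω]
      rw [this]; exact isGoodPath_zero T
    · have : G ω = fun s x y => Γ s x y ω := by funext s x y; simp [hG, hω]
      rw [this]
      by_contra hcon
      exact hω (hSsub hcon)
  · filter_upwards [hSae] with ω hω
    have : G ω = fun s x y => Γ s x y ω := by funext s x y; simp [hG, hω]
    rw [this]
    rfl
  · exact Measurable.ite hSm measurable_const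
      (((hh.crossVar x y).adapted s hs).mono (ℱ.le s) le_rfl)
  · exact ((hh.crossVar x y).adapted s hs).eventuallyMeasurable_of_eventuallyEq (hGΓ s x y)

variable {G : Ω → ℝ≥0 → ℝ → ℝ → ℝ}

theorem IsGoodVersion.aemeasurable_absForm (hG : IsGoodVersion P ℱ T Γ G) {u v : RField Ω}
    (hu : IsJointMeas T u) (hv : IsJointMeas T v) : AEMeasurable (absForm T Γ u v) P := by
  have h1 := measurable_lintegral_pathPair hG.good le_rfl hG.meas (hu.measurable_tens hv).enorm
  refine ⟨_, h1.1.add h1.2, ?_⟩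
  filter_upwards [hG.ae_eq] with ω hω
  rw [absForm, hω, lintegral_add_measure]
  rfl

theorem absForm_eq_integrable {u : RField Ω} (hu : IsJointMeas T u) {ω : Ω}
    (h : absForm T Γ u u ω < ∞) {t : ℝ≥0} (ht : t ≤ T) :
    Integrable (tens (sec T u ω) (sec T u ω))
      ((upTo t (crossPair T Γ ω)).1 + (upTo t (crossPair T Γ ω)).2) := by
  have h1 : Integrable (tens (sec T u ω) (sec T u ω))
      ((upTo T (crossPair T Γ ω)).1 + (upTo T (crossPair T Γ ω)).2) :=
    ⟨(measurable_tens (hu.measurable_sec_apply ω) (hu.measurable_sec_apply ω)).aestronglyMeasurable,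
      h⟩
  rw [upTo_add] at h1 ⊢
  exact h1.mono_measure (Measure.restrict_mono (Set.prod_mono (Set.Iic_subset_Iic.2 ht) subset_rfl)
    le_rfl)

theorem IsGoodVersion.ae_isPSDPair (hG : IsGoodVersion P ℱ T Γ G) :
    ∀ᵐ ω ∂P, ∀ t ≤ T, IsPSDPair (upTo t (crossPair T Γ ω)) := by
  filter_upwards [hG.ae_eq] with ω hω t ht
  rw [hω]
  exact (hG.good ω).isPSDPair ht

/-- Where the absolute form is finite, both integrals are differences of integrals of positive and
negative parts, whose measurability is known. -/
theorem IsGoodVersion.aestronglyMeasurable_crossInt (hG : IsGoodVersion P ℱ T Γ G) {u : RField Ω}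
    (hu : IsJointMeas T u) (hfin : ∀ᵐ ω ∂P, absForm T Γ u u ω < ∞) {t : ℝ≥0} (ht : t ≤ T) :
    AEStronglyMeasurable (crossInt T Γ u t) P := by
  have hm := hu.measurable_tens hu
  have h1 := measurable_lintegral_pathPair hG.good ht (fun s hs => hG.meas s (hs.trans ht))
    hm.ennreal_ofReal
  have h2 := measurable_lintegral_pathPair hG.good ht (fun s hs => hG.meas s (hs.trans ht))
    hm.neg.ennreal_ofReal
  refine (AEMeasurable.aestronglyMeasurable ⟨_, (h1.1.ennreal_toReal.sub h2.1.ennreal_toReal).sub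
    (h1.2.ennreal_toReal.sub h2.2.ennreal_toReal), ?_⟩)
  filter_upwards [hG.ae_eq, hfin] with ω hω hf
  have hint := absForm_eq_integrable hu hf ht
  obtain ⟨hi1, hi2⟩ := integrable_add_measure.1 hint
  rw [crossInt_eq u ht, qf, sInt, integral_eq_lintegral_pos_part_sub_lintegral_neg_part hi1,
    integral_eq_lintegral_pos_part_sub_lintegral_neg_part hi2, hω]
  rfl

theorem IsGoodVersion.ae_absForm_lt_top (hG : IsGoodVersion P ℱ T Γ G) {u v : RField Ω}
    (hu : IsJointMeas T u) (hv : IsJointMeas T v) (h : absInt P T Γ u v < ∞) :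
    ∀ᵐ ω ∂P, absForm T Γ u v ω < ∞ := by
  rw [absInt_eq] at h
  exact ae_lt_top' (hG.aemeasurable_absForm hu hv) h.ne

theorem IsGoodVersion.integrable_crossInt (hG : IsGoodVersion P ℱ T Γ G) {u : RField Ω}
    (hu : IsJointMeas T u) (h : absInt P T Γ u u < ∞) {t : ℝ≥0} (ht : t ≤ T) :
    Integrable (crossInt T Γ u t) P := by
  refine ⟨hG.aestronglyMeasurable_crossInt hu (hG.ae_absForm_lt_top hu hu h) ht, ?_⟩
  refine lt_of_le_of_lt (lintegral_mono fun ω => ?_) ((absInt_eq u u).symm.trans_lt h)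
  rw [← ofReal_norm]
  exact abs_crossInt_le ht ω

theorem IsGoodVersion.ae_crossInt_nonneg (hG : IsGoodVersion P ℱ T Γ G) {u : RField Ω}
    (hu : IsJointMeas T u) (hfin : ∀ᵐ ω ∂P, absForm T Γ u u ω < ∞) {t : ℝ≥0} (ht : t ≤ T) :
    ∀ᵐ ω ∂P, 0 ≤ crossInt T Γ u t ω := by
  filter_upwards [hG.ae_isPSDPair, hfin] with ω h1 h2
  rw [crossInt_eq u ht]
  exact (h1 t ht).qf_nonneg (hu.measurable_sec_apply ω) (absForm_eq_integrable hu h2 ht)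

/-- The random seminorm of a field. -/
def crossNorm (T : ℝ≥0) (Γ : ℝ≥0 → ℝ → ℝ → Ω → ℝ) (u : RField Ω) (t : ℝ≥0) (ω : Ω) : ℝ :=
  √(crossInt T Γ u t ω)

/-- Only the diagonal forms have to be finite; nothing is asked of the mixed forms of two different
summands. -/
theorem IsGoodVersion.ae_crossNorm_sum_le (hG : IsGoodVersion P ℱ T Γ G) {ι : Type*} (s : Finset ι)
    {u : RField Ω} {v : ι → RField Ω} (hv : ∀ i ∈ s, IsJointMeas T (v i)) (hu : IsJointMeas T u)
    (huv : ∀ r x ω, u r x ω = ∑ i ∈ s, v i r x ω)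
    (hfv : ∀ i ∈ s, ∀ᵐ ω ∂P, absForm T Γ (v i) (v i) ω < ∞)
    (hfu : ∀ᵐ ω ∂P, absForm T Γ u u ω < ∞) {t : ℝ≥0} (ht : t ≤ T) :
    ∀ᵐ ω ∂P, crossNorm T Γ u t ω ≤ ∑ i ∈ s, crossNorm T Γ (v i) t ω := by
  have hfv' : ∀ᵐ ω ∂P, ∀ i ∈ s, absForm T Γ (v i) (v i) ω < ∞ :=
    (ae_ball_iff s.countable_toSet).2 hfv
  filter_upwards [hG.ae_isPSDPair, hfv', hfu] with ω h1 h2 h3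
  have h4 : sec T u ω = fun p => ∑ i ∈ s, sec T (v i) ω p := funext fun p => huv _ _ _
  simp only [crossNorm, crossInt_eq _ ht]
  have h5 := absForm_eq_integrable hu h3 ht
  rw [h4] at h5 ⊢
  exact sqrt_qf_sum_le (h1 t ht) s (fun i hi => (hv i hi).measurable_sec_apply ω)
    (fun i hi => absForm_eq_integrable (hv i hi) (h2 i hi) ht) h5

theorem IsGoodVersion.eLpNorm_crossNorm_sq (hG : IsGoodVersion P ℱ T Γ G) {u : RField Ω}
    (hu : IsJointMeas T u) (hfin : ∀ᵐ ω ∂P, absForm T Γ u u ω < ∞) {t : ℝ≥0} (ht : t ≤ T) :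
    eLpNorm (crossNorm T Γ u t) 2 P ^ 2 = ∫⁻ ω, ENNReal.ofReal (crossInt T Γ u t ω) ∂P := by
  have h2 := eLpNorm_nnreal_pow_eq_lintegral (f := crossNorm T Γ u t) (μ := P) (p := 2) (by simp)
  have h3 : ∀ a : ℝ≥0∞, a ^ (((2 : ℝ≥0) : ℝ)) = a ^ 2 := fun a => by
    rw [← ENNReal.rpow_natCast]; norm_num
  rw [h3] at h2
  rw [show ((2 : ℝ≥0) : ℝ≥0∞) = 2 by norm_num] at h2
  rw [h2]
  refine lintegral_congr_ae ?_
  filter_upwards [hG.ae_crossInt_nonneg hu hfin ht] with ω h0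
  rw [h3, ← ofReal_norm, ← ENNReal.ofReal_pow (norm_nonneg _), Real.norm_eq_abs, sq_abs, crossNorm,
    Real.sq_sqrt h0]

theorem IsGoodVersion.eLpNorm_crossNorm_sq_le (hG : IsGoodVersion P ℱ T Γ G) {u : RField Ω}
    (hu : IsJointMeas T u) (h : absInt P T Γ u u < ∞) {t : ℝ≥0} (ht : t ≤ T) :
    eLpNorm (crossNorm T Γ u t) 2 P ^ 2 ≤ absInt P T Γ u u := by
  rw [hG.eLpNorm_crossNorm_sq hu (hG.ae_absForm_lt_top hu hu h) ht, absInt_eq]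
  refine lintegral_mono fun ω => ?_
  exact (ENNReal.ofReal_le_ofReal (le_abs_self _)).trans (abs_crossInt_le ht ω)

theorem IsGoodVersion.aestronglyMeasurable_crossNorm (hG : IsGoodVersion P ℱ T Γ G) {u : RField Ω}
    (hu : IsJointMeas T u) (hfin : ∀ᵐ ω ∂P, absForm T Γ u u ω < ∞) {t : ℝ≥0} (ht : t ≤ T) :
    AEStronglyMeasurable (crossNorm T Γ u t) P :=
  (Real.continuous_sqrt.comp_aestronglyMeasurable (hG.aestronglyMeasurable_crossInt hu hfin ht))

/-- Simple functions have finite forms, path by path. -/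
theorem IsGoodVersion.ae_absForm_simple_lt_top (hG : IsGoodVersion P ℱ T Γ G) (φ : Simple ℱ T) :
    ∀ᵐ ω ∂P, absForm T Γ φ.toField φ.toField ω < ∞ := by
  filter_upwards [hG.ae_isPSDPair] with ω h1
  have h2 := integrable_tens_of_bdd (h1 T le_rfl).fin (φ.isBddSupp ω) (φ.isBddSupp ω)
  have hS : MeasurableSet (Set.Iic T ×ˢ Set.univ : Set (ℝ≥0 × ℝ × ℝ)) := measurableSet_Iic.prod .univ
  have h3 : absForm T Γ φ.toField φ.toField ω = ∫⁻ z, ‖tens (fun p => φ.toField p.1 p.2 ω)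
      (fun p => φ.toField p.1 p.2 ω) z‖ₑ
      ∂((upTo T (crossPair T Γ ω)).1 + (upTo T (crossPair T Γ ω)).2) := by
    rw [absForm, upTo_add]
    refine setLIntegral_congr_fun hS fun z hz => ?_
    simp only [tens, sec, min_eq_left (show z.1 ≤ T from hz.1)]
  rw [h3]
  exact h2.2

theorem IsV2.ae_crossInt_simple [IsProbabilityMeasure P] {h : RField Ω} (hh : IsV2 P ℱ T h Γ)
    (φ : Simple ℱ T) :
    ∀ᵐ ω ∂P, ∀ t ≤ T, crossInt T Γ φ.toField t ω = ∑ j, ∑ i, ∑ k, φ.e j i ω * φ.e j k ω *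
        boxInc (fun s x y => Γ s x y ω) (min (φ.t j.castSucc) t) (min (φ.t j.succ) t)
          (φ.x i.castSucc) (φ.x i.succ) (φ.x k.castSucc) (φ.x k.succ) := by
  filter_upwards [hh.ae_isGoodPath] with ω hω t ht
  rw [← hω.qf_simple φ ω ht]
  rfl

end

/-! ### Convergence in `L²` -/

theorem tendsto_of_le_add_of_le_add {ι : Type*} {l : Filter ι} {f δ : ι → ℝ≥0∞} {y : ℝ≥0∞}
    (h1 : ∀ᶠ a in l, f a ≤ y + δ a) (h2 : ∀ᶠ a in l, y ≤ f a + δ a) (hδ : Tendsto δ l (𝓝 0)) :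
    Tendsto f l (𝓝 y) := by
  have e1 : Tendsto (fun a => y + δ a) l (𝓝 y) := by
    simpa using tendsto_const_nhds.add hδ
  have e2 : Tendsto (fun a => y - δ a) l (𝓝 y) := by
    simpa using ENNReal.Tendsto.sub tendsto_const_nhds hδ (Or.inr ENNReal.zero_ne_top)
  exact tendsto_of_tendsto_of_tendsto_of_le_of_le' e2 e1
    (h2.mono fun a ha => tsub_le_iff_right.2 ha) h1

section

variable {Ω : Type*} [MeasurableSpace Ω] {P : Measure Ω} {ℱ : Filtration ℝ≥0 ‹MeasurableSpace Ω›}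
  {T : ℝ≥0}

theorem tendsto_eLpNorm_of_tendsto_sub {ι : Type*} {l : Filter ι} {X : ι → Ω → ℝ} {Y : Ω → ℝ}
    {p : ℝ≥0∞} (hp : 1 ≤ p) (hX : ∀ a, AEStronglyMeasurable (X a) P) (hY : AEStronglyMeasurable Y P)
    (h : Tendsto (fun a => eLpNorm (fun ω => X a ω - Y ω) p P) l (𝓝 0)) :
    Tendsto (fun a => eLpNorm (X a) p P) l (𝓝 (eLpNorm Y p P)) := by
  refine tendsto_of_le_add_of_le_add (.of_forall fun a => ?_) (.of_forall fun a => ?_) h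
  · have := eLpNorm_add_le hY ((hX a).sub hY) hp
    rw [add_sub_cancel] at this
    exact this
  · have := eLpNorm_add_le (hX a) (hY.sub (hX a)) hp
    rw [add_sub_cancel] at this
    rw [eLpNorm_sub_comm] at this
    exact this

theorem integral_sq_eq {X : Ω → ℝ} (hX : AEStronglyMeasurable X P) :
    ∫ ω, X ω ^ 2 ∂P = (eLpNorm X 2 P ^ 2).toReal := by
  have h2 := eLpNorm_nnreal_pow_eq_lintegral (f := X) (μ := P) (p := 2) (by simp)
  have h3 : ∀ a : ℝ≥0∞, a ^ (((2 : ℝ≥0) : ℝ)) = a ^ 2 := fun a => by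
    rw [← ENNReal.rpow_natCast]; norm_num
  simp only [h3] at h2
  rw [show ((2 : ℝ≥0) : ℝ≥0∞) = 2 by norm_num] at h2
  rw [h2, integral_eq_lintegral_of_nonneg_ae (.of_forall fun ω => sq_nonneg _) (hX.pow 2)]
  congr 1
  refine lintegral_congr fun ω => ?_
  rw [← ofReal_norm, ← ENNReal.ofReal_pow (norm_nonneg _), Real.norm_eq_abs, sq_abs]

theorem eLpNorm_sq_eq_lintegral (X : Ω → ℝ) :
    eLpNorm X 2 P ^ 2 = ∫⁻ ω, ENNReal.ofReal (X ω ^ 2) ∂P := by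
  have h2 := eLpNorm_nnreal_pow_eq_lintegral (f := X) (μ := P) (p := 2) (by simp)
  have h3 : ∀ a : ℝ≥0∞, a ^ (((2 : ℝ≥0) : ℝ)) = a ^ 2 := fun a => by
    rw [← ENNReal.rpow_natCast]; norm_num
  simp only [h3] at h2
  rw [show ((2 : ℝ≥0) : ℝ≥0∞) = 2 by norm_num] at h2
  rw [h2]
  refine lintegral_congr fun ω => ?_
  rw [← ofReal_norm, ← ENNReal.ofReal_pow (norm_nonneg _), Real.norm_eq_abs, sq_abs]

theorem tendsto_zero_of_sq {ι : Type*} {l : Filter ι} {f : ι → ℝ≥0∞}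
    (h : Tendsto (fun a => f a ^ 2) l (𝓝 0)) : Tendsto f l (𝓝 0) := by
  have := (ENNReal.continuous_rpow_const (y := 1 / 2)).tendsto 0 |>.comp h
  rw [ENNReal.zero_rpow_of_pos (by norm_num)] at this
  refine this.congr fun a => ?_
  simp only [Function.comp]
  rw [← ENNReal.rpow_natCast, ← ENNReal.rpow_mul]; norm_num

/-- `L¹`-limits of martingales are martingales. -/
theorem IsMart.of_tendsto [IsFiniteMeasure P] {ι : Type*} {l : Filter ι} [l.NeBot] {X : ι → Proc Ω}
    {Y : Proc Ω} (hX : ∀ a, IsMart P ℱ T (X a)) (hm : ∀ t ≤ T, Measurable[ℱ t] (Y t))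
    (hi : ∀ t ≤ T, Integrable (Y t) P)
    (h : ∀ t ≤ T, Tendsto (fun a => eLpNorm (fun ω => X a t ω - Y t ω) 1 P) l (𝓝 0)) :
    IsMart P ℱ T Y := by
  refine .of_condExp hm hi fun s t hst ht => ?_
  refine (ae_eq_condExp_of_forall_setIntegral_eq (ℱ.le s) (hi t ht)
    (fun D _ _ => (hi s (hst.trans ht)).integrableOn) (fun D hD _ => ?_)
    (hm s (hst.trans ht)).stronglyMeasurable.aestronglyMeasurable).symm
  have key : ∀ r ≤ T, Tendsto (fun a => ∫ ω in D, X a r ω ∂P) l (𝓝 (∫ ω in D, Y r ω ∂P)) :=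
    fun r hr => tendsto_setIntegral_of_L1' _ (hi r hr).1 (.of_forall fun a => (hX a).integrable hr)
      (h r hr) D
  refine tendsto_nhds_unique (key s (hst.trans ht)) ((key t ht).congr fun a => ?_)
  rw [← setIntegral_condExp (ℱ.le s) ((hX a).integrable ht) hD]
  exact integral_congr_ae (ae_restrict_of_ae ((hX a).condExp_eq hst ht))

theorem IsContM2.of_cont {X : Proc Ω} (hX : IsMart P ℱ T X) (h2 : MemLp (X T) 2 P)
    (hc : ∀ᵐ ω ∂P, ContinuousOn (fun s => X s ω) (Set.Iic T)) : IsContM2 P ℱ T X :=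
  { mart := hX, memLp := h2, cont := hc
    rightCont := hc.mono fun _ hω _ ht =>
      (hω.continuousAt (Iic_mem_nhds ht)).continuousWithinAt }

/-! ### Increments of martingales -/

/-- Only the product has to be integrable, `ξ` need not be bounded: it will contain values of other
martingales. For `t ≤ s` the two stopped values coincide and there is nothing to prove. -/
theorem IsMart.integral_mul_incr_eq_zero [IsFiniteMeasure P] {N : Proc Ω} (hN : IsMart P ℱ T N)
    {ξ : Ω → ℝ} {s r t : ℝ≥0} (hξ : Measurable[ℱ s] ξ) (hsr : s ≤ r) (hr : r ≤ T)
    (hint : Integrable (fun ω => ξ ω * (N (min r t) ω - N (min s t) ω)) P) :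
    ∫ ω, ξ ω * (N (min r t) ω - N (min s t) ω) ∂P = 0 := by
  rcases le_total t s with h | h
  · simp [min_eq_right h, min_eq_right (h.trans hsr)]
  · have hr' : min r t ≤ T := (min_le_left _ _).trans hr
    have hs' : min s t ≤ min r t := min_le_min_right t hsr
    rw [min_eq_left h] at hint hs' ⊢
    have hi : Integrable (fun ω => N (min r t) ω - N s ω) P :=
      (hN.integrable hr').sub (hN.integrable (hs'.trans hr'))
    have h1 := condExp_mul_of_stronglyMeasurable_left (m := ℱ s) hξ.stronglyMeasurable hint hi
    have h2 : P[fun ω => N (min r t) ω - N s ω | ℱ s] =ᵐ[P] 0 := by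
      have e1 := condExp_sub (hN.integrable hr') (hN.integrable (hs'.trans hr')) (ℱ s)
      have e2 := hN.condExp_eq hs' hr'
      have e3 : P[N s | ℱ s] = N s := condExp_of_stronglyMeasurable (ℱ.le s)
        (hN.measurable (hs'.trans hr')).stronglyMeasurable (hN.integrable (hs'.trans hr'))
      filter_upwards [e1, e2] with ω h1 h2
      have h4 : P[fun ω => N (min r t) ω - N s ω | ℱ s] ω = P[N (min r t) - N s | ℱ s] ω := rfl
      rw [h4, h1, Pi.sub_apply, h2, e3]
      simp
    rw [← integral_condExp (ℱ.le s)]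
    refine (integral_congr_ae (g := fun _ => (0 : ℝ)) ?_).trans (by simp)
    refine h1.trans ?_
    filter_upwards [h2] with ω h2
    rw [Pi.mul_apply, h2]; simp

theorem integrable_bdd_mul {ξ f : Ω → ℝ} (hξ : Measurable ξ) {C : ℝ} (hC : ∀ ω, |ξ ω| ≤ C)
    (hf : Integrable f P) : Integrable (fun ω => ξ ω * f ω) P :=
  hf.bdd_mul (c := C) hξ.aestronglyMeasurable (.of_forall hC)

theorem memLp_bdd_mul {ξ f : Ω → ℝ} (hξ : Measurable ξ) {C : ℝ} (hC : ∀ ω, |ξ ω| ≤ C) {p : ℝ≥0∞}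
    (hf : MemLp f p P) : MemLp (fun ω => ξ ω * f ω) p P :=
  hf.of_le_mul (c := C) (hξ.aestronglyMeasurable.mul hf.1) (.of_forall fun ω => by
    rw [norm_mul]; gcongr; exact hC ω)

/-- Elementary stochastic integrals are martingales. -/
theorem IsMart.mul_incr [IsFiniteMeasure P] {N : Proc Ω} (hN : IsMart P ℱ T N)
    {ξ : Ω → ℝ} {s r : ℝ≥0} (hξ : Measurable[ℱ s] ξ) {C : ℝ} (hC : ∀ ω, |ξ ω| ≤ C) (hsr : s ≤ r)
    (hr : r ≤ T) : IsMart P ℱ T fun t ω => ξ ω * (N (min r t) ω - N (min s t) ω) := by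
  have hξ' : Measurable ξ := hξ.mono (ℱ.le s) le_rfl
  have hi : ∀ t ≤ T, Integrable (fun ω => ξ ω * (N (min r t) ω - N (min s t) ω)) P := fun t ht =>
    integrable_bdd_mul hξ' hC ((hN.integrable ((min_le_right _ _).trans ht)).sub
      (hN.integrable ((min_le_right _ _).trans ht)))
  have hm : ∀ t ≤ T, Measurable[ℱ t] fun ω => ξ ω * (N (min r t) ω - N (min s t) ω) := by
    intro t ht
    rcases le_total t s with h | h
    · simp only [min_eq_right h, min_eq_right (h.trans hsr), sub_self, mul_zero]
      exact measurable_const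
    · have : ∀ a, Measurable[ℱ t] (N (min a t)) := fun a =>
        (hN.measurable ((min_le_right _ _).trans ht)).mono (ℱ.mono (min_le_right _ _)) le_rfl
      exact (hξ.mono (ℱ.mono h) le_rfl).mul ((this r).sub (this s))
  refine .of_condExp hm hi fun u t hut ht => ?_
  refine (ae_eq_condExp_of_forall_setIntegral_eq (ℱ.le u) (hi t ht)
    (fun D _ _ => (hi u (hut.trans ht)).integrableOn) (fun D hD _ => ?_)
    (hm u (hut.trans ht)).stronglyMeasurable.aestronglyMeasurable).symm
  have hDm := ℱ.le u _ hD
  rw [eq_comm, ← sub_eq_zero, ← integral_sub (hi t ht).integrableOn (hi u (hut.trans ht)).integrableOn,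
    ← integral_indicator hDm]
  have hind : ∀ ω, |D.indicator ξ ω| ≤ C := fun ω => (norm_indicator_le_norm_self ξ ω).trans (hC ω)
  -- If `u ≤ s`, the process is still zero at `u` and `1_D ξ` is known at `s`. If `s ≤ u`, what
  -- remains is the increment of `N` from `u` to `t`, stopped at `r`, and `1_D ξ` is known at `u`.
  -- Both cases are centred increments.
  rcases le_total u s with hus | hus
  · have h1 : ∀ ω, D.indicator (fun ω => ξ ω * (N (min r t) ω - N (min s t) ω)
        - ξ ω * (N (min r u) ω - N (min s u) ω)) ω
        = D.indicator ξ ω * (N (min r t) ω - N (min s t) ω) := fun ω => by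
      by_cases hω : ω ∈ D <;> simp [hω, min_eq_right hus, min_eq_right (hus.trans hsr)]
    simp_rw [h1]
    refine hN.integral_mul_incr_eq_zero (hξ.indicator (ℱ.mono hus _ hD)) hsr hr ?_
    exact integrable_bdd_mul (hξ'.indicator hDm) hind ((hN.integrable ((min_le_right _ _).trans ht)).sub
      (hN.integrable ((min_le_right _ _).trans ht)))
  · have h1 : ∀ ω, D.indicator (fun ω => ξ ω * (N (min r t) ω - N (min s t) ω)
        - ξ ω * (N (min r u) ω - N (min s u) ω)) ω
        = D.indicator ξ ω * (N (min t r) ω - N (min u r) ω) := fun ω => by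
      by_cases hω : ω ∈ D
      · simp only [Set.indicator_of_mem hω, min_eq_left hus, min_eq_left (hus.trans hut), min_comm t r,
          min_comm u r]
        ring
      · simp [hω]
    simp_rw [h1]
    refine hN.integral_mul_incr_eq_zero ((hξ.mono (ℱ.mono hus) le_rfl).indicator hD) hut ht ?_
    exact integrable_bdd_mul (hξ'.indicator hDm) hind ((hN.integrable ((min_le_right _ _).trans hr)).sub
      (hN.integrable ((min_le_right _ _).trans hr)))

end

/-! ### The isometry for simple functions -/

section

variable {Ω : Type*} [MeasurableSpace Ω] {P : Measure Ω} {ℱ : Filtration ℝ≥0 ‹MeasurableSpace Ω›}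
  {T : ℝ≥0} {h : RField Ω} {Γ : ℝ≥0 → ℝ → ℝ → Ω → ℝ}

/-- The increment of `h` over the `i`-th space interval of the grid of `φ`. -/
def Simple.proc (φ : Simple ℱ T) (h : RField Ω) (i : Fin φ.n) : Proc Ω := fun r ω =>
  h r (φ.x i.succ) ω - h r (φ.x i.castSucc) ω

/-- The increment of the process over the `j`-th time interval. -/
def Simple.incr (φ : Simple ℱ T) (h : RField Ω) (j : Fin φ.m) (i : Fin φ.n) (t : ℝ≥0) (ω : Ω) : ℝ :=
  φ.proc h i (min (φ.t j.succ) t) ω - φ.proc h i (min (φ.t j.castSucc) t) ω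

/-- The part of the integral of `φ` over the `j`-th time interval. -/
def Simple.slice (φ : Simple ℱ T) (h : RField Ω) (j : Fin φ.m) (t : ℝ≥0) (ω : Ω) : ℝ :=
  ∑ i, φ.e j i ω * φ.incr h j i t ω

/-- The part of the quadratic form of `φ` over the `j`-th time interval. -/
def Simple.sliceForm (φ : Simple ℱ T) (Γ : ℝ≥0 → ℝ → ℝ → Ω → ℝ) (j : Fin φ.m) (t : ℝ≥0) (ω : Ω) : ℝ :=
  ∑ i, ∑ k, φ.e j i ω * φ.e j k ω *
    boxInc (fun s x y => Γ s x y ω) (min (φ.t j.castSucc) t) (min (φ.t j.succ) t)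
      (φ.x i.castSucc) (φ.x i.succ) (φ.x k.castSucc) (φ.x k.succ)

theorem Simple.integral_eq_sum_slice (φ : Simple ℱ T) (h : RField Ω) (t : ℝ≥0) (ω : Ω) :
    φ.integral h t ω = ∑ j, φ.slice h j t ω := by
  unfold Simple.integral Simple.slice Simple.incr Simple.proc
  refine Finset.sum_congr rfl fun j _ => Finset.sum_congr rfl fun i _ => ?_
  ring

theorem Simple.measurable_e (φ : Simple ℱ T) (j : Fin φ.m) (i : Fin φ.n) : Measurable (φ.e j i) :=
  (φ.e_meas j i).mono (ℱ.le _) le_rfl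

/-- The cross-variation of the processes of the grid. -/
def Simple.crossVar (φ : Simple ℱ T) (Γ : ℝ≥0 → ℝ → ℝ → Ω → ℝ) (i k : Fin φ.n) : Proc Ω := fun r ω =>
  Γ r (φ.x i.succ) (φ.x k.succ) ω - Γ r (φ.x i.castSucc) (φ.x k.succ) ω
    - Γ r (φ.x i.succ) (φ.x k.castSucc) ω + Γ r (φ.x i.castSucc) (φ.x k.castSucc) ω

/-- The restriction of a simple function to events that depend on the time interval. -/
def Simple.restrict (φ : Simple ℱ T) (S : Fin φ.m → Set Ω) (hS : ∀ j, MeasurableSet[ℱ (φ.t j.castSucc)] (S j)) :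
    Simple ℱ T where
  m := φ.m
  n := φ.n
  t := φ.t
  x := φ.x
  e := fun j i => (S j).indicator (φ.e j i)
  t_mono := φ.t_mono
  t_le := φ.t_le
  x_mono := φ.x_mono
  e_meas := fun j i => (φ.e_meas j i).indicator (hS j)

variable [IsProbabilityMeasure P]

theorem IsV2.isMart_proc (hh : IsV2 P ℱ T h Γ) (φ : Simple ℱ T) (i : Fin φ.n) : IsMart P ℱ T (φ.proc h i) :=
  (hh.mart _).mart.sub (hh.mart _).mart

theorem IsV2.memLp_proc (hh : IsV2 P ℱ T h Γ) (φ : Simple ℱ T) (i : Fin φ.n) {t : ℝ≥0} (ht : t ≤ T) : MemLp (φ.proc h i t) 2 P :=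
  (hh.memLp _ ht).sub (hh.memLp _ ht)

theorem IsV2.memLp_incr (hh : IsV2 P ℱ T h Γ) (φ : Simple ℱ T) (j : Fin φ.m) (i : Fin φ.n) {t : ℝ≥0} (ht : t ≤ T) :
    MemLp (φ.incr h j i t) 2 P :=
  (hh.memLp_proc φ i ((min_le_right _ _).trans ht)).sub
    (hh.memLp_proc φ i ((min_le_right _ _).trans ht))

theorem IsV2.isMart_mul_sub_crossVar (hh : IsV2 P ℱ T h Γ) (φ : Simple ℱ T) (i k : Fin φ.n) :
    IsMart P ℱ T fun r ω => φ.proc h i r ω * φ.proc h k r ω - φ.crossVar Γ i k r ω := by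
  have h1 := fun a b => (hh.crossVar a b).mart
  have h2 := (((h1 (φ.x i.succ) (φ.x k.succ)).sub (h1 (φ.x i.castSucc) (φ.x k.succ))).sub
    (h1 (φ.x i.succ) (φ.x k.castSucc))).add (h1 (φ.x i.castSucc) (φ.x k.castSucc))
  convert h2 using 2 with r
  funext ω
  simp only [Simple.proc, Simple.crossVar]
  ring

theorem IsV2.integrable_crossVar (hh : IsV2 P ℱ T h Γ) (φ : Simple ℱ T) (i k : Fin φ.n) {t : ℝ≥0} (ht : t ≤ T) :
    Integrable (φ.crossVar Γ i k t) P :=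
  (((hh.integrable_Γ _ _ ht).sub (hh.integrable_Γ _ _ ht)).sub (hh.integrable_Γ _ _ ht)).add
    (hh.integrable_Γ _ _ ht)

/-- The bracket of two increments, weighted by the past. -/
theorem IsV2.integral_mul_incr_mul_incr (hh : IsV2 P ℱ T h Γ) (φ : Simple ℱ T) (j : Fin φ.m) (i k : Fin φ.n) {t : ℝ≥0} (ht : t ≤ T)
    {ξ : Ω → ℝ} (hξ : Measurable[ℱ (φ.t j.castSucc)] ξ) {C : ℝ} (hC : ∀ ω, |ξ ω| ≤ C) :
    ∫ ω, ξ ω * (φ.incr h j i t ω * φ.incr h j k t ω) ∂P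
      = ∫ ω, ξ ω * (φ.crossVar Γ i k (min (φ.t j.succ) t) ω
          - φ.crossVar Γ i k (min (φ.t j.castSucc) t) ω) ∂P := by
  have hξ' : Measurable ξ := hξ.mono (ℱ.le _) le_rfl
  set a := min (φ.t j.castSucc) t with ha
  set b := min (φ.t j.succ) t with hb
  have haT : a ≤ T := (min_le_right _ _).trans ht
  have hbT : b ≤ T := (min_le_right _ _).trans ht
  have hst := (φ.t_mono (Fin.castSucc_lt_succ (i := j))).le
  have hM := fun l => hh.isMart_proc φ l
  have hN := hh.isMart_mul_sub_crossVar φ i k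
  have hMa : ∀ l, Measurable[ℱ (φ.t j.castSucc)] (φ.proc h l a) := fun l =>
    ((hM l).measurable haT).mono (ℱ.mono (min_le_left _ _)) le_rfl
  have hξM : ∀ l, MemLp (fun ω => ξ ω * φ.proc h l a ω) 2 P := fun l =>
    memLp_bdd_mul hξ' hC (hh.memLp_proc φ l haT)
  have i1 : Integrable (fun ω => ξ ω * ((φ.proc h i b ω * φ.proc h k b ω - φ.crossVar Γ i k b ω)
      - (φ.proc h i a ω * φ.proc h k a ω - φ.crossVar Γ i k a ω))) P :=
    integrable_bdd_mul hξ' hC ((hN.integrable hbT).sub (hN.integrable haT))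
  have i2 : ∀ l l', Integrable (fun ω => (ξ ω * φ.proc h l a ω) * φ.incr h j l' t ω) P := fun l l' =>
    (hξM l).integrable_mul (hh.memLp_incr φ j l' ht)
  have i3 : Integrable (fun ω => ξ ω * (φ.crossVar Γ i k b ω - φ.crossVar Γ i k a ω)) P :=
    integrable_bdd_mul hξ' hC ((hh.integrable_crossVar φ i k hbT).sub
      (hh.integrable_crossVar φ i k haT))
  have z1 := hN.integral_mul_incr_eq_zero (t := t) hξ hst (φ.t_le _) i1
  have z2 : ∀ l l', ∫ ω, (ξ ω * φ.proc h l a ω) * φ.incr h j l' t ω ∂P = 0 := fun l l' =>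
    (hM l').integral_mul_incr_eq_zero (t := t) (hξ.mul (hMa l)) hst (φ.t_le _) (i2 l l')
  -- The product of two increments is the increment of the product minus two terms in which one
  -- factor is frozen at the left end. Those two are centred, and so is the increment of the product
  -- minus the bracket; only the bracket remains.
  have hid : ∀ ω, ξ ω * (φ.incr h j i t ω * φ.incr h j k t ω)
      = ((ξ ω * ((φ.proc h i b ω * φ.proc h k b ω - φ.crossVar Γ i k b ω)
        - (φ.proc h i a ω * φ.proc h k a ω - φ.crossVar Γ i k a ω))
        - (ξ ω * φ.proc h i a ω) * φ.incr h j k t ω)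
        - (ξ ω * φ.proc h k a ω) * φ.incr h j i t ω)
        + ξ ω * (φ.crossVar Γ i k b ω - φ.crossVar Γ i k a ω) := fun ω => by
    simp only [Simple.incr, ← ha, ← hb]
    ring
  simp_rw [hid]
  have i4 := i1.sub (i2 i k)
  have i5 := i4.sub (i2 k i)
  rw [integral_add (by exact i5) i3, integral_sub (by exact i4) (i2 k i), integral_sub i1 (i2 i k),
    z1, z2, z2]
  simp

theorem IsV2.memLp_slice (hh : IsV2 P ℱ T h Γ) (φ : Simple ℱ T) {C : ℝ} (hC : ∀ j i ω, |φ.e j i ω| ≤ C) (j : Fin φ.m) {t : ℝ≥0}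
    (ht : t ≤ T) : MemLp (φ.slice h j t) 2 P :=
  memLp_finsetSum _ fun i _ => memLp_bdd_mul (φ.measurable_e j i) (hC j i) (hh.memLp_incr φ j i ht)

/-- The earlier slice is known when the later time interval begins, and the later slice is a
combination of centred increments. -/
theorem IsV2.integral_slice_mul_slice (hh : IsV2 P ℱ T h Γ) (φ : Simple ℱ T) {C : ℝ} (hC : ∀ j i ω, |φ.e j i ω| ≤ C) {j j' : Fin φ.m}
    (hj : j < j') {t : ℝ≥0} (ht : t ≤ T) : ∫ ω, φ.slice h j t ω * φ.slice h j' t ω ∂P = 0 := by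
  have hle := φ.t_mono.monotone (Fin.succ_le_castSucc_iff.2 hj)
  have hm : Measurable[ℱ (φ.t j'.castSucc)] (φ.slice h j t) := by
    refine Finset.measurable_fun_sum _ fun i _ => ?_
    have h1 : ∀ r, r ≤ φ.t j.succ → Measurable[ℱ (φ.t j'.castSucc)] (φ.proc h i (min r t)) :=
      fun r hr => ((hh.isMart_proc φ i).measurable ((min_le_right _ _).trans ht)).mono
        (ℱ.mono ((min_le_left _ _).trans (hr.trans hle))) le_rfl
    have h2 := (φ.t_mono (Fin.castSucc_lt_succ (i := j))).le
    exact ((φ.e_meas j i).mono (ℱ.mono (h2.trans hle)) le_rfl).mul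
      ((h1 _ le_rfl).sub (h1 _ h2))
  have hi : ∀ i, Integrable (fun ω => (φ.slice h j t ω * φ.e j' i ω) * φ.incr h j' i t ω) P :=
    fun i => by
      have := (hh.memLp_slice φ hC j ht).integrable_mul
        (memLp_bdd_mul (φ.measurable_e j' i) (hC j' i) (hh.memLp_incr φ j' i ht))
      refine this.congr (.of_forall fun ω => ?_)
      simp only [Pi.mul_apply]; ring
  have h1 : ∀ ω, φ.slice h j t ω * φ.slice h j' t ω
      = ∑ i, (φ.slice h j t ω * φ.e j' i ω) * φ.incr h j' i t ω := fun ω => by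
    conv_lhs => rw [Simple.slice.eq_1 φ h j']
    rw [Finset.mul_sum]
    exact Finset.sum_congr rfl fun i _ => by ring
  simp_rw [h1]
  rw [integral_finsetSum _ fun i _ => hi i]
  refine Finset.sum_eq_zero fun i _ => ?_
  exact (hh.isMart_proc φ i).integral_mul_incr_eq_zero (t := t) (hm.mul (φ.e_meas j' i))
    (φ.t_mono (Fin.castSucc_lt_succ (i := j'))).le (φ.t_le _) (hi i)

theorem IsV2.integrable_sliceForm (hh : IsV2 P ℱ T h Γ) (φ : Simple ℱ T) {C : ℝ} (hC : ∀ j i ω, |φ.e j i ω| ≤ C) (j : Fin φ.m) {t : ℝ≥0}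
    (ht : t ≤ T) : Integrable (φ.sliceForm Γ j t) P := by
  refine integrable_finsetSum _ fun i _ => integrable_finsetSum _ fun k _ => ?_
  refine integrable_bdd_mul ((φ.measurable_e j i).mul (φ.measurable_e j k)) (C := C * C)
    (fun ω => ?_) ((hh.integrable_crossVar φ i k ((min_le_right _ _).trans ht)).sub
      (hh.integrable_crossVar φ i k ((min_le_right _ _).trans ht)))
  simp only [abs_mul]
  exact mul_le_mul (hC _ _ _) (hC _ _ _) (abs_nonneg _) ((abs_nonneg _).trans (hC j i ω))

theorem IsV2.integral_slice_sq (hh : IsV2 P ℱ T h Γ) (φ : Simple ℱ T) {C : ℝ} (hC : ∀ j i ω, |φ.e j i ω| ≤ C) (j : Fin φ.m) {t : ℝ≥0}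
    (ht : t ≤ T) : ∫ ω, φ.slice h j t ω * φ.slice h j t ω ∂P = ∫ ω, φ.sliceForm Γ j t ω ∂P := by
  have hb : ∀ i k ω, |φ.e j i ω * φ.e j k ω| ≤ C * C := fun i k ω => by
    rw [abs_mul]
    exact mul_le_mul (hC _ _ _) (hC _ _ _) (abs_nonneg _) ((abs_nonneg _).trans (hC j i ω))
  have hm : ∀ i k, Measurable[ℱ (φ.t j.castSucc)] fun ω => φ.e j i ω * φ.e j k ω := fun i k =>
    (φ.e_meas j i).mul (φ.e_meas j k)
  have i1 : ∀ i k, Integrable (fun ω => (φ.e j i ω * φ.e j k ω) *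
      (φ.incr h j i t ω * φ.incr h j k t ω)) P := fun i k =>
    integrable_bdd_mul ((hm i k).mono (ℱ.le _) le_rfl) (hb i k)
      ((hh.memLp_incr φ j i ht).integrable_mul (hh.memLp_incr φ j k ht))
  have i2 : ∀ i k, Integrable (fun ω => (φ.e j i ω * φ.e j k ω) *
      (φ.crossVar Γ i k (min (φ.t j.succ) t) ω - φ.crossVar Γ i k (min (φ.t j.castSucc) t) ω)) P :=
    fun i k => integrable_bdd_mul ((hm i k).mono (ℱ.le _) le_rfl) (hb i k)
      ((hh.integrable_crossVar φ i k ((min_le_right _ _).trans ht)).sub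
      (hh.integrable_crossVar φ i k ((min_le_right _ _).trans ht)))
  have h1 : ∀ ω, φ.slice h j t ω * φ.slice h j t ω = ∑ i, ∑ k, (φ.e j i ω * φ.e j k ω) *
      (φ.incr h j i t ω * φ.incr h j k t ω) := fun ω => by
    rw [Simple.slice, Finset.sum_mul_sum]
    exact Finset.sum_congr rfl fun i _ => Finset.sum_congr rfl fun k _ => by ring
  have h2 : ∀ ω, φ.sliceForm Γ j t ω = ∑ i, ∑ k, (φ.e j i ω * φ.e j k ω) *
      (φ.crossVar Γ i k (min (φ.t j.succ) t) ω - φ.crossVar Γ i k (min (φ.t j.castSucc) t) ω) :=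
    fun ω => rfl
  simp_rw [h1, h2]
  rw [integral_finsetSum _ fun i _ => integrable_finsetSum _ fun k _ => i1 i k,
    integral_finsetSum _ fun i _ => integrable_finsetSum _ fun k _ => i2 i k]
  refine Finset.sum_congr rfl fun i _ => ?_
  rw [integral_finsetSum _ fun k _ => i1 i k, integral_finsetSum _ fun k _ => i2 i k]
  exact Finset.sum_congr rfl fun k _ => hh.integral_mul_incr_mul_incr φ j i k ht (hm i k) (hb i k)

theorem IsV2.memLp_integral_of_bdd (hh : IsV2 P ℱ T h Γ) (φ : Simple ℱ T) {C : ℝ} (hC : ∀ j i ω, |φ.e j i ω| ≤ C) {t : ℝ≥0}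
    (ht : t ≤ T) : MemLp (φ.integral h t) 2 P := by
  rw [show φ.integral h t = fun ω => ∑ j, φ.slice h j t ω from
    funext fun ω => φ.integral_eq_sum_slice h t ω]
  exact memLp_finsetSum _ fun j _ => hh.memLp_slice φ hC j ht

theorem IsV2.integral_sq_of_bdd (hh : IsV2 P ℱ T h Γ) (φ : Simple ℱ T) {C : ℝ} (hC : ∀ j i ω, |φ.e j i ω| ≤ C) {t : ℝ≥0}
    (ht : t ≤ T) : ∫ ω, φ.integral h t ω ^ 2 ∂P = ∫ ω, ∑ j, φ.sliceForm Γ j t ω ∂P := by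
  have i1 : ∀ j j', Integrable (fun ω => φ.slice h j t ω * φ.slice h j' t ω) P := fun j j' =>
    (hh.memLp_slice φ hC j ht).integrable_mul (hh.memLp_slice φ hC j' ht)
  have h1 : ∀ ω, φ.integral h t ω ^ 2 = ∑ j, ∑ j', φ.slice h j t ω * φ.slice h j' t ω := fun ω => by
    rw [φ.integral_eq_sum_slice, sq, Finset.sum_mul_sum]
  simp_rw [h1]
  rw [integral_finsetSum _ fun j _ => integrable_finsetSum _ fun j' _ => i1 j j',
    integral_finsetSum _ fun j _ => hh.integrable_sliceForm φ hC j ht]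
  refine Finset.sum_congr rfl fun j _ => ?_
  rw [integral_finsetSum _ fun j' _ => i1 j j', Finset.sum_eq_single j]
  · exact hh.integral_slice_sq φ hC j ht
  · intro j' _ hj'
    rcases lt_or_gt_of_ne hj' with hlt | hlt
    · simp_rw [mul_comm (φ.slice h j t _)]
      exact hh.integral_slice_mul_slice φ hC hlt ht
    · exact hh.integral_slice_mul_slice φ hC hlt ht
  · simp

theorem IsV2.isMart_integral_of_bdd (hh : IsV2 P ℱ T h Γ) (φ : Simple ℱ T) {C : ℝ} (hC : ∀ j i ω, |φ.e j i ω| ≤ C) :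
    IsMart P ℱ T (φ.integral h) := by
  have h1 : IsMart P ℱ T fun t ω => ∑ j, ∑ i, φ.e j i ω * φ.incr h j i t ω :=
    IsMart.sum _ fun j _ => IsMart.sum _ fun i _ => (hh.isMart_proc φ i).mul_incr (φ.e_meas j i)
      (hC j i) (φ.t_mono (Fin.castSucc_lt_succ (i := j))).le (φ.t_le _)
  convert h1 using 1
  funext t ω
  exact φ.integral_eq_sum_slice h t ω

/-- Each time slice is nonnegative by itself, so discarding slices can only decrease the form. The
truncation argument rests on this. -/
theorem IsV2.ae_sliceForm_nonneg (hh : IsV2 P ℱ T h Γ) (φ : Simple ℱ T) : ∀ᵐ ω ∂P, ∀ j, ∀ t ≤ T, 0 ≤ φ.sliceForm Γ j t ω := by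
  filter_upwards [hh.ae_isGoodPath] with ω hω j t ht
  exact hω.sum_boxInc_nonneg (fun i => φ.e j i ω) φ.x
    (min_le_min_right t (φ.t_mono (Fin.castSucc_lt_succ (i := j))).le) ((min_le_right _ _).trans ht)

end

/-! ### Simple functions with unbounded values, by truncation -/

theorem lintegral_ofReal_sq_le_of_tendsto {Ω : Type*} [MeasurableSpace Ω] {P : Measure Ω}
    {Y : ℕ → Ω → ℝ} {X : Ω → ℝ} {c : ℝ≥0∞} (hY : ∀ R, AEMeasurable (Y R) P)
    (hlim : ∀ ω, Tendsto (fun R => Y R ω) atTop (𝓝 (X ω)))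
    (hc : ∀ R, ∫⁻ ω, ENNReal.ofReal (Y R ω ^ 2) ∂P ≤ c) :
    ∫⁻ ω, ENNReal.ofReal (X ω ^ 2) ∂P ≤ c := by
  have hlim' : ∀ ω, Tendsto (fun R => ENNReal.ofReal (Y R ω ^ 2)) atTop
      (𝓝 (ENNReal.ofReal (X ω ^ 2))) := fun ω => ENNReal.tendsto_ofReal ((hlim ω).pow 2)
  calc _ = ∫⁻ ω, liminf (fun R => ENNReal.ofReal (Y R ω ^ 2)) atTop ∂P :=
        lintegral_congr fun ω => (hlim' ω).liminf_eq.symm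
    _ ≤ liminf (fun R => ∫⁻ ω, ENNReal.ofReal (Y R ω ^ 2) ∂P) atTop :=
        lintegral_liminf_le' fun R => ((hY R).pow_const 2).ennreal_ofReal
    _ ≤ liminf (fun _ : ℕ => c) atTop := liminf_le_liminf (.of_forall hc)
    _ = _ := liminf_const _

section

variable {Ω : Type*} [MeasurableSpace Ω] {P : Measure Ω} {ℱ : Filtration ℝ≥0 ‹MeasurableSpace Ω›}
  {T : ℝ≥0} {h : RField Ω} {Γ : ℝ≥0 → ℝ → ℝ → Ω → ℝ}

/-- The event may depend on the time interval but not on the space cell, so the slice and its form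
are merely multiplied by an indicator. Truncating single coefficients would not keep the form
dominated, since it is not monotone in them. -/
theorem Simple.slice_restrict (φ : Simple ℱ T) (S : Fin φ.m → Set Ω)
    (hS : ∀ j, MeasurableSet[ℱ (φ.t j.castSucc)] (S j)) (j : Fin φ.m) (t : ℝ≥0) (ω : Ω) :
    (φ.restrict S hS).slice h j t ω = (S j).indicator (φ.slice h j t) ω := by
  by_cases hω : ω ∈ S j
  · simp only [Set.indicator_of_mem hω, Simple.slice]
    refine Finset.sum_congr rfl fun i _ => ?_
    simp only [Simple.restrict, Set.indicator_of_mem hω]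
    rfl
  · simp only [Set.indicator_of_notMem hω, Simple.slice]
    refine Finset.sum_eq_zero fun i _ => ?_
    simp only [Simple.restrict, Set.indicator_of_notMem hω, zero_mul]

theorem Simple.sliceForm_restrict (φ : Simple ℱ T) (S : Fin φ.m → Set Ω)
    (hS : ∀ j, MeasurableSet[ℱ (φ.t j.castSucc)] (S j)) (j : Fin φ.m) (t : ℝ≥0) (ω : Ω) :
    (φ.restrict S hS).sliceForm Γ j t ω = (S j).indicator (φ.sliceForm Γ j t) ω := by
  by_cases hω : ω ∈ S j
  · simp only [Set.indicator_of_mem hω, Simple.sliceForm]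
    refine Finset.sum_congr rfl fun i _ => Finset.sum_congr rfl fun k _ => ?_
    simp only [Simple.restrict, Set.indicator_of_mem hω]
  · simp only [Set.indicator_of_notMem hω, Simple.sliceForm]
    refine Finset.sum_eq_zero fun i _ => Finset.sum_eq_zero fun k _ => ?_
    simp only [Simple.restrict, Set.indicator_of_notMem hω, zero_mul]

/-- The event that the values of `φ` on the `j`-th time interval are bounded by `R`. -/
def Simple.bddSet (φ : Simple ℱ T) (R : ℕ) (j : Fin φ.m) : Set Ω := {ω | ∀ i, |φ.e j i ω| ≤ R}

theorem Simple.measurableSet_bddSet (φ : Simple ℱ T) (R : ℕ) (j : Fin φ.m) :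
    MeasurableSet[ℱ (φ.t j.castSucc)] (φ.bddSet R j) := by
  have : φ.bddSet R j = ⋂ i, (φ.e j i) ⁻¹' Set.Icc (-(R : ℝ)) R := by
    ext ω; simp [Simple.bddSet, abs_le]
  rw [this]
  exact MeasurableSet.iInter fun i => (φ.e_meas j i) measurableSet_Icc

theorem Simple.eventually_mem_bddSet (φ : Simple ℱ T) (ω : Ω) :
    ∀ᶠ R in atTop, ∀ j, ω ∈ φ.bddSet R j := by
  refine eventually_all.2 fun j => ?_
  exact eventually_all.2 fun i => tendsto_natCast_atTop_atTop.eventually_ge_atTop _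

/-- The truncation of a simple function. -/
def Simple.trunc (φ : Simple ℱ T) (R : ℕ) : Simple ℱ T :=
  φ.restrict (φ.bddSet R) (φ.measurableSet_bddSet R)

/-- The difference of a simple function and its truncation. -/
def Simple.tail (φ : Simple ℱ T) (R : ℕ) : Simple ℱ T :=
  φ.restrict (fun j => (φ.bddSet R j)ᶜ) fun j => (φ.measurableSet_bddSet R j).compl

theorem Simple.abs_trunc_e_le (φ : Simple ℱ T) (R : ℕ) (j : Fin φ.m) (i : Fin φ.n) (ω : Ω) :
    |(φ.trunc R).e j i ω| ≤ R := by
  by_cases hω : ω ∈ φ.bddSet R j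
  · simp only [Simple.trunc, Simple.restrict, Set.indicator_of_mem hω]; exact hω i
  · simp only [Simple.trunc, Simple.restrict, Set.indicator_of_notMem hω]; simp

theorem Simple.integral_trunc (φ : Simple ℱ T) (R : ℕ) (t : ℝ≥0) (ω : Ω) :
    (φ.trunc R).integral h t ω = ∑ j, (φ.bddSet R j).indicator (φ.slice h j t) ω := by
  rw [Simple.integral_eq_sum_slice]
  exact Finset.sum_congr rfl fun j _ => φ.slice_restrict _ _ j t ω

theorem Simple.integral_trunc_sub (φ : Simple ℱ T) (R : ℕ) (t : ℝ≥0) (ω : Ω) :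
    (φ.trunc R).integral h t ω - φ.integral h t ω = -(φ.tail R).integral h t ω := by
  have h1 : (φ.tail R).integral h t ω = ∑ j, (φ.bddSet R j)ᶜ.indicator (φ.slice h j t) ω := by
    rw [Simple.integral_eq_sum_slice]
    exact Finset.sum_congr rfl fun j _ => φ.slice_restrict _ _ j t ω
  rw [h1, φ.integral_trunc, φ.integral_eq_sum_slice, ← Finset.sum_sub_distrib,
    ← Finset.sum_neg_distrib]
  refine Finset.sum_congr rfl fun j _ => ?_
  by_cases hω : ω ∈ φ.bddSet R j <;> simp [hω]

theorem Simple.tendsto_integral_trunc (φ : Simple ℱ T) (t : ℝ≥0) (ω : Ω) :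
    Tendsto (fun R => (φ.trunc R).integral h t ω) atTop (𝓝 (φ.integral h t ω)) := by
  refine tendsto_const_nhds.congr' ?_
  filter_upwards [φ.eventually_mem_bddSet ω] with R hR
  rw [φ.integral_trunc, φ.integral_eq_sum_slice]
  exact Finset.sum_congr rfl fun j _ => by rw [Set.indicator_of_mem (hR j)]

/-- The quadratic form of a simple function. -/
def Simple.form (φ : Simple ℱ T) (Γ : ℝ≥0 → ℝ → ℝ → Ω → ℝ) (t : ℝ≥0) (ω : Ω) : ℝ :=
  ∑ j, φ.sliceForm Γ j t ω

variable [IsProbabilityMeasure P]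

theorem IsV2.ae_crossInt_eq_form (hh : IsV2 P ℱ T h Γ) (φ : Simple ℱ T) :
    ∀ᵐ ω ∂P, ∀ t ≤ T, crossInt T Γ φ.toField t ω = φ.form Γ t ω := hh.ae_crossInt_simple φ

theorem IsV2.measurable_sliceForm (hh : IsV2 P ℱ T h Γ) (φ : Simple ℱ T) (j : Fin φ.m) {t : ℝ≥0}
    (ht : t ≤ T) : Measurable (φ.sliceForm Γ j t) := by
  have h1 : ∀ r x y, Measurable fun ω => Γ (min r t) x y ω := fun r x y =>
    ((hh.crossVar x y).adapted _ ((min_le_right _ _).trans ht)).mono (ℱ.le _) le_rfl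
  refine Finset.measurable_fun_sum _ fun i _ => Finset.measurable_fun_sum _ fun k _ => ?_
  refine ((φ.measurable_e j i).mul (φ.measurable_e j k)).mul ?_
  exact ((((h1 _ _ _).sub (h1 _ _ _)).sub (h1 _ _ _)).add (h1 _ _ _)).sub
    ((((h1 _ _ _).sub (h1 _ _ _)).sub (h1 _ _ _)).add (h1 _ _ _))

theorem IsV2.lintegral_trunc_sq (hh : IsV2 P ℱ T h Γ) (φ : Simple ℱ T) (R : ℕ) {t : ℝ≥0}
    (ht : t ≤ T) : ∫⁻ ω, ENNReal.ofReal ((φ.trunc R).integral h t ω ^ 2) ∂P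
      = ∫⁻ ω, ENNReal.ofReal (∑ j, (φ.bddSet R j).indicator (φ.sliceForm Γ j t) ω) ∂P := by
  have hC : ∀ j i ω, |(φ.trunc R).e j i ω| ≤ (R : ℝ) := φ.abs_trunc_e_le R
  have h1 : ∀ ω, (φ.trunc R).form Γ t ω
      = ∑ j, (φ.bddSet R j).indicator (φ.sliceForm Γ j t) ω := fun ω =>
    Finset.sum_congr rfl fun j _ => φ.sliceForm_restrict _ _ j t ω
  have hint : Integrable ((φ.trunc R).form Γ t) P :=
    integrable_finsetSum _ fun j _ => hh.integrable_sliceForm (φ.trunc R) hC j ht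
  have hpos : 0 ≤ᵐ[P] (φ.trunc R).form Γ t := by
    filter_upwards [hh.ae_sliceForm_nonneg (φ.trunc R)] with ω hω
    exact Finset.sum_nonneg fun j _ => hω j t ht
  simp_rw [← h1]
  rw [← ofReal_integral_eq_lintegral_ofReal hint hpos,
    ← ofReal_integral_eq_lintegral_ofReal (hh.memLp_integral_of_bdd _ hC ht).integrable_sq
      (.of_forall fun ω => sq_nonneg _), hh.integral_sq_of_bdd _ hC ht]
  rfl

/-- Fatou's lemma along the truncations. The right side may be infinite, so the bound also covers
differences of simple functions in the class, whose absolute forms may have infinite mean. -/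
theorem IsV2.lintegral_integral_sq_le (hh : IsV2 P ℱ T h Γ) (φ : Simple ℱ T) {t : ℝ≥0} (ht : t ≤ T) :
    ∫⁻ ω, ENNReal.ofReal (φ.integral h t ω ^ 2) ∂P ≤ ∫⁻ ω, ENNReal.ofReal (φ.form Γ t ω) ∂P := by
  have hm : ∀ R, MemLp ((φ.trunc R).integral h t) 2 P := fun R =>
    hh.memLp_integral_of_bdd (φ.trunc R) (φ.abs_trunc_e_le R) ht
  have hlim := fun ω => φ.tendsto_integral_trunc (h := h) t ω
  have hle : ∀ R : ℕ, ∫⁻ ω, ENNReal.ofReal ((φ.trunc R).integral h t ω ^ 2) ∂P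
      ≤ ∫⁻ ω, ENNReal.ofReal (φ.form Γ t ω) ∂P := fun R => by
    rw [hh.lintegral_trunc_sq φ R ht]
    refine lintegral_mono_ae ?_
    filter_upwards [hh.ae_sliceForm_nonneg φ] with ω hω
    refine ENNReal.ofReal_le_ofReal (Finset.sum_le_sum fun j _ => ?_)
    exact Set.indicator_le_self' (fun _ _ => hω j t ht) ω
  exact lintegral_ofReal_sq_le_of_tendsto (Y := fun R => (φ.trunc R).integral h t)
    (fun R => (hm R).1.aemeasurable) hlim hle

/-- The error is, up to sign, the integral of the tail. Its square is bounded by the mean form of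
the tail, which tends to zero by dominated convergence. -/
theorem IsV2.tendsto_trunc (hh : IsV2 P ℱ T h Γ) (φ : Simple ℱ T) {t : ℝ≥0} (ht : t ≤ T)
    (hfin : ∫⁻ ω, ENNReal.ofReal (φ.form Γ t ω) ∂P < ∞) :
    Tendsto (fun R => eLpNorm (fun ω => (φ.trunc R).integral h t ω - φ.integral h t ω) 2 P) atTop
      (𝓝 0) := by
  have hpos := hh.ae_sliceForm_nonneg φ
  refine tendsto_zero_of_sq ?_
  have h1 : ∀ R, eLpNorm (fun ω => (φ.trunc R).integral h t ω - φ.integral h t ω) 2 P ^ 2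
      ≤ ∫⁻ ω, ENNReal.ofReal (∑ j, (φ.bddSet R j)ᶜ.indicator (φ.sliceForm Γ j t) ω) ∂P := by
    intro R
    rw [eLpNorm_sq_eq_lintegral]
    simp_rw [φ.integral_trunc_sub, neg_sq]
    refine (hh.lintegral_integral_sq_le (φ.tail R) ht).trans (le_of_eq ?_)
    refine lintegral_congr fun ω => ?_
    congr 1
    exact Finset.sum_congr rfl fun j _ => φ.sliceForm_restrict _ _ j t ω
  refine tendsto_of_tendsto_of_tendsto_of_le_of_le tendsto_const_nhds ?_ (fun R => zero_le) h1
  have := tendsto_lintegral_of_dominated_convergence' (μ := P)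
    (F := fun R ω => ENNReal.ofReal (∑ j, (φ.bddSet R j)ᶜ.indicator (φ.sliceForm Γ j t) ω))
    (f := fun _ => 0) (fun ω => ENNReal.ofReal (φ.form Γ t ω)) (fun R => ?_) (fun R => ?_) hfin.ne
    (.of_forall fun ω => ?_)
  · simpa using this
  · refine (Measurable.ennreal_ofReal ?_).aemeasurable
    exact Finset.measurable_fun_sum _ fun j _ => (hh.measurable_sliceForm φ j ht).indicator
      (ℱ.le _ _ (φ.measurableSet_bddSet R j)).compl
  · filter_upwards [hpos] with ω hω
    refine ENNReal.ofReal_le_ofReal (Finset.sum_le_sum fun j _ => ?_)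
    exact Set.indicator_le_self' (fun _ _ => hω j t ht) ω
  · refine tendsto_const_nhds.congr' ?_
    filter_upwards [φ.eventually_mem_bddSet ω] with R hR
    rw [Finset.sum_eq_zero fun j _ => Set.indicator_of_notMem (by simpa using hR j) _]
    simp

/-- For every `ω` the truncated integrals are eventually equal to the full one, so adaptedness holds
without exceptional sets and without completing the filtration. -/
theorem IsV2.measurable_integral (hh : IsV2 P ℱ T h Γ) (φ : Simple ℱ T) {t : ℝ≥0} (ht : t ≤ T) :
    Measurable[ℱ t] (φ.integral h t) :=
  @measurable_of_tendsto_metrizable _ _ (ℱ t) _ _ _ _ _ _ (fun R => (hh.isMart_integral_of_bdd (φ.trunc R)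
    (φ.abs_trunc_e_le R)).measurable ht)
    (tendsto_pi_nhds.2 fun ω => φ.tendsto_integral_trunc t ω)

theorem IsV2.ae_continuousOn_integral (hh : IsV2 P ℱ T h Γ) (φ : Simple ℱ T) :
    ∀ᵐ ω ∂P, ContinuousOn (fun t => φ.integral h t ω) (Set.Iic T) := by
  have h1 : ∀ᵐ ω ∂P, ∀ i, ContinuousOn (fun s => h s (φ.x i) ω) (Set.Iic T) :=
    ae_all_iff.2 fun i => (hh.mart _).cont
  filter_upwards [h1] with ω hω
  have h2 : ∀ (r : ℝ≥0) i, ContinuousOn (fun t => h (min r t) (φ.x i) ω) (Set.Iic T) := fun r i =>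
    (hω i).comp (by fun_prop) fun t ht => Set.mem_Iic.2 ((min_le_right _ _).trans ht)
  unfold Simple.integral
  refine continuousOn_finsetSum _ fun j _ => continuousOn_finsetSum _ fun i _ => ?_
  exact continuousOn_const.mul ((((h2 _ _).sub (h2 _ _)).sub (h2 _ _)).add (h2 _ _))

theorem IsV2.lintegral_form_lt_top (hh : IsV2 P ℱ T h Γ) (φ : Simple ℱ T)
    (hφ : absInt P T Γ φ.toField φ.toField < ∞) {t : ℝ≥0} (ht : t ≤ T) :
    ∫⁻ ω, ENNReal.ofReal (φ.form Γ t ω) ∂P < ∞ := by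
  refine lt_of_le_of_lt ?_ hφ
  rw [absInt_eq]
  refine lintegral_mono_ae ?_
  filter_upwards [hh.ae_crossInt_eq_form φ] with ω hω
  rw [← hω t ht]
  exact (ENNReal.ofReal_le_ofReal (le_abs_self _)).trans (abs_crossInt_le ht ω)

/-- The integral of a simple function is a continuous martingale. -/
theorem IsV2.isContM2_integral (hh : IsV2 P ℱ T h Γ) (φ : Simple ℱ T)
    (hφ : absInt P T Γ φ.toField φ.toField < ∞) : IsContM2 P ℱ T (φ.integral h) := by
  have hmem : ∀ t ≤ T, MemLp (φ.integral h t) 2 P := fun t ht => by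
    refine ⟨((hh.measurable_integral φ ht).mono (ℱ.le t) le_rfl).aestronglyMeasurable, ?_⟩
    have h1 := (hh.lintegral_integral_sq_le φ ht).trans_lt (hh.lintegral_form_lt_top φ hφ ht)
    rw [← eLpNorm_sq_eq_lintegral] at h1
    exact (ENNReal.pow_lt_top_iff.1 h1).resolve_right (by norm_num)
  refine .of_cont ?_ (hmem T le_rfl) (hh.ae_continuousOn_integral φ)
  refine IsMart.of_tendsto (l := atTop) (fun R => hh.isMart_integral_of_bdd (φ.trunc R)
    (φ.abs_trunc_e_le R)) (fun t ht => hh.measurable_integral φ ht)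
    (fun t ht => (hmem t ht).integrable one_le_two) fun t ht => ?_
  refine tendsto_of_tendsto_of_tendsto_of_le_of_le tendsto_const_nhds
    (hh.tendsto_trunc φ ht (hh.lintegral_form_lt_top φ hφ ht)) (fun R => zero_le) fun R => ?_
  exact eLpNorm_le_eLpNorm_of_exponent_le one_le_two
    (((hh.memLp_integral_of_bdd (φ.trunc R) (φ.abs_trunc_e_le R) ht).1.sub (hmem t ht).1))

/-- The isometry for simple functions. -/
theorem IsV2.isIsometric_integral (hh : IsV2 P ℱ T h Γ) (φ : Simple ℱ T)
    (hφ : absInt P T Γ φ.toField φ.toField < ∞) :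
    IsIsometric P T Γ φ.toField (φ.integral h) := by
  intro t ht
  obtain ⟨G, hG⟩ := hh.exists_goodVersion
  have hmem := (hh.isContM2_integral φ hφ).toIsM2.memLp_of_le ht
  refine ⟨hmem.integrable_sq, hG.integrable_crossInt φ.isV1.meas hφ ht, ?_⟩
  have hpos := hh.ae_sliceForm_nonneg φ
  have hfin := hh.lintegral_form_lt_top φ hφ ht
  have h1 := tendsto_eLpNorm_of_tendsto_sub one_le_two (fun R => (hh.memLp_integral_of_bdd
    (φ.trunc R) (φ.abs_trunc_e_le R) ht).1) hmem.1
    (hh.tendsto_trunc φ ht hfin)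
  have h2 : Tendsto (fun R => eLpNorm ((φ.trunc R).integral h t) 2 P ^ 2) atTop
      (𝓝 (eLpNorm (φ.integral h t) 2 P ^ 2)) := ENNReal.Tendsto.pow h1
  have h3 : Tendsto (fun R => eLpNorm ((φ.trunc R).integral h t) 2 P ^ 2) atTop
      (𝓝 (∫⁻ ω, ENNReal.ofReal (φ.form Γ t ω) ∂P)) := by
    simp_rw [eLpNorm_sq_eq_lintegral, hh.lintegral_trunc_sq φ _ ht]
    refine tendsto_lintegral_of_dominated_convergence' (fun ω => ENNReal.ofReal (φ.form Γ t ω))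
      (fun R => ?_) (fun R => ?_) hfin.ne (.of_forall fun ω => ?_)
    · refine (Measurable.ennreal_ofReal ?_).aemeasurable
      exact Finset.measurable_fun_sum _ fun j _ => (hh.measurable_sliceForm φ j ht).indicator
        (ℱ.le _ _ (φ.measurableSet_bddSet R j))
    · filter_upwards [hpos] with ω hω
      refine ENNReal.ofReal_le_ofReal (Finset.sum_le_sum fun j _ => ?_)
      exact Set.indicator_le_self' (fun _ _ => hω j t ht) ω
    · refine tendsto_const_nhds.congr' ?_
      filter_upwards [φ.eventually_mem_bddSet ω] with R hR
      rw [Finset.sum_congr rfl fun j _ => Set.indicator_of_mem (hR j) _]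
      rfl
  have h4 := tendsto_nhds_unique h2 h3
  rw [integral_sq_eq hmem.1, h4]
  have h5 : crossInt T Γ φ.toField t =ᵐ[P] φ.form Γ t := by
    filter_upwards [hh.ae_crossInt_eq_form φ] with ω hω using hω t ht
  rw [integral_congr_ae h5, integral_eq_lintegral_of_nonneg_ae]
  · filter_upwards [hpos] with ω hω
    exact Finset.sum_nonneg fun j _ => hω j t ht
  · exact (Finset.measurable_fun_sum _ fun j _ => hh.measurable_sliceForm φ j ht).aestronglyMeasurable

/-- The norm of the integral of a simple function is at most the norm of its quadratic form. -/
theorem IsV2.eLpNorm_integral_le (hh : IsV2 P ℱ T h Γ) (φ : Simple ℱ T) {t : ℝ≥0} (ht : t ≤ T) :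
    eLpNorm (φ.integral h t) 2 P ≤ eLpNorm (crossNorm T Γ φ.toField t) 2 P := by
  obtain ⟨G, hG⟩ := hh.exists_goodVersion
  refine (ENNReal.pow_le_pow_left_iff two_ne_zero).1 ?_
  rw [eLpNorm_sq_eq_lintegral,
    hG.eLpNorm_crossNorm_sq φ.isV1.meas (hG.ae_absForm_simple_lt_top φ) ht]
  refine (hh.lintegral_integral_sq_le φ ht).trans (le_of_eq (lintegral_congr_ae ?_))
  filter_upwards [hh.ae_crossInt_eq_form φ] with ω hω
  rw [hω t ht]

end

/-! ### Doob's inequality and completeness of the space of continuous martingales -/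

section

variable {Ω : Type*} [MeasurableSpace Ω] {P : Measure Ω} {ℱ : Filtration ℝ≥0 ‹MeasurableSpace Ω›}
  {T : ℝ≥0}

/-- Doob's maximal inequality on a finite grid. -/
theorem IsMart.maximal_grid [IsFiniteMeasure P] {X : Proc Ω} (hX : IsMart P ℱ T X) (δ : ℝ≥0) (n : ℕ)
    (ε : ℝ≥0) : ε * P {ω | ∃ i ≤ n, (ε : ℝ) ≤ |X (min (i * δ) T) ω|} ≤ eLpNorm (X T) 1 P := by
  let 𝒢 : Filtration ℕ ‹MeasurableSpace Ω› :=
    { seq := fun i => ℱ (i * δ)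
      mono' := fun i j hij => ℱ.mono (by gcongr)
      le' := fun i => ℱ.le _ }
  have hM : Martingale (fun (i : ℕ) ω => X (min (i * δ) T) ω) 𝒢 P :=
    ⟨fun i => hX.1 _, fun i j hij => hX.2 _ _ (by gcongr)⟩
  have hS : Submartingale ((fun (i : ℕ) ω => X (min (i * δ) T) ω)
      ⊔ -(fun (i : ℕ) ω => X (min (i * δ) T) ω)) 𝒢 P := hM.submartingale.sup hM.neg.submartingale
  have h1 := maximal_ineq hS (fun i ω => (abs_nonneg (X (min (i * δ) T) ω))) (ε := ε) n
  have h2 : {ω | ∃ i ≤ n, (ε : ℝ) ≤ |X (min (i * δ) T) ω|} ⊆ {ω | (ε : ℝ) ≤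
      (Finset.range (n + 1)).sup' Finset.nonempty_range_add_one fun k =>
        ((fun (i : ℕ) ω => X (min (i * δ) T) ω) ⊔ -(fun (i : ℕ) ω => X (min (i * δ) T) ω)) k ω} := by
    rintro ω ⟨i, hi, h⟩
    exact h.trans (Finset.le_sup' (s := Finset.range (n + 1)) (fun k : ℕ => |X (min (k * δ) T) ω|)
      (Finset.mem_range.2 (Nat.lt_succ_of_le hi)))
  refine (mul_le_mul_right (measure_mono h2) _).trans (h1.trans ?_)
  have hi := hX.integrable (min_le_right (n * δ) T)
  have h3 : ∫ ω in {ω | (ε : ℝ) ≤ (Finset.range (n + 1)).sup' Finset.nonempty_range_add_one fun k =>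
        ((fun (i : ℕ) ω => X (min (i * δ) T) ω) ⊔ -(fun (i : ℕ) ω => X (min (i * δ) T) ω)) k ω},
      ((fun (i : ℕ) ω => X (min (i * δ) T) ω) ⊔ -(fun (i : ℕ) ω => X (min (i * δ) T) ω)) n ω ∂P
      ≤ ∫ ω, ‖X (min (n * δ) T) ω‖ ∂P :=
    setIntegral_le_integral hi.norm (.of_forall fun ω => norm_nonneg (X (min (n * δ) T) ω))
  refine (ENNReal.ofReal_le_ofReal h3).trans ?_
  rw [ofReal_integral_norm_eq_lintegral_enorm hi, ← eLpNorm_one_eq_lintegral_enorm,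
    ← eLpNorm_congr_ae (hX.condExp_eq (min_le_right (n * δ) T) le_rfl)]
  exact eLpNorm_condExp_le_eLpNorm _ le_rfl

/-- The grid with mesh `2^{-n}` and `4^n` steps extends to `2^n`, hence beyond `t` for large `n`.
Its point obtained by rounding `t` down converges to `t`, and the strict inequality leaves room for
the error. -/
theorem exists_grid_of_lt {f : ℝ≥0 → ℝ} (hf : ContinuousOn f (Set.Iic T)) {t : ℝ≥0} (ht : t ≤ T)
    {ε : ℝ} (h : ε < |f t|) :
    ∀ᶠ n : ℕ in atTop, ∃ i ≤ (4 ^ n : ℕ), ε ≤ |f (min (i * (1 / 2) ^ n : ℝ≥0) T)| := by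
  have h1 : Tendsto (fun n : ℕ => ((⌊(t : ℝ) * 2 ^ n⌋₊ : ℝ≥0) * (1 / 2) ^ n)) atTop (𝓝 t) := by
    have := (tendsto_nat_floor_mul_div_atTop (R := ℝ) t.2).comp
      (tendsto_pow_atTop_atTop_of_one_lt (one_lt_two (α := ℝ)))
    rw [← NNReal.tendsto_coe]
    refine this.congr fun n => ?_
    simp only [Function.comp]
    push_cast
    rw [one_div, inv_pow, div_eq_mul_inv]
    rfl
  have h2 : Tendsto (fun n : ℕ => min ((⌊(t : ℝ) * 2 ^ n⌋₊ : ℝ≥0) * (1 / 2) ^ n) T) atTop (𝓝[Set.Iic T] t) := by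
    refine tendsto_nhdsWithin_iff.2 ⟨?_, .of_forall fun n => Set.mem_Iic.2 (min_le_right _ _)⟩
    have := h1.min (tendsto_const_nhds (x := T))
    rwa [min_eq_left ht] at this
  have h3 := ((hf t ht).abs.tendsto.comp h2).eventually (lt_mem_nhds h)
  obtain ⟨k, hk⟩ := pow_unbounded_of_one_lt (t : ℝ) (one_lt_two (α := ℝ))
  filter_upwards [h3, eventually_ge_atTop k] with n hn hkn
  refine ⟨⌊(t : ℝ) * 2 ^ n⌋₊, Nat.floor_le_of_le ?_, hn.le⟩
  push_cast
  calc (t : ℝ) * 2 ^ n ≤ 2 ^ n * 2 ^ n := by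
        gcongr
        exact hk.le.trans (pow_le_pow_right₀ one_le_two hkn)
    _ = 4 ^ n := by rw [← mul_pow]; norm_num

/-- Doob's maximal inequality for continuous martingales. -/
theorem IsMart.maximal [IsFiniteMeasure P] {X : Proc Ω} (hX : IsMart P ℱ T X)
    (hc : ∀ᵐ ω ∂P, ContinuousOn (fun s => X s ω) (Set.Iic T)) (ε : ℝ≥0) :
    ε * P {ω | ∃ t ≤ T, (ε : ℝ) < |X t ω|} ≤ eLpNorm (X T) 1 P := by
  set E : ℕ → Set Ω := fun n => {ω | ∃ i ≤ (4 ^ n : ℕ), (ε : ℝ) ≤ |X (min (i * (1 / 2) ^ n : ℝ≥0) T) ω|}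
    with hE
  -- A strict excess on a continuous path is seen by all sufficiently fine grids. The event is thus
  -- contained in an increasing union of sets, each inside a single grid event.
  have h1 : {ω | ∃ t ≤ T, (ε : ℝ) < |X t ω|} ≤ᵐ[P] ⋃ k, ⋂ n ≥ k, E n := by
    filter_upwards [hc] with ω hω
    rintro ⟨t, ht, h⟩
    obtain ⟨k, hk⟩ := eventually_atTop.1 (exists_grid_of_lt hω ht h)
    exact Set.mem_iUnion.2 ⟨k, Set.mem_iInter₂.2 hk⟩
  have h2 : Monotone fun k => ⋂ n ≥ k, E n := fun k k' h =>
    Set.biInter_mono (fun n hn => h.trans hn) fun _ _ => le_rfl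
  refine (mul_le_mul_right (measure_mono_ae h1) _).trans ?_
  rw [h2.measure_iUnion, ENNReal.mul_iSup]
  refine iSup_le fun k => ?_
  refine (mul_le_mul_right (measure_mono (Set.biInter_subset_of_mem le_rfl)) _).trans ?_
  have := hX.maximal_grid ((1 / 2) ^ k) (4 ^ k) ε
  exact this

theorem IsM2.eLpNorm_le [IsFiniteMeasure P] {X : Proc Ω} (hX : IsM2 P ℱ T X) {t : ℝ≥0} (ht : t ≤ T) :
    eLpNorm (X t) 2 P ≤ eLpNorm (X T) 2 P := by
  rw [← eLpNorm_congr_ae (hX.mart.condExp_eq ht le_rfl)]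
  exact eLpNorm_condExp_le_eLpNorm _ one_le_two

theorem IsM2.sub [IsFiniteMeasure P] {X Y : Proc Ω} (hX : IsM2 P ℱ T X) (hY : IsM2 P ℱ T Y) :
    IsM2 P ℱ T fun t ω => X t ω - Y t ω where
  mart := hX.mart.sub hY.mart
  memLp := hX.memLp.sub hY.memLp
  rightCont := by
    filter_upwards [hX.rightCont, hY.rightCont] with ω h1 h2 t ht using (h1 t ht).sub (h2 t ht)

theorem IsContM2.sub [IsFiniteMeasure P] {X Y : Proc Ω} (hX : IsContM2 P ℱ T X)
    (hY : IsContM2 P ℱ T Y) : IsContM2 P ℱ T fun t ω => X t ω - Y t ω where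
  toIsM2 := hX.toIsM2.sub hY.toIsM2
  cont := by
    filter_upwards [hX.cont, hY.cont] with ω h1 h2 using h1.sub h2

theorem continuousOn_of_le_geometric_two {f : ℕ → ℝ≥0 → ℝ} {s : Set ℝ≥0}
    (hf : ∀ n, ContinuousOn (f n) s) (hb : ∀ᶠ n in atTop, ∀ t ∈ s, |f (n + 1) t - f n t| ≤ (1 / 2) ^ n) :
    ∃ F : ℝ≥0 → ℝ, ContinuousOn F s ∧ ∀ t ∈ s, Tendsto (fun n => f n t) atTop (𝓝 (F t)) := by
  obtain ⟨k, hk⟩ := eventually_atTop.1 hb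
  have hd : ∀ t ∈ s, ∀ n, dist (f (n + k) t) (f (n + 1 + k) t) ≤ 2 / 2 / 2 ^ n := by
    intro t ht n
    have := hk (n + k) (by omega) t ht
    rw [dist_comm, Real.dist_eq, show n + 1 + k = n + k + 1 by ring]
    refine this.trans ?_
    rw [div_self two_ne_zero, one_div, one_div, inv_pow]
    exact inv_anti₀ (by positivity) (pow_le_pow_right₀ one_le_two (by omega))
  have hl : ∀ t, ∃ a, t ∈ s → Tendsto (fun n => f (n + k) t) atTop (𝓝 a) := fun t => by
    by_cases ht : t ∈ s
    · obtain ⟨a, ha⟩ := cauchySeq_tendsto_of_complete (cauchySeq_of_le_geometric_two (hd t ht))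
      exact ⟨a, fun _ => ha⟩
    · exact ⟨0, fun h => absurd h ht⟩
  choose F hF using hl
  refine ⟨F, ?_, fun t ht => (tendsto_add_atTop_iff_nat k).1 (hF t ht)⟩
  have hu : TendstoUniformlyOn (fun n => f (n + k)) F atTop s := by
    rw [Metric.tendstoUniformlyOn_iff]
    intro ε hε
    have h0 : Tendsto (fun n : ℕ => 2 / (2 : ℝ) ^ n) atTop (𝓝 0) :=
      tendsto_const_nhds.div_atTop (tendsto_pow_atTop_atTop_of_one_lt one_lt_two)
    filter_upwards [h0.eventually (gt_mem_nhds hε)] with n hn t ht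
    rw [dist_comm]
    exact (dist_le_of_le_geometric_two_of_tendsto (hd t ht) (hF t ht) n).trans_lt hn
  exact hu.continuousOn (Frequently.of_forall fun n => hf (n + k))

/-- Completeness of the space of continuous square-integrable martingales. -/
theorem exists_isContM2_of_cauchy [IsProbabilityMeasure P] {X : ℕ → Proc Ω}
    (hX : ∀ n, IsContM2 P ℱ T (X n))
    (hC : ∀ ε > 0, ∃ N, ∀ m ≥ N, ∀ n ≥ N, eLpNorm (fun ω => X m T ω - X n T ω) 2 P ≤ ε) :
    ∃ J : Proc Ω, IsContM2 P ℱ T J ∧ TendstoM2 P T X J := by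
  -- With terminal distances at most `4^{-k}`, Doob's inequality bounds the probability that the
  -- paths ever differ by more than `2^{-k}` by `2^{-k}`. This is summable, so the Borel–Cantelli
  -- lemma gives uniform convergence.
  have hδ : ∀ k : ℕ, (0 : ℝ≥0∞) < (1 / 2) ^ k * (1 / 2) ^ k := fun k => by
    simp only [one_div]
    exact ENNReal.mul_pos (pow_ne_zero _ (by simp)) (pow_ne_zero _ (by simp))
  choose N hN using fun k => hC _ (hδ k)
  set v : ℕ → ℕ := fun k => ∑ j ∈ Finset.range (k + 1), N j + k with hv
  have hvN : ∀ k, N k ≤ v k := fun k => by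
    have := Finset.single_le_sum (f := N) (fun _ _ => Nat.zero_le _) (Finset.self_mem_range_succ k)
    simp only [hv]; omega
  have hvm : ∀ k, v k ≤ v (k + 1) := fun k => by
    simp only [hv, Finset.sum_range_succ _ (k + 1)]; omega
  have hvt : Tendsto v atTop atTop := tendsto_atTop_mono (fun k => Nat.le_add_left _ _) tendsto_id
  have hbc : ∀ᵐ ω ∂P, ∀ᶠ k in atTop, ∀ t ≤ T, |X (v (k + 1)) t ω - X (v k) t ω| ≤ (1 / 2) ^ k := by
    have h1 : ∀ k, P {ω | ∃ t ≤ T, (1 / 2) ^ k < |X (v (k + 1)) t ω - X (v k) t ω|}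
        ≤ (1 / 2) ^ k := fun k => by
      have h2 := ((hX (v (k + 1))).sub (hX (v k))).mart.maximal
        ((hX (v (k + 1))).sub (hX (v k))).cont ((1 / 2) ^ k)
      have h3 := h2.trans ((eLpNorm_le_eLpNorm_of_exponent_le one_le_two
        ((hX (v (k + 1))).sub (hX (v k))).memLp.1).trans
        (hN k _ ((hvN k).trans (hvm k)) _ (hvN k)))
      have h4 : (((1 / 2) ^ k : ℝ≥0) : ℝ≥0∞) = (1 / 2) ^ k := by
        rw [ENNReal.coe_pow]; congr 1; simp
      rw [h4] at h3
      have h5 := (ENNReal.mul_le_mul_iff_right (pow_ne_zero _ (by simp)) (by finiteness)).1 h3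
      push_cast at h5
      exact h5
    have h6 := ae_eventually_notMem (μ := P)
      (s := fun k => {ω | ∃ t ≤ T, (1 / 2) ^ k < |X (v (k + 1)) t ω - X (v k) t ω|})
      (ne_top_of_le_ne_top (b := ∑' k : ℕ, (1 / 2 : ℝ≥0∞) ^ k) (by
        rw [ENNReal.tsum_geometric]; simp) (ENNReal.tsum_le_tsum h1))
    filter_upwards [h6] with ω hω
    filter_upwards [hω] with k hk t ht
    by_contra! hcon
    exact hk ⟨t, ht, hcon⟩
  -- The limit is defined at every `ω` as a pointwise upper limit, so that it is measurable with
  -- respect to `ℱ t` itself; the filtration need not contain the null sets.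
  set J : Proc Ω := fun t ω => limsup (fun k => X (v k) t ω) atTop with hJ
  have hlim : ∀ᵐ ω ∂P, ContinuousOn (fun t => J t ω) (Set.Iic T) ∧
      ∀ t ≤ T, Tendsto (fun k => X (v k) t ω) atTop (𝓝 (J t ω)) := by
    filter_upwards [hbc, ae_all_iff.2 fun k => (hX (v k)).cont] with ω h1 h2
    obtain ⟨F, hF, hFt⟩ := continuousOn_of_le_geometric_two h2 h1
    have hJF : ∀ t ≤ T, J t ω = F t := fun t ht => (hFt t ht).limsup_eq
    refine ⟨hF.congr fun t ht => hJF t ht, fun t ht => ?_⟩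
    rw [hJF t ht]; exact hFt t ht
  have hmeas : ∀ t ≤ T, Measurable[ℱ t] (J t) := fun t ht =>
    Measurable.limsup (fun k => (hX (v k)).mart.measurable ht)
  -- Fatou's lemma along the subsequence, at every time: distances at `t` are at most those at `T`,
  -- because conditional expectation is a contraction.
  have hfat : ∀ t ≤ T, ∀ ε : ℝ≥0∞, ∀ M, (∀ m ≥ M, ∀ n ≥ M,
      eLpNorm (fun ω => X m T ω - X n T ω) 2 P ≤ ε) → ∀ n ≥ M,
      eLpNorm (fun ω => X n t ω - J t ω) 2 P ≤ ε := by
    intro t ht ε M hM n hn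
    have h1 := Lp.eLpNorm_lim_le_liminf_eLpNorm (p := 2) (μ := P)
      (f := fun k ω => X n t ω - X (v k) t ω)
      (fun k => (((hX n).toIsM2.memLp_of_le ht).1.sub ((hX (v k)).toIsM2.memLp_of_le ht).1))
      (fun ω => X n t ω - J t ω) (by
        filter_upwards [hlim] with ω hω using tendsto_const_nhds.sub (hω.2 t ht))
    refine h1.trans ?_
    refine (liminf_le_liminf (v := fun _ : ℕ => ε) ?_).trans (liminf_const _).le
    filter_upwards [hvt.eventually_ge_atTop M] with k hk
    exact (((hX n).toIsM2.sub (hX (v k)).toIsM2).eLpNorm_le ht).trans (hM n hn _ hk)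
  have htend : ∀ t ≤ T, Tendsto (fun n => eLpNorm (fun ω => X n t ω - J t ω) 2 P) atTop (𝓝 0) := by
    intro t ht
    rw [ENNReal.tendsto_nhds_zero]
    intro ε hε
    obtain ⟨M, hM⟩ := hC ε hε
    exact eventually_atTop.2 ⟨M, hfat t ht ε M hM⟩
  have hmem : ∀ t ≤ T, MemLp (J t) 2 P := fun t ht => by
    obtain ⟨M, hM⟩ := hC 1 one_pos
    have h1 : MemLp (fun ω => X M t ω - J t ω) 2 P :=
      ⟨((hX M).toIsM2.memLp_of_le ht).1.sub
        ((hmeas t ht).mono (ℱ.le t) le_rfl).aestronglyMeasurable,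
        (hfat t ht 1 M hM M le_rfl).trans_lt ENNReal.one_lt_top⟩
    have h2 := ((hX M).toIsM2.memLp_of_le ht).sub h1
    refine (memLp_congr_ae (.of_forall fun ω => ?_)).1 h2
    simp
  refine ⟨J, .of_cont ?_ (hmem T le_rfl) (hlim.mono fun ω hω => hω.1), htend T le_rfl⟩
  refine IsMart.of_tendsto (l := atTop) (fun n => (hX n).mart) hmeas
    (fun t ht => (hmem t ht).integrable one_le_two) fun t ht => ?_
  refine tendsto_of_tendsto_of_tendsto_of_le_of_le tendsto_const_nhds (htend t ht)
    (fun n => zero_le) fun n => ?_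
  exact eLpNorm_le_eLpNorm_of_exponent_le one_le_two
    (((hX n).toIsM2.memLp_of_le ht).1.sub (hmem t ht).1)

/-- Completeness, for families along a directed set with a cofinal sequence. -/
theorem exists_isContM2_of_tendsto [IsProbabilityMeasure P] {ι : Type*} [Preorder ι] [Nonempty ι]
    [IsDirectedOrder ι] {X : ι → Proc Ω} {d : ℕ → ι} (hd : Tendsto d atTop atTop)
    (hX : ∀ a, IsContM2 P ℱ T (X a))
    (hC : Tendsto (fun p : ι × ι => eLpNorm (fun ω => X p.1 T ω - X p.2 T ω) 2 P) atTop (𝓝 0)) :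
    ∃ J : Proc Ω, IsContM2 P ℱ T J ∧ TendstoM2 P T X J := by
  have hC' : ∀ ε > 0, ∃ c : ι, ∀ a ≥ c, ∀ b ≥ c, eLpNorm (fun ω => X a T ω - X b T ω) 2 P ≤ ε := by
    intro ε hε
    rw [← prod_atTop_atTop_eq] at hC
    obtain ⟨A, hA, B, hB, h⟩ := eventually_prod_iff.1 ((ENNReal.tendsto_nhds_zero.1 hC) ε hε)
    obtain ⟨p, hA⟩ := eventually_atTop.1 hA
    obtain ⟨q, hB⟩ := eventually_atTop.1 hB
    obtain ⟨c, hp, hq⟩ := exists_ge_ge p q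
    exact ⟨c, fun a ha b hb => h (hA a (hp.trans ha)) (hB b (hq.trans hb))⟩
  obtain ⟨J, hJ, hJt⟩ := exists_isContM2_of_cauchy (X := fun n => X (d n)) (fun n => hX _) (by
    intro ε hε
    obtain ⟨c, hc⟩ := hC' ε hε
    obtain ⟨M, hM⟩ := eventually_atTop.1 (hd.eventually_ge_atTop c)
    exact ⟨M, fun m hm n hn => hc _ (hM m hm) _ (hM n hn)⟩)
  refine ⟨J, hJ, ?_⟩
  refine ENNReal.tendsto_nhds_zero.2 fun ε hε => ?_
  obtain ⟨c, hc⟩ := hC' (ε / 2) (ENNReal.half_pos hε.ne')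
  have h1 := ENNReal.tendsto_nhds_zero.1 hJt (ε / 2) (ENNReal.half_pos hε.ne')
  obtain ⟨n, hn1, hn2⟩ := (h1.and (hd.eventually_ge_atTop c)).exists
  filter_upwards [eventually_ge_atTop c] with a ha
  have h2 := eLpNorm_add_le (p := 2) (μ := P) (f := fun ω => X a T ω - X (d n) T ω)
    (g := fun ω => X (d n) T ω - J T ω) ((hX a).memLp.1.sub (hX (d n)).memLp.1)
    ((hX (d n)).memLp.1.sub hJ.memLp.1) one_le_two
  have h3 : (fun ω => X a T ω - J T ω) = (fun ω => X a T ω - X (d n) T ω)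
    + fun ω => X (d n) T ω - J T ω := by funext ω; simp
  rw [h3]
  refine h2.trans ((add_le_add (hc a ha _ hn2) hn1).trans (ENNReal.add_halves ε).le)

/-- Two right-continuous martingales with the same terminal value are indistinguishable. -/
theorem IsM2.indistinguishable [IsFiniteMeasure P] {X Y : Proc Ω} (hX : IsM2 P ℱ T X)
    (hY : IsM2 P ℱ T Y) (hT : X T =ᵐ[P] Y T) : ∀ᵐ ω ∂P, ∀ t ≤ T, X t ω = Y t ω := by
  have h1 : ∀ t ≤ T, X t =ᵐ[P] Y t := fun t ht =>
    ((hX.mart.condExp_eq ht le_rfl).symm.trans (condExp_congr_ae hT)).trans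
      (hY.mart.condExp_eq ht le_rfl)
  have h2 : ∀ᵐ ω ∂P, ∀ q : ℚ, X (min (q : ℝ).toNNReal T) ω = Y (min (q : ℝ).toNNReal T) ω :=
    ae_all_iff.2 fun q => h1 _ (min_le_right _ _)
  filter_upwards [h2, hT, hX.rightCont, hY.rightCont] with ω h2 h3 h4 h5 t ht
  rcases ht.eq_or_lt with rfl | hlt
  · exact h3
  obtain ⟨u, hu, hu', hut⟩ := Real.exists_seq_rat_strictAnti_tendsto (t : ℝ)
  have h6 : Tendsto (fun n => (u n : ℝ).toNNReal) atTop (𝓝[≥] t) := by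
    refine tendsto_nhdsWithin_iff.2 ⟨?_, .of_forall fun n => ?_⟩
    · have := (continuous_real_toNNReal.tendsto _).comp hut
      rwa [Real.toNNReal_coe] at this
    · exact (Real.le_toNNReal_iff_coe_le (t.2.trans (hu' n).le)).2 (hu' n).le
  have h7 := (h4 t hlt).tendsto.comp h6
  have h8 := (h5 t hlt).tendsto.comp h6
  refine tendsto_nhds_unique h7 (h8.congr' ?_)
  have h9 : ∀ᶠ n in atTop, (u n : ℝ).toNNReal < T :=
    (tendsto_nhds_of_tendsto_nhdsWithin h6).eventually (gt_mem_nhds hlt)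
  filter_upwards [h9] with n hn
  have := h2 (u n)
  rw [min_eq_left hn.le] at this
  exact this.symm

end

/-! ### Integrals as limits: existence, isometry and uniqueness -/

section

variable {Ω : Type*} [MeasurableSpace Ω] {P : Measure Ω} {ℱ : Filtration ℝ≥0 ‹MeasurableSpace Ω›}
  {T : ℝ≥0} {h : RField Ω} {Γ : ℝ≥0 → ℝ → ℝ → Ω → ℝ} {G : Ω → ℝ≥0 → ℝ → ℝ → ℝ}

/-- The norm of a field that corresponds to the absolute form. -/
def absNorm (P : Measure Ω) (T : ℝ≥0) (Γ : ℝ≥0 → ℝ → ℝ → Ω → ℝ) (u : RField Ω) : ℝ≥0∞ :=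
  absInt P T Γ u u ^ (1 / 2 : ℝ)

theorem absNorm_sub_comm (u v : RField Ω) :
    absNorm P T Γ (fun s x ω => u s x ω - v s x ω) = absNorm P T Γ fun s x ω => v s x ω - u s x ω := by
  unfold absNorm absInt
  congr 1
  refine lintegral_congr fun ω => lintegral_congr fun z => ?_
  congr 1
  ring

/-- Of the convergence in two independent indices only the diagonal is used. -/
theorem Approx.tendsto_absNorm {ι : Type*} [Preorder ι] {k : ι → RField Ω} {g : RField Ω}
    (hk : Approx P T Γ k g) :
    Tendsto (fun a => absNorm P T Γ fun s x ω => g s x ω - k a s x ω) atTop (𝓝 0) := by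
  have h1 := hk.comp tendsto_atTop_diagonal
  have h2 := (ENNReal.continuous_rpow_const (y := 1 / 2)).tendsto 0 |>.comp h1
  rwa [ENNReal.zero_rpow_of_pos (by norm_num)] at h2

theorem IsGoodVersion.eLpNorm_crossNorm_le (hG : IsGoodVersion P ℱ T Γ G) {u : RField Ω}
    (hu : IsJointMeas T u) {t : ℝ≥0} (ht : t ≤ T) :
    eLpNorm (crossNorm T Γ u t) 2 P ≤ absNorm P T Γ u := by
  rcases eq_or_ne (absInt P T Γ u u) ∞ with h | h
  · simp [absNorm, h]
  · have h1 := hG.eLpNorm_crossNorm_sq_le hu h.lt_top ht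
    have h2 := ENNReal.rpow_le_rpow h1 (z := 1 / 2) (by norm_num)
    rwa [← ENNReal.rpow_natCast, ← ENNReal.rpow_mul, show ((2 : ℕ) : ℝ) * (1 / 2) = 1 by norm_num,
      ENNReal.rpow_one] at h2

theorem IsGoodVersion.eLpNorm_crossNorm_sum_le (hG : IsGoodVersion P ℱ T Γ G) {ι : Type*}
    (s : Finset ι) {u : RField Ω} {v : ι → RField Ω} (hv : ∀ i ∈ s, IsJointMeas T (v i))
    (hu : IsJointMeas T u) (huv : ∀ r x ω, u r x ω = ∑ i ∈ s, v i r x ω)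
    (hfv : ∀ i ∈ s, ∀ᵐ ω ∂P, absForm T Γ (v i) (v i) ω < ∞)
    (hfu : ∀ᵐ ω ∂P, absForm T Γ u u ω < ∞) {t : ℝ≥0} (ht : t ≤ T) :
    eLpNorm (crossNorm T Γ u t) 2 P ≤ ∑ i ∈ s, eLpNorm (crossNorm T Γ (v i) t) 2 P := by
  refine le_trans ?_ (eLpNorm_sum_le (f := fun i => crossNorm T Γ (v i) t)
    (fun i hi => hG.aestronglyMeasurable_crossNorm (hv i hi) (hfv i hi) ht) one_le_two)
  refine eLpNorm_mono_ae_real ?_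
  filter_upwards [hG.ae_crossNorm_sum_le s hv hu huv hfv hfu ht] with ω hω
  rw [Finset.sum_apply, crossNorm, Real.norm_of_nonneg (Real.sqrt_nonneg _)]
  exact hω

/-- If a summand has an absolute form of infinite mean, the right side is infinite. The field `u`
itself needs a finite absolute form only path by path, not in mean. -/
theorem IsGoodVersion.eLpNorm_crossNorm_le_sum (hG : IsGoodVersion P ℱ T Γ G) {ι : Type*}
    (s : Finset ι) {u : RField Ω} {v : ι → RField Ω} (hv : ∀ i ∈ s, IsJointMeas T (v i))
    (hu : IsJointMeas T u) (huv : ∀ r x ω, u r x ω = ∑ i ∈ s, v i r x ω)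
    (hfu : ∀ᵐ ω ∂P, absForm T Γ u u ω < ∞) {t : ℝ≥0} (ht : t ≤ T) :
    eLpNorm (crossNorm T Γ u t) 2 P ≤ ∑ i ∈ s, absNorm P T Γ (v i) := by
  by_cases hfin : ∀ i ∈ s, absInt P T Γ (v i) (v i) < ∞
  · refine (hG.eLpNorm_crossNorm_sum_le s hv hu huv (fun i hi => hG.ae_absForm_lt_top (hv i hi)
      (hv i hi) (hfin i hi)) hfu ht).trans ?_
    exact Finset.sum_le_sum fun i hi => hG.eLpNorm_crossNorm_le (hv i hi) ht
  · push Not at hfin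
    obtain ⟨i, hi, h⟩ := hfin
    have h1 : absNorm P T Γ (v i) = ∞ := by
      rw [absNorm, top_le_iff.1 h]; simp
    rw [ENNReal.sum_eq_top.2 ⟨i, hi, h1⟩]
    exact le_top

theorem IsGoodVersion.eLpNorm_crossNorm_le_add (hG : IsGoodVersion P ℱ T Γ G) {g k : RField Ω}
    (hg : IsV3 P ℱ T Γ g) (hk : IsV3 P ℱ T Γ k) {t : ℝ≥0} (ht : t ≤ T) :
    eLpNorm (crossNorm T Γ g t) 2 P ≤ eLpNorm (crossNorm T Γ k t) 2 P
      + absNorm P T Γ fun s x ω => g s x ω - k s x ω := by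
  have hd : IsJointMeas T fun s x ω => g s x ω - k s x ω := IsJointMeas.sub hg.v1.meas hk.v1.meas
  rcases eq_or_ne (absInt P T Γ (fun s x ω => g s x ω - k s x ω) fun s x ω => g s x ω - k s x ω) ∞
    with h | h
  · rw [absNorm, h]; simp
  have h1 := hG.eLpNorm_crossNorm_sum_le Finset.univ
    (v := fun b : Bool => if b then k else fun s x ω => g s x ω - k s x ω) (u := g)
    (fun b _ => by cases b; exacts [hd, hk.v1.meas]) hg.v1.meas
    (fun r x ω => by simp)
    (fun b _ => by
      cases b
      exacts [hG.ae_absForm_lt_top hd hd h.lt_top,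
        hG.ae_absForm_lt_top hk.v1.meas hk.v1.meas hk.finite])
    (hG.ae_absForm_lt_top hg.v1.meas hg.v1.meas hg.finite) ht
  simp only [Fintype.sum_bool, if_true, Bool.false_eq_true, if_false] at h1
  exact h1.trans (add_le_add_right (hG.eLpNorm_crossNorm_le hd ht) _)

variable [IsProbabilityMeasure P]

/-- The difference of two simple functions is simple. Its form is finite path by path but perhaps
not in mean, so the difference is estimated through pieces `v` that can be controlled one at a time.
-/
theorem IsV2.eLpNorm_integral_sub_le (hh : IsV2 P ℱ T h Γ) (φ ψ : Simple ℱ T) {ι : Type*}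
    (s : Finset ι) {v : ι → RField Ω} (hv : ∀ i ∈ s, IsJointMeas T (v i))
    (huv : ∀ r x ω, φ.toField r x ω - ψ.toField r x ω = ∑ i ∈ s, v i r x ω) {t : ℝ≥0} (ht : t ≤ T) :
    eLpNorm (fun ω => φ.integral h t ω - ψ.integral h t ω) 2 P ≤ ∑ i ∈ s, absNorm P T Γ (v i) := by
  obtain ⟨G, hG⟩ := hh.exists_goodVersion
  obtain ⟨χ, hχ, hχi⟩ := φ.exists_linear_comb_toField ψ 1 (-1)
  have h1 : (fun ω => φ.integral h t ω - ψ.integral h t ω) = χ.integral h t := by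
    funext ω; rw [hχi]; ring
  rw [h1]
  refine (hh.eLpNorm_integral_le χ ht).trans (hG.eLpNorm_crossNorm_le_sum s hv χ.isV1.meas
    (fun r x ω => ?_) (hG.ae_absForm_simple_lt_top χ) ht)
  rw [hχ, ← huv]; ring

/-- Integrals of a convergent double sequence of simple functions converge. -/
theorem IsV2.exists_limit_simple (hh : IsV2 P ℱ T h Γ) {g : RField Ω} (hg : IsV3 P ℱ T Γ g)
    {φ : ℕ × ℕ → Simple ℱ T} (hφ : IsSimpleApprox P Γ g φ) :
    ∃ J : Proc Ω, IsContM2 P ℱ T J ∧ TendstoM2 P T (fun a => (φ a).integral h) J := by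
  refine exists_isContM2_of_tendsto (d := fun n => (n, n)) tendsto_atTop_diagonal
    (fun a => hh.isContM2_integral _ (hφ.1 a).finite) ?_
  have h1 := hφ.2.tendsto_absNorm
  have h2 : Tendsto (fun p : (ℕ × ℕ) × ℕ × ℕ =>
      (absNorm P T Γ fun s x ω => g s x ω - (φ p.1).toField s x ω)
        + absNorm P T Γ fun s x ω => g s x ω - (φ p.2).toField s x ω) atTop (𝓝 0) := by
    rw [← prod_atTop_atTop_eq]
    simpa using (h1.comp tendsto_fst).add (h1.comp tendsto_snd)
  refine tendsto_of_tendsto_of_tendsto_of_le_of_le tendsto_const_nhds h2 (fun p => zero_le) fun p => ?_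
  have hm : ∀ a, IsJointMeas T fun s x ω => g s x ω - (φ a).toField s x ω := fun a =>
    IsJointMeas.sub hg.v1.meas (φ a).isV1.meas
  have hm' : ∀ a, IsJointMeas T fun s x ω => (φ a).toField s x ω - g s x ω := fun a =>
    IsJointMeas.sub (φ a).isV1.meas hg.v1.meas
  have h3 := hh.eLpNorm_integral_sub_le (φ p.1) (φ p.2) Finset.univ
    (v := fun b : Bool => if b then fun s x ω => (φ p.1).toField s x ω - g s x ω
      else fun s x ω => g s x ω - (φ p.2).toField s x ω)
    (fun b _ => by cases b; exacts [hm _, hm' _]) (fun r x ω => by simp) le_rfl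
  simp only [Fintype.sum_bool, if_true, Bool.false_eq_true, if_false] at h3
  rwa [absNorm_sub_comm] at h3

theorem TendstoM2.ae_eq {ι : Type*} [Preorder ι] [(atTop : Filter ι).NeBot] {X : ι → Proc Ω}
    {J J' : Proc Ω} (hX : ∀ a, AEStronglyMeasurable (X a T) P) (hJ : AEStronglyMeasurable (J T) P)
    (hJ' : AEStronglyMeasurable (J' T) P)
    (h1 : TendstoM2 P T X J) (h2 : TendstoM2 P T X J') : J T =ᵐ[P] J' T := by
  have h3 : Tendsto (fun a => eLpNorm (fun ω => X a T ω - J T ω) 2 P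
      + eLpNorm (fun ω => X a T ω - J' T ω) 2 P) atTop (𝓝 0) := by
    simpa using Tendsto.add h1 h2
  have h4 : eLpNorm (fun ω => J T ω - J' T ω) 2 P ≤ 0 := by
    refine ge_of_tendsto h3 (.of_forall fun a => ?_)
    have h5 := eLpNorm_sub_le (p := 2) (μ := P) ((hX a).sub hJ') ((hX a).sub hJ) one_le_two
    have h6 : (X a T - J' T) - (X a T - J T) = fun ω => J T ω - J' T ω := by funext ω; simp
    rw [h6, add_comm] at h5
    exact h5
  have h7 := (eLpNorm_eq_zero_iff (hJ.sub hJ') two_ne_zero).1 (le_antisymm h4 zero_le)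
  filter_upwards [h7] with ω hω
  simpa [sub_eq_zero] using hω

/-- The norm sees only the terminal value. Two limits therefore agree at time `T`, hence at all
times by the martingale property and right continuity, and `J` inherits the continuity of `J'`. -/
theorem IsContM2.of_tendsto {ι : Type*} [Preorder ι] [(atTop : Filter ι).NeBot] {X : ι → Proc Ω}
    {J J' : Proc Ω} (hX : ∀ a, IsM2 P ℱ T (X a)) (hJ : IsM2 P ℱ T J) (hJ' : IsContM2 P ℱ T J')
    (h1 : TendstoM2 P T X J) (h2 : TendstoM2 P T X J') : IsContM2 P ℱ T J where
  toIsM2 := hJ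
  cont := by
    filter_upwards [hJ.indistinguishable hJ'.toIsM2 (TendstoM2.ae_eq (fun a => (hX a).memLp.1)
      hJ.memLp.1 hJ'.memLp.1 h1 h2), hJ'.cont] with ω h3 h4
    exact h4.congr fun t ht => h3 t ht

theorem IsV2.isContM2_of_isSimpleLimit (hh : IsV2 P ℱ T h Γ) {g : RField Ω} (hg : IsV3 P ℱ T Γ g)
    {J : Proc Ω} (hJ : IsSimpleLimit P ℱ T h Γ g J) : IsContM2 P ℱ T J := by
  obtain ⟨φ, hφ, hJ2, hJt⟩ := hJ
  obtain ⟨J', hJ', hJt'⟩ := hh.exists_limit_simple hg hφ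
  exact .of_tendsto (fun a => (hh.isContM2_integral _ (hφ.1 a).finite).toIsM2) hJ2 hJ' hJt hJt'

/-- Distance of integrals of two fields. -/
theorem IsV2.eLpNorm_sub_le_of_isSimpleLimit (hh : IsV2 P ℱ T h Γ) {g k k' : RField Ω} {K K' : Proc Ω}
    (hg : IsV3 P ℱ T Γ g) (hk : IsV3 P ℱ T Γ k) (hk' : IsV3 P ℱ T Γ k')
    (hK : IsSimpleLimit P ℱ T h Γ k K) (hK' : IsSimpleLimit P ℱ T h Γ k' K') :
    eLpNorm (fun ω => K T ω - K' T ω) 2 P ≤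
      (absNorm P T Γ fun s x ω => g s x ω - k s x ω)
        + absNorm P T Γ fun s x ω => g s x ω - k' s x ω := by
  obtain ⟨φ, hφ, hK2, hKt⟩ := hK
  obtain ⟨ψ, hψ, hK2', hKt'⟩ := hK'
  have e1 := hφ.2.tendsto_absNorm
  have e2 := hψ.2.tendsto_absNorm
  set c := (absNorm P T Γ fun s x ω => g s x ω - k s x ω)
        + absNorm P T Γ fun s x ω => g s x ω - k' s x ω with hc
  have h1 : Tendsto (fun a => eLpNorm (fun ω => (φ a).integral h T ω - K T ω) 2 P
      + eLpNorm (fun ω => (ψ a).integral h T ω - K' T ω) 2 P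
      + ((absNorm P T Γ fun s x ω => k s x ω - (φ a).toField s x ω)
      + absNorm P T Γ fun s x ω => k' s x ω - (ψ a).toField s x ω) + c) atTop (𝓝 c) := by
    simpa using (((Tendsto.add hKt hKt').add (e1.add e2)).add_const c)
  refine ge_of_tendsto h1 (.of_forall fun a => ?_)
  have i1 := (hh.isContM2_integral _ (hφ.1 a).finite).memLp.1
  have i2 := (hh.isContM2_integral _ (hψ.1 a).finite).memLp.1
  -- The four pieces are the links of the chain φ, k, g, k', ψ. The outer links tend to zero and the
  -- two inner links make up the asserted bound.
  have h3 := hh.eLpNorm_integral_sub_le (φ a) (ψ a) Finset.univ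
    (v := ![fun s x ω => (φ a).toField s x ω - k s x ω, fun s x ω => k s x ω - g s x ω,
      fun s x ω => g s x ω - k' s x ω, fun s x ω => k' s x ω - (ψ a).toField s x ω])
    (fun b _ => by
      fin_cases b
      exacts [IsJointMeas.sub (φ a).isV1.meas hk.v1.meas, IsJointMeas.sub hk.v1.meas hg.v1.meas,
        IsJointMeas.sub hg.v1.meas hk'.v1.meas, IsJointMeas.sub hk'.v1.meas (ψ a).isV1.meas])
    (fun r x ω => by simp [Fin.sum_univ_four]) le_rfl
  simp only [Fin.sum_univ_four, Matrix.cons_val] at h3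
  rw [absNorm_sub_comm _ k, absNorm_sub_comm k g] at h3
  have h4 : (fun ω => K T ω - K' T ω) = (((φ a).integral h T - (ψ a).integral h T)
      - ((φ a).integral h T - K T)) + ((ψ a).integral h T - K' T) := by
    funext ω; simp
  rw [h4]
  have h5 := eLpNorm_add_le (p := 2) (μ := P) ((i1.sub i2).sub (i1.sub hK2.memLp.1))
    (i2.sub hK2'.memLp.1) one_le_two
  have h6 := eLpNorm_sub_le (p := 2) (μ := P) (i1.sub i2) (i1.sub hK2.memLp.1) one_le_two
  calc _ ≤ _ := h5
    _ ≤ _ := add_le_add_left h6 _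
    _ ≤ _ := add_le_add_left (add_le_add_left h3 _) _
    _ = _ := by
      rw [hc]
      change _ + eLpNorm (fun ω => (φ a).integral h T ω - K T ω) 2 P
        + eLpNorm (fun ω => (ψ a).integral h T ω - K' T ω) 2 P = _
      ring

/-- Iterated limits exist. -/
theorem IsV2.exists_limit_iter (hh : IsV2 P ℱ T h Γ) {g : RField Ω} (hg : IsV3 P ℱ T Γ g)
    {k : ℕ → RField Ω} {K : ℕ → Proc Ω} (hk : IsIterApprox P ℱ T h Γ g k K) :
    ∃ J : Proc Ω, IsContM2 P ℱ T J ∧ TendstoM2 P T K J := by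
  refine exists_isContM2_of_tendsto (d := id) tendsto_id
    (fun n => hh.isContM2_of_isSimpleLimit (hk.1 n).1 (hk.1 n).2) ?_
  have h1 := hk.2.tendsto_absNorm
  have h2 : Tendsto (fun p : ℕ × ℕ =>
      (absNorm P T Γ fun s x ω => g s x ω - k p.1 s x ω)
        + absNorm P T Γ fun s x ω => g s x ω - k p.2 s x ω) atTop (𝓝 0) := by
    rw [← prod_atTop_atTop_eq]
    simpa using (h1.comp tendsto_fst).add (h1.comp tendsto_snd)
  refine tendsto_of_tendsto_of_tendsto_of_le_of_le tendsto_const_nhds h2 (fun p => zero_le) fun p => ?_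
  exact hh.eLpNorm_sub_le_of_isSimpleLimit hg (hk.1 p.1).1 (hk.1 p.2).1 (hk.1 p.1).2 (hk.1 p.2).2

/-- A limit along simple functions is an iterated limit. -/
theorem IsSimpleLimit.isSLSIntegral {g : RField Ω} {J : Proc Ω} (hg : IsV3 P ℱ T Γ g)
    (hJ : IsSimpleLimit P ℱ T h Γ g J) : IsSLSIntegral P ℱ T h Γ g J := by
  refine ⟨fun _ => g, fun _ => J, ⟨fun n => ⟨hg, hJ⟩, ?_⟩, ?_, ?_⟩
  · simp [Approx, absInt]
  · obtain ⟨φ, -, h2, -⟩ := hJ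
    exact h2
  · simp [TendstoM2]

/-- Both sides are limits of the same sequence: the left one by convergence in the martingale space,
the right one because the norm of `crossNorm` changes by at most `absNorm` of the difference of the
fields. -/
theorem IsGoodVersion.eLpNorm_eq_of_tendsto (hG : IsGoodVersion P ℱ T Γ G) {ι : Type*} [Preorder ι]
    [(atTop : Filter ι).NeBot] {k : ι → RField Ω} {g : RField Ω} {K : ι → Proc Ω} {J : Proc Ω}
    (hg : IsV3 P ℱ T Γ g) (hk : ∀ a, IsV3 P ℱ T Γ (k a)) (hK : ∀ a, IsM2 P ℱ T (K a))
    (hJ : IsM2 P ℱ T J) (hkg : Approx P T Γ k g) (hKJ : TendstoM2 P T K J) {t : ℝ≥0} (ht : t ≤ T)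
    (hi : ∀ a, eLpNorm (K a t) 2 P = eLpNorm (crossNorm T Γ (k a) t) 2 P) :
    eLpNorm (J t) 2 P = eLpNorm (crossNorm T Γ g t) 2 P := by
  have h1 : Tendsto (fun a => eLpNorm (K a t) 2 P) atTop (𝓝 (eLpNorm (J t) 2 P)) := by
    refine tendsto_eLpNorm_of_tendsto_sub one_le_two (fun a => ((hK a).memLp_of_le ht).1)
      (hJ.memLp_of_le ht).1 ?_
    exact tendsto_of_tendsto_of_tendsto_of_le_of_le tendsto_const_nhds hKJ (fun a => zero_le)
      fun a => ((hK a).sub hJ).eLpNorm_le ht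
  have h2 : Tendsto (fun a => eLpNorm (K a t) 2 P) atTop (𝓝 (eLpNorm (crossNorm T Γ g t) 2 P)) := by
    simp_rw [hi]
    refine tendsto_of_le_add_of_le_add (.of_forall fun a => ?_)
      (.of_forall fun a => hG.eLpNorm_crossNorm_le_add hg (hk a) ht) hkg.tendsto_absNorm
    rw [absNorm_sub_comm]
    exact hG.eLpNorm_crossNorm_le_add (hk a) hg ht
  exact tendsto_nhds_unique h1 h2

/-- Positivity makes the mean of `crossInt` the square of an L² norm. The isometry thus becomes an
equality of norms, a form that is stable under limits. -/
theorem IsGoodVersion.isIsometric_iff (hG : IsGoodVersion P ℱ T Γ G) {g : RField Ω} {J : Proc Ω}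
    (hg : IsV3 P ℱ T Γ g) (hJ : IsM2 P ℱ T J) :
    IsIsometric P T Γ g J ↔
      ∀ t ≤ T, eLpNorm (J t) 2 P = eLpNorm (crossNorm T Γ g t) 2 P := by
  have hfin := hG.ae_absForm_lt_top hg.v1.meas hg.v1.meas hg.finite
  have h1 : ∀ t ≤ T, ∫ ω, crossInt T Γ g t ω ∂P
      = (eLpNorm (crossNorm T Γ g t) 2 P ^ 2).toReal := fun t ht => by
    rw [hG.eLpNorm_crossNorm_sq hg.v1.meas hfin ht]
    exact integral_eq_lintegral_of_nonneg_ae (hG.ae_crossInt_nonneg hg.v1.meas hfin ht)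
      (hG.aestronglyMeasurable_crossInt hg.v1.meas hfin ht)
  have h2 : ∀ t ≤ T, eLpNorm (crossNorm T Γ g t) 2 P ^ 2 ≠ ∞ := fun t ht =>
    ((hG.eLpNorm_crossNorm_sq_le hg.v1.meas hg.finite ht).trans_lt hg.finite).ne
  refine forall₂_congr fun t ht => ?_
  have hJt := hJ.memLp_of_le ht
  rw [h1 t ht, integral_sq_eq hJt.1,
    ENNReal.toReal_eq_toReal_iff' (ENNReal.pow_ne_top hJt.eLpNorm_ne_top) (h2 t ht),
    (ENNReal.pow_right_strictMono two_ne_zero).injective.eq_iff]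
  exact ⟨fun h => h.2.2, fun h => ⟨hJt.integrable_sq,
    hG.integrable_crossInt hg.v1.meas hg.finite ht, h⟩⟩

theorem IsV2.isIsometric_of_isSimpleLimit (hh : IsV2 P ℱ T h Γ) {g : RField Ω} (hg : IsV3 P ℱ T Γ g)
    {J : Proc Ω} (hJ : IsSimpleLimit P ℱ T h Γ g J) : IsIsometric P T Γ g J := by
  obtain ⟨G, hG⟩ := hh.exists_goodVersion
  obtain ⟨φ, hφ, hJ2, hJt⟩ := hJ
  have hM := fun a => (hh.isContM2_integral _ (hφ.1 a).finite).toIsM2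
  exact (hG.isIsometric_iff hg hJ2).2 fun t ht => hG.eLpNorm_eq_of_tendsto hg hφ.1 hM hJ2 hφ.2 hJt ht
    fun a => (hG.isIsometric_iff (hφ.1 a) (hM a)).1 (hh.isIsometric_integral _ (hφ.1 a).finite) t ht

theorem IsV2.isContM2_isIsometric_of_isSLSIntegral (hh : IsV2 P ℱ T h Γ) {g : RField Ω}
    (hg : IsV3 P ℱ T Γ g) {J : Proc Ω} (hJ : IsSLSIntegral P ℱ T h Γ g J) :
    IsContM2 P ℱ T J ∧ IsIsometric P T Γ g J := by
  obtain ⟨G, hG⟩ := hh.exists_goodVersion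
  obtain ⟨k, K, hk, hJ2, hJt⟩ := hJ
  obtain ⟨J', hJ', hJt'⟩ := hh.exists_limit_iter hg hk
  have hM := fun n => (hh.isContM2_of_isSimpleLimit (hk.1 n).1 (hk.1 n).2).toIsM2
  refine ⟨.of_tendsto hM hJ2 hJ' hJt hJt', (hG.isIsometric_iff hg hJ2).2 fun t ht => ?_⟩
  exact hG.eLpNorm_eq_of_tendsto hg (fun n => (hk.1 n).1) hM hJ2 hk.2 hJt ht fun n =>
    (hG.isIsometric_iff (hk.1 n).1 (hM n)).1
      (hh.isIsometric_of_isSimpleLimit (hk.1 n).1 (hk.1 n).2) t ht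

/-- The integral does not depend on the approximating sequences. -/
theorem IsV2.indistinguishable_of_isSLSIntegral (hh : IsV2 P ℱ T h Γ) {g : RField Ω}
    (hg : IsV3 P ℱ T Γ g) {J J' : Proc Ω} (hJ : IsSLSIntegral P ℱ T h Γ g J)
    (hJ' : IsSLSIntegral P ℱ T h Γ g J') : ∀ᵐ ω ∂P, ∀ t ≤ T, J t ω = J' t ω := by
  obtain ⟨k, K, hk, hJ2, hJt⟩ := hJ
  obtain ⟨k', K', hk', hJ2', hJt'⟩ := hJ'
  have hM := fun n => (hh.isContM2_of_isSimpleLimit (hk.1 n).1 (hk.1 n).2).toIsM2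
  have hM' := fun n => (hh.isContM2_of_isSimpleLimit (hk'.1 n).1 (hk'.1 n).2).toIsM2
  refine hJ2.indistinguishable hJ2' (TendstoM2.ae_eq (fun n => (hM n).memLp.1) hJ2.memLp.1
    hJ2'.memLp.1 hJt ?_)
  have h1 : Tendsto (fun n => (absNorm P T Γ fun s x ω => g s x ω - k n s x ω)
      + (absNorm P T Γ fun s x ω => g s x ω - k' n s x ω)
      + eLpNorm (fun ω => K' n T ω - J' T ω) 2 P) atTop (𝓝 0) := by
    simpa using (hk.2.tendsto_absNorm.add hk'.2.tendsto_absNorm).add hJt'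
  refine tendsto_of_tendsto_of_tendsto_of_le_of_le tendsto_const_nhds h1 (fun n => zero_le) fun n => ?_
  have h2 := eLpNorm_add_le (p := 2) (μ := P) ((hM n).memLp.1.sub (hM' n).memLp.1)
    ((hM' n).memLp.1.sub hJ2'.memLp.1) one_le_two
  rw [sub_add_sub_cancel] at h2
  exact h2.trans (add_le_add_left (hh.eLpNorm_sub_le_of_isSimpleLimit hg (hk.1 n).1 (hk'.1 n).1
    (hk.1 n).2 (hk'.1 n).2) _)

end

/-! ### Random fields with equal integrals over past events -/

theorem continuous_measureReal_Iic (n : Measure ℝ≥0) [IsFiniteMeasure n] (hn : ∀ s, n {s} = 0) :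
    Continuous fun t => n.real (Set.Iic t) := by
  have h1 : (fun t => n.real (Set.Iic t)) = fun t => ∫ s, (Set.Iic t).indicator (fun _ => (1 : ℝ)) s ∂n := by
    funext t
    rw [integral_indicator_const _ measurableSet_Iic]; simp
  rw [h1]
  refine continuous_iff_continuousAt.2 fun t => ?_
  refine continuousAt_of_dominated (bound := fun _ => 1)
    (.of_forall fun t => (measurable_const.indicator measurableSet_Iic).aestronglyMeasurable)
    (.of_forall fun t => .of_forall fun s => ?_) (integrable_const _) ?_
  · by_cases hs : s ∈ Set.Iic t <;> simp [hs]
  · filter_upwards [measure_eq_zero_iff_ae_notMem.1 (hn t)] with s hs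
    rcases lt_or_gt_of_ne (show s ≠ t from hs) with h | h
    · refine ContinuousAt.congr (f := fun _ => (1 : ℝ)) continuousAt_const ?_
      filter_upwards [lt_mem_nhds h] with r hr
      rw [Set.indicator_of_mem (Set.mem_Iic.2 hr.le)]
    · refine ContinuousAt.congr (f := fun _ => (0 : ℝ)) continuousAt_const ?_
      filter_upwards [gt_mem_nhds h] with r hr
      rw [Set.indicator_of_notMem fun hc => (not_lt.2 (Set.mem_Iic.1 hc)) hr]

theorem boundedVariationOn_of_monotoneOn {f : ℝ≥0 → ℝ} {T : ℝ≥0} (hf : MonotoneOn f (Set.Iic T)) :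
    BoundedVariationOn f (Set.Iic T) := by
  have h1 := hf.eVariationOn_eq (Set.mem_Iic.2 (zero_le (a := T))) (Set.mem_Iic.2 le_rfl)
  have h2 : Set.Iic T ∩ Set.Icc 0 T = Set.Iic T := by
    ext s; simp
  rw [h2] at h1
  exact h1.trans_ne ENNReal.ofReal_ne_top

section

variable {Ω : Type*} [m0 : MeasurableSpace Ω] {P : Measure Ω} {ℱ : Filtration ℝ≥0 m0}
  {T : ℝ≥0} {Γ : ℝ≥0 → ℝ → ℝ → Ω → ℝ} {G : Ω → ℝ≥0 → ℝ → ℝ → ℝ}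

/-- A function that is measurable with respect to the completion of a sub-σ-algebra is almost
surely equal to its conditional expectation. -/
theorem condExp_ae_eq_self_of_eventuallyMeasurable [IsFiniteMeasure P] {m : MeasurableSpace Ω}
    (hm : m ≤ m0) {Y : Ω → ℝ} (hY : Measurable[m0] Y) (hYm : Measurable[eventuallyMeasurableSpace m (ae P)] Y)
    (hi : Integrable Y P) : P[Y | m] =ᵐ[P] Y := by
  set m' : MeasurableSpace Ω := eventuallyMeasurableSpace m (ae P) ⊓ m0 with hm'
  have hle : m' ≤ m0 := inf_le_right
  have hmm' : m ≤ m' := le_inf le_eventuallyMeasurableSpace hm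
  have hYm' : StronglyMeasurable[m'] Y := by
    refine Measurable.stronglyMeasurable fun S hS => ?_
    exact MeasurableSpace.measurableSet_inf.2 ⟨hYm hS, hY hS⟩
  have h1 : P[Y | m'] = Y := condExp_of_stronglyMeasurable hle hYm' hi
  -- Every set of the larger σ-algebra differs from a set of `m` by a null set, so the integrals
  -- that characterise the two conditional expectations are the same.
  have h2 : P[Y | m] =ᵐ[P] P[Y | m'] := by
    refine ae_eq_condExp_of_forall_setIntegral_eq hle hi (fun S _ _ => integrable_condExp.integrableOn)
      (fun S hS _ => ?_) (stronglyMeasurable_condExp.mono hmm').aestronglyMeasurable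
    obtain ⟨S', hS', hSS'⟩ := (MeasurableSpace.measurableSet_inf.1 hS).1
    rw [setIntegral_congr_set hSS', setIntegral_congr_set hSS', setIntegral_condExp hm hi hS']
  rw [h1] at h2
  exact h2

/-- `Y` is adapted only up to null sets. Its conditional expectations given `ℱ t` form an adapted
version, while `Y` itself supplies the continuous paths of bounded variation; the theorem on
martingales accepts such a pair. -/
theorem ae_eq_of_setIntegral_eq_of_bv [IsProbabilityMeasure P] {Y : Proc Ω}
    (hY : ∀ t ≤ T, Measurable (Y t)) (hYF : ∀ t ≤ T, Measurable[eventuallyMeasurableSpace (ℱ t) (ae P)] (Y t))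
    (hint : ∀ t ≤ T, Integrable (Y t) P)
    (hmart : ∀ s t, s ≤ t → t ≤ T → ∀ D, MeasurableSet[ℱ s] D → ∫ ω in D, Y t ω ∂P = ∫ ω in D, Y s ω ∂P)
    (hcont : ∀ᵐ ω ∂P, ContinuousOn (fun s => Y s ω) (Set.Iic T))
    (hbv : ∀ᵐ ω ∂P, BoundedVariationOn (fun s => Y s ω) (Set.Iic T))
    {s t : ℝ≥0} (hst : s ≤ t) (ht : t ≤ T) : Y s =ᵐ[P] Y t := by
  have h1 : ∀ t ≤ T, P[Y t | ℱ t] =ᵐ[P] Y t := fun t ht =>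
    condExp_ae_eq_self_of_eventuallyMeasurable (ℱ.le t) (hY t ht) (hYF t ht) (hint t ht)
  have h2 := ae_eq_of_martingale_bv (P := P) (ℱ := ℱ) (T := T) (A := fun t => P[Y t | ℱ t]) (B := Y)
    (fun t _ => stronglyMeasurable_condExp.measurable) (fun t _ => integrable_condExp)
    (fun s t hst ht => ?_) h1 hcont hbv hst ht
  · exact (h1 s (hst.trans ht)).symm.trans (h2.trans (h1 t ht))
  · refine (condExp_condExp_of_le (ℱ.mono hst) (ℱ.le t)).trans ?_
    refine (ae_eq_condExp_of_forall_setIntegral_eq (ℱ.le s) (hint t ht)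
      (fun D _ _ => integrable_condExp.integrableOn) (fun D hD _ => ?_)
      stronglyMeasurable_condExp.aestronglyMeasurable).symm
    rw [setIntegral_condExp (ℱ.le s) (hint s (hst.trans ht)) hD, hmart s t hst ht D hD]

/-- The total variation measure of the paths of a good version. -/
def pathTV (T : ℝ≥0) (G : Ω → ℝ≥0 → ℝ → ℝ → ℝ) (ω : Ω) : Measure (ℝ≥0 × ℝ × ℝ) :=
  (pathPair T (G ω)).1 + (pathPair T (G ω)).2

/-- The integral of a nonnegative field against the total variation measure, over `(0, t]`. -/
def cumul (T : ℝ≥0) (G : Ω → ℝ≥0 → ℝ → ℝ → ℝ) (H : Ω × ℝ≥0 × ℝ × ℝ → ℝ≥0∞) (t : ℝ≥0) (ω : Ω) :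
    ℝ≥0∞ :=
  ∫⁻ z in Set.Ioc 0 t ×ˢ Set.univ, H (ω, z) ∂(pathTV T G ω)

/-- Measurability with respect to the past, of fields on `(0, T]`. -/
def IsPast {E : Type*} [MeasurableSpace E] (ℱ : Filtration ℝ≥0 m0) (T : ℝ≥0)
    (H : Ω × ℝ≥0 × E → ℝ≥0∞) : Prop :=
  ∀ t ≤ T, Measurable[(ℱ t).prod inferInstance]
    ((Set.univ ×ˢ Set.Ioc 0 t ×ˢ Set.univ : Set (Ω × ℝ≥0 × E)).indicator H)

theorem cumul_eq (H : Ω × ℝ≥0 × ℝ × ℝ → ℝ≥0∞) (t : ℝ≥0) (ω : Ω) :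
    cumul T G H t ω = ∫⁻ z in Set.Iic t ×ˢ Set.univ,
      (Set.univ ×ˢ Set.Ioc 0 t ×ˢ Set.univ : Set (Ω × ℝ≥0 × ℝ × ℝ)).indicator H (ω, z)
        ∂(pathTV T G ω) := by
  have hS : MeasurableSet (Set.Ioc 0 t ×ˢ Set.univ : Set (ℝ≥0 × ℝ × ℝ)) := measurableSet_Ioc.prod .univ
  have hsub : (Set.Ioc 0 t ×ˢ Set.univ : Set (ℝ≥0 × ℝ × ℝ)) ⊆ Set.Iic t ×ˢ Set.univ :=
    Set.prod_mono Set.Ioc_subset_Iic_self subset_rfl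
  have : (fun z : ℝ≥0 × ℝ × ℝ => (Set.univ ×ˢ Set.Ioc 0 t ×ˢ Set.univ : Set (Ω × ℝ≥0 × ℝ × ℝ)).indicator H (ω, z))
      = (Set.Ioc 0 t ×ˢ Set.univ : Set (ℝ≥0 × ℝ × ℝ)).indicator fun z => H (ω, z) := by
    funext z
    by_cases hz : z ∈ (Set.Ioc 0 t ×ˢ Set.univ : Set (ℝ≥0 × ℝ × ℝ))
    · rw [Set.indicator_of_mem hz, Set.indicator_of_mem (Set.mk_mem_prod (Set.mem_univ ω) hz)]
    · rw [Set.indicator_of_notMem hz, Set.indicator_of_notMem fun h => hz h.2]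
  rw [this, lintegral_indicator hS, Measure.restrict_restrict hS, Set.inter_eq_left.2 hsub]
  rfl

theorem IsGoodVersion.measurable_cumul (hG : IsGoodVersion P ℱ T Γ G) {H : Ω × ℝ≥0 × ℝ × ℝ → ℝ≥0∞}
    (hH : Measurable H) {t : ℝ≥0} (ht : t ≤ T) : Measurable (cumul T G H t) := by
  have hS : MeasurableSet (Set.univ ×ˢ Set.Ioc 0 t ×ˢ Set.univ : Set (Ω × ℝ≥0 × ℝ × ℝ)) :=
    MeasurableSet.univ.prod (measurableSet_Ioc.prod .univ)
  have h1 := measurable_lintegral_pathPair hG.good ht (fun s hs => hG.meas s (hs.trans ht))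
    (hH.indicator hS)
  have h2 : cumul T G H t = fun ω => _ := funext fun ω => (cumul_eq H t ω).trans
    (by rw [pathTV, Measure.restrict_add, lintegral_add_measure])
  rw [h2]
  exact h1.1.add h1.2

/-- The measurability of path integrals is used over `Ω` with the completion of `ℱ t`, which is the
reason why that lemma asks only for values of the path up to `t`. -/
theorem IsGoodVersion.measurable_cumul_past (hG : IsGoodVersion P ℱ T Γ G)
    {H : Ω × ℝ≥0 × ℝ × ℝ → ℝ≥0∞} (hH : IsPast ℱ T H) {t : ℝ≥0} (ht : t ≤ T) :
    Measurable[eventuallyMeasurableSpace (ℱ t) (ae P)] (cumul T G H t) := by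
  have h1 := @measurable_lintegral_pathPair T Ω (eventuallyMeasurableSpace (ℱ t) (ae P)) G t hG.good ht
    (fun s hs x y => by
      refine (hG.adapted s (hs.trans ht) x y).mono ?_ le_rfl
      exact fun S ⟨S', hS', h⟩ => ⟨S', ℱ.mono hs _ hS', h⟩) _
    ((hH t ht).mono (sup_le_sup_right (MeasurableSpace.comap_mono le_eventuallyMeasurableSpace) _) le_rfl)
  have h2 : cumul T G H t = fun ω => _ := funext fun ω => (cumul_eq H t ω).trans
    (by rw [pathTV, Measure.restrict_add, lintegral_add_measure])
  rw [h2]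
  exact h1.1.add h1.2

theorem cumul_mono (H : Ω × ℝ≥0 × ℝ × ℝ → ℝ≥0∞) (ω : Ω) : Monotone fun t => cumul T G H t ω :=
  fun _ _ h => lintegral_mono_set (Set.prod_mono (Set.Ioc_subset_Ioc_right h) subset_rfl)

theorem cumul_add (H : Ω × ℝ≥0 × ℝ × ℝ → ℝ≥0∞) (ω : Ω) {s t : ℝ≥0} (hst : s ≤ t) :
    cumul T G H t ω = cumul T G H s ω + ∫⁻ z in Set.Ioc s t ×ˢ Set.univ, H (ω, z) ∂(pathTV T G ω) := by
  have h1 : (Set.Ioc 0 t ×ˢ Set.univ : Set (ℝ≥0 × ℝ × ℝ))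
      = Set.Ioc 0 s ×ˢ Set.univ ∪ Set.Ioc s t ×ˢ Set.univ := by
    rw [← Set.union_prod, Set.Ioc_union_Ioc_eq_Ioc zero_le hst]
  rw [cumul, h1, lintegral_union (measurableSet_Ioc.prod .univ)]
  · rfl
  · refine Set.disjoint_left.2 fun z hz hz' => ?_
    exact (not_lt.2 hz.1.2) hz'.1.1

/-- Projected to the time axis, the measure with density `f` is finite and has no atoms, since no
fixed time carries mass. -/
theorem IsGoodPath.continuousOn_setLIntegral {F : ℝ≥0 → ℝ → ℝ → ℝ} (hF : IsGoodPath T F)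
    {f : ℝ≥0 × ℝ × ℝ → ℝ≥0∞}
    (hfin : ∫⁻ z in Set.Ioc 0 T ×ˢ Set.univ, f z ∂((pathPair T F).1 + (pathPair T F).2) < ∞) :
    ContinuousOn (fun t => (∫⁻ z in Set.Ioc 0 t ×ˢ Set.univ, f z
      ∂((pathPair T F).1 + (pathPair T F).2)).toReal) (Set.Iic T) := by
  set κ := (pathPair T F).1 + (pathPair T F).2 with hκ
  have hS : ∀ t, MeasurableSet (Set.Ioc 0 t ×ˢ Set.univ : Set (ℝ≥0 × ℝ × ℝ)) := fun t =>
    measurableSet_Ioc.prod .univ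
  set n := ((κ.restrict (Set.Ioc 0 T ×ˢ Set.univ)).withDensity f).map Prod.fst with hn
  have hfinn : IsFiniteMeasure n := by
    have : IsFiniteMeasure ((κ.restrict (Set.Ioc 0 T ×ˢ Set.univ)).withDensity f) :=
      isFiniteMeasure_withDensity hfin.ne
    infer_instance
  have h0 : ∀ s, n {s} = 0 := fun s => by
    rw [hn, Measure.map_apply measurable_fst (measurableSet_singleton s),
      withDensity_apply _ (measurable_fst (measurableSet_singleton s))]
    refine setLIntegral_measure_zero _ _ (le_antisymm ((Measure.restrict_apply_le _ _).trans ?_) zero_le)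
    have := hF.measure_singleton s
    rw [show (Prod.fst ⁻¹' {s} : Set (ℝ≥0 × ℝ × ℝ)) = {s} ×ˢ Set.univ by ext; simp, hκ,
      Measure.add_apply, this.1, this.2, add_zero]
  refine (continuous_measureReal_Iic n h0).continuousOn.congr fun t ht => ?_
  have h1 : (Prod.fst ⁻¹' Set.Iic t ∩ Set.Ioc 0 T ×ˢ Set.univ : Set (ℝ≥0 × ℝ × ℝ))
      = Set.Ioc 0 t ×ˢ Set.univ := by
    ext z
    simp only [Set.mem_inter_iff, Set.mem_preimage, Set.mem_prod, Set.mem_Ioc, Set.mem_Iic, Set.mem_univ,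
      and_true]
    exact ⟨fun h => ⟨h.2.1, h.1⟩, fun h => ⟨h.2, h.1, h.2.trans ht⟩⟩
  change _ = n.real (Set.Iic t)
  rw [measureReal_def, hn, Measure.map_apply measurable_fst measurableSet_Iic,
    withDensity_apply _ (measurable_fst measurableSet_Iic),
    Measure.restrict_restrict (measurable_fst measurableSet_Iic), h1]

/-- Two nonnegative random fields with the same predictable projection have the same integrals. -/
theorem IsGoodVersion.ae_cumul_eq [IsProbabilityMeasure P] (hG : IsGoodVersion P ℱ T Γ G)
    {H H' : Ω × ℝ≥0 × ℝ × ℝ → ℝ≥0∞} (hm : Measurable H) (hm' : Measurable H') (hH : IsPast ℱ T H)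
    (hH' : IsPast ℱ T H') (hfin : ∫⁻ ω, cumul T G H T ω ∂P < ∞) (hfin' : ∫⁻ ω, cumul T G H' T ω ∂P < ∞)
    (heq : ∀ s t, s ≤ t → t ≤ T → ∀ D, MeasurableSet[ℱ s] D →
      ∫⁻ ω in D, ∫⁻ z in Set.Ioc s t ×ˢ Set.univ, H (ω, z) ∂(pathTV T G ω) ∂P
        = ∫⁻ ω in D, ∫⁻ z in Set.Ioc s t ×ˢ Set.univ, H' (ω, z) ∂(pathTV T G ω) ∂P)
    {t : ℝ≥0} (ht : t ≤ T) : cumul T G H t =ᵐ[P] cumul T G H' t := by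
  have key : ∀ K : Ω × ℝ≥0 × ℝ × ℝ → ℝ≥0∞, Measurable K → ∫⁻ ω, cumul T G K T ω ∂P < ∞ →
      (∀ᵐ ω ∂P, ∀ t ≤ T, cumul T G K t ω < ∞) ∧ (∀ t ≤ T, Integrable (fun ω => (cumul T G K t ω).toReal) P) ∧
      (∀ t ≤ T, ∀ D, MeasurableSet D →
        ∫ ω in D, (cumul T G K t ω).toReal ∂P = (∫⁻ ω in D, cumul T G K t ω ∂P).toReal) ∧
      ∀ t ≤ T, ∀ D, ∫⁻ ω in D, cumul T G K t ω ∂P < ∞ := by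
    intro K hK hKf
    have h1 : ∀ᵐ ω ∂P, ∀ t ≤ T, cumul T G K t ω < ∞ := by
      filter_upwards [ae_lt_top (hG.measurable_cumul hK le_rfl) hKf.ne] with ω hω t ht
      exact (cumul_mono K ω ht).trans_lt hω
    have h2 : ∀ t ≤ T, ∀ D, ∫⁻ ω in D, cumul T G K t ω ∂P < ∞ := fun t ht D =>
      ((setLIntegral_le_lintegral _ _).trans (lintegral_mono fun ω => cumul_mono K ω ht)).trans_lt hKf
    refine ⟨h1, fun t ht => ?_, fun t ht D hD => ?_, h2⟩
    · refine integrable_toReal_of_lintegral_ne_top (hG.measurable_cumul hK ht).aemeasurable ?_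
      have := h2 t ht Set.univ
      rw [Measure.restrict_univ] at this
      exact this.ne
    · refine integral_toReal (hG.measurable_cumul hK ht).aemeasurable ?_
      exact ae_restrict_of_ae (h1.mono fun ω hω => hω t ht)
  obtain ⟨a1, a2, a3, a4⟩ := key H hm hfin
  obtain ⟨b1, b2, b3, b4⟩ := key H' hm' hfin'
  -- `Y` is a difference of continuous increasing processes, and `heq` says that its increments are
  -- centred on past events. It is therefore constant in time, and it starts from zero.
  set Y : Proc Ω := fun t ω => (cumul T G H t ω).toReal - (cumul T G H' t ω).toReal with hY
  have h := ae_eq_of_setIntegral_eq_of_bv (P := P) (ℱ := ℱ) (T := T) (Y := Y)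
    (fun t ht => (hG.measurable_cumul hm ht).ennreal_toReal.sub (hG.measurable_cumul hm' ht).ennreal_toReal)
    (fun t ht => ((hG.measurable_cumul_past hH ht).ennreal_toReal.sub
      (hG.measurable_cumul_past hH' ht).ennreal_toReal))
    (fun t ht => (a2 t ht).sub (b2 t ht)) (fun s t hst ht D hD => ?_) ?_ ?_ (zero_le (a := t)) ht
  · filter_upwards [h, a1, b1] with ω h1 h2 h3
    have h4 : ∀ K, cumul T G K 0 ω = 0 := fun K => by simp [cumul]
    simp only [hY, h4, ENNReal.toReal_zero, sub_zero] at h1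
    exact (ENNReal.toReal_eq_toReal_iff' (h2 t ht).ne (h3 t ht).ne).1 (by linarith)
  · have hs := hst.trans ht
    have hD' := ℱ.le s D hD
    have e1 : ∀ K : Ω × ℝ≥0 × ℝ × ℝ → ℝ≥0∞, Measurable K → ∫⁻ ω in D, cumul T G K t ω ∂P
        = ∫⁻ ω in D, cumul T G K s ω ∂P
          + ∫⁻ ω in D, ∫⁻ z in Set.Ioc s t ×ˢ Set.univ, K (ω, z) ∂(pathTV T G ω) ∂P := fun K hK => by
      rw [← lintegral_add_left (hG.measurable_cumul hK hs)]
      exact lintegral_congr fun ω => cumul_add K ω hst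
    have e2 := e1 H hm
    have e3 := e1 H' hm'
    have f2 := a4 t ht D
    have f3 := b4 t ht D
    rw [e2] at f2
    rw [e3] at f3
    simp only [hY]
    rw [integral_sub (a2 t ht).integrableOn (b2 t ht).integrableOn,
      integral_sub (a2 s hs).integrableOn (b2 s hs).integrableOn, a3 t ht D hD', a3 s hs D hD',
      b3 t ht D hD', b3 s hs D hD', e2, e3, heq s t hst ht D hD,
      ENNReal.toReal_add (ENNReal.add_lt_top.1 f2).1.ne, ENNReal.toReal_add (ENNReal.add_lt_top.1 f3).1.ne]
    · ring
    · exact (ENNReal.add_lt_top.1 f3).2.ne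
    · rw [← heq s t hst ht D hD]; exact (ENNReal.add_lt_top.1 f2).2.ne
  · filter_upwards [a1, b1] with ω h2 h3
    exact ((hG.good ω).continuousOn_setLIntegral (h2 T le_rfl)).sub
      ((hG.good ω).continuousOn_setLIntegral (h3 T le_rfl))
  · filter_upwards [a1, b1] with ω h2 h3
    have m1 : BoundedVariationOn (fun t => (cumul T G H t ω).toReal) (Set.Iic T) :=
      boundedVariationOn_of_monotoneOn fun s hs t ht hst =>
        ENNReal.toReal_mono (h2 t ht).ne (cumul_mono H ω hst)
    have m2 : BoundedVariationOn (fun t => (cumul T G H' t ω).toReal) (Set.Iic T) :=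
      boundedVariationOn_of_monotoneOn fun s hs t ht hst =>
        ENNReal.toReal_mono (h3 t ht).ne (cumul_mono H' ω hst)
    have := boundedVariationOn_linear_comb Finset.univ (fun b : Bool => if b then (1 : ℝ) else -1)
      (f := fun b t => if b then (cumul T G H t ω).toReal else (cumul T G H' t ω).toReal)
      (s := Set.Iic T) (fun b _ => by cases b; exacts [m2, m1])
    simpa [hY, sub_eq_add_neg] using this

end

/-! ### Past measurability and the laws generated by the total variation -/

theorem measurable_map_space {Ω E E' : Type*} [MeasurableSpace Ω] [MeasurableSpace E]
    [MeasurableSpace E'] {e : E' → E} (he : Measurable e) :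
    Measurable fun q : Ω × ℝ≥0 × E' => (q.1, q.2.1, e q.2.2) :=
  measurable_fst.prodMk (measurable_snd.fst.prodMk (he.comp measurable_snd.snd))

theorem measurable_restrict_time {Ω : Type*} [MeasurableSpace Ω] (t : ℝ≥0) :
    Measurable fun q : Ω × ℝ≥0 × ℝ =>
      ((⟨min q.2.1 t, Set.mem_Iic.2 (min_le_right _ _)⟩ : Set.Iic t), q.2.2, q.1) :=
  (measurable_snd.fst.min measurable_const).subtype_mk.prodMk
    (measurable_snd.snd.prodMk measurable_fst)

section

variable {Ω : Type*} [m0 : MeasurableSpace Ω] {P : Measure Ω} {ℱ : Filtration ℝ≥0 m0}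
  {T : ℝ≥0} {Γ : ℝ≥0 → ℝ → ℝ → Ω → ℝ} {G : Ω → ℝ≥0 → ℝ → ℝ → ℝ}

section Past

variable {E E' : Type*} [MeasurableSpace E] [MeasurableSpace E']

theorem IsPast.mul {H H' : Ω × ℝ≥0 × E → ℝ≥0∞} (h : IsPast ℱ T H) (h' : IsPast ℱ T H') :
    IsPast ℱ T fun q => H q * H' q := fun t ht => by
  rw [Set.indicator_mul]
  exact (h t ht).mul (h' t ht)

theorem IsPast.add {H H' : Ω × ℝ≥0 × E → ℝ≥0∞} (h : IsPast ℱ T H) (h' : IsPast ℱ T H') :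
    IsPast ℱ T fun q => H q + H' q := fun t ht => by
  rw [Set.indicator_add]
  exact (h t ht).add (h' t ht)

theorem IsPast.comp {H : Ω × ℝ≥0 × E → ℝ≥0∞} (h : IsPast ℱ T H) {e : E' → E} (he : Measurable e) :
    IsPast ℱ T fun q : Ω × ℝ≥0 × E' => H (q.1, q.2.1, e q.2.2) := fun t ht => by
  have h1 := @measurable_map_space Ω E E' (ℱ t) _ _ e he
  have h2 := (h t ht).comp h1
  exact h2

theorem isPast_snd {f : ℝ≥0 × E → ℝ≥0∞} (hf : Measurable f) :
    IsPast ℱ T fun q : Ω × ℝ≥0 × E => f q.2 := fun t _ => by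
  refine Measurable.indicator (hf.comp (@measurable_snd _ _ (ℱ t) _)) ?_
  exact @MeasurableSet.prod _ _ (ℱ t) _ _ _ .univ (measurableSet_Ioc.prod .univ)

end Past

theorem IsProg.isPast {g : RField Ω} (hg : IsProg ℱ T g) {f : ℝ → ℝ≥0∞} (hf : Measurable f) :
    IsPast ℱ T fun q : Ω × ℝ≥0 × ℝ => f (sec T g q.1 q.2) := fun t ht => by
  have hS : MeasurableSet[(ℱ t).prod inferInstance]
      (Set.univ ×ˢ Set.Ioc 0 t ×ˢ Set.univ : Set (Ω × ℝ≥0 × ℝ)) :=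
    @MeasurableSet.prod _ _ (ℱ t) _ _ _ .univ (measurableSet_Ioc.prod .univ)
  have h2 := @measurable_restrict_time Ω (ℱ t) t
  have h3 := (hf.comp ((hg t ht).comp h2)).indicator hS
  refine Eq.mp (congrArg _ (funext fun q => ?_)) h3
  by_cases hq : q ∈ (Set.univ ×ˢ Set.Ioc 0 t ×ˢ Set.univ : Set (Ω × ℝ≥0 × ℝ))
  · rw [Set.indicator_of_mem hq, Set.indicator_of_mem hq]
    have : q.2.1 ≤ t := hq.2.1.2
    simp only [sec, Function.comp, min_eq_left this, min_eq_left (this.trans ht)]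
  · rw [Set.indicator_of_notMem hq, Set.indicator_of_notMem hq]

/-- A rectangle that begins at or after `t` misses `(0, t]`, one that begins earlier has its event
in `ℱ t`, and the sets at time zero are cut off. -/
theorem measurableSet_inter_of_predSigma {S : Set (Ω × ℝ≥0 × ℝ)} (hS : MeasurableSet[predSigma ℱ] S)
    (t : ℝ≥0) : MeasurableSet[(ℱ t).prod inferInstance]
      (S ∩ (Set.univ ×ˢ Set.Ioc 0 t ×ˢ Set.univ)) := by
  have hK : MeasurableSet[(ℱ t).prod inferInstance]
      (Set.univ ×ˢ Set.Ioc 0 t ×ˢ Set.univ : Set (Ω × ℝ≥0 × ℝ)) :=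
    @MeasurableSet.prod _ _ (ℱ t) _ _ _ .univ (measurableSet_Ioc.prod .univ)
  induction hS with
  | basic S hS =>
    rcases hS with ⟨a, b, c, d, D, hD, rfl⟩ | ⟨h, h0⟩
    · rcases lt_or_ge a t with hat | hat
      · refine MeasurableSet.inter ?_ hK
        exact @MeasurableSet.prod _ _ (ℱ t) _ _ _ (ℱ.mono hat.le _ hD)
          (measurableSet_Ioc.prod measurableSet_Ico)
      · convert MeasurableSet.empty
        refine Set.eq_empty_of_forall_notMem fun q hq => ?_
        exact absurd (hq.1.2.1.1.trans_le hq.2.2.1.2) (not_lt.2 hat)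
    · convert MeasurableSet.empty
      refine Set.eq_empty_of_forall_notMem fun q hq => ?_
      exact absurd (h0 q hq.1) hq.2.2.1.1.ne'
  | empty => simp
  | compl S _ ih =>
    convert hK.diff ih using 1
    ext q
    simp only [Set.mem_inter_iff, Set.mem_compl_iff, Set.mem_sdiff]
    tauto
  | iUnion S _ ih =>
    rw [Set.iUnion_inter]
    exact .iUnion ih

theorem isPast_of_predSigma {f : Ω × ℝ≥0 × ℝ → ℝ≥0∞} (hf : Measurable[predSigma ℱ] f) :
    IsPast ℱ T f := fun t _ => by
  have hK : MeasurableSet[(ℱ t).prod inferInstance]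
      (Set.univ ×ˢ Set.Ioc 0 t ×ˢ Set.univ : Set (Ω × ℝ≥0 × ℝ)) :=
    @MeasurableSet.prod _ _ (ℱ t) _ _ _ .univ (measurableSet_Ioc.prod .univ)
  intro B hB
  rw [Set.indicator_preimage, Set.ite]
  refine (measurableSet_inter_of_predSigma (hf hB) t).union (MeasurableSet.diff ?_ hK)
  by_cases h0 : (0 : ℝ≥0∞) ∈ B
  · convert MeasurableSet.univ
    ext q; simpa using h0
  · convert MeasurableSet.empty
    ext q; simpa using h0

/-- The law on `Ω × ℝ≥0 × ℝ × ℝ` generated by the total variation measures. -/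
def crossLaw (P : Measure Ω) (T : ℝ≥0) (G : Ω → ℝ≥0 → ℝ → ℝ → ℝ) : Measure (Ω × ℝ≥0 × ℝ × ℝ) :=
  P.bind fun ω => ((pathTV T G ω).restrict (Set.Ioc 0 T ×ˢ Set.univ)).map (Prod.mk ω)

theorem IsGoodVersion.lintegral_crossLaw (hG : IsGoodVersion P ℱ T Γ G)
    {F : Ω × ℝ≥0 × ℝ × ℝ → ℝ≥0∞} (hF : Measurable F) :
    ∫⁻ q, F q ∂(crossLaw P T G) = ∫⁻ ω, cumul T G F T ω ∂P := by
  have hm : Measurable fun ω => ((pathTV T G ω).restrict (Set.Ioc 0 T ×ˢ Set.univ)).map (Prod.mk ω) := by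
    refine Measure.measurable_of_measurable_coe _ fun S hS => ?_
    convert hG.measurable_cumul (H := S.indicator 1) (measurable_one.indicator hS) le_rfl using 1
    funext ω
    rw [← lintegral_indicator_one hS, lintegral_map (measurable_one.indicator hS) measurable_prodMk_left]
    rfl
  rw [crossLaw, Measure.lintegral_bind hm.aemeasurable hF.aemeasurable]
  refine lintegral_congr fun ω => ?_
  rw [lintegral_map hF measurable_prodMk_left]
  rfl

/-- The integrand that corresponds to `p`, with the weights `A` and `B`. -/
def wInt (A B : Ω × ℝ≥0 × ℝ × ℝ → ℝ≥0∞) (p : Ω × ℝ≥0 × ℝ → ℝ≥0∞) (q : Ω × ℝ≥0 × ℝ × ℝ) : ℝ≥0∞ :=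
  A q * p (q.1, q.2.1, q.2.2.1) + B q * p (q.1, q.2.1, q.2.2.2)

/-- The sum of the two marginals of the weighted law. -/
def wLaw (P : Measure Ω) (T : ℝ≥0) (G : Ω → ℝ≥0 → ℝ → ℝ → ℝ) (A B : Ω × ℝ≥0 × ℝ × ℝ → ℝ≥0∞) :
    Measure (Ω × ℝ≥0 × ℝ) :=
  ((crossLaw P T G).withDensity A).map (fun q => (q.1, q.2.1, q.2.2.1))
    + ((crossLaw P T G).withDensity B).map (fun q => (q.1, q.2.1, q.2.2.2))

variable {A B : Ω × ℝ≥0 × ℝ × ℝ → ℝ≥0∞} {p p' : Ω × ℝ≥0 × ℝ → ℝ≥0∞}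

theorem measurable_proj_fst : Measurable fun q : Ω × ℝ≥0 × ℝ × ℝ => (q.1, q.2.1, q.2.2.1) :=
  measurable_fst.prodMk (measurable_snd.fst.prodMk measurable_snd.snd.fst)

theorem measurable_proj_snd : Measurable fun q : Ω × ℝ≥0 × ℝ × ℝ => (q.1, q.2.1, q.2.2.2) :=
  measurable_fst.prodMk (measurable_snd.fst.prodMk measurable_snd.snd.snd)

theorem measurable_wInt (hA : Measurable A) (hB : Measurable B) (hp : Measurable p) :
    Measurable (wInt A B p) :=
  (hA.mul (hp.comp measurable_proj_fst)).add (hB.mul (hp.comp measurable_proj_snd))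

theorem IsPast.wInt (hA : IsPast ℱ T A) (hB : IsPast ℱ T B) (hp : IsPast ℱ T p) :
    IsPast ℱ T (wInt A B p) :=
  (hA.mul (hp.comp measurable_fst)).add (hB.mul (hp.comp measurable_snd))

/-- One L¹ norm on `Ω × ℝ≥0 × ℝ` controls a weighted error in `x` and a weighted error in `y`
together. This reduces the approximation of a form in two space variables to a density theorem in
one. -/
theorem IsGoodVersion.lintegral_wLaw (hG : IsGoodVersion P ℱ T Γ G) (hA : Measurable A)
    (hB : Measurable B) (hp : Measurable p) :
    ∫⁻ z, p z ∂(wLaw P T G A B) = ∫⁻ ω, cumul T G (wInt A B p) T ω ∂P := by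
  have h1 := lintegral_withDensity_eq_lintegral_mul (crossLaw P T G) hA (hp.comp measurable_proj_fst)
  have h2 := lintegral_withDensity_eq_lintegral_mul (crossLaw P T G) hB (hp.comp measurable_proj_snd)
  simp only [Function.comp_apply] at h1 h2
  rw [wLaw, lintegral_add_measure, lintegral_map hp measurable_proj_fst,
    lintegral_map hp measurable_proj_snd, h1, h2,
    ← hG.lintegral_crossLaw (measurable_wInt hA hB hp), ← lintegral_add_left
      (hA.mul (hp.comp measurable_proj_fst))]
  rfl

theorem IsGoodVersion.setLIntegral_wLaw (hG : IsGoodVersion P ℱ T Γ G) (hA : Measurable A)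
    (hB : Measurable B) (hp : Measurable p) {D : Set Ω} (hD : MeasurableSet D) {s t : ℝ≥0}
    (ht : t ≤ T) {C : Set ℝ} (hC : MeasurableSet C) :
    ∫⁻ z in D ×ˢ Set.Ioc s t ×ˢ C, p z ∂(wLaw P T G A B)
      = ∫⁻ ω in D, ∫⁻ z in Set.Ioc s t ×ˢ Set.univ,
        wInt A B (fun z => p z * C.indicator 1 z.2.2) (ω, z) ∂(pathTV T G ω) ∂P := by
  have hS : MeasurableSet (D ×ˢ Set.Ioc s t ×ˢ C) := hD.prod (measurableSet_Ioc.prod hC)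
  rw [← lintegral_indicator hS, hG.lintegral_wLaw hA hB (hp.indicator hS), ← lintegral_indicator hD]
  refine lintegral_congr fun ω => ?_
  have hSt : MeasurableSet (Set.Ioc s t ×ˢ Set.univ : Set (ℝ≥0 × ℝ × ℝ)) := measurableSet_Ioc.prod .univ
  have hsub : (Set.Ioc s t ×ˢ Set.univ : Set (ℝ≥0 × ℝ × ℝ)) ⊆ Set.Ioc 0 T ×ˢ Set.univ :=
    Set.prod_mono (Set.Ioc_subset_Ioc zero_le ht) subset_rfl
  by_cases hω : ω ∈ D
  · rw [Set.indicator_of_mem hω, cumul, ← Set.inter_eq_left.2 hsub, ← Measure.restrict_restrict hSt,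
      ← lintegral_indicator hSt]
    refine lintegral_congr fun z => ?_
    by_cases hz : z.1 ∈ Set.Ioc s t
    · rw [Set.indicator_of_mem (Set.mk_mem_prod hz (Set.mem_univ z.2))]
      have : ∀ x : ℝ, (D ×ˢ Set.Ioc s t ×ˢ C).indicator p (ω, z.1, x)
          = p (ω, z.1, x) * C.indicator 1 x := fun x => by
        by_cases hx : x ∈ C
        · rw [Set.indicator_of_mem (Set.mk_mem_prod hω (Set.mk_mem_prod hz hx)), Set.indicator_of_mem hx]
          simp
        · rw [Set.indicator_of_notMem fun h => hx h.2.2, Set.indicator_of_notMem hx]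
          simp
      simp only [wInt, this]
    · rw [Set.indicator_of_notMem fun h => hz h.1]
      have : ∀ x : ℝ, (D ×ˢ Set.Ioc s t ×ˢ C).indicator p (ω, z.1, x) = 0 := fun x =>
        Set.indicator_of_notMem (fun h => hz h.2.1) _
      simp only [wInt, this, mul_zero, add_zero]
  · rw [Set.indicator_of_notMem hω]
    have : ∀ x, (D ×ˢ Set.Ioc s t ×ˢ C).indicator p (ω, x) = 0 := fun x =>
      Set.indicator_of_notMem (fun h => hω h.1) _
    simp [cumul, wInt, this]

/-- One factor at a time: intervals `[c, d)` determine the measure in space, then half-lines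
determine it in time. -/
theorem measure_ext_of_rect {μ ν : Measure (Ω × ℝ≥0 × ℝ)} [IsFiniteMeasure μ] [IsFiniteMeasure ν]
    (h : ∀ D, MeasurableSet D → ∀ (t : ℝ≥0) (c d : ℝ),
      μ (D ×ˢ Set.Iic t ×ˢ Set.Ico c d) = ν (D ×ˢ Set.Iic t ×ˢ Set.Ico c d)) : μ = ν := by
  have hm : Measurable fun q : Ω × ℝ≥0 × ℝ => q.2.2 := measurable_snd.snd
  have hm' : Measurable fun q : Ω × ℝ≥0 × ℝ => q.2.1 := measurable_snd.fst
  have h1 : ∀ D, MeasurableSet D → ∀ (t : ℝ≥0) C, MeasurableSet C →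
      μ (D ×ˢ Set.Iic t ×ˢ C) = ν (D ×ˢ Set.Iic t ×ˢ C) := by
    intro D hD t C hC
    have hS : MeasurableSet (D ×ˢ Set.Iic t ×ˢ (Set.univ : Set ℝ)) :=
      hD.prod (measurableSet_Iic.prod .univ)
    have e : ∀ (ρ : Measure (Ω × ℝ≥0 × ℝ)) C, MeasurableSet C →
        (ρ.restrict (D ×ˢ Set.Iic t ×ˢ (Set.univ : Set ℝ))).map (fun q => q.2.2) C
          = ρ (D ×ˢ Set.Iic t ×ˢ C) := fun ρ C hC => by
      rw [Measure.map_apply hm hC, Measure.restrict_apply (hm hC)]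
      congr 1; ext q; simp; tauto
    rw [← e μ C hC, ← e ν C hC]
    congr 1
    refine Measure.ext_of_Ico _ _ fun c d _ => ?_
    rw [e μ _ measurableSet_Ico, e ν _ measurableSet_Ico, h D hD]
  refine Measure.ext_prod₃ fun {D S C} hD hS hC => ?_
  have hU : MeasurableSet (D ×ˢ (Set.univ : Set ℝ≥0) ×ˢ C) := hD.prod (MeasurableSet.univ.prod hC)
  have e : ∀ (ρ : Measure (Ω × ℝ≥0 × ℝ)) S, MeasurableSet S →
      (ρ.restrict (D ×ˢ (Set.univ : Set ℝ≥0) ×ˢ C)).map (fun q => q.2.1) S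
        = ρ (D ×ˢ S ×ˢ C) := fun ρ S hS => by
    rw [Measure.map_apply hm' hS, Measure.restrict_apply (hm' hS)]
    congr 1; ext q; simp; tauto
  rw [← e μ S hS, ← e ν S hS]
  congr 1
  refine Measure.ext_of_Iic _ _ fun t => ?_
  rw [e μ _ measurableSet_Iic, e ν _ measurableSet_Iic, h1 D hD t C hC]

theorem IsGoodVersion.wLaw_ae_mem (hG : IsGoodVersion P ℱ T Γ G) (hA : Measurable A)
    (hB : Measurable B) {I : Set ℝ} (hI : MeasurableSet I) (hA0 : ∀ q, q.2.2.1 ∉ I → A q = 0)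
    (hB0 : ∀ q, q.2.2.2 ∉ I → B q = 0) :
    ∀ᵐ z ∂(wLaw P T G A B), z.2.1 ∈ Set.Ioc 0 T ∧ z.2.2 ∈ I := by
  have hS : MeasurableSet (Set.univ ×ˢ Set.Ioc 0 T ×ˢ I : Set (Ω × ℝ≥0 × ℝ)) :=
    MeasurableSet.univ.prod (measurableSet_Ioc.prod hI)
  have h1 : ∫⁻ z, (Set.univ ×ˢ Set.Ioc 0 T ×ˢ I : Set (Ω × ℝ≥0 × ℝ))ᶜ.indicator 1 z
      ∂(wLaw P T G A B) = 0 := by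
    rw [hG.lintegral_wLaw hA hB (measurable_one.indicator hS.compl)]
    refine (lintegral_congr fun ω => ?_).trans lintegral_zero
    refine (setLIntegral_congr_fun (g := fun _ => 0) (measurableSet_Ioc.prod .univ) fun z hz => ?_).trans
      lintegral_zero
    have hz1 : z.1 ∈ Set.Ioc 0 T := hz.1
    have e : ∀ (x : ℝ) (a : ℝ≥0∞), (x ∉ I → a = 0) → a * (Set.univ ×ˢ Set.Ioc 0 T ×ˢ I :
        Set (Ω × ℝ≥0 × ℝ))ᶜ.indicator 1 (ω, z.1, x) = 0 := fun x a ha => by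
      by_cases hx : x ∈ I
      · rw [Set.indicator_of_notMem (Set.notMem_compl_iff.2 (Set.mk_mem_prod (Set.mem_univ ω)
          (Set.mk_mem_prod hz1 hx))), mul_zero]
      · rw [ha hx, zero_mul]
    simp only [wInt]
    rw [e _ _ (hA0 (ω, z)), e _ _ (hB0 (ω, z)), add_zero]
  rw [lintegral_indicator_one hS.compl] at h1
  filter_upwards [measure_eq_zero_iff_ae_notMem.1 h1] with z hz
  have hz' := Set.notMem_compl_iff.1 hz
  exact hz'.2

/-- A bounded progressive field is determined by its integrals over predictable rectangles. -/
theorem IsGoodVersion.ae_eq_of_predictable [IsProbabilityMeasure P] (hG : IsGoodVersion P ℱ T Γ G)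
    (hA : Measurable A) (hB : Measurable B) (hA' : IsPast ℱ T A) (hB' : IsPast ℱ T B)
    [IsFiniteMeasure (wLaw P T G A B)] (hp : Measurable p) (hp' : Measurable p')
    (hpp : IsPast ℱ T p) (hpp' : IsPast ℱ T p') {K : ℝ≥0} (hK : ∀ z, p z ≤ K) (hK' : ∀ z, p' z ≤ K)
    (heq : ∀ s t, s ≤ t → t ≤ T → ∀ D, MeasurableSet[ℱ s] D → ∀ c d : ℝ,
      ∫⁻ z in D ×ˢ Set.Ioc s t ×ˢ Set.Ico c d, p z ∂(wLaw P T G A B)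
        = ∫⁻ z in D ×ˢ Set.Ioc s t ×ˢ Set.Ico c d, p' z ∂(wLaw P T G A B)) :
    p =ᵐ[wLaw P T G A B] p' := by
  have hfin : ∀ r : Ω × ℝ≥0 × ℝ → ℝ≥0∞, (∀ z, r z ≤ K) → ∫⁻ z, r z ∂(wLaw P T G A B) < ∞ :=
    fun r hr => (lintegral_mono hr).trans_lt (by
      rw [lintegral_const]; exact ENNReal.mul_lt_top ENNReal.coe_lt_top (measure_lt_top _ _))
  have i1 : IsFiniteMeasure ((wLaw P T G A B).withDensity p) := isFiniteMeasure_withDensity (hfin p hK).ne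
  have i2 : IsFiniteMeasure ((wLaw P T G A B).withDensity p') :=
    isFiniteMeasure_withDensity (hfin p' hK').ne
  refine (withDensity_eq_iff hp.aemeasurable hp'.aemeasurable (hfin p hK).ne).1 ?_
  refine measure_ext_of_rect fun D hD t c d => ?_
  have hS : MeasurableSet (D ×ˢ Set.Iic t ×ˢ Set.Ico c d) := hD.prod (measurableSet_Iic.prod measurableSet_Ico)
  rw [withDensity_apply _ hS, withDensity_apply _ hS]
  have hae : (D ×ˢ Set.Iic t ×ˢ Set.Ico c d : Set (Ω × ℝ≥0 × ℝ)) =ᵐ[wLaw P T G A B]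
      (D ×ˢ Set.Ioc 0 (min t T) ×ˢ Set.Ico c d : Set (Ω × ℝ≥0 × ℝ)) := by
    filter_upwards [hG.wLaw_ae_mem hA hB MeasurableSet.univ (fun q h => absurd (Set.mem_univ _) h)
      (fun q h => absurd (Set.mem_univ _) h)] with z hz
    have h1 : z.2.1 ∈ Set.Iic t ↔ z.2.1 ∈ Set.Ioc 0 (min t T) := by
      simp [hz.1.1, hz.1.2]
    refine propext ?_
    change z ∈ (D ×ˢ Set.Iic t ×ˢ Set.Ico c d : Set (Ω × ℝ≥0 × ℝ))
      ↔ z ∈ (D ×ˢ Set.Ioc 0 (min t T) ×ˢ Set.Ico c d : Set (Ω × ℝ≥0 × ℝ))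
    simp only [Set.mem_prod, h1]
  rw [setLIntegral_congr hae, setLIntegral_congr hae]
  have hC : MeasurableSet (Set.Ico c d) := measurableSet_Ico
  rw [hG.setLIntegral_wLaw hA hB hp hD (min_le_right _ _) hC,
    hG.setLIntegral_wLaw hA hB hp' hD (min_le_right _ _) hC]
  have hCm : Measurable fun z : Ω × ℝ≥0 × ℝ => (Set.Ico c d).indicator (1 : ℝ → ℝ≥0∞) z.2.2 :=
    (measurable_one.indicator hC).comp measurable_snd.snd
  have hCp : IsPast ℱ T fun z : Ω × ℝ≥0 × ℝ => (Set.Ico c d).indicator (1 : ℝ → ℝ≥0∞) z.2.2 :=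
    isPast_snd (f := fun z : ℝ≥0 × ℝ => (Set.Ico c d).indicator (1 : ℝ → ℝ≥0∞) z.2)
      ((measurable_one.indicator hC).comp measurable_snd)
  have hle : ∀ r : Ω × ℝ≥0 × ℝ → ℝ≥0∞, (∀ z, r z ≤ K) → ∀ z,
      r z * (Set.Ico c d).indicator 1 z.2.2 ≤ K := fun r hr z => by
    by_cases hz : z.2.2 ∈ Set.Ico c d
    · rw [Set.indicator_of_mem hz]; simpa using hr z
    · rw [Set.indicator_of_notMem hz]; simp
  -- Here `D` is an arbitrary event, out of reach of `heq`. It suffices that the cumulated integrals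
  -- agree on almost every path, which the argument with continuous martingales provides.
  refine setLIntegral_congr_fun_ae hD ?_
  have key := hG.ae_cumul_eq (measurable_wInt hA hB (hp.mul hCm)) (measurable_wInt hA hB (hp'.mul hCm))
    (hA'.wInt hB' (hpp.mul hCp)) (hA'.wInt hB' (hpp'.mul hCp))
    (by
      have := hfin _ (hle p hK)
      exact (hG.lintegral_wLaw hA hB (hp.mul hCm)).symm.trans_lt this)
    (by
      have := hfin _ (hle p' hK')
      exact (hG.lintegral_wLaw hA hB (hp'.mul hCm)).symm.trans_lt this)
    (fun s t hst ht D hD => ?_) (min_le_right t T)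
  · filter_upwards [key] with ω hω _
    exact hω
  · have := heq s t hst ht D hD c d
    rw [hG.setLIntegral_wLaw hA hB hp (ℱ.le s D hD) ht hC,
      hG.setLIntegral_wLaw hA hB hp' (ℱ.le s D hD) ht hC] at this
    exact this

end

/-! ### Approximation of progressive fields by simple functions -/

section

variable {Ω : Type*} [m0 : MeasurableSpace Ω] {P : Measure Ω} {ℱ : Filtration ℝ≥0 m0}
  {T : ℝ≥0} {Γ : ℝ≥0 → ℝ → ℝ → Ω → ℝ} {G : Ω → ℝ≥0 → ℝ → ℝ → ℝ}
  {A B : Ω × ℝ≥0 × ℝ × ℝ → ℝ≥0∞}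

/-- Simple functions are dense in the bounded progressive fields. -/
theorem IsGoodVersion.isSimpleApproximable [IsProbabilityMeasure P] (hG : IsGoodVersion P ℱ T Γ G)
    (hA : Measurable A) (hB : Measurable B) (hA' : IsPast ℱ T A) (hB' : IsPast ℱ T B)
    [IsFiniteMeasure (wLaw P T G A B)] {R : ℝ} (hA0 : ∀ q, q.2.2.1 ∉ Set.Ico (-R) R → A q = 0)
    (hB0 : ∀ q, q.2.2.2 ∉ Set.Ico (-R) R → B q = 0) {u : Ω × ℝ≥0 × ℝ → ℝ} (hu : Measurable u)
    {C : ℝ≥0} (hC : ∀ z, |u z| ≤ C) (hup : IsPast ℱ T fun z => ENNReal.ofReal (u z + C)) :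
    IsSimpleApproximable ℱ T R (wLaw P T G A B) u := by
  set ν := wLaw P T G A B with hν
  have hui : Integrable u ν :=
    .of_bound hu.aestronglyMeasurable (C := C) (.of_forall fun z => hC z)
  set f₀ := ν[u | predSigma ℱ] with hf₀
  -- The conditional expectation is bounded by `C` only almost everywhere; clipping makes it bounded
  -- everywhere and keeps it predictable.
  set f : Ω × ℝ≥0 × ℝ → ℝ := fun z => clip C (f₀ z) with hf
  have hclip : Measurable (clip C) := by unfold clip; fun_prop
  have hfm : Measurable[predSigma ℱ] f := hclip.comp stronglyMeasurable_condExp.measurable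
  have hfC : ∀ z, |f z| ≤ C := fun z => abs_clip_le C.2 _
  have hff₀ : f =ᵐ[ν] f₀ := by
    have h1 : ∀ᵐ z ∂ν, |f₀ z| ≤ C := ae_bdd_abs_condExp_of_ae_bdd_abs (.of_forall fun z => hC z)
    filter_upwards [h1] with z hz using clip_of_abs_le hz
  have hfi : Integrable f ν := integrable_condExp.congr hff₀.symm
  have hfm' : Measurable f := hfm.mono predSigma_le le_rfl
  have hmf : Measurable fun x : ℝ => ENNReal.ofReal (x + C) := by fun_prop
  -- Adding `C` keeps both integrands nonnegative. A conditional expectation has the same integrals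
  -- over predictable rectangles as `u`, so the progressive field and its predictable version
  -- coincide almost everywhere.
  have key := hG.ae_eq_of_predictable hA hB hA' hB' (p := fun z => ENNReal.ofReal (u z + C))
    (p' := fun z => ENNReal.ofReal (f z + C)) (hmf.comp hu) (hmf.comp hfm') hup
    (isPast_of_predSigma (hmf.comp hfm)) (K := 2 * C)
    (fun z => ?_) (fun z => ?_) (fun s t _ _ D hD c d => ?_)
  · refine (isSimpleApproximable_of_bounded (hG.wLaw_ae_mem hA hB measurableSet_Ico hA0 hB0) hfm
      hfC).congr ?_
    filter_upwards [key] with z hz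
    have h1 := neg_le_of_abs_le (hC z)
    have h2 := neg_le_of_abs_le (hfC z)
    have h3 := (ENNReal.ofReal_eq_ofReal_iff (by linarith) (by linarith)).1 hz
    linarith
  · rw [← ENNReal.ofReal_coe_nnreal]
    refine ENNReal.ofReal_le_ofReal ?_
    push_cast
    linarith [le_of_abs_le (hC z)]
  · rw [← ENNReal.ofReal_coe_nnreal]
    refine ENNReal.ofReal_le_ofReal ?_
    push_cast
    linarith [le_of_abs_le (hfC z)]
  · have hS := measurableSet_predSigma_rect s t c d hD
    rw [← ofReal_integral_eq_lintegral_ofReal, ← ofReal_integral_eq_lintegral_ofReal]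
    · congr 1
      rw [integral_add hui.integrableOn (integrable_const _),
        integral_add hfi.integrableOn (integrable_const _),
        integral_congr_ae (ae_restrict_of_ae hff₀), setIntegral_condExp predSigma_le hui hS]
    · exact (hfi.add (integrable_const _)).integrableOn
    · exact .of_forall fun z => by
        have := neg_le_of_abs_le (hfC z)
        simp only [Pi.zero_apply]; linarith
    · exact (hui.add (integrable_const _)).integrableOn
    · exact .of_forall fun z => by
        have := neg_le_of_abs_le (hC z)
        simp only [Pi.zero_apply]; linarith

/-- Time zero carries no mass, so `[0, T]` may be replaced by `(0, T]`, the range on which past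
measurability is formulated. -/
theorem IsGoodVersion.absInt_eq_crossLaw (hG : IsGoodVersion P ℱ T Γ G) {u v : RField Ω}
    (hu : IsJointMeas T u) (hv : IsJointMeas T v) : absInt P T Γ u v
      = ∫⁻ q, ‖sec T u q.1 (q.2.1, q.2.2.1) * sec T v q.1 (q.2.1, q.2.2.2)‖ₑ ∂(crossLaw P T G) := by
  have hm := (hu.measurable_tens hv).enorm
  have h1 := hG.lintegral_crossLaw hm
  refine Eq.trans ?_ h1.symm
  rw [absInt_eq]
  refine lintegral_congr_ae ?_
  filter_upwards [hG.ae_eq] with ω hω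
  rw [absForm, upTo_add, hω, cumul]
  refine setLIntegral_congr ?_
  have h0 : (pathPair T (G ω)).1 ({0} ×ˢ Set.univ) + (pathPair T (G ω)).2 ({0} ×ˢ Set.univ) = 0 := by
    rw [((hG.good ω).measure_singleton 0).1, ((hG.good ω).measure_singleton 0).2, add_zero]
  rw [← Measure.add_apply] at h0
  filter_upwards [measure_eq_zero_iff_ae_notMem.1 h0] with z hz
  have hz0 : z.1 ≠ 0 := fun h => hz ⟨h, Set.mem_univ _⟩
  refine propext ?_
  change z ∈ (Set.Iic T ×ˢ Set.univ : Set (ℝ≥0 × ℝ × ℝ)) ↔ z ∈ (Set.Ioc 0 T ×ˢ Set.univ : Set (ℝ≥0 × ℝ × ℝ))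
  simp [pos_iff_ne_zero, hz0]

/-- The field `g 1_{|g| ≤ R} 1_{[-R, R)}(x)`. -/
def truncField (g : RField Ω) (R : ℝ) : RField Ω := fun s x ω =>
  (Set.Icc (-R) R).indicator id (g s x ω) * (Set.Ico (-R) R).indicator 1 x

theorem truncField_of_mem {g : RField Ω} {R : ℝ} {s : ℝ≥0} {x : ℝ} {ω : Ω} (h : |g s x ω| ≤ R)
    (hx : x ∈ Set.Ico (-R) R) : truncField g R s x ω = g s x ω := by
  rw [truncField, Set.indicator_of_mem (Set.mem_Icc.2 (abs_le.1 h)), Set.indicator_of_mem hx]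
  simp

theorem truncField_of_notMem {g : RField Ω} {R : ℝ} {s : ℝ≥0} {x : ℝ} {ω : Ω}
    (hx : x ∉ Set.Ico (-R) R) : truncField g R s x ω = 0 := by
  rw [truncField, Set.indicator_of_notMem hx, mul_zero]

theorem truncField_eq_or (g : RField Ω) (R : ℝ) (s : ℝ≥0) (x : ℝ) (ω : Ω) :
    truncField g R s x ω = 0 ∨ truncField g R s x ω = g s x ω ∧ |g s x ω| ≤ R := by
  by_cases h : |g s x ω| ≤ R
  · by_cases hx : x ∈ Set.Ico (-R) R
    · exact .inr ⟨truncField_of_mem h hx, h⟩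
    · exact .inl (truncField_of_notMem hx)
  · left
    rw [truncField, Set.indicator_of_notMem fun hc => h (abs_le.2 (Set.mem_Icc.1 hc)), zero_mul]

theorem abs_truncField_le (g : RField Ω) {R : ℝ} (hR : 0 ≤ R) (s : ℝ≥0) (x : ℝ) (ω : Ω) :
    |truncField g R s x ω| ≤ R := by
  rcases truncField_eq_or g R s x ω with h | ⟨h, h'⟩
  · rw [h]; simpa
  · rw [h]; exact h'

theorem abs_sub_truncField_le (g : RField Ω) (R : ℝ) (s : ℝ≥0) (x : ℝ) (ω : Ω) :
    |g s x ω - truncField g R s x ω| ≤ |g s x ω| := by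
  rcases truncField_eq_or g R s x ω with h | ⟨h, -⟩
  · rw [h, sub_zero]
  · rw [h, sub_self, abs_zero]; exact abs_nonneg _

theorem measurable_indicator_id (R : ℝ) : Measurable ((Set.Icc (-R) R).indicator (id : ℝ → ℝ)) :=
  measurable_id.indicator measurableSet_Icc

theorem measurable_indicator_Ico (R : ℝ) :
    Measurable ((Set.Ico (-R) R).indicator (1 : ℝ → ℝ)) := measurable_one.indicator measurableSet_Ico

theorem IsV1.truncField {g : RField Ω} (hg : IsV1 ℱ T g) (R : ℝ) : IsV1 ℱ T (truncField g R) where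
  meas := ((measurable_indicator_id R).comp hg.meas).mul
    ((measurable_indicator_Ico R).comp measurable_snd.fst)
  adapted s hs x := ((measurable_indicator_id R).comp (hg.adapted s hs x)).mul_const _

theorem measurable_cutoff (R : ℝ) : Measurable fun x : ℝ => (Set.Icc (-R) R).indicator (1 : ℝ → ℝ) x :=
  measurable_one.indicator measurableSet_Icc

theorem IsV1.abs_add_cutoff {g : RField Ω} (hg : IsV1 ℱ T g) (R : ℝ) :
    IsV1 ℱ T fun s x ω => |g s x ω| + cutoff R s x ω where
  meas := (measurable_norm.comp hg.meas).add ((measurable_cutoff R).comp measurable_snd.fst)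
  adapted s hs x := (measurable_norm.comp (hg.adapted s hs x)).add_const _

theorem measurable_snd_fst_prod {S Ω : Type*} [MeasurableSpace S] [MeasurableSpace Ω] {f : ℝ → ℝ}
    (hf : Measurable f) : Measurable fun p : S × ℝ × Ω => f p.2.1 :=
  hf.comp measurable_snd.fst

theorem IsProg.truncField {g : RField Ω} (hg : IsProg ℱ T g) (R : ℝ) : IsProg ℱ T (truncField g R) :=
  fun t ht => ((measurable_indicator_id R).comp (hg t ht)).mul
    (@measurable_snd_fst_prod (Set.Iic t) Ω _ (ℱ t) _ (measurable_indicator_Ico R))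

theorem IsProg.abs_add_cutoff {g : RField Ω} (hg : IsProg ℱ T g) (R : ℝ) :
    IsProg ℱ T fun s x ω => |g s x ω| + cutoff R s x ω :=
  fun t ht => (measurable_norm.comp (hg t ht)).add
    (@measurable_snd_fst_prod (Set.Iic t) Ω _ (ℱ t) _ (measurable_cutoff R))

theorem cutoff_of_mem {R : ℝ} {s : ℝ≥0} {x : ℝ} {ω : Ω} (hx : x ∈ Set.Ico (-R) R) :
    cutoff R s x ω = 1 := Set.indicator_of_mem (Set.Ico_subset_Icc_self hx) _

theorem cutoff_nonneg (R : ℝ) (s : ℝ≥0) (x : ℝ) (ω : Ω) : 0 ≤ cutoff R s x ω :=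
  Set.indicator_nonneg (fun _ _ => zero_le_one) _

theorem absInt_lt_top_of_le {u v : RField Ω} {C : ℝ≥0}
    (h : ∀ s x ω, |u s x ω| ≤ C * |v s x ω|) (hv : absInt P T Γ v v < ∞) : absInt P T Γ u u < ∞ := by
  have h1 : absInt P T Γ u u ≤ (C * C : ℝ≥0) * absInt P T Γ v v := by
    unfold absInt
    rw [← lintegral_const_mul' _ _ ENNReal.coe_ne_top]
    refine lintegral_mono fun ω => ?_
    dsimp only
    rw [← lintegral_const_mul' _ _ ENNReal.coe_ne_top]
    refine lintegral_mono fun z => ?_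
    rw [← enorm_norm, Real.norm_eq_abs, abs_mul, ← enorm_norm (v _ _ _ * _), Real.norm_eq_abs, abs_mul,
      Real.enorm_of_nonneg (by positivity), Real.enorm_of_nonneg (by positivity),
      ← ENNReal.ofReal_coe_nnreal, ← ENNReal.ofReal_mul (NNReal.coe_nonneg _)]
    refine ENNReal.ofReal_le_ofReal ?_
    push_cast
    calc |u z.1 z.2.1 ω| * |u z.1 z.2.2 ω| ≤ (C * |v z.1 z.2.1 ω|) * (C * |v z.1 z.2.2 ω|) := by
          gcongr <;> apply h
      _ = _ := by ring
  exact h1.trans_lt (ENNReal.mul_lt_top ENNReal.coe_lt_top hv)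

/-- Dominated convergence with majorant `|g(s,x) g(s,y)|`. Leaving `g` in the second variable gives
a bound uniform in the second truncation level, because `|g - truncField g n| ≤ |g|`. -/
theorem IsGoodVersion.tendsto_absInt_truncField (hG : IsGoodVersion P ℱ T Γ G) {g : RField Ω}
    (hg : IsV3 P ℱ T Γ g) :
    Tendsto (fun n : ℕ => absInt P T Γ (fun s x ω => g s x ω - truncField g n s x ω) g) atTop (𝓝 0) := by
  have hd : ∀ n : ℕ, IsJointMeas T fun s x ω => g s x ω - truncField g n s x ω := fun n =>
    IsJointMeas.sub hg.v1.meas (hg.v1.truncField n).meas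
  have hg' : IsJointMeas T g := hg.v1.meas
  have hfin := hg.finite
  rw [hG.absInt_eq_crossLaw hg' hg'] at hfin
  simp_rw [hG.absInt_eq_crossLaw (hd _) hg']
  have := tendsto_lintegral_of_dominated_convergence (μ := crossLaw P T G)
    (F := fun (n : ℕ) q => ‖sec T (fun s x ω => g s x ω - truncField g n s x ω) q.1 (q.2.1, q.2.2.1)
      * sec T g q.1 (q.2.1, q.2.2.2)‖ₑ) (f := fun _ => 0)
    (fun q => ‖sec T g q.1 (q.2.1, q.2.2.1) * sec T g q.1 (q.2.1, q.2.2.2)‖ₑ)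
    (fun n => ((hd n).measurable_tens hg').enorm) (fun n => .of_forall fun q => ?_) hfin.ne
    (.of_forall fun q => ?_)
  · simpa using this
  · simp only [enorm_mul]
    refine mul_le_mul_left ?_ _
    rw [enorm_le_iff_norm_le]
    exact abs_sub_truncField_le g n _ _ _
  · refine tendsto_const_nhds.congr' ?_
    have h1 : ∀ᶠ n : ℕ in atTop, |g (min q.2.1 T) q.2.2.1 q.1| ≤ n :=
      tendsto_natCast_atTop_atTop.eventually_ge_atTop _
    have h2 : ∀ᶠ n : ℕ in atTop, |q.2.2.1| < n := tendsto_natCast_atTop_atTop.eventually_gt_atTop _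
    filter_upwards [h1, h2] with n h1 h2
    have h3 : q.2.2.1 ∈ Set.Ico (-(n : ℝ)) n := ⟨(abs_lt.1 h2).1.le, (abs_lt.1 h2).2⟩
    simp only [sec, truncField_of_mem h1 h3, sub_self, zero_mul, enorm_zero]

end

/-- The pointwise estimate behind the approximation of a field by simple functions. -/
theorem abs_mul_abs_le_of_weights {a₁ c₁ b₁ a₂ c₂ b₂ m n A B : ℝ} (hm : 0 ≤ m) (hn : 0 ≤ n)
    (h1 : |a₁ - c₁| ≤ |a₁|) (h2 : |a₂ - c₂| ≤ |a₂|) (hA : 0 ≤ A) (hB : 0 ≤ B)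
    (hb₁ : |b₁| ≤ 2 * m) (hb₂ : |b₂| ≤ 2 * n) (hA1 : b₁ ≠ 0 → |a₂| ≤ A) (hB1 : b₂ ≠ 0 → |a₁| ≤ B)
    (hA' : b₁ ≠ 0 → b₂ ≠ 0 → n ≤ m → 1 ≤ A) (hB' : b₁ ≠ 0 → b₂ ≠ 0 → m ≤ n → 1 ≤ B) :
    |a₁ - c₁ + b₁| * |a₂ - c₂ + b₂|
      ≤ |(a₁ - c₁) * a₂| + (1 + 2 * m) * (A * |b₁|) + (1 + 2 * n) * (B * |b₂|) := by
  have e1 : |a₁ - c₁| * |a₂ - c₂| ≤ |(a₁ - c₁) * a₂| := by rw [abs_mul]; gcongr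
  have e2 : |b₁| * |a₂ - c₂| ≤ A * |b₁| := by
    rcases eq_or_ne b₁ 0 with h | h
    · simp [h]
    · rw [mul_comm]; gcongr; exact h2.trans (hA1 h)
  have e3 : |a₁ - c₁| * |b₂| ≤ B * |b₂| := by
    rcases eq_or_ne b₂ 0 with h | h
    · simp [h]
    · gcongr; exact h1.trans (hB1 h)
  have p1 : 0 ≤ A * |b₁| := by positivity
  have p2 : 0 ≤ B * |b₂| := by positivity
  -- The factor of the smaller level is bounded by twice the larger level. The other factor is
  -- absorbed by its own weight, which is at least `1` because both points lie in the interval of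
  -- the larger level.
  have e4 : |b₁| * |b₂| ≤ 2 * m * (A * |b₁|) + 2 * n * (B * |b₂|) := by
    rcases eq_or_ne b₁ 0 with h | h
    · simp only [h, abs_zero, zero_mul, mul_zero, zero_add]; positivity
    rcases eq_or_ne b₂ 0 with h' | h'
    · simp only [h', abs_zero, mul_zero, add_zero]; positivity
    rcases le_total m n with hmn | hmn
    · have : |b₁| * |b₂| ≤ 2 * n * (B * |b₂|) := by
        refine mul_le_mul (hb₁.trans (by linarith)) ?_ (abs_nonneg _) (by positivity)
        exact le_mul_of_one_le_left (abs_nonneg _) (hB' h h' hmn)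
      have : 0 ≤ 2 * m * (A * |b₁|) := by positivity
      linarith
    · have : |b₂| * |b₁| ≤ 2 * m * (A * |b₁|) := by
        refine mul_le_mul (hb₂.trans (by linarith)) ?_ (abs_nonneg _) (by positivity)
        exact le_mul_of_one_le_left (abs_nonneg _) (hA' h h' hmn)
      have : 0 ≤ 2 * n * (B * |b₂|) := by positivity
      linarith
  calc |a₁ - c₁ + b₁| * |a₂ - c₂ + b₂| ≤ (|a₁ - c₁| + |b₁|) * (|a₂ - c₂| + |b₂|) := by
        gcongr <;> exact abs_add_le _ _
    _ = |a₁ - c₁| * |a₂ - c₂| + |b₁| * |a₂ - c₂| + |a₁ - c₁| * |b₂| + |b₁| * |b₂| := by ring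
    _ ≤ _ := by linarith

section

variable {Ω : Type*} [m0 : MeasurableSpace Ω] {P : Measure Ω} {ℱ : Filtration ℝ≥0 m0}
  {T : ℝ≥0} {Γ : ℝ≥0 → ℝ → ℝ → Ω → ℝ} {G : Ω → ℝ≥0 → ℝ → ℝ → ℝ}

/-- The field `|g| + 1_{[-R, R]}`. -/
def cutAbs (g : RField Ω) (R : ℝ) : RField Ω := fun s x ω => |g s x ω| + cutoff R s x ω

theorem cutAbs_nonneg (g : RField Ω) (R : ℝ) (s : ℝ≥0) (x : ℝ) (ω : Ω) : 0 ≤ cutAbs g R s x ω :=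
  add_nonneg (abs_nonneg _) (cutoff_nonneg R s x ω)

theorem abs_le_cutAbs (g : RField Ω) (R : ℝ) (s : ℝ≥0) (x : ℝ) (ω : Ω) :
    |g s x ω| ≤ cutAbs g R s x ω := le_add_of_nonneg_right (cutoff_nonneg R s x ω)

theorem one_le_cutAbs (g : RField Ω) {R : ℝ} {x : ℝ} (hx : x ∈ Set.Ico (-R) R) (s : ℝ≥0) (ω : Ω) :
    1 ≤ cutAbs g R s x ω := by
  rw [cutAbs, cutoff_of_mem hx]
  exact le_add_of_nonneg_left (abs_nonneg _)

/-- The weight `w(s, x) w(s, y)` with `w = |g| + 1_{[-R, R]}`. -/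
def weight (T : ℝ≥0) (g : RField Ω) (R : ℝ) (q : Ω × ℝ≥0 × ℝ × ℝ) : ℝ :=
  sec T (cutAbs g R) q.1 (q.2.1, q.2.2.1) * sec T (cutAbs g R) q.1 (q.2.1, q.2.2.2)

theorem weight_nonneg (g : RField Ω) (R : ℝ) (q : Ω × ℝ≥0 × ℝ × ℝ) : 0 ≤ weight T g R q :=
  mul_nonneg (cutAbs_nonneg _ _ _ _ _) (cutAbs_nonneg _ _ _ _ _)

/-- The weight, restricted to `x ∈ [-R, R)`. -/
def weightFst (T : ℝ≥0) (g : RField Ω) (R : ℝ) (q : Ω × ℝ≥0 × ℝ × ℝ) : ℝ≥0∞ :=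
  ENNReal.ofReal (weight T g R q) * (Set.Ico (-R) R).indicator 1 q.2.2.1

/-- The weight, restricted to `y ∈ [-R, R)`. -/
def weightSnd (T : ℝ≥0) (g : RField Ω) (R : ℝ) (q : Ω × ℝ≥0 × ℝ × ℝ) : ℝ≥0∞ :=
  ENNReal.ofReal (weight T g R q) * (Set.Ico (-R) R).indicator 1 q.2.2.2

theorem measurable_indicator_Ico_ennreal (R : ℝ) :
    Measurable ((Set.Ico (-R) R).indicator (1 : ℝ → ℝ≥0∞)) := measurable_one.indicator measurableSet_Ico

theorem measurable_weight {g : RField Ω} (hg : IsV1 ℱ T g) (R : ℝ) :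
    Measurable fun q => ENNReal.ofReal (weight T g R q) := by
  have h : IsJointMeas T (cutAbs g R) := (hg.abs_add_cutoff R).meas
  exact (IsJointMeas.measurable_tens h h).ennreal_ofReal

theorem isPast_weight {g : RField Ω} (hg : IsProg ℱ T g) (R : ℝ) :
    IsPast ℱ T fun q => ENNReal.ofReal (weight T g R q) := by
  have h1 := (hg.abs_add_cutoff R).isPast ENNReal.measurable_ofReal
  have h2 := (h1.comp (measurable_fst (α := ℝ) (β := ℝ))).mul (h1.comp measurable_snd)
  convert h2 using 1
  funext q
  exact ENNReal.ofReal_mul (cutAbs_nonneg _ _ _ _ _)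

theorem measurable_weightFst {g : RField Ω} (hg : IsV1 ℱ T g) (R : ℝ) : Measurable (weightFst T g R) :=
  (measurable_weight hg R).mul ((measurable_indicator_Ico_ennreal R).comp measurable_snd.snd.fst)

theorem measurable_weightSnd {g : RField Ω} (hg : IsV1 ℱ T g) (R : ℝ) : Measurable (weightSnd T g R) :=
  (measurable_weight hg R).mul ((measurable_indicator_Ico_ennreal R).comp measurable_snd.snd.snd)

theorem isPast_weightFst {g : RField Ω} (hg : IsProg ℱ T g) (R : ℝ) : IsPast ℱ T (weightFst T g R) :=
  (isPast_weight hg R).mul (isPast_snd (f := fun z : ℝ≥0 × ℝ × ℝ => (Set.Ico (-R) R).indicator 1 z.2.1)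
    ((measurable_indicator_Ico_ennreal R).comp measurable_snd.fst))

theorem isPast_weightSnd {g : RField Ω} (hg : IsProg ℱ T g) (R : ℝ) : IsPast ℱ T (weightSnd T g R) :=
  (isPast_weight hg R).mul (isPast_snd (f := fun z : ℝ≥0 × ℝ × ℝ => (Set.Ico (-R) R).indicator 1 z.2.2)
    ((measurable_indicator_Ico_ennreal R).comp measurable_snd.snd))

/-- The mass is at most twice the absolute form of `|g| + 1_{[-R,R]}`; this is where the hypothesis
on that field is spent. -/
theorem IsGoodVersion.isFiniteMeasure_wLaw (hG : IsGoodVersion P ℱ T Γ G) {g : RField Ω} {R : ℝ}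
    (hg : IsV1 ℱ T g) (hw : absInt P T Γ (cutAbs g R) (cutAbs g R) < ∞) :
    IsFiniteMeasure (wLaw P T G (weightFst T g R) (weightSnd T g R)) := by
  have hA := measurable_weightFst hg R
  have hB := measurable_weightSnd hg R
  refine ⟨?_⟩
  rw [← lintegral_one, hG.lintegral_wLaw hA hB measurable_const,
    ← hG.lintegral_crossLaw (measurable_wInt hA hB measurable_const)]
  have hle : ∀ q, wInt (weightFst T g R) (weightSnd T g R) (fun _ => 1) q
      ≤ 2 * ENNReal.ofReal (weight T g R q) := fun q => by
    have h1 : ∀ x : ℝ, (Set.Ico (-R) R).indicator (1 : ℝ → ℝ≥0∞) x ≤ 1 := fun x =>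
      Set.indicator_le_self' (fun _ _ => zero_le) x
    simp only [wInt, weightFst, weightSnd, mul_one, two_mul]
    exact add_le_add (mul_le_of_le_one_right zero_le (h1 _)) (mul_le_of_le_one_right zero_le (h1 _))
  refine (lintegral_mono hle).trans_lt ?_
  rw [lintegral_const_mul _ (measurable_weight hg R)]
  refine ENNReal.mul_lt_top (by simp) ?_
  have hm : IsJointMeas T (cutAbs g R) := (hg.abs_add_cutoff R).meas
  rw [hG.absInt_eq_crossLaw hm hm] at hw
  refine (lintegral_congr fun q => ?_).trans_lt hw
  exact (Real.enorm_of_nonneg (weight_nonneg g R q)).symm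

/-- Approximation of the truncation of a field by a simple function. -/
theorem IsGoodVersion.exists_simple_truncField [IsProbabilityMeasure P] (hG : IsGoodVersion P ℱ T Γ G)
    {g : RField Ω} (hg : IsV1 ℱ T g) (hp : IsProg ℱ T g) (m : ℝ≥0)
    (hw : absInt P T Γ (cutAbs g m) (cutAbs g m) < ∞) {ε : ℝ≥0∞} (hε : 0 < ε) :
    ∃ ψ : Simple ℱ T, (∀ s x ω, |ψ.toField s x ω| ≤ m) ∧
      (∀ s x ω, x ∉ Set.Ico (-(m : ℝ)) m → ψ.toField s x ω = 0) ∧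
      ∫⁻ q, wInt (weightFst T g m) (weightSnd T g m) (fun z => ‖sec T (fun s x ω =>
        truncField g m s x ω - ψ.toField s x ω) z.1 z.2‖ₑ) q ∂(crossLaw P T G) < ε := by
  have hA := measurable_weightFst hg m
  have hB := measurable_weightSnd hg m
  have hfin := hG.isFiniteMeasure_wLaw hg hw
  have hum : IsJointMeas T (truncField g m) := (hg.truncField m).meas
  have hC : ∀ s x ω, |truncField g m s x ω| ≤ m := abs_truncField_le g m.2
  have hA0 : ∀ q, q.2.2.1 ∉ Set.Ico (-(m : ℝ)) m → weightFst T g m q = 0 := fun q hq => by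
    rw [weightFst, Set.indicator_of_notMem hq, mul_zero]
  have hB0 : ∀ q, q.2.2.2 ∉ Set.Ico (-(m : ℝ)) m → weightSnd T g m q = 0 := fun q hq => by
    rw [weightSnd, Set.indicator_of_notMem hq, mul_zero]
  have happ := hG.isSimpleApproximable hA hB (isPast_weightFst hp m) (isPast_weightSnd hp m) hA0 hB0
    (u := fun z => sec T (truncField g m) z.1 z.2) hum.measurable_sec (C := m) (fun z => hC _ _ _)
    ((hp.truncField m).isPast (f := fun v => ENNReal.ofReal (v + m)) (by fun_prop))
  obtain ⟨φ, hφ0, hφ⟩ := happ ε hε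
  obtain ⟨ψ, hψC, hψ0, hψ⟩ := exists_simple_clamp φ m.2
  refine ⟨ψ, hψC, fun s x ω hx => hψ0 _ _ _ (hφ0 _ _ _ hx), lt_of_le_of_lt ?_ hφ⟩
  have hd : IsJointMeas T fun s x ω => truncField g m s x ω - ψ.toField s x ω := hum.sub ψ.isV1.meas
  have hde := hd.measurable_sec.enorm
  rw [hG.lintegral_crossLaw (measurable_wInt hA hB hde), ← hG.lintegral_wLaw hA hB hde]
  refine lintegral_mono_ae ?_
  filter_upwards [hG.wLaw_ae_mem hA hB MeasurableSet.univ (fun q h => absurd (Set.mem_univ _) h)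
    (fun q h => absurd (Set.mem_univ _) h)] with z hz
  rw [enorm_le_iff_norm_le]
  simp only [sec, min_eq_left hz.1.2]
  exact hψ _ _ _ _ (hC _ _ _)

/-- Each factor splits into a truncation error and a bounded approximation error. Products of
truncation errors are dominated by `|(g - truncField g m)(s,x) g(s,y)|`; every product containing an
approximation error is paid for by the weighted L¹ error of its own level. -/
theorem IsGoodVersion.absInt_sub_simple_le (hG : IsGoodVersion P ℱ T Γ G)
    {g : RField Ω} (hg : IsV1 ℱ T g) {ψ : ℕ → Simple ℱ T} {ε : ℕ → ℝ≥0∞}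
    (hψC : ∀ m : ℕ, ∀ s x ω, |(ψ m).toField s x ω| ≤ m)
    (hψ0 : ∀ m : ℕ, ∀ s x ω, x ∉ Set.Ico (-(m : ℝ)) m → (ψ m).toField s x ω = 0)
    (hψ : ∀ m : ℕ, ∫⁻ q, wInt (weightFst T g m) (weightSnd T g m) (fun z => ‖sec T (fun s x ω =>
        truncField g m s x ω - (ψ m).toField s x ω) z.1 z.2‖ₑ) q ∂(crossLaw P T G) ≤ ε m) (m n : ℕ) :
    absInt P T Γ (fun s x ω => g s x ω - (ψ m).toField s x ω)
        (fun s x ω => g s x ω - (ψ n).toField s x ω)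
      ≤ absInt P T Γ (fun s x ω => g s x ω - truncField g m s x ω) g + (1 + 2 * m) * ε m
        + (1 + 2 * n) * ε n := by
  have hg' : IsJointMeas T g := hg.meas
  have hd : ∀ m, IsJointMeas T fun s x ω => g s x ω - (ψ m).toField s x ω := fun m =>
    hg'.sub (ψ m).isV1.meas
  have ht : IsJointMeas T fun s x ω => g s x ω - truncField g m s x ω :=
    hg'.sub (hg.truncField m).meas
  set b : ℕ → Ω × ℝ≥0 × ℝ → ℝ≥0∞ := fun m z => ‖sec T (fun s x ω =>
        truncField g m s x ω - (ψ m).toField s x ω) z.1 z.2‖ₑ with hb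
  have hbm : ∀ m, Measurable (b m) := fun m =>
    (IsJointMeas.measurable_sec (IsJointMeas.sub (hg.truncField m).meas (ψ m).isV1.meas)).enorm
  set W : ℕ → Ω × ℝ≥0 × ℝ × ℝ → ℝ≥0∞ := fun m =>
    wInt (weightFst T g m) (weightSnd T g m) (b m) with hW
  have hWm : ∀ m, Measurable (W m) := fun m =>
    measurable_wInt (measurable_weightFst hg _) (measurable_weightSnd hg _) (hbm m)
  rw [hG.absInt_eq_crossLaw (hd m) (hd n), hG.absInt_eq_crossLaw ht hg']
  have key : ∀ q : Ω × ℝ≥0 × ℝ × ℝ,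
      ‖sec T (fun s x ω => g s x ω - (ψ m).toField s x ω) q.1 (q.2.1, q.2.2.1)
        * sec T (fun s x ω => g s x ω - (ψ n).toField s x ω) q.1 (q.2.1, q.2.2.2)‖ₑ
      ≤ ‖sec T (fun s x ω => g s x ω - truncField g m s x ω) q.1 (q.2.1, q.2.2.1)
        * sec T g q.1 (q.2.1, q.2.2.2)‖ₑ + (1 + 2 * m) * W m q + (1 + 2 * n) * W n q := by
    rintro ⟨ω, s', x, y⟩
    set s := min s' T with hs
    have hI : ∀ (k : ℕ) z, truncField g k s z ω - (ψ k).toField s z ω ≠ 0 → z ∈ Set.Ico (-(k : ℝ)) k := by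
      intro k z h
      by_contra hz
      exact h (by rw [truncField_of_notMem hz, hψ0 k s z ω hz, sub_zero])
    have hbd : ∀ (k : ℕ) z, |truncField g k s z ω - (ψ k).toField s z ω| ≤ 2 * k := fun k z => by
      refine (abs_sub _ _).trans ?_
      have h1 := abs_truncField_le g (Nat.cast_nonneg k) s z ω
      have h2 := hψC k s z ω
      linarith
    set A : ℝ := cutAbs g m s x ω * cutAbs g m s y ω * (Set.Ico (-(m : ℝ)) m).indicator 1 x with hA
    set B : ℝ := cutAbs g n s x ω * cutAbs g n s y ω * (Set.Ico (-(n : ℝ)) n).indicator 1 y with hB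
    have hind : ∀ (k : ℕ) (z : ℝ), 0 ≤ (Set.Ico (-(k : ℝ)) k).indicator (1 : ℝ → ℝ) z := fun k z =>
      Set.indicator_nonneg (fun _ _ => zero_le_one) z
    have hcut : ∀ (k : ℕ) z, 0 ≤ cutAbs g k s z ω := fun k z => cutAbs_nonneg g k s z ω
    have hA0 : 0 ≤ A := mul_nonneg (mul_nonneg (hcut m x) (hcut m y)) (hind m x)
    have hB0 : 0 ≤ B := mul_nonneg (mul_nonneg (hcut n x) (hcut n y)) (hind n y)
    have hmono : ∀ {k l : ℕ} {z : ℝ}, k ≤ l → z ∈ Set.Ico (-(k : ℝ)) k → z ∈ Set.Ico (-(l : ℝ)) l :=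
      fun {k l z} hkl hz => by
        have : (k : ℝ) ≤ l := Nat.cast_le.2 hkl
        exact ⟨by linarith [hz.1], by linarith [hz.2]⟩
    have main := abs_mul_abs_le_of_weights (a₁ := g s x ω) (c₁ := truncField g m s x ω)
      (b₁ := truncField g m s x ω - (ψ m).toField s x ω) (a₂ := g s y ω) (c₂ := truncField g n s y ω)
      (b₂ := truncField g n s y ω - (ψ n).toField s y ω) (Nat.cast_nonneg m) (Nat.cast_nonneg n)
      (abs_sub_truncField_le g m s x ω) (abs_sub_truncField_le g n s y ω) hA0 hB0 (hbd m x) (hbd n y)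
      (fun h => by
        have hx := hI m x h
        rw [hA, Set.indicator_of_mem hx, Pi.one_apply, mul_one]
        exact (abs_le_cutAbs g m s y ω).trans
          (le_mul_of_one_le_left (hcut m y) (one_le_cutAbs g hx s ω)))
      (fun h => by
        have hy := hI n y h
        rw [hB, Set.indicator_of_mem hy, Pi.one_apply, mul_one]
        exact (abs_le_cutAbs g n s x ω).trans
          (le_mul_of_one_le_right (hcut n x) (one_le_cutAbs g hy s ω)))
      (fun h h' hnm => by
        have hx := hI m x h
        have hy := hmono (Nat.cast_le.1 hnm) (hI n y h')
        rw [hA, Set.indicator_of_mem hx, Pi.one_apply, mul_one]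
        exact one_le_mul_of_one_le_of_one_le (one_le_cutAbs g hx s ω) (one_le_cutAbs g hy s ω))
      (fun h h' hmn => by
        have hx := hmono (Nat.cast_le.1 hmn) (hI m x h)
        have hy := hI n y h'
        rw [hB, Set.indicator_of_mem hy, Pi.one_apply, mul_one]
        exact one_le_mul_of_one_le_of_one_le (one_le_cutAbs g hx s ω) (one_le_cutAbs g hy s ω))
    have hofi : ∀ (k : ℕ) (z : ℝ), ENNReal.ofReal ((Set.Ico (-(k : ℝ)) k).indicator 1 z)
        = (Set.Ico (-(k : ℝ)) k).indicator 1 z := fun k z => by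
      by_cases hz : z ∈ Set.Ico (-(k : ℝ)) k <;> simp [hz]
    have hnat : ∀ k : ℕ, ENNReal.ofReal (1 + 2 * k) = 1 + 2 * k := fun k => by
      rw [ENNReal.ofReal_add zero_le_one (by positivity), ENNReal.ofReal_mul zero_le_two]
      simp
    have hW1 : ENNReal.ofReal (A * |truncField g m s x ω - (ψ m).toField s x ω|) ≤ W m (ω, s', x, y) := by
      refine le_trans (le_of_eq ?_) le_self_add
      rw [ENNReal.ofReal_mul hA0, hA, ENNReal.ofReal_mul (mul_nonneg (hcut m x) (hcut m y)), hofi,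
        ← Real.enorm_eq_ofReal_abs]
      rfl
    have hW2 : ENNReal.ofReal (B * |truncField g n s y ω - (ψ n).toField s y ω|) ≤ W n (ω, s', x, y) := by
      refine le_trans (le_of_eq ?_) le_add_self
      rw [ENNReal.ofReal_mul hB0, hB, ENNReal.ofReal_mul (mul_nonneg (hcut n x) (hcut n y)), hofi,
        ← Real.enorm_eq_ofReal_abs]
      rfl
    rw [sub_add_sub_cancel, sub_add_sub_cancel, ← abs_mul] at main
    calc ‖(g s x ω - (ψ m).toField s x ω) * (g s y ω - (ψ n).toField s y ω)‖ₑ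
        = ENNReal.ofReal |(g s x ω - (ψ m).toField s x ω) * (g s y ω - (ψ n).toField s y ω)| :=
          Real.enorm_eq_ofReal_abs _
      _ ≤ _ := ENNReal.ofReal_le_ofReal main
      _ = ‖(g s x ω - truncField g m s x ω) * g s y ω‖ₑ
          + (1 + 2 * m) * ENNReal.ofReal (A * |truncField g m s x ω - (ψ m).toField s x ω|)
          + (1 + 2 * n) * ENNReal.ofReal (B * |truncField g n s y ω - (ψ n).toField s y ω|) := by
        rw [ENNReal.ofReal_add (by positivity) (by positivity),
          ENNReal.ofReal_add (by positivity) (by positivity), ← Real.enorm_eq_ofReal_abs,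
          ENNReal.ofReal_mul (p := 1 + 2 * (m : ℝ)) (by positivity),
          ENNReal.ofReal_mul (p := 1 + 2 * (n : ℝ)) (by positivity), hnat, hnat]
      _ ≤ _ := add_le_add (add_le_add le_rfl (mul_le_mul_right hW1 _)) (mul_le_mul_right hW2 _)
  refine (lintegral_mono key).trans ?_
  rw [lintegral_add_right _ ((hWm n).const_mul _), lintegral_add_right _ ((hWm m).const_mul _),
    lintegral_const_mul _ (hWm m), lintegral_const_mul _ (hWm n)]
  exact add_le_add (add_le_add le_rfl (mul_le_mul_right (hψ m) _)) (mul_le_mul_right (hψ n) _)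

/-- Approximation of progressive fields by simple functions. -/
theorem IsGoodVersion.exists_isSimpleApprox [IsProbabilityMeasure P] (hG : IsGoodVersion P ℱ T Γ G)
    {g : RField Ω} (hg : IsV3 P ℱ T Γ g) (hp : IsProg ℱ T g)
    (hcut : ∀ R : ℝ, absInt P T Γ (cutAbs g R) (cutAbs g R) < ∞) :
    ∃ φ : ℕ × ℕ → Simple ℱ T, IsSimpleApprox P Γ g φ := by
  -- Chosen so that `(1 + 2 m) ε m = 1 / m`. For `m = 0` the inverse of zero is infinite, so `ε 0`
  -- is still positive and the condition is void.
  set ε : ℕ → ℝ≥0∞ := fun m => (1 + 2 * (m : ℝ≥0∞))⁻¹ * (m : ℝ≥0∞)⁻¹ with hε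
  have hc0 : ∀ m : ℕ, (1 + 2 * m : ℝ≥0∞) ≠ 0 := fun m => by simp
  have hct : ∀ m : ℕ, (1 + 2 * m : ℝ≥0∞) ≠ ∞ := fun m => by finiteness
  have hεpos : ∀ m, 0 < ε m := fun m =>
    ENNReal.mul_pos (ENNReal.inv_ne_zero.2 (hct m)) (ENNReal.inv_ne_zero.2 (ENNReal.natCast_ne_top m))
  have hεm : ∀ m : ℕ, (1 + 2 * m) * ε m = (m : ℝ≥0∞)⁻¹ := fun m => by
    rw [hε, ← mul_assoc, ENNReal.mul_inv_cancel (hc0 m) (hct m), one_mul]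
  choose ψ hψC hψ0 hψ using fun m : ℕ =>
    hG.exists_simple_truncField hg.v1 hp (m : ℝ≥0) (hcut _) (hεpos m)
  simp only [NNReal.coe_natCast] at hψC hψ0 hψ
  -- The second index is idle. Membership in the class holds because `ψ m` is bounded by `m` and
  -- supported where `cutAbs g m` is at least `1`.
  refine ⟨fun a => ψ a.1, fun a => ⟨(ψ a.1).isV1, .of_forall fun ω => ?_, ?_⟩, ?_⟩
  · obtain ⟨R, hR⟩ := (ψ a.1).exists_supp
    exact ⟨R, fun s _ x hx => hR s x ω hx⟩
  · refine absInt_lt_top_of_le (C := a.1) (fun s x ω => ?_) (hcut a.1)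
    rw [abs_of_nonneg (cutAbs_nonneg g a.1 s x ω), NNReal.coe_natCast]
    by_cases hx : x ∈ Set.Ico (-(a.1 : ℝ)) a.1
    · exact (hψC _ s x ω).trans (le_mul_of_one_le_right (Nat.cast_nonneg _) (one_le_cutAbs g hx s ω))
    · rw [hψ0 _ s x ω hx, abs_zero]
      exact mul_nonneg (Nat.cast_nonneg _) (cutAbs_nonneg g a.1 s x ω)
  · have h1 : Tendsto (fun m : ℕ => (m : ℝ≥0∞)⁻¹) atTop (𝓝 0) := ENNReal.tendsto_inv_nat_nhds_zero
    have hf : Tendsto (fun p : (ℕ × ℕ) × ℕ × ℕ => p.1.1) atTop atTop := by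
      simp only [← prod_atTop_atTop_eq]
      exact tendsto_fst.comp tendsto_fst
    have hs : Tendsto (fun p : (ℕ × ℕ) × ℕ × ℕ => p.2.1) atTop atTop := by
      simp only [← prod_atTop_atTop_eq]
      exact tendsto_fst.comp tendsto_snd
    have h2 : Tendsto (fun p : (ℕ × ℕ) × ℕ × ℕ =>
        absInt P T Γ (fun s x ω => g s x ω - truncField g p.1.1 s x ω) g + (p.1.1 : ℝ≥0∞)⁻¹
          + (p.2.1 : ℝ≥0∞)⁻¹) atTop (𝓝 0) := by
      simpa using (((hG.tendsto_absInt_truncField hg).comp hf).add (h1.comp hf)).add (h1.comp hs)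
    refine tendsto_of_tendsto_of_tendsto_of_le_of_le tendsto_const_nhds h2 (fun p => zero_le) fun p => ?_
    have h3 := hG.absInt_sub_simple_le hg.v1 hψC hψ0 (fun m => (hψ m).le) p.1.1 p.2.1
    rwa [hεm, hεm] at h3

theorem absInt_mono {u v u' v' : RField Ω} (hu : ∀ s x ω, |u s x ω| ≤ |u' s x ω|)
    (hv : ∀ s x ω, |v s x ω| ≤ |v' s x ω|) : absInt P T Γ u v ≤ absInt P T Γ u' v' := by
  refine lintegral_mono fun ω => lintegral_mono fun z => ?_
  simp only [enorm_mul]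
  refine mul_le_mul' ?_ ?_ <;> rw [enorm_le_iff_norm_le]
  exacts [hu _ _ _, hv _ _ _]

/-- If the cross-variation has locally integrable variation, every progressive field in `𝓥₃(h)` has
an integral. -/
theorem IsV2.exists_isSLSIntegral [IsProbabilityMeasure P] {h : RField Ω} (hh : IsV2 P ℱ T h Γ)
    (hloc : IsLocIntegrable P T Γ) {g : RField Ω} (hg : IsV3 P ℱ T Γ g) (hp : IsProg ℱ T g) :
    ∃ J : Proc Ω, IsSLSIntegral P ℱ T h Γ g J := by
  obtain ⟨G, hG⟩ := hh.exists_goodVersion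
  have hle : ∀ (n : ℕ) s x ω, |truncField g n s x ω| ≤ (n : ℝ≥0) * |cutoff n s x ω| := by
    intro n s x ω
    rw [NNReal.coe_natCast]
    by_cases hx : x ∈ Set.Ico (-(n : ℝ)) n
    · rw [cutoff_of_mem hx, abs_one, mul_one]
      exact abs_truncField_le g (Nat.cast_nonneg n) s x ω
    · rw [truncField_of_notMem hx, abs_zero]
      positivity
  have hk : ∀ n : ℕ, IsV3 P ℱ T Γ (truncField g n) := fun n =>
    ⟨hg.v1.truncField n, .of_forall fun ω => ⟨n, fun s _ x hx => truncField_of_notMem fun hc =>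
      not_lt.2 (abs_le.2 ⟨hc.1, hc.2.le⟩) hx⟩, absInt_lt_top_of_le (hle n) (hloc n)⟩
  -- The constant `n + 1` used here is `n` for the truncated field plus `1` for the cutoff, both
  -- measured against the larger of the two cutoffs.
  have hcut : ∀ (n : ℕ) (R : ℝ), absInt P T Γ (cutAbs (truncField g n) R) (cutAbs (truncField g n) R)
      < ∞ := by
    intro n R
    refine absInt_lt_top_of_le (C := n + 1) (v := cutoff (max n R)) (fun s x ω => ?_) (hloc _)
    have h1 : ∀ r ≤ max (n : ℝ) R, cutoff r s x ω ≤ cutoff (max n R) s x ω := fun r hr => by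
      refine Set.indicator_le_indicator_of_subset (Set.Icc_subset_Icc (neg_le_neg hr) hr)
        (fun _ => zero_le_one) x
    rw [abs_of_nonneg (cutAbs_nonneg _ R s x ω), abs_of_nonneg (cutoff_nonneg _ s x ω), cutAbs]
    have h2 := hle n s x ω
    rw [abs_of_nonneg (cutoff_nonneg _ s x ω)] at h2
    have h3 := mul_le_mul_of_nonneg_left (h1 n (le_max_left _ _)) (n : ℝ≥0).2
    push_cast at h2 h3 ⊢
    have h4 := h1 R (le_max_right _ _)
    calc |truncField g n s x ω| + cutoff R s x ω
        ≤ n * cutoff (max n R) s x ω + cutoff (max n R) s x ω := add_le_add (h2.trans h3) h4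
      _ = _ := by ring
  -- The truncations satisfy the weight condition by local integrability. For `g` itself the form of
  -- `|g| + 1_{[-R,R]}` may be infinite, so `g` is reached only by a second limit.
  choose φ hφ using fun n => hG.exists_isSimpleApprox (hk n) (hp.truncField n) (hcut n)
  choose K hK hKt using fun n => hh.exists_limit_simple (hk n) (hφ n)
  have hiter : IsIterApprox P ℱ T h Γ g (fun n : ℕ => truncField g n) K := by
    refine ⟨fun n => ⟨hk n, φ n, hφ n, (hK n).toIsM2, hKt n⟩, ?_⟩
    have h1 : Tendsto (fun p : ℕ × ℕ =>
        absInt P T Γ (fun s x ω => g s x ω - truncField g p.1 s x ω) g) atTop (𝓝 0) := by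
      rw [← prod_atTop_atTop_eq]
      exact (hG.tendsto_absInt_truncField hg).comp tendsto_fst
    exact tendsto_of_tendsto_of_tendsto_of_le_of_le tendsto_const_nhds h1 (fun p => zero_le) fun p =>
      absInt_mono (fun _ _ _ => le_rfl) fun s x ω => abs_sub_truncField_le g _ s x ω
  obtain ⟨J, hJ, hJt⟩ := hh.exists_limit_iter hg hiter
  exact ⟨J, _, K, hiter, hJ.toIsM2, hJt⟩

end

end StochLS

end

theorem lemma2p1 {Ω : Type*} [MeasurableSpace Ω] (P : Measure Ω) [IsProbabilityMeasure P]
    (ℱ : Filtration ℝ≥0 ‹MeasurableSpace Ω›) (T : ℝ≥0)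
    (h : RField Ω) (Γ : ℝ≥0 → ℝ → ℝ → Ω → ℝ) (hh : IsV2 P ℱ T h Γ) :
    -- the integral of a simple function: continuous martingale and isometry
    (∀ φ : Simple ℱ T, IsV3 P ℱ T Γ φ.toField →
      IsContM2 P ℱ T (φ.integral h) ∧ IsIsometric P T Γ φ.toField (φ.integral h)) ∧
    -- limits along simple functions exist in the space of square-integrable martingales
    (∀ g : RField Ω, IsV3 P ℱ T Γ g → ∀ φ : ℕ × ℕ → Simple ℱ T, IsSimpleApprox P Γ g φ →
      ∃ J : Proc Ω, IsContM2 P ℱ T J ∧ TendstoM2 P T (fun a => (φ a).integral h) J) ∧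
    -- iterated limits along simple functions exist as well
    (∀ g : RField Ω, IsV3 P ℱ T Γ g → ∀ (k : ℕ → RField Ω) (K : ℕ → Proc Ω),
      IsIterApprox P ℱ T h Γ g k K →
      ∃ J : Proc Ω, IsContM2 P ℱ T J ∧ TendstoM2 P T K J) ∧
    -- a limit along simple functions is an iterated limit
    (∀ (g : RField Ω) (J : Proc Ω), IsV3 P ℱ T Γ g →
      IsSimpleLimit P ℱ T h Γ g J → IsSLSIntegral P ℱ T h Γ g J) ∧
    -- the limit is a continuous martingale and satisfies the isometry
    (∀ (g : RField Ω) (J : Proc Ω), IsV3 P ℱ T Γ g → IsSLSIntegral P ℱ T h Γ g J →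
      IsContM2 P ℱ T J ∧ IsIsometric P T Γ g J) ∧
    -- the limit does not depend on the approximating sequences
    (∀ (g : RField Ω) (J J' : Proc Ω), IsV3 P ℱ T Γ g → IsSLSIntegral P ℱ T h Γ g J →
      IsSLSIntegral P ℱ T h Γ g J' → ∀ᵐ ω ∂P, ∀ t ≤ T, J t ω = J' t ω) ∧
    -- a single sequence of simple functions suffices for bounded fields, and more generally
    (∀ g : RField Ω, IsV3 P ℱ T Γ g → IsProg ℱ T g →
      (∀ R : ℝ, IsV3 P ℱ T Γ (fun s x ω => |g s x ω| + cutoff R s x ω)) →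
      ∃ φ : ℕ × ℕ → Simple ℱ T, IsSimpleApprox P Γ g φ) ∧
    -- the integral is defined on the whole class
    (IsLocIntegrable P T Γ → ∀ g : RField Ω, IsV3 P ℱ T Γ g → IsProg ℱ T g →
      ∃ J : Proc Ω, IsSLSIntegral P ℱ T h Γ g J) := by
  refine ⟨fun φ hφ => ⟨hh.isContM2_integral φ hφ.finite, hh.isIsometric_integral φ hφ.finite⟩,
    fun g hg φ hφ => hh.exists_limit_simple hg hφ, fun g hg k K hk => hh.exists_limit_iter hg hk,
    fun g J hg hJ => hJ.isSLSIntegral hg, fun g J hg hJ => hh.isContM2_isIsometric_of_isSLSIntegral hg hJ,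
    fun g J J' hg hJ hJ' => hh.indistinguishable_of_isSLSIntegral hg hJ hJ', fun g hg hp hcut => ?_,
    fun hloc g hg hp => hh.exists_isSLSIntegral hloc hg hp⟩
  obtain ⟨G, hG⟩ := hh.exists_goodVersion
  exact hG.exists_isSimpleApprox hg hp fun R => (hcut R).finite
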